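/- **Setting.** Let $\mathfrak t$ be a finite dimensional complex vector space, $R\subset\mathfrak t^*$ a reduced crystallographic root system (spanning $\mathfrak t^*$) with coroots $\check\alpha\in\mathfrak t$, a fixed base of simple roots, Weyl group $W$ and weight lattice $\mathbb X^*=\{\mu\in\mathfrak t^* : \langle\mu,\check\alpha\rangle\in\mathbb Z\ \ \forall\alpha\in R\}$. Let $T$ be the torus with coordinate ring $\mathbb C[T]=\mathbb C[\mathbb X^*]$, with basis $t^\mu$, $\mu\in\mathbb X^*$ (the maximal torus of the simply connected semisimple group with root system $R$). Let $\mathscr D(T)$ be the algebra of differential operators on $T$, and for $\xi\in\mathfrak t$ let $\partial_\xi$ be the invariant vector field $\partial_\xi t^\mu=\langle\mu,\xi\rangle t^\mu$; thus $\operatorname{Sym}\mathfrak t=\mathbb C[\mathfrak t^*]\hookrightarrow\mathscr D(T)$, $\xi\mapsto\partial_\xi$. Let $\mathscr D_\hbar(T)=\bigoplus_n \mathscr D(T)_{\le n}\hbar^n$ be the Rees algebra of $\mathscr D(T)$ for the filtration by order; in it $t^\mu$ and $\partial_\xi$ are placed in degrees $0$ and $1$. The group $W$ acts on all these algebras. Let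 $\widetilde W=W\ltimes\mathbb X^*$ (with $e^\mu\in\widetilde W$ for $\mu\in\mathbb X^*$) and $\mathfrak t_{\rm aff}=\mathfrak t\oplus\mathbb C\hbar$. View $\operatorname{Sym}\mathfrak t_{\rm aff}$ as the polynomial functions $f(x,\hbar)$ on $\mathfrak t^*\times\mathbb C$; $\widetilde W$ acts by $(wf)(x,\hbar)=f(w^{-1}x,\hbar)$ and $(e^\mu f)(x,\hbar)=f(x-\hbar\mu,\hbar)$. In the smash product $\widetilde W\ltimes\operatorname{Frac}(\operatorname{Sym}\mathfrak t_{\rm aff})$ put $$\theta_\alpha=\tfrac1{\check\alpha}(s_\alpha-1)\ \ (\alpha \text{ a simple root}),\qquad \theta_{\alpha_0}=\tfrac1{\check\delta-\hbar}(e^{\delta}s_\delta-1),$$ where $\delta\in R$ is the root whose coroot is the highest coroot (one such $\delta$ for each irreducible component of $R$). The degenerate nil DAHA $\mathcal H=\mathcal H(\mathfrak t_{\rm aff},\widetilde W)$ is the subalgebra generated by $\operatorname{Sym}\mathfrak t_{\rm aff}$, these Demazure elements, and $\widetilde W$. For an algebra $A$ with a central element $\hbar$ and $c\in\mathbb C$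 write $A|_{\hbar=c}=A/(\hbar-c)A$. Let $\mathbb H=\mathcal H|_{\hbar=1}$, $\mathbf e=\frac1{\# W}\sum_{w\in W}w$ and $\mathbb H^{\rm sph}=\mathbf e\mathbb H\mathbf e$. There is a unique algebra homomorphism $W\ltimes\mathscr D_\hbar(T)\to\mathcal H$ with $w\mapsto w$, $t^\mu\mapsto e^\mu$, $\partial_\xi\mapsto\xi$, $\hbar\mapsto\hbar$, and it is injective. There is a unique algebra homomorphism $\mathscr D(T)^W\to\mathbb H^{\rm sph}$ that sends $D$ to $\bar D\,\mathbf e$, where $\bar D$ is the image in $\mathbb H$ of any element of $\mathscr D_\hbar(T)$ that specializes to $D$ at $\hbar=1$, and it is injective. **Proposition.** (i) Let $M$ be a $W\ltimes\mathscr D_\hbar(T)$-module. The action of $W\ltimes\mathscr D_\hbar(T)$ on $M$ can be extended to an action of $\mathcal H(\mathfrak t_{\rm aff},\widetilde W)$ if and only if the natural map $$\mathbb C[\mathfrak t^*]\otimes_{\mathbb C[\mathfrak t^*]^W}M^W\to M$$ is an isomorphism; such an extension is unique when it exists. Likewise, for every $c\in\mathbb C$ and every module $M$ over $(W\ltimes\mathscr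 D_\hbar(T))|_{\hbar=c}$, the action extends to $\mathcal H(\mathfrak t_{\rm aff},\widetilde W)|_{\hbar=c}$ if and only if the same map is an isomorphism, and the extension is unique when it exists. (ii) Let $L$ be a $\mathscr D(T)^W$-module. The action of $\mathscr D(T)^W$ on $L$ can be extended to an action of $\mathbb H^{\rm sph}$ if and only if the map $$\operatorname{Sym}\mathfrak t\otimes_{(\operatorname{Sym}\mathfrak t)^W}L\to\mathscr D(T)\otimes_{\mathscr D(T)^W}L$$ induced by the inclusion $\operatorname{Sym}\mathfrak t\hookrightarrow\mathscr D(T)$ is an isomorphism; such an extension is unique when it exists. -/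

import Mathlib

open scoped TensorProduct

noncomputable section

namespace NilDAHA

/-! ## Modules over algebras, extensions of actions, tensor products over a subalgebra

A module over a (noncommutative) complex algebra `A` is a complex vector space `M` with an algebra
homomorphism `A →ₐ[ℂ] Module.End ℂ M`. -/

section General

variable {A B X Y R R' L M : Type*}
  [Semiring A] [Algebra ℂ A] [Semiring B] [Algebra ℂ B]
  [Ring X] [Algebra ℂ X] [Ring Y] [Algebra ℂ Y]
  [Semiring R] [Algebra ℂ R] [Semiring R'] [Algebra ℂ R']
  [AddCommGroup L] [Module ℂ L] [AddCommGroup M] [Module ℂ M]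

/-- The extensions, along an algebra homomorphism `f : A → B`, of an `A`-action `ρ` on `M`
to a `B`-action on `M`. -/
def Extension (f : A →ₐ[ℂ] B) (ρ : A →ₐ[ℂ] Module.End ℂ M) : Type _ :=
  {ρ' : B →ₐ[ℂ] Module.End ℂ M // ρ'.comp f = ρ}

/-- The relations `x f(r) ⊗ l = x ⊗ r l`. -/
def balancedRel (f : R →ₐ[ℂ] X) (σ : R →ₐ[ℂ] Module.End ℂ L) : Submodule ℂ (X ⊗[ℂ] L) :=
  Submodule.span ℂ {t | ∃ (x : X) (r : R) (l : L), t = (x * f r) ⊗ₜ[ℂ] l - x ⊗ₜ[ℂ] (σ r l)}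

/-- The tensor product `X ⊗_R L` of the right `R`-module `X` (an algebra containing `R` through
`f : R → X`) and the left `R`-module `L`. -/
def BalancedTensor (f : R →ₐ[ℂ] X) (σ : R →ₐ[ℂ] Module.End ℂ L) : Type _ :=
  (X ⊗[ℂ] L) ⧸ balancedRel f σ

instance (f : R →ₐ[ℂ] X) (σ : R →ₐ[ℂ] Module.End ℂ L) : AddCommGroup (BalancedTensor f σ) :=
  inferInstanceAs (AddCommGroup ((X ⊗[ℂ] L) ⧸ balancedRel f σ))

instance (f : R →ₐ[ℂ] X) (σ : R →ₐ[ℂ] Module.End ℂ L) : Module ℂ (BalancedTensor f σ) :=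
  inferInstanceAs (Module ℂ ((X ⊗[ℂ] L) ⧸ balancedRel f σ))

/-- The map `X ⊗_R L → M`, `x ⊗ l ↦ x · l`, for an `R`-submodule `L` of an `X`-module `M`
(inclusion `k : L → M`). -/
def BalancedTensor.act (f : R →ₐ[ℂ] X) (σ : R →ₐ[ℂ] Module.End ℂ L)
    (τ : X →ₐ[ℂ] Module.End ℂ M) (k : L →ₗ[ℂ] M) (hk : ∀ r l, k (σ r l) = τ (f r) (k l)) :
    BalancedTensor f σ →ₗ[ℂ] M :=
  (balancedRel f σ).liftQ (TensorProduct.lift ((LinearMap.lcomp ℂ M k).comp τ.toLinearMap)) (by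
    rw [balancedRel, Submodule.span_le]
    rintro _ ⟨x, r, l, rfl⟩
    simp [hk])

/-- The map `X ⊗_R L → Y ⊗_{R'} L` induced by a commutative square of algebras. -/
def BalancedTensor.map (f : R →ₐ[ℂ] X) (f' : R' →ₐ[ℂ] Y) (g : X →ₐ[ℂ] Y) (r : R →ₐ[ℂ] R')
    (h : ∀ a, g (f a) = f' (r a)) (σ : R' →ₐ[ℂ] Module.End ℂ L) :
    BalancedTensor f (σ.comp r) →ₗ[ℂ] BalancedTensor f' σ :=
  (balancedRel f (σ.comp r)).mapQ (balancedRel f' σ) (g.toLinearMap.rTensor L) (by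
    rw [balancedRel, Submodule.span_le]
    rintro _ ⟨x, a, l, rfl⟩
    refine Submodule.subset_span ⟨g x, r a, l, ?_⟩
    simp [h])

/-- The relation `h = c` on `B`. -/
def specRel (h : B) (c : ℂ) : B → B → Prop := fun x y => x = h ∧ y = algebraMap ℂ B c

/-- The specialization `B|_{h = c} = B / (h - c) B` at a complex number `c` (for `h` central). -/
abbrev Specialization (h : B) (c : ℂ) : Type _ := RingQuot (specRel h c)

/-- The quotient map `B → B|_{h = c}`. -/
def Specialization.mk (h : B) (c : ℂ) : B →ₐ[ℂ] Specialization h c :=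
  RingQuot.mkAlgHom ℂ (specRel h c)

/-- The homomorphism of specializations induced by `f : A → B` with `f h = h'`. -/
def Specialization.map (f : A →ₐ[ℂ] B) {h : A} {h' : B} (hf : f h = h') (c : ℂ) :
    Specialization h c →ₐ[ℂ] Specialization h' c :=
  RingQuot.liftAlgHom ℂ ⟨(Specialization.mk h' c).comp f, by
    rintro _ _ ⟨rfl, rfl⟩
    rw [AlgHom.comp_apply, hf, AlgHom.comp_apply, AlgHom.commutes]
    exact RingQuot.mkAlgHom_rel ℂ ⟨rfl, rfl⟩⟩

/-- The complex algebra structure on the corner `e B e`, with unit `e`. -/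
instance cornerAlgebra {e : B} (he : IsIdempotentElem e) : Algebra ℂ he.Corner where
  smul z x := ⟨z • x.1, by
    obtain ⟨_, y, rfl⟩ := x
    exact ⟨z • y, by simp⟩⟩
  algebraMap :=
    { toFun := fun z => ⟨z • e, z • 1, by simp [he.eq]⟩
      map_one' := Subtype.ext (one_smul ℂ e)
      map_mul' := fun z w => Subtype.ext (by
        change (z * w) • e = (z • e) * (w • e)
        rw [smul_mul_smul_comm, he.eq])
      map_zero' := Subtype.ext (zero_smul ℂ e)
      map_add' := fun z w => Subtype.ext (add_smul z w e) }
  commutes' z x := Subtype.ext (by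
    have hx := (Subsemigroup.mem_corner_iff he).mp x.2
    change (z • e) * x.1 = x.1 * (z • e)
    rw [smul_mul_assoc, mul_smul_comm, hx.1, hx.2])
  smul_def' z x := Subtype.ext (by
    have hx := (Subsemigroup.mem_corner_iff he).mp x.2
    change z • x.1 = (z • e) * x.1
    rw [smul_mul_assoc, hx.1])

/-- The symmetrizer `e = (1 / #G) ∑_g u(g)` of a finite group `G` mapping to the units of `B`. -/
def symmetrizer {G : Type*} [Group G] (u : G →* B) : B := (Nat.card G : ℂ)⁻¹ • ∑ᶠ g, u g

lemma symmetrizer_idem {G : Type*} [Group G] [Finite G] (u : G →* B) :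
    IsIdempotentElem (symmetrizer u) := by
  cases nonempty_fintype G
  have h : ∀ g, u g * ∑ x, u x = ∑ x, u x := fun g => by
    rw [Finset.mul_sum]
    exact Fintype.sum_equiv (Equiv.mulLeft g) _ _ fun x => (map_mul u g x).symm
  have hc : (Fintype.card G : ℂ) ≠ 0 := Nat.cast_ne_zero.mpr Fintype.card_ne_zero
  rw [IsIdempotentElem, symmetrizer, finsum_eq_sum_of_fintype, Nat.card_eq_fintype_card,
    smul_mul_smul_comm, Finset.sum_mul, Finset.sum_congr rfl fun g _ => h g, Finset.sum_const,
    Finset.card_univ, ← Nat.cast_smul_eq_nsmul ℂ, smul_smul]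
  congr 1
  field_simp

end General

/-! ## Algebraic differential operators and their Rees algebra -/

section DifferentialOperators

variable (A : Type*) [CommRing A] [Algebra ℂ A]

/-- The algebraic differential operators of order `≤ n` on the commutative algebra `A`:
those of order `≤ 0` commute with the multiplication operators, and `P` is of order `≤ n + 1` if
its commutators with all multiplication operators are of order `≤ n`. -/
def diffOrder : ℕ → Submodule ℂ (Module.End ℂ A)
  | 0 => 
    { carrier := {D | ∀ a, D * LinearMap.mulLeft ℂ a - LinearMap.mulLeft ℂ a * D = 0}
      add_mem' := fun {D E} hD hE a => by
        rw [add_mul, mul_add, add_sub_add_comm, hD a, hE a, add_zero]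
      zero_mem' := fun a => by simp
      smul_mem' := fun c D hD a => by
        rw [smul_mul_assoc, mul_smul_comm, ← smul_sub, hD a, smul_zero] }
  | n + 1 => 
    { carrier := {D | ∀ a, D * LinearMap.mulLeft ℂ a - LinearMap.mulLeft ℂ a * D ∈ diffOrder n}
      add_mem' := fun {D E} hD hE a => by
        rw [add_mul, mul_add, add_sub_add_comm]
        exact add_mem (hD a) (hE a)
      zero_mem' := fun a => by simp
      smul_mem' := fun c D hD a => by
        rw [smul_mul_assoc, mul_smul_comm, ← smul_sub]
        exact Submodule.smul_mem _ _ (hD a) }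

variable {A}

lemma mem_diffOrder_zero {D : Module.End ℂ A} : D ∈ diffOrder A 0 ↔
    ∀ a, D * LinearMap.mulLeft ℂ a - LinearMap.mulLeft ℂ a * D = 0 := Iff.rfl

lemma mem_diffOrder_succ {n : ℕ} {D : Module.End ℂ A} : D ∈ diffOrder A (n + 1) ↔
    ∀ a, D * LinearMap.mulLeft ℂ a - LinearMap.mulLeft ℂ a * D ∈ diffOrder A n := Iff.rfl

lemma diffOrder_le_succ (n : ℕ) : diffOrder A n ≤ diffOrder A (n + 1) := by
  induction n with
  | zero => intro D hD a; rw [hD a]; exact zero_mem _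
  | succ n ih => intro D hD a; exact ih (hD a)

lemma diffOrder_mono : Monotone (diffOrder A) := monotone_nat_of_le_succ diffOrder_le_succ

lemma mulLeft_mem_diffOrder (a : A) (n : ℕ) : LinearMap.mulLeft ℂ a ∈ diffOrder A n := by
  refine diffOrder_mono (Nat.zero_le n) fun b => ?_
  ext c
  simp [mul_left_comm]

lemma one_mem_diffOrder (n : ℕ) : (1 : Module.End ℂ A) ∈ diffOrder A n := by
  have := mulLeft_mem_diffOrder (1 : A) n
  rwa [LinearMap.mulLeft_one] at this

lemma mul_mem_diffOrder {m n : ℕ} {D E : Module.End ℂ A} (hD : D ∈ diffOrder A m)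
    (hE : E ∈ diffOrder A n) : D * E ∈ diffOrder A (m + n) := by
  have key : ∀ (k m n : ℕ) (D E : Module.End ℂ A), m + n = k → D ∈ diffOrder A m →
      E ∈ diffOrder A n → D * E ∈ diffOrder A k := by
    intro k
    induction k with
    | zero =>
      intro m n D E h hD hE a
      obtain ⟨rfl, rfl⟩ : m = 0 ∧ n = 0 := by omega
      have h1 := sub_eq_zero.mp (hD a)
      have h2 := sub_eq_zero.mp (hE a)
      rw [mul_assoc, h2, ← mul_assoc, h1, mul_assoc, sub_self]
    | succ k ih =>
      intro m n D E h hD hE a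
      have e : D * E * LinearMap.mulLeft ℂ a - LinearMap.mulLeft ℂ a * (D * E) =
          D * (E * LinearMap.mulLeft ℂ a - LinearMap.mulLeft ℂ a * E) +
          (D * LinearMap.mulLeft ℂ a - LinearMap.mulLeft ℂ a * D) * E := by
        simp only [mul_sub, sub_mul, mul_assoc]
        abel
      rw [e]
      refine add_mem ?_ ?_
      · cases n with
        | zero => rw [hE a, mul_zero]; exact zero_mem _
        | succ n => exact ih m n _ _ (by omega) hD (hE a)
      · cases m with
        | zero => rw [hD a, zero_mul]; exact zero_mem _
        | succ m => exact ih m n _ _ (by omega) (hD a) hE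
  exact key _ m n D E rfl hD hE

variable (A)

/-- The algebra of algebraic differential operators on `A`. -/
def diffOps : Subalgebra ℂ (Module.End ℂ A) where
  carrier := {D | ∃ n, D ∈ diffOrder A n}
  mul_mem' := fun ⟨m, hm⟩ ⟨n, hn⟩ => ⟨m + n, mul_mem_diffOrder hm hn⟩
  add_mem' := fun ⟨m, hm⟩ ⟨n, hn⟩ => ⟨max m n,
    add_mem (diffOrder_mono (le_max_left m n) hm) (diffOrder_mono (le_max_right m n) hn)⟩
  algebraMap_mem' := fun c => ⟨0, by
    rw [Algebra.algebraMap_eq_smul_one]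
    exact Submodule.smul_mem _ _ (one_mem_diffOrder 0)⟩

/-- The Rees algebra `⊕ₙ Fₙ ħⁿ` of the algebra of differential operators with the
filtration by order; the polynomial variable is `ħ`. -/
def reesDiffOps : Subalgebra ℂ (Polynomial (Module.End ℂ A)) where
  carrier := {p | ∀ n, p.coeff n ∈ diffOrder A n}
  mul_mem' := fun {p q} hp hq n => by
    rw [Polynomial.coeff_mul]
    refine Submodule.sum_mem _ fun x hx => ?_
    rw [← Finset.HasAntidiagonal.mem_antidiagonal.mp hx]
    exact mul_mem_diffOrder (hp _) (hq _)
  add_mem' := fun {p q} hp hq n => by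
    rw [Polynomial.coeff_add]
    exact add_mem (hp n) (hq n)
  algebraMap_mem' := fun c n => by
    rw [Polynomial.algebraMap_apply, Polynomial.coeff_C]
    split_ifs
    · rw [Algebra.algebraMap_eq_smul_one]
      exact Submodule.smul_mem _ _ (one_mem_diffOrder n)
    · exact zero_mem _

variable {A}

lemma monomial_mem_reesDiffOps {n : ℕ} {D : Module.End ℂ A} (hD : D ∈ diffOrder A n) :
    Polynomial.monomial n D ∈ reesDiffOps A := by
  intro m
  rw [Polynomial.coeff_monomial]
  split_ifs with h
  · exact h ▸ hD
  · exact zero_mem _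

/-- Conjugation of operators by an automorphism of `A`. -/
def conjAct (g : A ≃ₐ[ℂ] A) : Module.End ℂ A ≃ₐ[ℂ] Module.End ℂ A :=
  g.toLinearEquiv.conjAlgEquiv ℂ

lemma conjAct_apply (g : A ≃ₐ[ℂ] A) (D : Module.End ℂ A) (a : A) :
    conjAct g D a = g (D (g.symm a)) := rfl

lemma conjAct_mulLeft (g : A ≃ₐ[ℂ] A) (a : A) :
    conjAct g (LinearMap.mulLeft ℂ a) = LinearMap.mulLeft ℂ (g a) := by
  ext b
  simp [conjAct_apply]

lemma conjAct_mem_diffOrder (g : A ≃ₐ[ℂ] A) {n : ℕ} {D : Module.End ℂ A}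
    (hD : D ∈ diffOrder A n) : conjAct g D ∈ diffOrder A n := by
  have e : ∀ (D : Module.End ℂ A) (a : A),
      conjAct g D * LinearMap.mulLeft ℂ a - LinearMap.mulLeft ℂ a * conjAct g D =
      conjAct g (D * LinearMap.mulLeft ℂ (g.symm a) - LinearMap.mulLeft ℂ (g.symm a) * D) := by
    intro D a
    rw [map_sub, map_mul, map_mul, conjAct_mulLeft, AlgEquiv.apply_symm_apply]
  induction n generalizing D with
  | zero => intro a; rw [e, hD (g.symm a), map_zero]
  | succ n ih => intro a; rw [e]; exact ih (hD (g.symm a))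

/-- The action of an automorphism of `A` on the Rees algebra. -/
def reesConj (g : A ≃ₐ[ℂ] A) : reesDiffOps A →ₐ[ℂ] reesDiffOps A :=
  ((Polynomial.mapAlgHom (conjAct g).toAlgHom).comp (reesDiffOps A).val).codRestrict
    (reesDiffOps A) (fun p n => by
      have : (Polynomial.mapAlgHom (conjAct g).toAlgHom (p : Polynomial (Module.End ℂ A))).coeff n
          = conjAct g ((p : Polynomial (Module.End ℂ A)).coeff n) := by
        simp [Polynomial.mapAlgHom, Polynomial.coeff_map]
      rw [AlgHom.comp_apply, Subalgebra.coe_val, this]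
      exact conjAct_mem_diffOrder g (p.2 n))

lemma reesConj_coeff (g : A ≃ₐ[ℂ] A) (p : reesDiffOps A) (n : ℕ) :
    (reesConj g p : Polynomial (Module.End ℂ A)).coeff n =
      conjAct g ((p : Polynomial (Module.End ℂ A)).coeff n) := by
  simp [reesConj, Polynomial.mapAlgHom, Polynomial.coeff_map]

/-- Evaluation at `ħ = 1`. -/
def reesEvalOne : reesDiffOps A →ₐ[ℂ] diffOps A :=
  ((Polynomial.eval₂AlgHom (AlgHom.id ℂ (Module.End ℂ A)) 1
    (fun _ => Commute.one_right _)).comp (reesDiffOps A).val).codRestrict (diffOps A) (fun p => by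
      change Polynomial.eval₂ _ 1 (p : Polynomial (Module.End ℂ A)) ∈ diffOps A
      rw [Polynomial.eval₂_eq_sum_range]
      refine Subalgebra.sum_mem _ fun n _ => ?_
      rw [one_pow, mul_one]
      exact ⟨n, p.2 n⟩)

lemma reesEvalOne_apply (p : reesDiffOps A) : (reesEvalOne p : Module.End ℂ A) =
    ∑ n ∈ Finset.range ((p : Polynomial (Module.End ℂ A)).natDegree + 1),
      (p : Polynomial (Module.End ℂ A)).coeff n := by
  change Polynomial.eval₂ _ 1 (p : Polynomial (Module.End ℂ A)) = _
  rw [Polynomial.eval₂_eq_sum_range]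
  simp

end DifferentialOperators

/-! ## The torus, the Weyl group and `W ⋉ 𝒟_ħ(T)`

`P` is a root system with roots in `V = 𝔱*` and coroots in `𝔱`. -/

section Torus

variable {ι V 𝔱 : Type*} [AddCommGroup V] [Module ℂ V] [AddCommGroup 𝔱] [Module ℂ 𝔱]
  (P : RootPairing ι ℂ V 𝔱)

/-- The weight lattice `𝕏* ⊂ 𝔱*`. -/
def weightLattice : AddSubgroup V where
  carrier := {x | ∀ i, ∃ n : ℤ, P.toLinearMap x (P.coroot i) = n}
  add_mem' := fun {x y} hx hy i => by
    obtain ⟨m, hm⟩ := hx i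
    obtain ⟨n, hn⟩ := hy i
    exact ⟨m + n, by simp [hm, hn]⟩
  zero_mem' := fun i => ⟨0, by simp⟩
  neg_mem' := fun {x} hx i => by
    obtain ⟨m, hm⟩ := hx i
    exact ⟨-m, by simp [hm]⟩

/-- The action of the Weyl group on `𝔱`, contragredient to its action on `𝔱*`. -/
def cartanRep : P.weylGroup →* (𝔱 ≃ₗ[ℂ] 𝔱) where
  toFun w := (RootPairing.Equiv.coweightHom P (w : P.Aut)⁻¹).unop
  map_one' := by
    simp only [OneMemClass.coe_one, inv_one, map_one, MulOpposite.unop_one]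
  map_mul' := fun v w => by
    simp only [Subgroup.coe_mul, mul_inv_rev, map_mul, MulOpposite.unop_mul]

lemma pairing_weyl (w : P.weylGroup) (x : V) (ξ : 𝔱) :
    P.toLinearMap (w • x) ξ = P.toLinearMap x (cartanRep P w⁻¹ ξ) := by
  have h := (w : P.Aut).toHom.weight_coweight_transpose_apply P P ξ
  have h' := LinearMap.congr_fun h x
  simp only [cartanRep, MonoidHom.coe_mk, OneHom.coe_mk]
  simpa using! h'

lemma pairing_weyl_weyl (w : P.weylGroup) (x : V) (ξ : 𝔱) :
    P.toLinearMap (w • x) (cartanRep P w ξ) = P.toLinearMap x ξ := by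
  rw [pairing_weyl, ← LinearEquiv.mul_apply, ← map_mul]
  simp

lemma weyl_mem_weightLattice (w : P.weylGroup) {x : V} (hx : x ∈ weightLattice P) :
    w • x ∈ weightLattice P := by
  intro i
  have h : cartanRep P w⁻¹ (P.coroot i) = P.coroot ((w : P.Aut).toHom.indexEquiv.symm i) := by
    have := (w : P.Aut).toHom.coroot_coweightMap_apply P P i
    simp only [cartanRep, MonoidHom.coe_mk, OneHom.coe_mk]
    simpa using! this
  rw [pairing_weyl, h]
  exact hx _

/-- The action of the Weyl group on the weight lattice. -/
def weightAct (w : P.weylGroup) : weightLattice P ≃+ weightLattice P where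
  toFun x := ⟨w • (x : V), weyl_mem_weightLattice P w x.2⟩
  invFun x := ⟨w⁻¹ • (x : V), weyl_mem_weightLattice P w⁻¹ x.2⟩
  left_inv := fun x => Subtype.ext (inv_smul_smul w (x : V))
  right_inv := fun x => Subtype.ext (smul_inv_smul w (x : V))
  map_add' := fun x y => Subtype.ext (smul_add w (x : V) (y : V))

/-- The coordinate ring `ℂ[T]` of the torus `T` with character lattice `𝕏*`: the group algebra
of `𝕏*`. -/
def TorusRing : Type _ := AddMonoidAlgebra ℂ (weightLattice P)

instance : CommRing (TorusRing P) :=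
  inferInstanceAs (CommRing (AddMonoidAlgebra ℂ (weightLattice P)))

instance : Algebra ℂ (TorusRing P) :=
  inferInstanceAs (Algebra ℂ (AddMonoidAlgebra ℂ (weightLattice P)))

/-- The element `c t^μ`. -/
def charMonomial (μ : weightLattice P) (c : ℂ) : TorusRing P := AddMonoidAlgebra.single μ c

/-- The character `t^μ`. -/
def character (μ : weightLattice P) : TorusRing P := charMonomial P μ 1

lemma torusRing_induction {motive : TorusRing P → Prop} (x : TorusRing P) (zero : motive 0)
    (add : ∀ x y, motive x → motive y → motive (x + y))
    (single : ∀ m r, motive (charMonomial P m r)) : motive x :=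
  AddMonoidAlgebra.induction_linear x zero add single

lemma charMonomial_mul (μ ν : weightLattice P) (c d : ℂ) :
    charMonomial P μ c * charMonomial P ν d = charMonomial P (μ + ν) (c * d) :=
  AddMonoidAlgebra.single_mul_single ..

/-- The action of the Weyl group on `ℂ[T]`: `w t^μ = t^{w μ}`. -/
def torusAct (w : P.weylGroup) : TorusRing P ≃ₐ[ℂ] TorusRing P :=
  (AddMonoidAlgebra.domCongr ℂ ℂ (weightAct P w) :
    AddMonoidAlgebra ℂ (weightLattice P) ≃ₐ[ℂ] AddMonoidAlgebra ℂ (weightLattice P))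

lemma torusAct_single (w : P.weylGroup) (μ : weightLattice P) (c : ℂ) :
    torusAct P w (charMonomial P μ c) = charMonomial P (weightAct P w μ) c :=
  AddMonoidAlgebra.domCongr_single ..

lemma torusAct_one (a : TorusRing P) : torusAct P 1 a = a := by
  induction a using torusRing_induction with
  | zero => simp
  | add x y hx hy => rw [map_add, hx, hy]
  | single m r =>
    rw [torusAct_single]
    rw [show weightAct P 1 m = m from Subtype.ext (one_smul P.weylGroup (m : V))]

lemma torusAct_mul (v w : P.weylGroup) (a : TorusRing P) :
    torusAct P (v * w) a = torusAct P v (torusAct P w a) := by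
  induction a using torusRing_induction with
  | zero => simp
  | add x y hx hy => simp only [map_add, hx, hy]
  | single m r =>
    simp only [torusAct_single]
    rw [show weightAct P (v * w) m = weightAct P v (weightAct P w m) from
      Subtype.ext (mul_smul v w (m : V))]

lemma torusAct_symm (w : P.weylGroup) : (torusAct P w).symm = torusAct P w⁻¹ := by
  refine AlgEquiv.ext fun a => ?_
  rw [AlgEquiv.symm_apply_eq, ← torusAct_mul, mul_inv_cancel, torusAct_one]

/-- The algebra `𝒟(T)`. -/
abbrev DT : Subalgebra ℂ (Module.End ℂ (TorusRing P)) := diffOps (TorusRing P)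

/-- The Rees algebra `𝒟_ħ(T)`. -/
abbrev DhT : Subalgebra ℂ (Polynomial (Module.End ℂ (TorusRing P))) := reesDiffOps (TorusRing P)

/-- The action of the Weyl group on `𝒟(T)` by conjugation. -/
def weylConj (w : P.weylGroup) :
    Module.End ℂ (TorusRing P) ≃ₐ[ℂ] Module.End ℂ (TorusRing P) := conjAct (torusAct P w)

lemma weylConj_one (D : Module.End ℂ (TorusRing P)) : weylConj P 1 D = D := by
  refine LinearMap.ext fun a => ?_
  rw [weylConj, conjAct_apply, torusAct_one, torusAct_symm, inv_one, torusAct_one]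

lemma weylConj_mul (v w : P.weylGroup) (D : Module.End ℂ (TorusRing P)) :
    weylConj P (v * w) D = weylConj P v (weylConj P w D) := by
  refine LinearMap.ext fun a => ?_
  simp only [weylConj, conjAct_apply, torusAct_symm, torusAct_mul, mul_inv_rev]

lemma reesDiffOps_ext {x y : DhT P}
    (h : ∀ n, (x : Polynomial (Module.End ℂ (TorusRing P))).coeff n =
      (y : Polynomial (Module.End ℂ (TorusRing P))).coeff n) : x = y :=
  Subtype.ext (Polynomial.ext h)

/-- The action of the Weyl group on `𝒟_ħ(T)` by algebra automorphisms. -/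
instance weylActionDhT : MulSemiringAction P.weylGroup (DhT P) where
  smul w x := reesConj (torusAct P w) x
  one_smul := fun x => reesDiffOps_ext P fun n =>
    (reesConj_coeff _ _ _).trans (weylConj_one P _)
  mul_smul := fun v w x => reesDiffOps_ext P fun n => by
    change ((reesConj _ _ : DhT P) : Polynomial (Module.End ℂ (TorusRing P))).coeff n =
      ((reesConj _ (reesConj _ _) : DhT P) : Polynomial (Module.End ℂ (TorusRing P))).coeff n
    rw [reesConj_coeff, reesConj_coeff, reesConj_coeff]
    exact weylConj_mul P v w _
  smul_zero := fun w => map_zero (reesConj (torusAct P w))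
  smul_add := fun w => map_add (reesConj (torusAct P w))
  smul_one := fun w => map_one (reesConj (torusAct P w))
  smul_mul := fun w => map_mul (reesConj (torusAct P w))

lemma weyl_smul_def (w : P.weylGroup) (x : DhT P) : w • x = reesConj (torusAct P w) x := rfl

instance weylActionDhT_comm : SMulCommClass P.weylGroup ℂ (DhT P) where
  smul_comm w c x := map_smul (reesConj (torusAct P w)) c x

/-- The smash product `W ⋉ 𝒟_ħ(T)`. -/
abbrev WDhT : Type _ := SkewMonoidAlgebra (DhT P) P.weylGroup

/-- The translation invariant vector field `∂_ξ` on `T`: `∂_ξ t^μ = ⟨μ, ξ⟩ t^μ`. -/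
def vectorField (ξ : 𝔱) : Module.End ℂ (TorusRing P) :=
  ((Finsupp.lsum ℂ fun μ : weightLattice P =>
    P.toLinearMap (μ : V) ξ • AddMonoidAlgebra.lsingle (R := ℂ) (S := ℂ) μ) ∘ₗ
    (AddMonoidAlgebra.coeffLinearEquiv ℂ).toLinearMap :
      AddMonoidAlgebra ℂ (weightLattice P) →ₗ[ℂ] AddMonoidAlgebra ℂ (weightLattice P))

lemma vectorField_single (ξ : 𝔱) (μ : weightLattice P) (c : ℂ) :
    vectorField P ξ (charMonomial P μ c) = P.toLinearMap (μ : V) ξ • charMonomial P μ c := by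
  have h : ((Finsupp.lsum ℂ fun μ : weightLattice P =>
      P.toLinearMap (μ : V) ξ • AddMonoidAlgebra.lsingle (R := ℂ) (S := ℂ) μ) ∘ₗ
      (AddMonoidAlgebra.coeffLinearEquiv ℂ).toLinearMap :
      AddMonoidAlgebra ℂ (weightLattice P) →ₗ[ℂ] AddMonoidAlgebra ℂ (weightLattice P))
        (AddMonoidAlgebra.single μ c) =
      P.toLinearMap (μ : V) ξ • AddMonoidAlgebra.single μ c := by
    simp
  exact h

lemma vectorField_mul (ξ : 𝔱) (a b : TorusRing P) :
    vectorField P ξ (a * b) = vectorField P ξ a * b + a * vectorField P ξ b := by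
  induction a using torusRing_induction with
  | zero => simp
  | add x y hx hy => simp only [add_mul, map_add, hx, hy]; abel
  | single m r =>
    induction b using torusRing_induction with
    | zero => simp
    | add x y hx hy => simp only [mul_add, map_add, hx, hy]; abel
    | single n s =>
      simp only [charMonomial_mul, vectorField_single, smul_mul_assoc,
        mul_smul_comm, ← add_smul]
      simp

lemma vectorField_mem (ξ : 𝔱) : vectorField P ξ ∈ diffOrder (TorusRing P) 1 := by
  intro a
  have : vectorField P ξ * LinearMap.mulLeft ℂ a - LinearMap.mulLeft ℂ a * vectorField P ξ =
      LinearMap.mulLeft ℂ (vectorField P ξ a) := by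
    refine LinearMap.ext fun b => ?_
    simp [vectorField_mul]
  rw [this]
  exact mulLeft_mem_diffOrder _ 0

lemma vectorField_comm (ξ η : 𝔱) :
    vectorField P ξ * vectorField P η = vectorField P η * vectorField P ξ := by
  refine LinearMap.ext fun a => ?_
  induction a using torusRing_induction with
  | zero => simp
  | add x y hx hy => simp only [map_add, hx, hy]
  | single m r =>
    simp only [Module.End.mul_apply, vectorField_single, map_smul]
    rw [smul_comm]

lemma vectorField_add (ξ η : 𝔱) : vectorField P (ξ + η) = vectorField P ξ + vectorField P η := by
  refine LinearMap.ext fun a => ?_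
  induction a using torusRing_induction with
  | zero => simp
  | add x y hx hy => simp only [map_add, hx, hy]
  | single m r => simp only [LinearMap.add_apply, vectorField_single, map_add, add_smul]

lemma vectorField_smul (c : ℂ) (ξ : 𝔱) : vectorField P (c • ξ) = c • vectorField P ξ := by
  refine LinearMap.ext fun a => ?_
  induction a using torusRing_induction with
  | zero => simp
  | add x y hx hy => simp only [map_add, hx, hy]
  | single m r =>
    simp only [LinearMap.smul_apply, vectorField_single, map_smul, smul_eq_mul, mul_smul]

lemma weylConj_vectorField (w : P.weylGroup) (ξ : 𝔱) :
    weylConj P w (vectorField P ξ) = vectorField P (cartanRep P w ξ) := by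
  refine LinearMap.ext fun a => ?_
  induction a using torusRing_induction with
  | zero => simp
  | add x y hx hy => simp only [map_add, hx, hy]
  | single m r =>
    rw [weylConj, conjAct_apply, torusAct_symm, torusAct_single, vectorField_single, map_smul,
      ← torusAct_single, ← torusAct_mul, mul_inv_cancel, torusAct_one, vectorField_single]
    congr 1
    change P.toLinearMap (w⁻¹ • (m : V)) ξ = _
    rw [pairing_weyl, inv_inv]

/-- `t^μ` as an element of `𝒟_ħ(T)` of degree `0`. -/
def charDh (μ : weightLattice P) : DhT P :=
  ⟨Polynomial.monomial 0 (LinearMap.mulLeft ℂ (character P μ)),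
    monomial_mem_reesDiffOps (mulLeft_mem_diffOrder _ 0)⟩

/-- `∂_ξ` as an element of `𝒟_ħ(T)` of degree `1`. -/
def fieldDh (ξ : 𝔱) : DhT P :=
  ⟨Polynomial.monomial 1 (vectorField P ξ), monomial_mem_reesDiffOps (vectorField_mem P ξ)⟩

/-- The element `ħ` of `𝒟_ħ(T)`. -/
def hbarDh : DhT P :=
  ⟨Polynomial.monomial 1 1, monomial_mem_reesDiffOps (one_mem_diffOrder 1)⟩

/-- `ξ ↦ ∂_ξ` as a linear map. -/
def fieldDhLin : 𝔱 →ₗ[ℂ] DhT P where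
  toFun := fieldDh P
  map_add' := fun ξ η => Subtype.ext (by
    simp [fieldDh, vectorField_add])
  map_smul' := fun c ξ => Subtype.ext (by
    change Polynomial.monomial 1 (vectorField P (c • ξ)) =
      c • Polynomial.monomial 1 (vectorField P ξ)
    rw [vectorField_smul, Polynomial.smul_monomial])

/-- The embedding `Sym 𝔱 → 𝒟_ħ(T)`, `ξ ↦ ∂_ξ`. -/
def symDh : SymmetricAlgebra ℂ 𝔱 →ₐ[ℂ] DhT P :=
  RingCon.liftₐ (TensorAlgebra.symRingCon ℂ 𝔱) (TensorAlgebra.lift ℂ (fieldDhLin P)) (by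
    refine RingCon.ringConGen_le.2 fun x y h => ?_
    induction h with
    | mul_comm x y =>
      rw [RingCon.ker_apply]
      refine Subtype.ext ?_
      simp [fieldDhLin, fieldDh, Polynomial.monomial_mul_monomial, vectorField_comm P x y])

lemma symDh_ι (ξ : 𝔱) : symDh P (SymmetricAlgebra.ι ℂ 𝔱 ξ) = fieldDh P ξ := by
  have : symDh P (SymmetricAlgebra.ι ℂ 𝔱 ξ) =
    TensorAlgebra.lift ℂ (fieldDhLin P) (TensorAlgebra.ι ℂ ξ) := rfl
  rw [this, TensorAlgebra.lift_ι_apply]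
  rfl

/-- The action of the Weyl group on `Sym 𝔱 = ℂ[𝔱*]`. -/
def symAct (w : P.weylGroup) : SymmetricAlgebra ℂ 𝔱 →ₐ[ℂ] SymmetricAlgebra ℂ 𝔱 :=
  SymmetricAlgebra.lift (SymmetricAlgebra.ι ℂ 𝔱 ∘ₗ (cartanRep P w).toLinearMap)

/-- The algebra of invariants `(Sym 𝔱)^W`. -/
def symInv : Subalgebra ℂ (SymmetricAlgebra ℂ 𝔱) where
  carrier := {s | ∀ w, symAct P w s = s}
  mul_mem' := fun hs ht w => by rw [map_mul, hs w, ht w]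
  add_mem' := fun hs ht w => by rw [map_add, hs w, ht w]
  algebraMap_mem' := fun c w => (symAct P w).commutes c

lemma symDh_symAct (w : P.weylGroup) (s : SymmetricAlgebra ℂ 𝔱) :
    symDh P (symAct P w s) = w • symDh P s := by
  induction s using SymmetricAlgebra.induction with
  | algebraMap c => simp only [AlgHom.commutes, weyl_smul_def]
  | ι ξ =>
    have h : symAct P w (SymmetricAlgebra.ι ℂ 𝔱 ξ) = SymmetricAlgebra.ι ℂ 𝔱 (cartanRep P w ξ) := by
      simp [symAct]
    rw [h, symDh_ι, symDh_ι, weyl_smul_def]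
    refine reesDiffOps_ext P fun n => ?_
    rw [reesConj_coeff]
    simp only [fieldDh, Polynomial.coeff_monomial]
    split_ifs
    · exact (weylConj_vectorField P w ξ).symm
    · exact (map_zero _).symm
  | mul s t hs ht => rw [map_mul, map_mul, hs, ht, map_mul, smul_mul']
  | add s t hs ht => rw [map_add, map_add, hs, ht, map_add, smul_add]

/-- `w ∈ W` as an element of `W ⋉ 𝒟_ħ(T)`. -/
def weylA (w : P.weylGroup) : WDhT P := SkewMonoidAlgebra.single w 1

/-- The embedding `𝒟_ħ(T) → W ⋉ 𝒟_ħ(T)`. -/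
def diffA : DhT P →ₐ[ℂ] WDhT P where
  toRingHom := SkewMonoidAlgebra.singleOneRingHom
  commutes' := fun _ => rfl

lemma weylA_mul_diffA (w : P.weylGroup) (x : DhT P) :
    weylA P w * diffA P x = diffA P (w • x) * weylA P w := by
  change SkewMonoidAlgebra.single w 1 * SkewMonoidAlgebra.single 1 x =
    SkewMonoidAlgebra.single 1 (w • x) * SkewMonoidAlgebra.single w 1
  simp [SkewMonoidAlgebra.single_mul_single]

/-- The embedding `ℂ[𝔱*] → W ⋉ 𝒟_ħ(T)`. -/
def symA : SymmetricAlgebra ℂ 𝔱 →ₐ[ℂ] WDhT P := (diffA P).comp (symDh P)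

/-- The element `ħ` of `W ⋉ 𝒟_ħ(T)`. -/
def hbarA : WDhT P := diffA P (hbarDh P)

section Invariants

variable {M : Type*} [AddCommGroup M] [Module ℂ M] (ρ : WDhT P →ₐ[ℂ] Module.End ℂ M)

/-- The space of invariants `M^W`. -/
def invariants : Submodule ℂ M where
  carrier := {m | ∀ w, ρ (weylA P w) m = m}
  add_mem' := fun hx hy w => by rw [map_add, hx w, hy w]
  zero_mem' := fun w => map_zero _
  smul_mem' := fun c x hx w => by rw [map_smul, hx w]

lemma symInv_mem_invariants (s : symInv P) {m : M} (hm : m ∈ invariants P ρ) :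
    ρ (symA P s) m ∈ invariants P ρ := by
  intro w
  have h : weylA P w * symA P s = symA P s * weylA P w := by
    simp only [symA, AlgHom.comp_apply]
    rw [weylA_mul_diffA, ← symDh_symAct, s.2 w]
  rw [← Module.End.mul_apply, ← map_mul, h, map_mul, Module.End.mul_apply, hm w]

/-- The action of `ℂ[𝔱*]^W` on `M^W`. -/
def invariantsAct : symInv P →ₐ[ℂ] Module.End ℂ (invariants P ρ) where
  toFun s := (ρ (symA P s)).restrict fun _ hm => symInv_mem_invariants P ρ s hm
  map_one' := by ext m; simp
  map_mul' := fun s t => by ext m; simp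
  map_zero' := by ext m; simp
  map_add' := fun s t => by ext m; simp
  commutes' := fun c => by
    ext m
    have : symA P ((algebraMap ℂ (symInv P) c : symInv P) : SymmetricAlgebra ℂ 𝔱) =
      algebraMap ℂ (WDhT P) c := (symA P).commutes c
    change ρ (symA P ((algebraMap ℂ (symInv P) c : symInv P) : SymmetricAlgebra ℂ 𝔱)) m = c • (m : M)
    rw [this, AlgHom.commutes, Module.algebraMap_end_apply]

/-- The natural map `ℂ[𝔱*] ⊗_{ℂ[𝔱*]^W} M^W → M`. -/
def naturalMap : BalancedTensor (symInv P).val (invariantsAct P ρ) →ₗ[ℂ] M :=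
  BalancedTensor.act (symInv P).val (invariantsAct P ρ) (ρ.comp (symA P))
    (invariants P ρ).subtype (fun _ _ => rfl)

end Invariants

/-- The algebra of invariants `𝒟(T)^W`. -/
def DTinv : Subalgebra ℂ (Module.End ℂ (TorusRing P)) where
  carrier := {D | D ∈ DT P ∧ ∀ w, weylConj P w D = D}
  mul_mem' := fun hD hE => ⟨mul_mem hD.1 hE.1, fun w => by rw [map_mul, hD.2 w, hE.2 w]⟩
  add_mem' := fun hD hE => ⟨add_mem hD.1 hE.1, fun w => by rw [map_add, hD.2 w, hE.2 w]⟩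
  algebraMap_mem' := fun c => ⟨algebraMap_mem _ c, fun w => (weylConj P w).commutes c⟩

/-- The inclusion `𝒟(T)^W → 𝒟(T)`. -/
def DTinvIncl : DTinv P →ₐ[ℂ] DT P := Subalgebra.inclusion fun _ h => h.1

/-- The embedding `Sym 𝔱 → 𝒟(T)`, `ξ ↦ ∂_ξ`. -/
def symD : SymmetricAlgebra ℂ 𝔱 →ₐ[ℂ] DT P := reesEvalOne.comp (symDh P)

lemma reesEvalOne_smul (w : P.weylGroup) (x : DhT P) :
    (reesEvalOne (w • x) : Module.End ℂ (TorusRing P)) = weylConj P w (reesEvalOne x) := by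
  have h : ((w • x : DhT P) : Polynomial (Module.End ℂ (TorusRing P))) =
      (x : Polynomial (Module.End ℂ (TorusRing P))).map (weylConj P w : _ →+* _) := by
    ext1 n
    rw [Polynomial.coeff_map]
    exact reesConj_coeff _ _ _
  change Polynomial.eval₂ _ 1 ((w • x : DhT P) : Polynomial (Module.End ℂ (TorusRing P))) =
    weylConj P w (Polynomial.eval₂ _ 1 (x : Polynomial (Module.End ℂ (TorusRing P))))
  rw [h, Polynomial.eval₂_eq_sum_range, Polynomial.eval₂_eq_sum_range,
    Polynomial.natDegree_map_eq_of_injective (weylConj P w).injective, map_sum]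
  simp [Polynomial.coeff_map]

/-- The embedding `(Sym 𝔱)^W → 𝒟(T)^W`. -/
def symDinv : symInv P →ₐ[ℂ] DTinv P :=
  (((DT P).val.comp (symD P)).comp (symInv P).val).codRestrict (DTinv P) (fun s =>
    ⟨(symD P s).2, fun w => by
      change weylConj P w (reesEvalOne (symDh P s)) = reesEvalOne (symDh P s)
      rw [← reesEvalOne_smul, ← symDh_symAct, s.2 w]⟩)

lemma symD_comp (s : symInv P) : symD P s = DTinvIncl P (symDinv P s) := Subtype.ext rfl

/-- The map `Sym 𝔱 ⊗_{(Sym 𝔱)^W} L → 𝒟(T) ⊗_{𝒟(T)^W} L` induced by `Sym 𝔱 → 𝒟(T)`. -/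
def sphericalMap {L : Type*} [AddCommGroup L] [Module ℂ L] (σ : DTinv P →ₐ[ℂ] Module.End ℂ L) :=
  @BalancedTensor.map (SymmetricAlgebra ℂ 𝔱) (DT P) (symInv P) (DTinv P) L _ _ _ _ _ _ _ _ _ _
    (symInv P).val (DTinvIncl P) (symD P) (symDinv P) (symD_comp P) σ

end Torus

/-! ## The degenerate nil DAHA `ℋ(𝔱_aff, W̃)` -/

section NilHecke

variable {ι V 𝔱 : Type*} [AddCommGroup V] [Module ℂ V] [AddCommGroup 𝔱] [Module ℂ 𝔱]
  (P : RootPairing ι ℂ V 𝔱)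

instance weylGroup_finite [Finite ι] [P.IsRootSystem] : Finite P.weylGroup := by
  refine Finite.of_injective (fun w : P.weylGroup => P.weylGroupToPerm w) fun v w h => ?_
  have h1 : ∀ x : V, v • x = w • x := by
    intro x
    have hx : x ∈ Submodule.span ℂ (Set.range P.root) := by simp
    induction hx using Submodule.span_induction with
    | mem x hx =>
      obtain ⟨i, rfl⟩ := hx
      rw [P.weylGroup_apply_root, P.weylGroup_apply_root]
      exact congrArg (fun f : Equiv.Perm ι => P.root (f i)) h
    | zero => simp
    | add x y _ _ hx hy => rw [smul_add, smul_add, hx, hy]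
    | smul c x _ hx => rw [smul_comm, smul_comm w, hx]
  refine Subtype.ext (RootPairing.Equiv.weightHom_injective P ?_)
  exact LinearEquiv.ext h1

/-- The action of `W` on the lattice `𝕏*`, written multiplicatively. -/
def latticeAct : P.weylGroup →* MulAut (Multiplicative (weightLattice P)) where
  toFun w := AddEquiv.toMultiplicative (weightAct P w)
  map_one' := MulEquiv.ext fun x =>
    congrArg Multiplicative.ofAdd (Subtype.ext (one_smul P.weylGroup (x.toAdd : V)))
  map_mul' := fun v w => MulEquiv.ext fun x =>
    congrArg Multiplicative.ofAdd (Subtype.ext (mul_smul v w (x.toAdd : V)))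

/-- The extended affine Weyl group `W̃ = W ⋉ 𝕏*`. -/
abbrev ExtWeyl : Type _ := Multiplicative (weightLattice P) ⋊[latticeAct P] P.weylGroup

/-- `e^μ` as an element of `W̃`. -/
def translation (μ : weightLattice P) : ExtWeyl P := SemidirectProduct.inl (Multiplicative.ofAdd μ)

/-- The linear action of `W̃` on `𝔱_aff = 𝔱 ⊕ ℂħ`:
`w (ξ + c ħ) = w ξ + c ħ` and `e^μ (ξ + c ħ) = ξ + (c - ⟨μ, ξ⟩) ħ`. -/
def affineRep : ExtWeyl P →* Module.End ℂ (𝔱 × ℂ) where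
  toFun g :=
    { toFun := fun x => (cartanRep P g.right x.1,
        x.2 - P.toLinearMap (g.left.toAdd : V) (cartanRep P g.right x.1))
      map_add' := fun x y => by
        ext
        · simp
        · simp only [Prod.fst_add, Prod.snd_add, map_add]
          ring
      map_smul' := fun c x => by
        ext
        · simp
        · simp only [Prod.smul_fst, Prod.smul_snd, map_smul, smul_eq_mul, RingHom.id_apply]
          ring }
  map_one' := by
    refine LinearMap.ext fun x => ?_
    ext <;> simp
  map_mul' := fun g h => by
    refine LinearMap.ext fun x => ?_
    have hl : (((g * h).left.toAdd : weightLattice P) : V) =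
      (g.left.toAdd : V) + g.right • (h.left.toAdd : V) := rfl
    have hr : cartanRep P (g * h).right x.1 = cartanRep P g.right (cartanRep P h.right x.1) := by
      rw [SemidirectProduct.mul_right, map_mul]
      rfl
    ext
    · exact hr
    · simp only [LinearMap.coe_mk, AddHom.coe_mk, Module.End.mul_apply]
      rw [hr, hl, map_add, LinearMap.add_apply, pairing_weyl_weyl]
      ring

variable (𝔱) in
/-- `Sym 𝔱_aff = ℂ[𝔱*][ħ]`. -/
abbrev SymAff : Type _ := SymmetricAlgebra ℂ (𝔱 × ℂ)

variable (𝔱) in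
/-- The field of fractions of `Sym 𝔱_aff`. -/
abbrev FracAff : Type _ := FractionRing (SymAff 𝔱)

/-- The algebra endomorphism of `Sym 𝔱_aff` given by `g ∈ W̃`. -/
def symAffAct (g : ExtWeyl P) : SymAff 𝔱 →ₐ[ℂ] SymAff 𝔱 :=
  SymmetricAlgebra.lift (SymmetricAlgebra.ι ℂ (𝔱 × ℂ) ∘ₗ affineRep P g)

lemma symAffAct_ι (g : ExtWeyl P) (x : 𝔱 × ℂ) :
    symAffAct P g (SymmetricAlgebra.ι ℂ _ x) = SymmetricAlgebra.ι ℂ _ (affineRep P g x) := by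
  simp [symAffAct]

/-- The action of `W̃` on `Sym 𝔱_aff` by algebra automorphisms. -/
instance symAffAction : MulSemiringAction (ExtWeyl P) (SymAff 𝔱) where
  smul g s := symAffAct P g s
  one_smul := fun s => by
    have : symAffAct P 1 = AlgHom.id ℂ (SymAff 𝔱) := by
      refine SymmetricAlgebra.algHom_ext (LinearMap.ext fun x => ?_)
      change symAffAct P 1 (SymmetricAlgebra.ι ℂ _ x) = SymmetricAlgebra.ι ℂ _ x
      rw [symAffAct_ι, map_one, Module.End.one_apply]
    exact DFunLike.congr_fun this s
  mul_smul := fun g h s => by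
    have : symAffAct P (g * h) = (symAffAct P g).comp (symAffAct P h) := by
      refine SymmetricAlgebra.algHom_ext (LinearMap.ext fun x => ?_)
      change symAffAct P (g * h) (SymmetricAlgebra.ι ℂ _ x) =
        symAffAct P g (symAffAct P h (SymmetricAlgebra.ι ℂ _ x))
      rw [symAffAct_ι, symAffAct_ι, symAffAct_ι, map_mul, Module.End.mul_apply]
    exact DFunLike.congr_fun this s
  smul_zero := fun g => map_zero (symAffAct P g)
  smul_add := fun g => map_add (symAffAct P g)
  smul_one := fun g => map_one (symAffAct P g)
  smul_mul := fun g => map_mul (symAffAct P g)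

/-- The induced action of `W̃` on the field of fractions. -/
instance fracAffAction : MulSemiringAction (ExtWeyl P) (FracAff 𝔱) :=
  IsFractionRing.mulSemiringAction (ExtWeyl P) (SymAff 𝔱) (FracAff 𝔱)

lemma smul_algebraMap_frac (g : ExtWeyl P) (s : SymAff 𝔱) :
    g • algebraMap (SymAff 𝔱) (FracAff 𝔱) s = algebraMap (SymAff 𝔱) (FracAff 𝔱) (g • s) :=
  IsFractionRing.ringEquivOfRingEquiv_algebraMap _ _

instance fracAffAction_comm : SMulCommClass (ExtWeyl P) ℂ (FracAff 𝔱) where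
  smul_comm g c x := by
    rw [Algebra.smul_def, Algebra.smul_def, smul_mul',
      IsScalarTower.algebraMap_apply ℂ (SymAff 𝔱) (FracAff 𝔱), smul_algebraMap_frac]
    congr 2
    exact (symAffAct P g).commutes c

/-- The smash product `W̃ ⋉ Frac(Sym 𝔱_aff)`. -/
abbrev WFrac : Type _ := SkewMonoidAlgebra (FracAff 𝔱) (ExtWeyl P)

/-- An element of `Sym 𝔱_aff` as an element of `W̃ ⋉ Frac(Sym 𝔱_aff)`. -/
def polyElt (s : SymAff 𝔱) : WFrac P :=
  SkewMonoidAlgebra.single 1 (algebraMap (SymAff 𝔱) (FracAff 𝔱) s)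

/-- An element of `W̃` as an element of `W̃ ⋉ Frac(Sym 𝔱_aff)`. -/
def groupElt (g : ExtWeyl P) : WFrac P := SkewMonoidAlgebra.single g 1

/-- The Demazure element `(1 / a) (s - 1)` of an affine reflection `s` with affine coroot `a`. -/
def demazure (a : 𝔱 × ℂ) (s : ExtWeyl P) : WFrac P :=
  SkewMonoidAlgebra.single 1 (algebraMap (SymAff 𝔱) (FracAff 𝔱) (SymmetricAlgebra.ι ℂ _ a))⁻¹ *
    (groupElt P s - 1)

/-- The weight lattice contains the roots. -/
def rootWeight [P.IsCrystallographic] (i : ι) : weightLattice P :=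
  ⟨P.root i, fun j => by
    obtain ⟨n, hn⟩ := P.exists_value (S := ℤ) i j
    exact ⟨n, by simpa using! hn.symm⟩⟩

variable {P}

/-- The root `δ` with index `j` is the one that defines an additional affine simple root: its
coroot is the highest coroot of an irreducible component. -/
def IsHighest (b : P.Base) (j : ι) : Prop :=
  ∀ i ∈ b.support, P.coroot j + P.coroot i ≠ 0 ∧ P.coroot j + P.coroot i ∉ Set.range P.coroot

/-- The Demazure element `θ_α = (1 / α̌) (s_α - 1)` of a root `α ∈ R`. -/
def thetaFin (P : RootPairing ι ℂ V 𝔱) (i : ι) : WFrac P :=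
  demazure P (P.coroot i, 0) (SemidirectProduct.inr (RootPairing.weylGroup.ofIdx P i))

/-- The Demazure element `θ_{α₀} = (1 / (δ̌ - ħ)) (s_{α₀} - 1)`, where `s_{α₀} = e^δ s_δ` is the
reflection in the hyperplane `δ̌ = ħ`. -/
def thetaAff (P : RootPairing ι ℂ V 𝔱) [P.IsCrystallographic] (j : ι) : WFrac P :=
  demazure P (P.coroot j, -1)
    (translation P (rootWeight P j) * SemidirectProduct.inr (RootPairing.weylGroup.ofIdx P j))

variable [P.IsCrystallographic]

/-- The nil-Hecke algebra `ℋ(𝔱_aff, W_aff)`: the subalgebra of `W̃ ⋉ Frac(Sym 𝔱_aff)` generated by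
`Sym 𝔱_aff` and the Demazure elements of the simple affine roots. -/
def nilHeckeAff (b : P.Base) : Subalgebra ℂ (WFrac P) :=
  Algebra.adjoin ℂ (Set.range (polyElt P) ∪ thetaFin P '' {i | i ∈ b.support} ∪
    thetaAff P '' {j | IsHighest b j})

/-- The degenerate nil DAHA `ℋ(𝔱_aff, W̃)`: the subalgebra generated by `ℋ(𝔱_aff, W_aff)`
and the extended affine Weyl group. -/
def nilDAHA (b : P.Base) : Subalgebra ℂ (WFrac P) :=
  Algebra.adjoin ℂ ((nilHeckeAff b : Set (WFrac P)) ∪ Set.range (groupElt P))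

lemma polyElt_mem (b : P.Base) (s : SymAff 𝔱) : polyElt P s ∈ nilDAHA b :=
  Algebra.subset_adjoin (Or.inl (Algebra.subset_adjoin (Or.inl (Or.inl ⟨s, rfl⟩))))

lemma groupElt_mem (b : P.Base) (g : ExtWeyl P) : groupElt P g ∈ nilDAHA b :=
  Algebra.subset_adjoin (Or.inr ⟨g, rfl⟩)

/-- The element `ħ` of `ℋ(𝔱_aff, W̃)`. -/
def hbarH (b : P.Base) : nilDAHA b :=
  ⟨polyElt P (SymmetricAlgebra.ι ℂ _ (0, 1)), polyElt_mem b _⟩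

/-- The group homomorphism from `W` to `ℋ(𝔱_aff, W̃)`. -/
def weylH (b : P.Base) : P.weylGroup →* nilDAHA b where
  toFun w := ⟨groupElt P (SemidirectProduct.inr w), groupElt_mem b _⟩
  map_one' := rfl
  map_mul' := fun v w => Subtype.ext (by
    simp [groupElt, SkewMonoidAlgebra.single_mul_single])

/-- The canonical embedding `W ⋉ 𝒟_ħ(T) → ℋ(𝔱_aff, W̃)`, determined by `w ↦ w`, `t^μ ↦ e^μ`,
`∂_ξ ↦ ξ`, `ħ ↦ ħ`. -/
structure IsCanonical (b : P.Base) (i : WDhT P →ₐ[ℂ] nilDAHA b) : Prop where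
  map_weyl : ∀ w : P.weylGroup, i (weylA P w) = weylH b w
  map_char : ∀ μ : weightLattice P,
    i (diffA P (charDh P μ)) = ⟨groupElt P (translation P μ), groupElt_mem b _⟩
  map_field : ∀ ξ : 𝔱,
    i (diffA P (fieldDh P ξ)) = ⟨polyElt P (SymmetricAlgebra.ι ℂ _ (ξ, 0)), polyElt_mem b _⟩
  map_hbar : i (hbarA P) = hbarH b

/-- The specialization `ℍ = ℋ(𝔱_aff, W̃)|_{ħ = 1}`. -/
abbrev HOne (b : P.Base) : Type _ := Specialization (hbarH b) 1

/-- The idempotent `e ∈ ℍ`. -/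
def eOne (b : P.Base) : HOne b :=
  symmetrizer (((Specialization.mk (hbarH b) 1 : nilDAHA b →ₐ[ℂ] HOne b) :
    nilDAHA b →* HOne b).comp (weylH b))

variable [Finite ι] [P.IsRootSystem]

lemma eOne_idem (b : P.Base) : IsIdempotentElem (eOne b) := symmetrizer_idem _

/-- The spherical algebra `ℍ^sph = e ℍ e`. -/
abbrev HSph (b : P.Base) : Type _ := (eOne_idem b).Corner

/-- The canonical homomorphism `𝒟(T)^W → ℍ^sph`: if `x ∈ 𝒟_ħ(T)` specializes at `ħ = 1` to
`D ∈ 𝒟(T)^W`, then `D` goes to the image of `x` in `ℍ` times `e`. -/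
def IsCanonicalSph (b : P.Base) (i : WDhT P →ₐ[ℂ] nilDAHA b) (k : DTinv P →ₐ[ℂ] HSph b) : Prop :=
  ∀ (x : DhT P) (D : DTinv P), (reesEvalOne x : Module.End ℂ (TorusRing P)) = D →
    (k D).1 = Specialization.mk (hbarH b) 1 (i (diffA P x)) * eOne b

end NilHecke

end NilDAHA

set_option linter.unusedSectionVars false
set_option linter.unusedSimpArgs false

namespace NilDAHA

/-! ### Real affine roots, the action of `W̃` on them, and affine reflections -/

section AffineRoots

variable {ι V 𝔱 : Type*} [AddCommGroup V] [Module ℂ V] [AddCommGroup 𝔱] [Module ℂ 𝔱]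
  (P : RootPairing ι ℂ V 𝔱)

/-! The proof rests on a presentation of `ℋ`. A `NilSys` in a ring consists of an action of `Sym
𝔱_aff`, a compatible action of `W̃`, and for every real affine root `a = α̌ + nħ` an element `θ_a`
with `a θ_a = s_a - 1`, `θ_a² = 0`, the twisted Leibniz rule, and equivariance under `W̃`. These are
relations of rank one only. The braid relations follow from them: expanding the braid relation of
two reflections in Demazure words gives `π Δ = 0`, where `π` is the product of the positive roots of
rank two and `Δ` the defect of the braid relation of the `θ`; iterated divided differences reduce
`π` to a nonzero integer (`alt_demazure_eq`). Hence `T_w = θ ⋯ θ ω` is independent of the reduced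
word, and the `T_w` span over polynomials. In `W̃ ⋉ Frac` they are also independent, being
triangular for the length, so every `NilSys` extends to `ℋ` (`NilSys.exists_algHom`).

On the other side, `W ⋉ 𝒟_ħ(T)` is just `W̃ ⋉ Sym 𝔱_aff` (`toWDhT_injective`, `toWDhT_surjective`);
surjectivity is the statement that operators of order `≤ n` on a torus are generated by characters
and vector fields with the correct power of `ħ`. The canonical embedding can be read off from this.

For (i), every real affine root is `W̃`-conjugate to a simple root of the finite system, because the
lattice contains the fundamental weights. An extension of the action on `M` is therefore the same as
suitable operators `θ_i` for the finite simple roots. If `M = Sym 𝔱 ⊗ M^W`, the Demazure operator on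
the first factor provides them (`exists_demazure`). Conversely, `ℋ` contains a decomposition `1 = ∑
u_j e y_j` with `u_j ∈ Sym 𝔱` (`NilSys.exists_decomposition`), and `m ↦ ∑ u_j ⊗ e y_j m` inverts the
natural map. Uniqueness holds because multiplication by `a` is injective on elements fixed by `s_a`,
so that `a θ_a = s_a - 1` determines `θ_a`.

For (ii), let `M = 𝒟(T) ⊗ L` over `𝒟(T)^W`. Then `M^W = 1 ⊗ L`, and the map of (ii) is the natural
map of `M`, so (i) applies once extensions of `L` to `ℍ^sph` are matched with extensions of `M` to
`ℍ`. Given the former, written as a map `κ` on `ℍ`, let `h` act by `x ⊗ l ↦ ∑ u_j ⊗ κ(y_j h x) l`.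
The identities to be checked hold after projecting all translates to `L`, and these projections
separate points, since `e` generates the unit ideal of `W ⋉ 𝒟(T)` (`one_mem_of_symmetrizer_mem`).
Injectivity of `𝒟(T)^W → ℍ^sph` is seen in a module of functions on `W̃` where `ħ = 1`, from which a
differential operator can be recovered through its matrix coefficients. -/

lemma cartanRep_coroot (w : P.weylGroup) (i : ι) :
    cartanRep P w (P.coroot i) = P.coroot (P.weylGroupToPerm w i) := by
  have := ((w⁻¹ : P.weylGroup) : P.Aut).toHom.coroot_coweightMap_apply P P i
  have h : cartanRep P w (P.coroot i) =
      P.coroot (((w⁻¹ : P.weylGroup) : P.Aut).toHom.indexEquiv.symm i) := by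
    simp only [cartanRep, MonoidHom.coe_mk, OneHom.coe_mk]
    simpa using! this
  rw [h]
  have h2 : P.weylGroupToPerm w⁻¹ (((w⁻¹ : P.weylGroup) : P.Aut).toHom.indexEquiv.symm i) = i :=
    (((w⁻¹ : P.weylGroup) : P.Aut).toHom.indexEquiv).apply_symm_apply i
  rw [map_inv, Equiv.Perm.inv_def, Equiv.symm_apply_eq] at h2
  rw [h2]

lemma cartanRep_ofIdx (i : ι) (ξ : 𝔱) :
    cartanRep P (RootPairing.weylGroup.ofIdx P i) ξ = P.coreflection i ξ := by
  have h : (RootPairing.weylGroup.ofIdx P i)⁻¹ = RootPairing.weylGroup.ofIdx P i := by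
    refine Subtype.ext ?_
    change (RootPairing.Equiv.reflection P i)⁻¹ = RootPairing.Equiv.reflection P i
    simp
  have h2 : ((RootPairing.weylGroup.ofIdx P i : P.weylGroup) : P.Aut)⁻¹ =
      RootPairing.Equiv.reflection P i := congrArg Subtype.val h
  simp only [cartanRep, MonoidHom.coe_mk, OneHom.coe_mk]
  rw [h2]
  rfl

lemma cartanRep_injective : Function.Injective (cartanRep P) := by
  intro v w h
  have h1 : (RootPairing.Equiv.coweightHom P (v : P.Aut)⁻¹) =
      (RootPairing.Equiv.coweightHom P (w : P.Aut)⁻¹) := MulOpposite.unop_injective h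
  exact Subtype.ext (inv_injective (RootPairing.Equiv.coweightHom_injective P h1))

/-- The integer `⟨μ, α̌ᵢ⟩`. -/
def wtPair (μ : weightLattice P) (i : ι) : ℤ := Classical.choose (μ.2 i)

lemma wtPair_spec (μ : weightLattice P) (i : ι) :
    P.toLinearMap (μ : V) (P.coroot i) = (wtPair P μ i : ℂ) := Classical.choose_spec (μ.2 i)

/-- Real affine roots `α̌ᵢ + n ħ`. -/
@[ext] structure AffRoot {ι V 𝔱 : Type*} [AddCommGroup V] [Module ℂ V] [AddCommGroup 𝔱]
    [Module ℂ 𝔱] (P : RootPairing ι ℂ V 𝔱) where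
  idx : ι
  lev : ℤ

variable {P}

/-- The affine root as a vector of `𝔱 ⊕ ℂ ħ`. -/
def AffRoot.vec (a : AffRoot P) : 𝔱 × ℂ := (P.coroot a.idx, a.lev)

lemma AffRoot.vec_injective : Function.Injective (AffRoot.vec : AffRoot P → 𝔱 × ℂ) := by
  rintro ⟨i, n⟩ ⟨j, m⟩ h
  simp only [AffRoot.vec, Prod.mk.injEq, Int.cast_inj] at h
  rw [P.coroot.injective h.1, h.2]

lemma affineRep_apply (g : ExtWeyl P) (x : 𝔱 × ℂ) : affineRep P g x = (cartanRep P g.right x.1,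
    x.2 - P.toLinearMap (g.left.toAdd : V) (cartanRep P g.right x.1)) := rfl

instance : SMul (ExtWeyl P) (AffRoot P) where
  smul g a := ⟨P.weylGroupToPerm g.right a.idx,
    a.lev - wtPair P g.left.toAdd (P.weylGroupToPerm g.right a.idx)⟩

lemma AffRoot.vec_smul (g : ExtWeyl P) (a : AffRoot P) :
    (g • a).vec = affineRep P g a.vec := by
  rw [affineRep_apply]
  simp only [AffRoot.vec]
  rw [cartanRep_coroot]
  refine Prod.ext rfl ?_
  simp only
  rw [wtPair_spec]
  change (((a.lev - wtPair P g.left.toAdd (P.weylGroupToPerm g.right a.idx) : ℤ)) : ℂ) = _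
  push_cast
  rfl

instance : MulAction (ExtWeyl P) (AffRoot P) where
  one_smul a := AffRoot.vec_injective (by rw [AffRoot.vec_smul, map_one, Module.End.one_apply])
  mul_smul g h a := AffRoot.vec_injective (by
    simp only [AffRoot.vec_smul, map_mul, Module.End.mul_apply])

instance : Neg (AffRoot P) where
  neg a := ⟨P.reflectionPerm a.idx a.idx, -a.lev⟩

lemma AffRoot.vec_neg (a : AffRoot P) : (-a).vec = -a.vec := by
  change (P.coroot (P.reflectionPerm a.idx a.idx), ((-a.lev : ℤ) : ℂ)) = _
  simp [AffRoot.vec]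

/-- The value of the linear part of the root of `a` on a vector. -/
def AffRoot.ev (a : AffRoot P) : 𝔱 × ℂ →ₗ[ℂ] ℂ :=
  P.toLinearMap (P.root a.idx) ∘ₗ LinearMap.fst ℂ 𝔱 ℂ

lemma AffRoot.ev_apply (a : AffRoot P) (x : 𝔱 × ℂ) :
    a.ev x = P.toLinearMap (P.root a.idx) x.1 := rfl

lemma AffRoot.ev_vec (a b : AffRoot P) : a.ev b.vec = P.pairing a.idx b.idx := rfl

lemma AffRoot.ev_self (a : AffRoot P) : a.ev a.vec = 2 := P.pairing_same _

lemma AffRoot.vec_ne_zero (a : AffRoot P) : a.vec ≠ 0 := by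
  intro h
  have := a.ev_self
  rw [h, map_zero] at this
  norm_num at this

/-- On `(ξ, 0)` the first coordinate detects the Weyl group part, and then the `ħ`-coordinate
detects the translation because the pairing is perfect. Identities between affine reflections are
checked in this faithful representation. -/
lemma affineRep_injective : Function.Injective (affineRep P) := by
  refine (injective_iff_map_eq_one _).mpr fun g hg => ?_
  have h : ∀ x, affineRep P g x = x := fun x => by rw [hg, Module.End.one_apply]
  have hr : g.right = 1 := by
    apply cartanRep_injective
    ext ξ
    rw [map_one]
    exact congrArg Prod.fst (h (ξ, 0))
  have hl : (g.left.toAdd : V) = 0 := by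
    apply P.toPerfPair.injective
    ext ξ
    have h2 := congrArg Prod.snd (h (ξ, 0))
    rw [affineRep_apply, hr] at h2
    simpa using h2
  refine SemidirectProduct.ext ?_ hr
  exact congrArg Multiplicative.ofAdd (Subtype.ext hl)

variable [P.IsCrystallographic]

/-- The affine reflection `x ↦ x - ⟨α, x⟩ (α̌ + n ħ)`. -/
def AffRoot.refl (a : AffRoot P) : ExtWeyl P :=
  translation P (-a.lev • rootWeight P a.idx) *
    SemidirectProduct.inr (RootPairing.weylGroup.ofIdx P a.idx)

lemma AffRoot.refl_left (a : AffRoot P) :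
    (a.refl.left.toAdd : V) = -(a.lev : ℂ) • P.root a.idx := by
  have h : a.refl.left = Multiplicative.ofAdd (-a.lev • rootWeight P a.idx) := by
    rw [AffRoot.refl, SemidirectProduct.mul_left, SemidirectProduct.left_inr, map_one, mul_one]
    rfl
  rw [h]
  simp [rootWeight, Int.cast_smul_eq_zsmul]

lemma AffRoot.refl_right (a : AffRoot P) :
    a.refl.right = RootPairing.weylGroup.ofIdx P a.idx := by
  rw [AffRoot.refl, SemidirectProduct.mul_right]
  exact one_mul _

lemma AffRoot.refl_apply (a : AffRoot P) (x : 𝔱 × ℂ) :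
    affineRep P a.refl x = x - a.ev x • a.vec := by
  rw [affineRep_apply, a.refl_left, a.refl_right, cartanRep_ofIdx, P.coreflection_apply]
  refine Prod.ext ?_ ?_
  · rfl
  · simp only [AffRoot.ev_apply, AffRoot.vec, Prod.snd_sub, map_sub, map_smul,
      LinearMap.smul_apply, smul_eq_mul]
    have h1 : P.toLinearMap (P.root a.idx) (P.coroot a.idx) = 2 := P.pairing_same _
    have h2 : P.root' a.idx x.1 = P.toLinearMap (P.root a.idx) x.1 := rfl
    rw [h1, h2, Prod.smul_snd, smul_eq_mul]
    ring

lemma thetaFin_eq (i : ι) : thetaFin P i = demazure P (AffRoot.vec (P := P) ⟨i, 0⟩)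
    (AffRoot.refl (P := P) ⟨i, 0⟩) := by
  simp [thetaFin, AffRoot.vec, AffRoot.refl, translation]

lemma thetaAff_eq (i : ι) : thetaAff P i = demazure P (AffRoot.vec (P := P) ⟨i, -1⟩)
    (AffRoot.refl (P := P) ⟨i, -1⟩) := by
  simp [thetaAff, AffRoot.vec, AffRoot.refl]

end AffineRoots


/-! ### Affine heights, simple affine roots, and the length function on `W̃` -/

section Length

variable {ι V 𝔱 : Type*} [AddCommGroup V] [Module ℂ V] [AddCommGroup 𝔱] [Module ℂ 𝔱]
  {P : RootPairing ι ℂ V 𝔱} [P.IsCrystallographic]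

/-- The integer `⟨α, β̌⟩` for affine roots `a`, `c` with linear parts `α̌`, `β̌`. -/
def AffRoot.pair (a c : AffRoot P) : ℤ := P.pairingIn ℤ a.idx c.idx

lemma AffRoot.ev_vec_eq (a c : AffRoot P) : a.ev c.vec = (a.pair c : ℂ) := by
  rw [AffRoot.ev_vec, AffRoot.pair]
  exact (P.algebraMap_pairingIn ℤ a.idx c.idx).symm

lemma AffRoot.pair_self (a : AffRoot P) : a.pair a = 2 := by
  have h := a.ev_self
  rw [AffRoot.ev_vec_eq] at h
  exact_mod_cast h

lemma AffRoot.vec_refl_smul (a c : AffRoot P) :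
    (a.refl • c).vec = c.vec - (a.pair c : ℂ) • a.vec := by
  rw [AffRoot.vec_smul, AffRoot.refl_apply, AffRoot.ev_vec_eq]

lemma AffRoot.refl_smul_self (a : AffRoot P) : a.refl • a = -a := by
  apply AffRoot.vec_injective
  rw [AffRoot.vec_refl_smul, AffRoot.pair_self, AffRoot.vec_neg]
  push_cast
  module

lemma AffRoot.neg_neg' (a : AffRoot P) : -(-a) = a :=
  AffRoot.vec_injective (by rw [AffRoot.vec_neg, AffRoot.vec_neg, neg_neg])

lemma AffRoot.smul_neg' (g : ExtWeyl P) (a : AffRoot P) : g • (-a) = -(g • a) :=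
  AffRoot.vec_injective (by simp only [AffRoot.vec_neg, AffRoot.vec_smul, map_neg])

lemma AffRoot.ev_smul (g : ExtWeyl P) (a : AffRoot P) (x : 𝔱 × ℂ) :
    (g • a).ev (affineRep P g x) = a.ev x := by
  rw [AffRoot.ev_apply, AffRoot.ev_apply, affineRep_apply]
  change P.toLinearMap (P.root (P.weylGroupToPerm g.right a.idx)) (cartanRep P g.right x.1) = _
  rw [← P.weylGroup_apply_root, pairing_weyl_weyl]

lemma AffRoot.refl_mul_self (a : AffRoot P) : a.refl * a.refl = 1 := by
  apply affineRep_injective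
  refine LinearMap.ext fun x => ?_
  rw [map_mul, Module.End.mul_apply, AffRoot.refl_apply, AffRoot.refl_apply, map_one,
    Module.End.one_apply, map_sub, map_smul, AffRoot.ev_self]
  simp only [smul_eq_mul]
  module

lemma AffRoot.refl_inv (a : AffRoot P) : a.refl⁻¹ = a.refl :=
  inv_eq_of_mul_eq_one_left a.refl_mul_self

lemma AffRoot.refl_smul (g : ExtWeyl P) (a : AffRoot P) :
    (g • a).refl = g * a.refl * g⁻¹ := by
  rw [eq_mul_inv_iff_mul_eq]
  apply affineRep_injective
  refine LinearMap.ext fun x => ?_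
  rw [map_mul, map_mul, Module.End.mul_apply, Module.End.mul_apply, AffRoot.refl_apply,
    AffRoot.refl_apply, AffRoot.ev_smul, AffRoot.vec_smul, map_sub, map_smul]

lemma AffRoot.refl_smul_refl_smul (a c : AffRoot P) : a.refl • a.refl • c = c := by
  rw [← mul_smul, AffRoot.refl_mul_self, one_smul]

section Height

variable [Finite ι] [P.IsRootSystem] [P.IsReduced] (b : P.Base)

/-- A bound for the heights of the coroots. -/
lemma exists_height_bound : ∃ h : ℤ, ∀ i, |b.flip.height i| < h := by
  obtain ⟨m, hm⟩ := (Set.finite_range fun i => |b.flip.height i|).bddAbove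
  exact ⟨m + 1, fun i => Int.lt_add_one_of_le (hm ⟨i, rfl⟩)⟩

/-- The height of `ħ`. -/
def hbarHeight : ℤ := Classical.choose (exists_height_bound b)

lemma height_lt_hbarHeight (i : ι) : |b.flip.height i| < hbarHeight b :=
  Classical.choose_spec (exists_height_bound b) i

/-- The affine height. -/
def AffRoot.ht (a : AffRoot P) : ℤ := b.flip.height a.idx + a.lev * hbarHeight b

/-- The affine height as a linear form. -/
def htForm : 𝔱 × ℂ →ₗ[ℂ] ℂ :=
  (b.toCoweightBasis.constr ℂ fun _ => (1 : ℂ)) ∘ₗ LinearMap.fst ℂ 𝔱 ℂ +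
    (hbarHeight b : ℂ) • LinearMap.snd ℂ 𝔱 ℂ

lemma htForm_vec (a : AffRoot P) : htForm b a.vec = (a.ht b : ℂ) := by
  obtain ⟨f, -, -, hf⟩ := b.flip.exists_root_eq_sum_int a.idx
  have h1 := b.flip.height_eq_sum hf
  have h2 : P.coroot a.idx = ∑ j ∈ b.support, f j • P.coroot j := by simpa using! hf
  have h3 : b.toCoweightBasis.constr ℂ (fun _ => (1 : ℂ)) (P.coroot a.idx) =
      (b.flip.height a.idx : ℂ) := by
    rw [h1, h2, map_sum]
    push_cast
    refine Finset.sum_congr rfl fun j hj => ?_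
    have : P.coroot j = b.toCoweightBasis ⟨j, hj⟩ := by simp
    rw [map_zsmul, this, Module.Basis.constr_basis]
    simp
  simp only [htForm, AffRoot.vec, LinearMap.add_apply, LinearMap.comp_apply, LinearMap.fst_apply,
    LinearMap.smul_apply, LinearMap.snd_apply, h3, AffRoot.ht, smul_eq_mul]
  push_cast
  ring

/-- Heights of integral combinations of affine roots, after transport by `g`. -/
lemma ht_smul_combo (g : ExtWeyl P) {c a d : AffRoot P} {x y : ℤ}
    (h : c.vec = (x : ℂ) • a.vec + (y : ℂ) • d.vec) :
    (g • c).ht b = x * (g • a).ht b + y * (g • d).ht b := by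
  have h2 := congrArg (fun v => htForm b (affineRep P g v)) h
  simp only [map_add, map_smul, ← AffRoot.vec_smul, htForm_vec, smul_eq_mul] at h2
  exact_mod_cast h2

lemma ht_combo {c a d : AffRoot P} {x y : ℤ}
    (h : c.vec = (x : ℂ) • a.vec + (y : ℂ) • d.vec) :
    c.ht b = x * a.ht b + y * d.ht b := by
  have := ht_smul_combo b 1 h
  simpa using this

lemma ht_refl_smul (a c : AffRoot P) : (a.refl • c).ht b = c.ht b - a.pair c * a.ht b := by
  have := ht_combo b (c := a.refl • c) (a := c) (d := a) (x := 1) (y := -a.pair c)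
    (by rw [AffRoot.vec_refl_smul]; push_cast; module)
  rw [this]
  ring

lemma ht_neg (a : AffRoot P) : (-a).ht b = -a.ht b := by
  have := ht_combo b (c := -a) (a := a) (d := a) (x := -1) (y := 0)
    (by rw [AffRoot.vec_neg]; push_cast; module)
  rw [this]
  ring

/-- The height of `ħ` exceeds that of every coroot, so a nonzero level decides the sign; at level
zero the height is that of a coroot. -/
lemma ht_ne_zero (a : AffRoot P) : a.ht b ≠ 0 := by
  intro h
  have h1 := height_lt_hbarHeight b a.idx
  have h2 := b.flip.height_ne_zero a.idx
  rw [abs_lt] at h1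
  rw [AffRoot.ht] at h
  rcases lt_trichotomy a.lev 0 with h3 | h3 | h3
  · nlinarith
  · rw [h3] at h; simp at h; exact h2 h
  · nlinarith

lemma hbarHeight_pos [Nonempty ι] : 0 < hbarHeight b :=
  lt_of_le_of_lt (abs_nonneg _) (height_lt_hbarHeight b (Classical.arbitrary ι))

/-- A simple affine root: its reflection permutes the other positive affine roots. -/
def IsSimple (a : AffRoot P) : Prop :=
  0 < a.ht b ∧ ∀ c : AffRoot P, 0 < c.ht b → c ≠ a → 0 < (a.refl • c).ht b

/-- The inversion set. -/
def invSet (w : ExtWeyl P) : Set (AffRoot P) := {a | 0 < a.ht b ∧ (w⁻¹ • a).ht b < 0}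

/-- The group element shifts the level by an amount depending only on the coroot, so for each of the
finitely many coroots the level of an inversion is confined to a finite interval. -/
lemma invSet_finite (w : ExtWeyl P) : (invSet b w).Finite := by
  have hw : ∀ i : ι, ∃ j : ι, ∃ k : ℤ, ∀ n : ℤ, (w⁻¹ • (⟨i, n⟩ : AffRoot P)) = ⟨j, n - k⟩ :=
    fun i => ⟨P.weylGroupToPerm w⁻¹.right i,
      wtPair P w⁻¹.left.toAdd (P.weylGroupToPerm w⁻¹.right i), fun n => rfl⟩
  choose j k hk using hw
  have hfin : (⋃ i : ι, (fun n => (⟨i, n⟩ : AffRoot P)) '' Set.Icc (0 : ℤ) (k i)).Finite :=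
    Set.finite_iUnion fun i => (Set.finite_Icc _ _).image _
  refine hfin.subset ?_
  rintro ⟨i, n⟩ ⟨h1, h2⟩
  rw [hk] at h2
  simp only [AffRoot.ht] at h1 h2
  have h3 := abs_lt.mp (height_lt_hbarHeight b i)
  have h4 := abs_lt.mp (height_lt_hbarHeight b (j i))
  refine Set.mem_iUnion.mpr ⟨i, n, ⟨?_, ?_⟩, rfl⟩
  · by_contra hn
    nlinarith
  · by_contra hn
    nlinarith

/-- The length function. -/
def len (w : ExtWeyl P) : ℕ := (invSet b w).ncard

/-- If `y` were negative, then `a = x + (-y)` would decompose `a` into two positive roots. -/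
lemma pos_of_sub {a : AffRoot P}
    (ha : ∀ c d : AffRoot P, a.vec = c.vec + d.vec → 0 < c.ht b → ¬ 0 < d.ht b)
    {x y : AffRoot P} (hx : 0 < x.ht b) (hy : y.vec = x.vec - a.vec) : 0 < y.ht b := by
  rcases lt_or_gt_of_ne (ht_ne_zero b y) with h | h
  · exact absurd (by rw [ht_neg]; omega) (ha x (-y) (by rw [AffRoot.vec_neg, hy]; abel) hx)
  · exact h

lemma exists_sub_of_pair_pos {a c : AffRoot P} (h : 0 < a.pair c) (hne : c.idx ≠ a.idx) :
    ∃ d : AffRoot P, d.vec = c.vec - a.vec := by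
  have h1 : P.coroot c.idx - P.coroot a.idx ∈ Set.range P.coroot := by
    have := P.flip.root_sub_root_mem_of_pairingIn_pos (i := c.idx) (j := a.idx) (by
      have h2 : P.flip.pairingIn ℤ c.idx a.idx = P.pairingIn ℤ a.idx c.idx := by
        have h3 := P.flip.algebraMap_pairingIn ℤ c.idx a.idx
        have h4 := P.algebraMap_pairingIn ℤ a.idx c.idx
        exact (FaithfulSMul.algebraMap_injective ℤ ℂ) (h3.trans h4.symm)
      rw [h2]
      exact h) hne
    simpa using! this
  obtain ⟨k, hk⟩ := h1
  refine ⟨⟨k, c.lev - a.lev⟩, Prod.ext hk ?_⟩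
  simp [AffRoot.vec]

/-- When `⟨α, č⟩ ≤ 0` the reflection does not lower the height. Otherwise one descends the
`a`-string from `c` to `s_a c` in steps of `-a`; every root on the way stays positive by
indecomposability. -/
lemma isSimple_of_indecomposable {a : AffRoot P} (h0 : 0 < a.ht b) (h1 : a.ht b < hbarHeight b)
    (ha : ∀ c d : AffRoot P, a.vec = c.vec + d.vec → 0 < c.ht b → ¬ 0 < d.ht b) :
    IsSimple b a := by
  refine ⟨h0, fun c hc hca => ?_⟩
  by_cases hk : a.pair c ≤ 0
  · rw [ht_refl_smul]
    nlinarith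
  push Not at hk
  -- Equal coroots: `c = a + mħ` with `m ≥ 1`, and `s_a c = -a + mħ` is positive because `a` is
  -- lower than `ħ`.
  by_cases hi : c.idx = a.idx
  · have h2 : a.pair c = 2 := by
      rw [← a.pair_self, AffRoot.pair, AffRoot.pair, hi]
    rw [ht_refl_smul, h2]
    have hlev : c.lev ≠ a.lev := fun h => hca (AffRoot.ext hi h)
    have h3 : c.ht b = a.ht b + (c.lev - a.lev) * hbarHeight b := by
      simp only [AffRoot.ht, hi]; ring
    have h4 : 0 ≤ c.lev - a.lev := by
      by_contra h
      nlinarith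
    have h5 : 1 ≤ c.lev - a.lev := by omega
    nlinarith
  · obtain ⟨d, hd⟩ := exists_sub_of_pair_pos hk hi
    have hdpos := pos_of_sub b ha hc hd
    have hpd : a.pair d = a.pair c - 2 := by
      have := congrArg a.ev hd
      rw [map_sub, AffRoot.ev_vec_eq, AffRoot.ev_vec_eq, AffRoot.ev_vec_eq, AffRoot.pair_self] at this
      exact_mod_cast this
    -- Reducedness bounds the Cartan integer for nonproportional roots, so at most three
    -- subtractions of `a` occur.
    have hle : a.pair c ≤ 3 := by
      have := P.pairingIn_pairingIn_mem_set_of_isCrystal_of_isRed a.idx c.idx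
      simp only [Set.mem_insert_iff, Set.mem_singleton_iff, Prod.mk.injEq] at this
      rw [AffRoot.pair]
      omega
    have hv := a.vec_refl_smul c
    obtain h | h | h : a.pair c = 1 ∨ a.pair c = 2 ∨ a.pair c = 3 := by omega
    · refine pos_of_sub b ha hc ?_
      rw [hv, h]; push_cast; module
    · refine pos_of_sub b ha hdpos ?_
      rw [hv, h, hd]; push_cast; module
    · obtain ⟨d2, hd2⟩ := exists_sub_of_pair_pos (a := a) (c := d) (by omega) (by
        intro hda
        have : a.pair d = 2 := by rw [← a.pair_self, AffRoot.pair, AffRoot.pair, hda]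
        omega)
      refine pos_of_sub b ha (pos_of_sub b ha hdpos hd2) ?_
      rw [hv, h, hd2, hd]; push_cast; module

/-- An inversion of minimal height is simple. It lies below `ħ`, as subtracting `ħ` would give a
lower inversion. It is indecomposable, as one of two positive summands would again be an inversion,
of smaller height. -/
lemma exists_simple_descent {w : ExtWeyl P} (h : (invSet b w).Nonempty) :
    ∃ a, IsSimple b a ∧ (w⁻¹ • a).ht b < 0 := by
  obtain ⟨a, ha, hmin⟩ := Set.exists_min_image (invSet b w) (fun a => a.ht b) (invSet_finite b w) h
  have : Nonempty ι := ⟨a.idx⟩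
  refine ⟨a, isSimple_of_indecomposable b ha.1 ?_ ?_, ha.2⟩
  · by_contra hge
    push Not at hge
    have hpos := hbarHeight_pos b
    have h1 : (⟨a.idx, a.lev - 1⟩ : AffRoot P).ht b = a.ht b - hbarHeight b := by
      simp only [AffRoot.ht]; ring
    have h2 : (w⁻¹ • (⟨a.idx, a.lev - 1⟩ : AffRoot P)).ht b = (w⁻¹ • a).ht b - hbarHeight b := by
      have : w⁻¹ • (⟨a.idx, a.lev - 1⟩ : AffRoot P) = ⟨(w⁻¹ • a).idx, (w⁻¹ • a).lev - 1⟩ := by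
        refine AffRoot.ext rfl ?_
        change a.lev - 1 - _ = a.lev - _ - 1
        ring
      rw [this]
      simp only [AffRoot.ht]; ring
    have h3 : a.ht b - hbarHeight b ≠ 0 := h1 ▸ ht_ne_zero b _
    have h4 := hmin ⟨a.idx, a.lev - 1⟩ ⟨by omega, by rw [h2]; have := ha.2; omega⟩
    omega
  · intro c d hcd hc hd
    have hv : a.vec = ((1 : ℤ) : ℂ) • c.vec + ((1 : ℤ) : ℂ) • d.vec := by
      rw [hcd]; push_cast; module
    have h1 := ht_smul_combo b w⁻¹ hv
    have h2 := ht_combo b hv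
    have h3 := ha.2
    have : (w⁻¹ • c).ht b < 0 ∨ (w⁻¹ • d).ht b < 0 := by
      by_contra hcon
      push Not at hcon
      omega
    rcases this with h | h
    · have := hmin c ⟨hc, h⟩; omega
    · have := hmin d ⟨hd, h⟩; omega

lemma mem_invSet_of_simple {w : ExtWeyl P} {a : AffRoot P} (ha : IsSimple b a)
    (h : (w⁻¹ • a).ht b < 0) : a ∈ invSet b w := ⟨ha.1, h⟩

/-- The reflection permutes the positive roots other than `a`, so it carries the remaining
inversions bijectively and only `a` itself is lost. -/
lemma invSet_refl_mul {w : ExtWeyl P} {a : AffRoot P} (ha : IsSimple b a)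
    (h : (w⁻¹ • a).ht b < 0) :
    invSet b (a.refl * w) = (fun c => a.refl • c) '' (invSet b w \ {a}) := by
  have hinv : ∀ c : AffRoot P, (a.refl * w)⁻¹ • c = w⁻¹ • a.refl • c := fun c => by
    rw [mul_inv_rev, mul_smul, AffRoot.refl_inv]
  ext c
  constructor
  · rintro ⟨h1, h2⟩
    rw [hinv] at h2
    have hca : c ≠ a := by
      rintro rfl
      rw [AffRoot.refl_smul_self, AffRoot.smul_neg', ht_neg] at h2
      omega
    refine ⟨a.refl • c, ⟨⟨ha.2 c h1 hca, h2⟩, ?_⟩, AffRoot.refl_smul_refl_smul a c⟩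
    rintro hc
    rw [Set.mem_singleton_iff] at hc
    rw [hc] at h2
    have h3 := a.refl_smul_refl_smul c
    rw [hc, AffRoot.refl_smul_self] at h3
    rw [← h3, ht_neg] at h1
    have := ha.1
    omega
  · rintro ⟨d, ⟨⟨h1, h2⟩, hda⟩, rfl⟩
    refine ⟨ha.2 d h1 hda, ?_⟩
    simp only
    rw [hinv, AffRoot.refl_smul_refl_smul]
    exact h2

lemma len_refl_mul_of_descent {w : ExtWeyl P} {a : AffRoot P} (ha : IsSimple b a)
    (h : (w⁻¹ • a).ht b < 0) : len b (a.refl * w) + 1 = len b w := by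
  rw [len, invSet_refl_mul b ha h, Set.ncard_image_of_injective _ (MulAction.injective a.refl)]
  exact Set.ncard_sdiff_singleton_add_one (mem_invSet_of_simple b ha h) (invSet_finite b w)

lemma refl_descent_iff {w : ExtWeyl P} {a : AffRoot P} :
    ((a.refl * w)⁻¹ • a).ht b = -(w⁻¹ • a).ht b := by
  rw [mul_inv_rev, mul_smul, AffRoot.refl_inv, AffRoot.refl_smul_self, AffRoot.smul_neg', ht_neg]

lemma len_refl_mul_of_ascent {w : ExtWeyl P} {a : AffRoot P} (ha : IsSimple b a)
    (h : ¬ (w⁻¹ • a).ht b < 0) : len b (a.refl * w) = len b w + 1 := by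
  have h0 := ht_ne_zero b (w⁻¹ • a)
  have h1 := len_refl_mul_of_descent b (w := a.refl * w) ha (by rw [refl_descent_iff]; omega)
  rw [← mul_assoc, AffRoot.refl_mul_self, one_mul] at h1
  exact h1.symm

/-- The elements of length zero preserve the positive roots. In the extended group there may be
nontrivial ones, so inductions on the length start from them and not from the identity alone. -/
lemma pos_of_len_eq_zero {w : ExtWeyl P} (h : len b w = 0) {c : AffRoot P} (hc : 0 < c.ht b) :
    0 < (w⁻¹ • c).ht b := by
  have h1 : invSet b w = ∅ := (Set.ncard_eq_zero (invSet_finite b w)).mp h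
  have h0 := ht_ne_zero b (w⁻¹ • c)
  by_contra hcon
  have : c ∈ invSet b w := ⟨hc, by omega⟩
  rw [h1] at this
  exact this

lemma pos_of_len_eq_zero' {w : ExtWeyl P} (h : len b w = 0) {c : AffRoot P} (hc : 0 < c.ht b) :
    0 < (w • c).ht b := by
  have h0 := ht_ne_zero b (w • c)
  by_contra hcon
  have := pos_of_len_eq_zero b h (c := -(w • c)) (by rw [ht_neg]; omega)
  rw [AffRoot.smul_neg', inv_smul_smul, ht_neg] at this
  omega

lemma exists_simple_descent_of_len {w : ExtWeyl P} (h : len b w ≠ 0) :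
    ∃ a, IsSimple b a ∧ (w⁻¹ • a).ht b < 0 :=
  exists_simple_descent b (Set.nonempty_of_ncard_ne_zero h)

lemma IsSimple.smul_of_len_eq_zero {w : ExtWeyl P} (h : len b w = 0) {a : AffRoot P}
    (ha : IsSimple b a) : IsSimple b (w • a) := by
  refine ⟨pos_of_len_eq_zero' b h ha.1, fun c hc hca => ?_⟩
  rw [AffRoot.refl_smul, mul_smul, mul_smul]
  refine pos_of_len_eq_zero' b h (ha.2 _ (pos_of_len_eq_zero b h hc) ?_)
  rintro rfl
  rw [smul_inv_smul] at hca
  exact hca rfl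

/-- Every affine root is conjugate to a simple one, up to sign. -/
lemma exists_smul_simple (a : AffRoot P) : ∃ (g : ExtWeyl P) (c : AffRoot P),
    IsSimple b c ∧ a = g • c := by
  have key : ∀ (n : ℕ) (w : ExtWeyl P) (a : AffRoot P), len b w = n → 0 < a.ht b →
      (w⁻¹ • a).ht b < 0 → ∃ (g : ExtWeyl P) (c : AffRoot P), IsSimple b c ∧ a = g • c := by
    intro n
    induction n with
    | zero =>
      intro w a hw ha h
      have := pos_of_len_eq_zero b hw ha
      omega
    | succ n ih =>
      intro w a hw ha h
      obtain ⟨c, hc, hcd⟩ := exists_simple_descent_of_len b (w := w) (by omega)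
      by_cases hac : a = c
      · exact ⟨1, c, hc, by rw [hac, one_smul]⟩
      · have hl := len_refl_mul_of_descent b hc hcd
        obtain ⟨g, d, hd, hgd⟩ := ih (c.refl * w) (c.refl • a) (by omega) (hc.2 a ha hac) (by
          rwa [mul_inv_rev, mul_smul, AffRoot.refl_inv, AffRoot.refl_smul_refl_smul])
        exact ⟨c.refl * g, d, hd, by rw [mul_smul, ← hgd, AffRoot.refl_smul_refl_smul]⟩
  -- The reflection in `a` inverts `a`, so there is an element from which the induction on the
  -- length can start.
  have hpos : ∀ a : AffRoot P, 0 < a.ht b → ∃ (g : ExtWeyl P) (c : AffRoot P),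
      IsSimple b c ∧ a = g • c := fun a ha =>
    key _ a.refl a rfl ha (by
      rw [AffRoot.refl_inv, AffRoot.refl_smul_self, ht_neg]; omega)
  rcases lt_or_gt_of_ne (ht_ne_zero b a) with h | h
  · obtain ⟨g, c, hc, hgc⟩ := hpos (-a) (by rw [ht_neg]; omega)
    refine ⟨g * c.refl, c, hc, ?_⟩
    rw [mul_smul, AffRoot.refl_smul_self, AffRoot.smul_neg', ← hgc, AffRoot.neg_neg']
  · exact hpos a h

end Height

end Length


/-! ### Braid relations of Demazure elements from those of reflections -/

section Braid

/-- The alternating product `x y x ⋯` with `n` factors. -/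
def alt {C : Type*} [Monoid C] (x y : C) : ℕ → C
  | 0 => 1
  | n + 1 => x * alt y x n

lemma map_alt {C D : Type*} [Monoid C] [Monoid D] (f : C →* D) (x y : C) (n : ℕ) :
    f (alt x y n) = alt (f x) (f y) n := by
  induction n generalizing x y with
  | zero => exact map_one f
  | succ n ih => rw [alt, map_mul, ih, alt]

variable {S C : Type*} [CommRing S]

/-- In the expansion of the alternating product of two reflections `s = 1 + A t`, the coefficient
of the alternating word of length `k` which begins with the same letter. -/
def ownCoeff (A : S) (σ : S →+* S) (B : S) (τ : S →+* S) : ℕ → ℕ → S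
  | 0, 0 => 1
  | 0, _ + 1 => 0
  | n + 1, 0 => σ (ownCoeff B τ A σ n 0)
  | n + 1, k + 1 => A * σ (ownCoeff B τ A σ n k) +
      match n with
      | 0 => 0
      | m + 1 => σ (τ (ownCoeff A σ B τ m (k + 1)))

/-- The coefficient of the word of length `k` which begins with the other letter. -/
def otherCoeff (A : S) (σ : S →+* S) (B : S) (τ : S →+* S) : ℕ → ℕ → S
  | 0, _ => 0
  | _ + 1, 0 => 0
  | n + 1, k + 1 => σ (ownCoeff B τ A σ n (k + 1))

lemma ownCoeff_eq_zero (n : ℕ) : ∀ (A : S) (σ : S →+* S) (B : S) (τ : S →+* S) {k : ℕ}, n < k →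
    ownCoeff A σ B τ n k = 0 := by
  induction n using Nat.strong_induction_on with
  | _ n ih =>
    intro A σ B τ k h
    match n, k, h with
    | 0, k + 1, _ => simp [ownCoeff]
    | 1, k + 1, h =>
      simp [ownCoeff, ih 0 (by omega) B τ A σ (show 0 < k by omega)]
    | n + 2, k + 1, h =>
      simp [ownCoeff, ih (n + 1) (by omega) B τ A σ (show n + 1 < k by omega),
        ih n (by omega) A σ B τ (show n < k + 1 by omega)]

lemma ownCoeff_succ_succ (A : S) (σ : S →+* S) (B : S) (τ : S →+* S) (n k : ℕ) :
    ownCoeff A σ B τ (n + 1) (k + 1) =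
      A * σ (ownCoeff B τ A σ n k) + σ (otherCoeff B τ A σ n (k + 1)) := by
  cases n <;> simp [ownCoeff, otherCoeff]

variable [Ring C]

/-- One more letter `s = 1 + A t` on the left fixes the words beginning with `t`, since `t² = 0`,
and adds to a word beginning with `t'` the next longer word with coefficient `A`. This is the
recursion defining the coefficients. -/
lemma alt_expand (pol : S →+* C) (n : ℕ) : ∀ (A : S) (σ : S →+* S) (B : S) (τ : S →+* S)
    (s t s' t' : C), s = 1 + pol A * t → s' = 1 + pol B * t' →
    (∀ f, s * pol f = pol (σ f) * s) → (∀ f, s' * pol f = pol (τ f) * s') →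
    t * t = 0 → t' * t' = 0 →
    alt s s' n = ∑ k ∈ Finset.range (n + 1), pol (ownCoeff A σ B τ n k) * alt t t' k +
      ∑ k ∈ Finset.range n, pol (otherCoeff A σ B τ n (k + 1)) * alt t' t (k + 1) := by
  induction n with
  | zero => intros; simp [alt, ownCoeff]
  | succ n ih =>
    intro A σ B τ s t s' t' hs hs' hσ hτ ht ht'
    have h1 : ∀ k, s * alt t t' (k + 1) = alt t t' (k + 1) := fun k => by
      rw [hs, alt, add_mul, one_mul, mul_assoc, ← mul_assoc t, ht, zero_mul, mul_zero, add_zero]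
    have h2 : ∀ k, s * alt t' t k = alt t' t k + pol A * alt t t' (k + 1) := fun k => by
      rw [hs, alt, add_mul, one_mul, mul_assoc]
    have e1 : ∑ k ∈ Finset.range (n + 1), s * (pol (ownCoeff B τ A σ n k) * alt t' t k) =
        ∑ k ∈ Finset.range (n + 1), (pol (σ (ownCoeff B τ A σ n k)) * alt t' t k) +
        ∑ k ∈ Finset.range (n + 1),
          pol (A * σ (ownCoeff B τ A σ n k)) * alt t t' (k + 1) := by
      rw [← Finset.sum_add_distrib]
      refine Finset.sum_congr rfl fun k _ => ?_
      rw [← mul_assoc, hσ, mul_assoc, h2, mul_add, mul_comm A, map_mul, mul_assoc]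
    have e2 : ∑ k ∈ Finset.range n, s * (pol (otherCoeff B τ A σ n (k + 1)) * alt t t' (k + 1)) =
        ∑ k ∈ Finset.range n, (pol (σ (otherCoeff B τ A σ n (k + 1))) * alt t t' (k + 1)) := by
      refine Finset.sum_congr rfl fun k _ => ?_
      rw [← mul_assoc, hσ, mul_assoc, h1]
    have e3 : ∑ k ∈ Finset.range n, (pol (σ (otherCoeff B τ A σ n (k + 1))) * alt t t' (k + 1)) =
        ∑ k ∈ Finset.range (n + 1),
          (pol (σ (otherCoeff B τ A σ n (k + 1))) * alt t t' (k + 1)) := by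
      rw [Finset.sum_range_succ]
      cases n with
      | zero => simp [otherCoeff]
      | succ n =>
        rw [otherCoeff, ownCoeff_eq_zero _ _ _ _ _ (by omega)]
        simp
    rw [alt, ih B τ A σ s' t' s t hs' hs hτ hσ ht' ht, mul_add, Finset.mul_sum, Finset.mul_sum,
      e1, e2, e3, Finset.sum_range_succ' _ (n + 1), Finset.sum_range_succ' _ n]
    have e4 : ∑ k ∈ Finset.range (n + 1), pol (ownCoeff A σ B τ (n + 1) (k + 1)) *
        alt t t' (k + 1) = ∑ k ∈ Finset.range (n + 1),
          pol (A * σ (ownCoeff B τ A σ n k)) * alt t t' (k + 1) +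
        ∑ k ∈ Finset.range (n + 1),
          (pol (σ (otherCoeff B τ A σ n (k + 1))) * alt t t' (k + 1)) := by
      rw [← Finset.sum_add_distrib]
      refine Finset.sum_congr rfl fun k _ => ?_
      rw [ownCoeff_succ_succ, map_add, add_mul]
    have e5 : ∑ k ∈ Finset.range (n + 1), pol (otherCoeff A σ B τ (n + 1) (k + 1)) *
        alt t' t (k + 1) = ∑ k ∈ Finset.range n,
          (pol (σ (ownCoeff B τ A σ n (k + 1))) * alt t' t (k + 1)) := by
      rw [Finset.sum_range_succ]
      simp only [otherCoeff]
      rw [ownCoeff_eq_zero _ _ _ _ _ (show n < n + 1 by omega)]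
      simp
    rw [e4, e5]
    simp only [alt, ownCoeff]
    abel

lemma mul_alt_self {t t' : C} (ht : t * t = 0) (n : ℕ) : t * alt t t' (n + 1) = 0 := by
  rw [alt, ← mul_assoc, ht, zero_mul]

lemma alt_succ_right (n : ℕ) : ∀ t t' : C, alt t t' (n + 1) =
    alt t t' n * (if Even n then t else t') := by
  induction n with
  | zero => intro t t'; simp [alt]
  | succ n ih =>
    intro t t'
    rw [alt, ih, alt, mul_assoc]
    simp only [Nat.even_add_one]
    split_ifs <;> rfl

lemma alt_mul_right {t t' : C} (ht : t * t = 0) (ht' : t' * t' = 0) (n : ℕ) :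
    alt t t' (n + 1) * (if Even n then t else t') = 0 := by
  rw [alt_succ_right, mul_assoc]
  split_ifs <;> simp [ht, ht']

/-- Left multiplication by `t` is a right multiplication on the difference of the two alternating
words of length `n`. -/
lemma mul_alt_sub {t t' : C} (ht : t * t = 0) (ht' : t' * t' = 0) (n : ℕ) :
    ∃ y, t * (alt t t' (n + 1) - alt t' t (n + 1)) = (alt t t' (n + 1) - alt t' t (n + 1)) * y := by
  refine ⟨-(if Even (n + 1) then t else t'), ?_⟩
  have h1 : alt t' t (n + 1) * (if Even (n + 1) then t else t') = 0 := by
    have := alt_mul_right ht' ht n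
    simp only [Nat.even_add_one]
    split_ifs at this ⊢ <;> assumption
  rw [mul_sub, mul_alt_self ht, mul_neg, sub_mul, h1, ← alt_succ_right]
  simp [alt]

/-- The left annihilator of such an `x` is stable under divided differences. Indeed `t f x = σ(f) t
x + q x`; the left side is zero, and `σ(f) t x = s f s x y` vanishes because `s x = x + A x y` is
killed by `f`. -/
lemma mul_eq_zero_of_demazure (pol : S →+* C) {A : S} {σ : S →+* S} {s t x : C}
    (hs : s = 1 + pol A * t) (hσ : ∀ f, s * pol f = pol (σ f) * s) (hss : s * s = 1)
    (hd : ∀ f q, σ f - f = A * q → t * pol f = pol (σ f) * t + pol q)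
    (hx : ∃ y, t * x = x * y) {f q : S} (hf : pol f * x = 0) (hq : σ f - f = A * q) :
    pol q * x = 0 := by
  obtain ⟨y, hy⟩ := hx
  have h1 : pol (σ f) = s * pol f * s := by rw [hσ, mul_assoc, hss, mul_one]
  have h2 : s * x = x + pol A * (x * y) := by rw [hs, add_mul, one_mul, mul_assoc, hy]
  have h3 : pol f * (s * x) = 0 := by
    rw [h2, mul_add, hf, ← mul_assoc, ← map_mul, mul_comm f, map_mul, mul_assoc,
      ← mul_assoc (pol f), hf, zero_mul, mul_zero, add_zero]
  have h4 : pol (σ f) * (t * x) = 0 := by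
    rw [hy, ← mul_assoc, h1, mul_assoc (s * pol f), mul_assoc s, h3, mul_zero, zero_mul]
  have h5 : t * (pol f * x) = pol (σ f) * (t * x) + pol q * x := by
    rw [← mul_assoc, hd f q hq, add_mul, mul_assoc]
  rw [hf, h4, mul_zero, zero_add] at h5
  exact h5.symm

/-- The order of the product of two reflections with Cartan integers `-p` and `-q`. -/
def coxeterNumber : ℕ → ℕ
  | 0 => 2
  | 1 => 3
  | 2 => 4
  | _ => 6

/-- Comparing the expansions of the two sides of the braid relation for `s, s'`, the shorter words
cancel and `π Δ = 0` remains, with `π` the product of the positive roots and `Δ` the difference of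
the two longest Demazure words. Left multiplication by `t` or `t'` on `Δ` is a right multiplication,
so divided differences may be applied to `π` until it is a nonzero integer, invertible over `ℂ`. -/
lemma alt_demazure_eq [Algebra ℂ C] (pol : S →+* C) {A : S} {σ : S →+* S} {B : S} {τ : S →+* S}
    {s t s' t' : C} (hs : s = 1 + pol A * t) (hs' : s' = 1 + pol B * t')
    (hσ : ∀ f, s * pol f = pol (σ f) * s) (hτ : ∀ f, s' * pol f = pol (τ f) * s')
    (ht : t * t = 0) (ht' : t' * t' = 0) (hss : s * s = 1) (hss' : s' * s' = 1)
    (hd : ∀ f q, σ f - f = A * q → t * pol f = pol (σ f) * t + pol q)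
    (hd' : ∀ f q, τ f - f = B * q → t' * pol f = pol (τ f) * t' + pol q)
    (hσA : σ A = -A) (hτB : τ B = -B) {p q : ℕ} (hσB : σ B = B + p * A) (hτA : τ A = A + q * B)
    (hpq : p = 0 ∧ q = 0 ∨ p = 1 ∧ (q = 1 ∨ q = 2 ∨ q = 3))
    (hb : alt s s' (coxeterNumber q) = alt s' s (coxeterNumber q)) :
    alt t t' (coxeterNumber q) = alt t' t (coxeterNumber q) := by
  have hx : ∀ n, ∃ y, t * (alt t t' (n + 1) - alt t' t (n + 1)) =
    (alt t t' (n + 1) - alt t' t (n + 1)) * y := mul_alt_sub ht ht'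
  have hx' : ∀ n, ∃ y, t' * (alt t t' (n + 1) - alt t' t (n + 1)) =
      (alt t t' (n + 1) - alt t' t (n + 1)) * y := fun n => by
    obtain ⟨y, hy⟩ := mul_alt_sub ht' ht n
    refine ⟨y, ?_⟩
    rw [← neg_sub, mul_neg, hy, neg_mul]
  have hz : ∀ (c : ℤ) (x : C), c ≠ 0 → pol (c : S) * x = 0 → x = 0 := fun c x hc h => by
    rw [map_intCast, ← zsmul_eq_mul, ← Int.cast_smul_eq_zsmul ℂ] at h
    exact (smul_eq_zero.mp h).resolve_left (by exact_mod_cast hc)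
  have stepA : ∀ {n : ℕ} {f : S} (q : S), pol f * (alt t t' (n + 1) - alt t' t (n + 1)) = 0 →
      σ f - f = A * q → pol q * (alt t t' (n + 1) - alt t' t (n + 1)) = 0 :=
    fun {n f} q hf hq => mul_eq_zero_of_demazure pol hs hσ hss hd (hx n) hf hq
  have stepB : ∀ {n : ℕ} {f : S} (q : S), pol f * (alt t t' (n + 1) - alt t' t (n + 1)) = 0 →
      τ f - f = B * q → pol q * (alt t t' (n + 1) - alt t' t (n + 1)) = 0 :=
    fun {n f} q hf hq => mul_eq_zero_of_demazure pol hs' hτ hss' hd' (hx' n) hf hq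
  -- The word of length `k` has an own coefficient in one expansion and an other coefficient in the
  -- opposite one. Length zero is exempt, since both expansions share the empty word; its
  -- coefficients are compared separately.
  have top : ∀ (n : ℕ) (π : S), alt s s' (n + 1) = alt s' s (n + 1) →
      (∀ k, k < n + 1 → ownCoeff A σ B τ (n + 1) k = otherCoeff B τ A σ (n + 1) k ∨ k = 0) →
      (∀ k, k < n + 1 → ownCoeff B τ A σ (n + 1) k = otherCoeff A σ B τ (n + 1) k ∨ k = 0) →
      ownCoeff A σ B τ (n + 1) 0 = ownCoeff B τ A σ (n + 1) 0 →
      ownCoeff A σ B τ (n + 1) (n + 1) = π → ownCoeff B τ A σ (n + 1) (n + 1) = π →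
      pol π * (alt t t' (n + 1) - alt t' t (n + 1)) = 0 := by
    intro n π hb h1 h2 h0 h3 h4
    have z : ∀ (A : S) (σ : S →+* S) (B : S) (τ : S →+* S),
        otherCoeff A σ B τ (n + 1) (n + 1) = 0 := fun A σ B τ => by
      rw [otherCoeff, ownCoeff_eq_zero _ _ _ _ _ (Nat.lt_succ_self n), map_zero]
    rw [alt_expand pol _ A σ B τ s t s' t' hs hs' hσ hτ ht ht',
      alt_expand pol _ B τ A σ s' t' s t hs' hs hτ hσ ht' ht, Finset.sum_range_succ' _ (n + 1),
      Finset.sum_range_succ' _ (n + 1), h0, Finset.sum_range_succ _ n, Finset.sum_range_succ _ n,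
      Finset.sum_range_succ _ n, Finset.sum_range_succ _ n, h3, h4, z, z] at hb
    have e1 : ∑ k ∈ Finset.range n, pol (ownCoeff A σ B τ (n + 1) (k + 1)) * alt t t' (k + 1) =
        ∑ k ∈ Finset.range n, pol (otherCoeff B τ A σ (n + 1) (k + 1)) * alt t t' (k + 1) :=
      Finset.sum_congr rfl fun k hk => by
        rw [(h1 (k + 1) (by simp at hk; omega)).resolve_right (by omega)]
    have e2 : ∑ k ∈ Finset.range n, pol (ownCoeff B τ A σ (n + 1) (k + 1)) * alt t' t (k + 1) =
        ∑ k ∈ Finset.range n, pol (otherCoeff A σ B τ (n + 1) (k + 1)) * alt t' t (k + 1) :=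
      Finset.sum_congr rfl fun k hk => by
        rw [(h2 (k + 1) (by simp at hk; omega)).resolve_right (by omega)]
    rw [e1, e2] at hb
    simp only [alt, map_zero, zero_mul, add_zero] at hb
    rw [mul_sub, sub_eq_zero]
    simp only [alt]
    have := congrArg (fun x => x -
      ∑ k ∈ Finset.range n, pol (otherCoeff B τ A σ (n + 1) (k + 1)) * (t * alt t' t k) -
      ∑ k ∈ Finset.range n, pol (otherCoeff A σ B τ (n + 1) (k + 1)) * (t' * alt t t' k) -
      pol (ownCoeff B τ A σ (n + 1) 0) * 1) hb
    convert this using 1 <;> abel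
  have hσ2 : σ 2 = 2 := map_ofNat σ 2
  have hτ2 : τ 2 = 2 := map_ofNat τ 2
  have hσ3 : σ 3 = 3 := map_ofNat σ 3
  have hτ3 : τ 3 = 3 := map_ofNat τ 3
  rw [← sub_eq_zero]
  obtain ⟨rfl, rfl⟩ | ⟨rfl, rfl | rfl | rfl⟩ := hpq <;>
    simp only [Nat.cast_zero, Nat.cast_one, zero_mul, add_zero, one_mul, Nat.cast_ofNat]
      at hσB hτA <;> simp only [coxeterNumber] at hb ⊢
  · have h := top 1 (A * B) hb
      (fun k hk => by interval_cases k <;> simp [ownCoeff, otherCoeff, hσA, hτB, hσB, hτA])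
      (fun k hk => by interval_cases k <;> simp [ownCoeff, otherCoeff, hσA, hτB, hσB, hτA])
      (by simp [ownCoeff])
      (by simp [ownCoeff, hσA, hτB, hσB, hτA])
      (by simp [ownCoeff, hσA, hτB, hσB, hτA, hσ2, hτ2, hσ3, hτ3]; ring)
    -- In this and in the other three cases the polynomials are the successive divided differences
    -- of `π`, taken alternately along `A` and `B`. Their number is the degree of `π`, so the last
    -- one is a constant.
    have h := stepA (-2 * B) h (by simp only [map_mul, hσA, hσB]; ring)
    have h := stepB (4 : ℤ) h (by simp only [map_mul, map_neg, map_ofNat, hτB]; push_cast; ring)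
    exact hz _ _ (by norm_num) h
  · have h := top 2 (A * B * (A + B)) hb
      (fun k hk => by interval_cases k <;> simp [ownCoeff, otherCoeff, hσA, hτB, hσB, hτA, hσ2, hτ2, hσ3, hτ3] <;> ring)
      (fun k hk => by interval_cases k <;> simp [ownCoeff, otherCoeff, hσA, hτB, hσB, hτA, hσ2, hτ2, hσ3, hτ3] <;> ring)
      (by simp [ownCoeff])
      (by simp [ownCoeff, hσA, hτB, hσB, hτA, hσ2, hτ2, hσ3, hτ3]; ring)
      (by simp [ownCoeff, hσA, hτB, hσB, hτA, hσ2, hτ2, hσ3, hτ3]; ring)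
    have h := stepA (-2 * B ^ 2 - 2 * A * B) h
      (by simp only [map_mul, map_add, hσA, hσB]; ring)
    have h := stepB (2 * B + 4 * A) h
      (by simp only [map_mul, map_add, map_sub, map_pow, map_neg, map_ofNat, hτB, hτA]; ring)
    have h := stepA (-6 : ℤ) h
      (by simp only [map_mul, map_add, map_ofNat, hσB, hσA]; push_cast; ring)
    exact hz _ _ (by norm_num) h
  · have h := top 3 (A * B * (A + B) * (A + 2 * B)) hb
      (fun k hk => by interval_cases k <;> simp [ownCoeff, otherCoeff, hσA, hτB, hσB, hτA, hσ2, hτ2, hσ3, hτ3] <;> ring)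
      (fun k hk => by interval_cases k <;> simp [ownCoeff, otherCoeff, hσA, hτB, hσB, hτA, hσ2, hτ2, hσ3, hτ3] <;> ring)
      (by simp [ownCoeff])
      (by simp [ownCoeff, hσA, hτB, hσB, hτA, hσ2, hτ2, hσ3, hτ3]; ring)
      (by simp [ownCoeff, hσA, hτB, hσB, hτA, hσ2, hτ2, hσ3, hτ3]; ring)
    have h := stepA (-4 * B ^ 3 - 6 * A * B ^ 2 - 2 * A ^ 2 * B) h
      (by simp only [map_mul, map_add, map_ofNat, hσA, hσB]; ring)
    have h := stepB (4 * B ^ 2 + 8 * A * B + 4 * A ^ 2) h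
      (by simp only [map_mul, map_add, map_sub, map_pow, map_neg, map_ofNat, hτB, hτA]; ring)
    have h := stepA (-8 * B - 4 * A) h
      (by simp only [map_mul, map_add, map_pow, map_ofNat, hσB, hσA]; ring)
    have h := stepB (8 : ℤ) h
      (by simp only [map_mul, map_sub, map_neg, map_ofNat, hτB, hτA]; push_cast; ring)
    exact hz _ _ (by norm_num) h
  · have h := top 5 (A * B * (A + B) * (A + 2 * B) * (A + 3 * B) * (2 * A + 3 * B)) hb
      (fun k hk => by interval_cases k <;> simp [ownCoeff, otherCoeff, hσA, hτB, hσB, hτA, hσ2, hτ2, hσ3, hτ3] <;> ring)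
      (fun k hk => by interval_cases k <;> simp [ownCoeff, otherCoeff, hσA, hτB, hσB, hτA, hσ2, hτ2, hσ3, hτ3] <;> ring)
      (by simp [ownCoeff])
      (by simp [ownCoeff, hσA, hτB, hσB, hτA, hσ2, hτ2, hσ3, hτ3]; ring)
      (by simp [ownCoeff, hσA, hτB, hσB, hτA, hσ2, hτ2, hσ3, hτ3]; ring)
    have h := stepA (-36 * B ^ 5 - 90 * A * B ^ 4 - 80 * A ^ 2 * B ^ 3 - 30 * A ^ 3 * B ^ 2
        - 4 * A ^ 4 * B) h
      (by simp only [map_mul, map_add, map_ofNat, hσA, hσB]; ring)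
    have h := stepB (36 * B ^ 4 + 102 * A * B ^ 3 + 106 * A ^ 2 * B ^ 2 + 48 * A ^ 3 * B
        + 8 * A ^ 4) h
      (by simp only [map_mul, map_add, map_sub, map_pow, map_neg, map_ofNat, hτB, hτA]; ring)
    have h := stepA (-60 * B ^ 3 - 90 * A * B ^ 2 - 46 * A ^ 2 * B - 8 * A ^ 3) h
      (by simp only [map_mul, map_add, map_pow, map_ofNat, hσB, hσA]; ring)
    have h := stepB (48 * B ^ 2 + 60 * A * B + 20 * A ^ 2) h
      (by simp only [map_mul, map_sub, map_pow, map_neg, map_ofNat, hτB, hτA]; ring)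
    have h := stepA (-24 * B - 12 * A) h
      (by simp only [map_mul, map_add, map_pow, map_ofNat, hσB, hσA]; ring)
    have h := stepB (12 : ℤ) h
      (by simp only [map_mul, map_sub, map_neg, map_ofNat, hτB, hτA]; push_cast; ring)
    exact hz _ _ (by norm_num) h

end Braid


/-! ### Divided differences on a symmetric algebra -/

section DividedDifference

variable {E : Type*} [AddCommGroup E] [Module ℂ E]

lemma sym_algHom_ext {A : Type*} [Semiring A] [Algebra ℂ A] {F G : SymmetricAlgebra ℂ E →ₐ[ℂ] A}
    (h : ∀ x, F (SymmetricAlgebra.ι ℂ E x) = G (SymmetricAlgebra.ι ℂ E x)) : F = G := by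
  refine AlgHom.ext fun p => ?_
  induction p using SymmetricAlgebra.induction with
  | algebraMap c => rw [AlgHom.commutes, AlgHom.commutes]
  | ι x => exact h x
  | mul p q hp hq => rw [map_mul, map_mul, hp, hq]
  | add p q hp hq => rw [map_add, map_add, hp, hq]

/-- The universal property of the symmetric algebra for linear maps with commuting values. -/
def symLift {A : Type*} [Semiring A] [Algebra ℂ A] (f : E →ₗ[ℂ] A) (hf : ∀ x y, f x * f y = f y * f x) :
    SymmetricAlgebra ℂ E →ₐ[ℂ] A :=
  RingCon.liftₐ (TensorAlgebra.symRingCon ℂ E) (TensorAlgebra.lift ℂ f) (by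
    refine RingCon.ringConGen_le.2 fun x y h => ?_
    induction h with
    | mul_comm x y =>
      rw [RingCon.ker_apply]
      change TensorAlgebra.lift ℂ f (TensorAlgebra.ι ℂ x * TensorAlgebra.ι ℂ y) =
        TensorAlgebra.lift ℂ f (TensorAlgebra.ι ℂ y * TensorAlgebra.ι ℂ x)
      rw [map_mul, map_mul, TensorAlgebra.lift_ι_apply, TensorAlgebra.lift_ι_apply, hf])

lemma symLift_ι {A : Type*} [Semiring A] [Algebra ℂ A] (f : E →ₗ[ℂ] A)
    (hf : ∀ x y, f x * f y = f y * f x) (x : E) :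
    symLift f hf (SymmetricAlgebra.ι ℂ E x) = f x := by
  have : symLift f hf (SymmetricAlgebra.ι ℂ E x) = TensorAlgebra.lift ℂ f (TensorAlgebra.ι ℂ x) :=
    rfl
  rw [this, TensorAlgebra.lift_ι_apply]

lemma sym_ι_ne_zero {v : E} (hv : v ≠ 0) : SymmetricAlgebra.ι ℂ E v ≠ 0 := by
  intro h
  refine hv ((Module.forall_dual_apply_eq_zero_iff ℂ v).mp fun f => ?_)
  have := congrArg (SymmetricAlgebra.lift (R := ℂ) f) h
  rwa [SymmetricAlgebra.lift_ι_apply, map_zero] at this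

/-- The automorphism of the symmetric algebra induced by `x ↦ x - α x • v`. -/
def symRefl (v : E) (α : E →ₗ[ℂ] ℂ) : SymmetricAlgebra ℂ E →ₐ[ℂ] SymmetricAlgebra ℂ E :=
  SymmetricAlgebra.lift (SymmetricAlgebra.ι ℂ E ∘ₗ (LinearMap.id - α.smulRight v))

lemma symRefl_ι (v : E) (α : E →ₗ[ℂ] ℂ) (x : E) : symRefl v α (SymmetricAlgebra.ι ℂ E x) =
    SymmetricAlgebra.ι ℂ E (x - α x • v) := by
  simp [symRefl]

/-- Divisibility is clear on generators and passes to products by `s(pp') - pp' = (sp - p) s(p') + p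
(sp' - p')`. -/
lemma exists_divDiff (v : E) (α : E →ₗ[ℂ] ℂ) (p : SymmetricAlgebra ℂ E) :
    ∃ q, symRefl v α p - p = SymmetricAlgebra.ι ℂ E v * q := by
  induction p using SymmetricAlgebra.induction with
  | algebraMap c => exact ⟨0, by rw [AlgHom.commutes, sub_self, mul_zero]⟩
  | ι x => exact ⟨algebraMap ℂ _ (-α x), by
      rw [symRefl_ι, map_sub, map_smul, Algebra.smul_def, map_neg]; ring⟩
  | mul p p' h h' =>
    obtain ⟨q, hq⟩ := h
    obtain ⟨q', hq'⟩ := h'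
    refine ⟨q * symRefl v α p' + p * q', ?_⟩
    rw [map_mul, mul_add, ← mul_assoc, ← hq, mul_left_comm, ← hq']
    ring
  | add p p' h h' =>
    obtain ⟨q, hq⟩ := h
    obtain ⟨q', hq'⟩ := h'
    exact ⟨q + q', by rw [map_add, mul_add, ← hq, ← hq']; ring⟩

/-- The divided difference operator `p ↦ (s p - p) / v`. -/
def divDiff {v : E} (hv : v ≠ 0) (α : E →ₗ[ℂ] ℂ) :
    SymmetricAlgebra ℂ E →ₗ[ℂ] SymmetricAlgebra ℂ E where
  toFun p := Classical.choose (exists_divDiff v α p)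
  map_add' p p' := by
    refine mul_left_cancel₀ (sym_ι_ne_zero hv) ?_
    rw [mul_add, ← Classical.choose_spec (exists_divDiff v α (p + p')),
      ← Classical.choose_spec (exists_divDiff v α p),
      ← Classical.choose_spec (exists_divDiff v α p'), map_add]
    ring
  map_smul' c p := by
    refine mul_left_cancel₀ (sym_ι_ne_zero hv) ?_
    rw [RingHom.id_apply, mul_smul_comm, ← Classical.choose_spec (exists_divDiff v α (c • p)),
      ← Classical.choose_spec (exists_divDiff v α p), map_smul, smul_sub]

lemma divDiff_spec {v : E} (hv : v ≠ 0) (α : E →ₗ[ℂ] ℂ) (p : SymmetricAlgebra ℂ E) :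
    SymmetricAlgebra.ι ℂ E v * divDiff hv α p = symRefl v α p - p :=
  (Classical.choose_spec (exists_divDiff v α p)).symm

lemma divDiff_unique {v : E} (hv : v ≠ 0) (α : E →ₗ[ℂ] ℂ) {p q : SymmetricAlgebra ℂ E}
    (h : symRefl v α p - p = SymmetricAlgebra.ι ℂ E v * q) : divDiff hv α p = q :=
  mul_left_cancel₀ (sym_ι_ne_zero hv) (by rw [divDiff_spec, h])

lemma symRefl_symRefl {v : E} {α : E →ₗ[ℂ] ℂ} (h : α v = 2) (p : SymmetricAlgebra ℂ E) :
    symRefl v α (symRefl v α p) = p := by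
  have : (symRefl v α).comp (symRefl v α) = AlgHom.id ℂ _ := by
    refine sym_algHom_ext fun x => ?_
    rw [AlgHom.comp_apply, symRefl_ι, symRefl_ι, AlgHom.id_apply]
    congr 1
    rw [map_sub, map_smul, h, smul_eq_mul]
    module
  exact DFunLike.congr_fun this p

/-- The reflection negates both `v` and `s p - p`, hence fixes their quotient. -/
lemma symRefl_divDiff {v : E} (hv : v ≠ 0) {α : E →ₗ[ℂ] ℂ} (h : α v = 2)
    (p : SymmetricAlgebra ℂ E) : symRefl v α (divDiff hv α p) = divDiff hv α p := by
  refine mul_left_cancel₀ (sym_ι_ne_zero hv) ?_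
  have h1 := congrArg (symRefl v α) (divDiff_spec hv α p)
  have h2 : SymmetricAlgebra.ι ℂ E (v - α v • v) = -SymmetricAlgebra.ι ℂ E v := by
    rw [h, ← map_neg]
    congr 1
    module
  rw [map_mul, symRefl_ι, h2, map_sub, symRefl_symRefl h] at h1
  rw [divDiff_spec, ← neg_sub, ← h1]
  ring

end DividedDifference

/-! ### Systems of generators with the relations of rank one -/

section System

variable {ι V 𝔱 : Type*} [AddCommGroup V] [Module ℂ V] [AddCommGroup 𝔱] [Module ℂ 𝔱]
  {P : RootPairing ι ℂ V 𝔱}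

/-- The affine root as an element of `Sym 𝔱_aff`. -/
def AffRoot.lin (a : AffRoot P) : SymAff 𝔱 := SymmetricAlgebra.ι ℂ (𝔱 × ℂ) a.vec

lemma AffRoot.lin_ne_zero (a : AffRoot P) : a.lin ≠ 0 := sym_ι_ne_zero a.vec_ne_zero

lemma AffRoot.lin_smul (g : ExtWeyl P) (a : AffRoot P) : (g • a).lin = g • a.lin := by
  rw [AffRoot.lin, AffRoot.vec_smul]
  exact (symAffAct_ι P g a.vec).symm

/-- The Demazure operator on `Sym 𝔱_aff`. -/
def AffRoot.dem (a : AffRoot P) : SymAff 𝔱 →ₗ[ℂ] SymAff 𝔱 := divDiff a.vec_ne_zero a.ev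

variable [P.IsCrystallographic]

lemma AffRoot.refl_smul_sym (a : AffRoot P) (p : SymAff 𝔱) : a.refl • p = symRefl a.vec a.ev p := by
  have : symAffAct P a.refl = symRefl a.vec a.ev := by
    refine sym_algHom_ext fun x => ?_
    rw [symRefl_ι, symAffAct_ι, AffRoot.refl_apply]
  exact DFunLike.congr_fun this p

lemma AffRoot.lin_mul_dem (a : AffRoot P) (p : SymAff 𝔱) : a.lin * a.dem p = a.refl • p - p := by
  rw [AffRoot.refl_smul_sym]
  exact divDiff_spec _ _ _

lemma AffRoot.dem_unique (a : AffRoot P) {p q : SymAff 𝔱} (h : a.refl • p - p = a.lin * q) :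
    a.dem p = q :=
  mul_left_cancel₀ a.lin_ne_zero (by rw [AffRoot.lin_mul_dem, h])

lemma AffRoot.refl_smul_dem (a : AffRoot P) (p : SymAff 𝔱) : a.refl • a.dem p = a.dem p := by
  rw [AffRoot.refl_smul_sym]
  exact symRefl_divDiff _ a.ev_self p

lemma AffRoot.refl_smul_lin (a : AffRoot P) : a.refl • a.lin = -a.lin := by
  rw [← AffRoot.lin_smul, AffRoot.refl_smul_self, AffRoot.lin, AffRoot.vec_neg, map_neg,
    AffRoot.lin]

variable (P) in
/-- A representation of the degenerate nil DAHA in a ring, in terms of generators and of relations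
of rank one. -/
structure NilSys (C : Type*) [Ring C] [Algebra ℂ C] where
  pol : SymAff 𝔱 →ₐ[ℂ] C
  grp : ExtWeyl P →* C
  th : AffRoot P → C
  grp_pol : ∀ g p, grp g * pol p = pol (g • p) * grp g
  pol_th : ∀ a, pol a.lin * th a = grp a.refl - 1
  th_th : ∀ a, th a * th a = 0
  th_pol : ∀ a p, th a * pol p = pol (a.refl • p) * th a + pol (a.dem p)
  grp_th : ∀ g a, grp g * th a = th (g • a) * grp g

/-- The relations of rank one follow if the linear forms are injective on the invariants of the
reflections. -/
def NilSys.ofInjective {C : Type*} [Ring C] [Algebra ℂ C] (pol : SymAff 𝔱 →ₐ[ℂ] C)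
    (grp : ExtWeyl P →* C) (th : AffRoot P → C)
    (grp_pol : ∀ g p, grp g * pol p = pol (g • p) * grp g)
    (pol_th : ∀ a, pol a.lin * th a = grp a.refl - 1)
    (refl_th : ∀ a, grp a.refl * th a = th a)
    (inj : ∀ (a : AffRoot P) (y : C), grp a.refl * y = y → pol a.lin * y = 0 → y = 0) :
    NilSys P C where
  pol := pol
  grp := grp
  th := th
  grp_pol := grp_pol
  pol_th := pol_th
  -- In each of the remaining relations the difference of the two sides is fixed by the reflection
  -- and killed by the linear form, hence zero.
  th_th a := inj a _ (by rw [← mul_assoc, refl_th]) (by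
    rw [← mul_assoc, pol_th, sub_mul, refl_th, one_mul, sub_self])
  th_pol a p := by
    rw [← sub_eq_zero]
    have hs : a.refl • a.refl • p = p := by rw [← mul_smul, AffRoot.refl_mul_self, one_smul]
    have h1 : pol (a.refl • p) - pol p = pol (a.dem p) * pol a.lin := by
      rw [← map_sub, ← AffRoot.lin_mul_dem, mul_comm, map_mul]
    apply inj a
    · have h2 : (pol (a.refl • p) - pol p) * th a = pol (a.dem p) * grp a.refl - pol (a.dem p) := by
        rw [h1, mul_assoc, pol_th, mul_sub, mul_one]
      rw [mul_sub, mul_add, ← mul_assoc, refl_th, ← mul_assoc, grp_pol, hs, mul_assoc, refl_th,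
        grp_pol, AffRoot.refl_smul_dem]
      rw [sub_mul, sub_eq_sub_iff_add_eq_add] at h2
      rw [sub_right_inj, add_comm, ← h2]
    · have h3 : pol a.lin * pol (a.refl • p) = pol (a.refl • p) * pol a.lin := by
        rw [← map_mul, mul_comm, map_mul]
      have h4 : pol a.lin * pol (a.dem p) = pol (a.refl • p) - pol p := by
        rw [h1, ← map_mul, mul_comm, map_mul]
      rw [mul_sub, mul_add, ← mul_assoc, pol_th, ← mul_assoc, h3, mul_assoc, pol_th, h4, sub_mul,
        grp_pol, mul_sub, one_mul, mul_one]
      abel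
  grp_th g a := by
    have hg : grp g * grp g⁻¹ = 1 := by rw [← map_mul, mul_inv_cancel, map_one]
    have hg' : grp g⁻¹ * grp g = 1 := by rw [← map_mul, inv_mul_cancel, map_one]
    have key : grp g * th a * grp g⁻¹ - th (g • a) = 0 := by
      apply inj (g • a)
      · rw [mul_sub, refl_th, AffRoot.refl_smul, map_mul, map_mul]
        congr 1
        calc _ = grp g * grp a.refl * (grp g⁻¹ * grp g) * th a * grp g⁻¹ := by
              simp only [mul_assoc]
          _ = _ := by rw [hg', mul_one, mul_assoc (grp g), refl_th]
      · rw [mul_sub, pol_th, AffRoot.lin_smul, ← mul_assoc, ← mul_assoc, ← grp_pol,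
          mul_assoc (grp g), pol_th, mul_sub, sub_mul, mul_one, hg, AffRoot.refl_smul, map_mul,
          map_mul, sub_self]
    rw [sub_eq_zero] at key
    rw [← key, mul_assoc, hg', mul_one]

namespace NilSys

variable {C : Type*} [Ring C] [Algebra ℂ C] (N : NilSys P C)

lemma grp_refl (a : AffRoot P) : N.grp a.refl = 1 + N.pol a.lin * N.th a := by
  rw [N.pol_th, add_sub_cancel]

lemma grp_refl_mul_self (a : AffRoot P) : N.grp a.refl * N.grp a.refl = 1 := by
  rw [← map_mul, AffRoot.refl_mul_self, map_one]

lemma grp_mul_inv (g : ExtWeyl P) : N.grp g * N.grp g⁻¹ = 1 := by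
  rw [← map_mul, mul_inv_cancel, map_one]

/-- The product of two systems. -/
def prod {D : Type*} [Ring D] [Algebra ℂ D] (N' : NilSys P D) : NilSys P (C × D) where
  pol := N.pol.prod N'.pol
  grp := N.grp.prod N'.grp
  th a := (N.th a, N'.th a)
  grp_pol g p := Prod.ext (N.grp_pol g p) (N'.grp_pol g p)
  pol_th a := Prod.ext (N.pol_th a) (N'.pol_th a)
  th_th a := Prod.ext (N.th_th a) (N'.th_th a)
  th_pol a p := Prod.ext (N.th_pol a p) (N'.th_pol a p)
  grp_th g a := Prod.ext (N.grp_th g a) (N'.grp_th g a)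

end NilSys

variable (P) in
/-- The field of fractions in the smash product. -/
def fracElt : FracAff 𝔱 →+* WFrac P := SkewMonoidAlgebra.singleOneRingHom

lemma groupElt_mul_fracElt (g : ExtWeyl P) (f : FracAff 𝔱) :
    groupElt P g * fracElt P f = fracElt P (g • f) * groupElt P g := by
  change SkewMonoidAlgebra.single g 1 * SkewMonoidAlgebra.single 1 f =
    SkewMonoidAlgebra.single 1 (g • f) * SkewMonoidAlgebra.single g 1
  simp [SkewMonoidAlgebra.single_mul_single]

variable (P) in
/-- `polyElt` as an algebra homomorphism. -/
def polyHom : SymAff 𝔱 →ₐ[ℂ] WFrac P where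
  toRingHom := (fracElt P).comp (algebraMap (SymAff 𝔱) (FracAff 𝔱))
  commutes' c := by
    change SkewMonoidAlgebra.single 1 (algebraMap (SymAff 𝔱) (FracAff 𝔱) (algebraMap ℂ _ c)) = _
    rw [← IsScalarTower.algebraMap_apply]
    rfl

variable (P) in
/-- `groupElt` as a homomorphism. -/
def groupHom : ExtWeyl P →* WFrac P where
  toFun := groupElt P
  map_one' := rfl
  map_mul' g h := by simp [groupElt, SkewMonoidAlgebra.single_mul_single]

lemma algebraMap_lin_ne_zero (a : AffRoot P) : algebraMap (SymAff 𝔱) (FracAff 𝔱) a.lin ≠ 0 :=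
  fun h => a.lin_ne_zero ((FaithfulSMul.algebraMap_eq_zero_iff (SymAff 𝔱) (FracAff 𝔱)).mp h)

lemma fracElt_mul_inv {f : FracAff 𝔱} (hf : f ≠ 0) (y : WFrac P) :
    fracElt P f * (fracElt P f⁻¹ * y) = y := by
  rw [← mul_assoc, ← map_mul, mul_inv_cancel₀ hf, map_one, one_mul]

/-- Supplies the injectivity required by `NilSys.ofInjective`: a nonzero element of the field has an
inverse in the smash product. -/
lemma fracElt_mul_eq_zero {f : FracAff 𝔱} (hf : f ≠ 0) {y : WFrac P} (h : fracElt P f * y = 0) :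
    y = 0 := by
  have := fracElt_mul_inv (inv_ne_zero hf) y
  rw [inv_inv, h, mul_zero] at this
  exact this.symm

/-- Both factors of `a⁻¹ (s - 1)` change sign when `s` passes through. -/
lemma mul_demazure_eq {K R : Type*} [Ring K] [Ring R] (φ : K →+* R) (s : R) {x y : K}
    (hs : s * s = 1) (h : s * φ x = φ y * s) (hy : y = -x) : s * (φ x * (s - 1)) = φ x * (s - 1) := by
  rw [← mul_assoc, h, hy, mul_assoc, mul_sub, hs, mul_one, map_neg, neg_mul, ← mul_neg, neg_sub]

variable (P) in
/-- The tautological system in `W̃ ⋉ Frac(Sym 𝔱_aff)`. -/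
def fracSys : NilSys P (WFrac P) :=
  NilSys.ofInjective (polyHom P) (groupHom P) (fun a => demazure P a.vec a.refl)
    (fun g p => by
      change groupElt P g * fracElt P _ = fracElt P _ * groupElt P g
      rw [groupElt_mul_fracElt, smul_algebraMap_frac])
    (fun a => fracElt_mul_inv (algebraMap_lin_ne_zero a) _)
    (fun a => mul_demazure_eq (fracElt P) (groupHom P a.refl)
      (by rw [← map_mul, AffRoot.refl_mul_self, map_one]) (groupElt_mul_fracElt _ _)
      (by
        rw [smul_inv'', smul_algebraMap_frac]
        change (algebraMap (SymAff 𝔱) (FracAff 𝔱) (a.refl • a.lin))⁻¹ = _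
        rw [AffRoot.refl_smul_lin, map_neg]
        exact neg_inv.symm))
    (fun a y _ h => fracElt_mul_eq_zero (algebraMap_lin_ne_zero a) h)

end System


/-! ### Pairs of simple affine roots and dihedral subgroups -/

section Coxeter

variable {ι V 𝔱 : Type*} [AddCommGroup V] [Module ℂ V] [AddCommGroup 𝔱] [Module ℂ 𝔱]
  {P : RootPairing ι ℂ V 𝔱} [P.IsCrystallographic]

/-- The Cartan integers of a pair of simple roots that generates a finite group, with the longer
coroot first. -/
def IsRankTwo (a c : AffRoot P) (q : ℕ) : Prop :=
  q = 0 ∧ a.pair c = 0 ∧ c.pair a = 0 ∨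
    (q = 1 ∨ q = 2 ∨ q = 3) ∧ a.pair c = -1 ∧ c.pair a = -q

lemma IsRankTwo.ev {a c : AffRoot P} {q : ℕ} (h : IsRankTwo a c q) :
    ∃ p : ℕ, a.ev c.vec = -p ∧ c.ev a.vec = -q ∧
      (p = 0 ∧ q = 0 ∨ p = 1 ∧ (q = 1 ∨ q = 2 ∨ q = 3)) := by
  rcases h with ⟨rfl, h1, h2⟩ | ⟨hq, h1, h2⟩
  · exact ⟨0, by rw [AffRoot.ev_vec_eq, h1]; simp, by rw [AffRoot.ev_vec_eq, h2]; simp, by simp⟩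
  · exact ⟨1, by rw [AffRoot.ev_vec_eq, h1]; simp, by rw [AffRoot.ev_vec_eq, h2]; simp, by simp [hq]⟩

lemma alt_refl_eq {a c : AffRoot P} {q : ℕ} (h : IsRankTwo a c q) :
    alt a.refl c.refl (coxeterNumber q) = alt c.refl a.refl (coxeterNumber q) := by
  obtain ⟨p, h1, h2, h3⟩ := h.ev
  apply affineRep_injective
  refine LinearMap.ext fun x => ?_
  obtain ⟨rfl, rfl⟩ | ⟨rfl, rfl | rfl | rfl⟩ := h3 <;>
  · simp only [coxeterNumber, alt, map_mul, Module.End.mul_apply, map_one, Module.End.one_apply,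
      AffRoot.refl_apply, map_sub, map_smul, h1, h2, AffRoot.ev_self, smul_eq_mul, Nat.cast_zero,
      Nat.cast_one, Nat.cast_ofNat]
    module

variable [Finite ι] [P.IsRootSystem] [P.IsReduced] (b : P.Base)

/-- The roots inverted by the successive letters of the longest dihedral word are nonnegative
combinations of `a` and `c`. As `g` makes both of these negative, it makes all of them negative. -/
lemma ht_alt_neg {a c : AffRoot P} {q : ℕ} (h : IsRankTwo a c q) {g : ExtWeyl P}
    (ha : (g • a).ht b < 0) (hc : (g • c).ht b < 0) {j : ℕ} (hj : j < coxeterNumber q) :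
    (g • alt a.refl c.refl j • (if Even j then a else c)).ht b < 0 ∧
    (g • alt c.refl a.refl j • (if Even j then c else a)).ht b < 0 := by
  obtain ⟨p, h1, h2, h3⟩ := h.ev
  have key : ∀ (x y : ℤ) (d : AffRoot P), d.vec = (x : ℂ) • a.vec + (y : ℂ) • c.vec → 0 ≤ x → 0 ≤ y →
      0 < x + y → (g • d).ht b < 0 := fun x y d hd hx hy hxy => by
    rw [ht_smul_combo b g hd]
    nlinarith
  have vec : ∀ (d e : AffRoot P), (d.refl • e).vec = e.vec - d.ev e.vec • d.vec := fun d e => by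
    rw [AffRoot.vec_smul, AffRoot.refl_apply]
  have fin : ∀ (x y : ℕ) (d : AffRoot P), 0 < x + y → d.vec = (x : ℂ) • a.vec + (y : ℂ) • c.vec →
      (g • d).ht b < 0 := fun x y d hxy hd =>
    key x y d (by exact_mod_cast hd) (by omega) (by omega) (by omega)
  obtain ⟨rfl, rfl⟩ | ⟨rfl, rfl | rfl | rfl⟩ := h3 <;> simp only [coxeterNumber] at hj <;>
    interval_cases j
  all_goals
    simp only [alt, mul_smul, one_smul, Nat.even_iff, Nat.reduceMod, one_ne_zero, if_true, if_false]
    refine ⟨?_, ?_⟩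
    -- The candidates `x a + y c` run over the positive roots of the systems of rank two, with the
    -- longer coroot first.
    all_goals first
      | exact ha
      | exact hc
      | exact fin 1 0 _ (by norm_num) (by
          simp only [vec, map_sub, map_smul, h1, h2, AffRoot.ev_self, smul_eq_mul, Nat.cast_zero,
            Nat.cast_one, Nat.cast_ofNat]
          module)
      | exact fin 0 1 _ (by norm_num) (by
          simp only [vec, map_sub, map_smul, h1, h2, AffRoot.ev_self, smul_eq_mul, Nat.cast_zero,
            Nat.cast_one, Nat.cast_ofNat]
          module)
      | exact fin 1 1 _ (by norm_num) (by
          simp only [vec, map_sub, map_smul, h1, h2, AffRoot.ev_self, smul_eq_mul, Nat.cast_zero,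
            Nat.cast_one, Nat.cast_ofNat]
          module)
      | exact fin 1 2 _ (by norm_num) (by
          simp only [vec, map_sub, map_smul, h1, h2, AffRoot.ev_self, smul_eq_mul, Nat.cast_zero,
            Nat.cast_one, Nat.cast_ofNat]
          module)
      | exact fin 1 3 _ (by norm_num) (by
          simp only [vec, map_sub, map_smul, h1, h2, AffRoot.ev_self, smul_eq_mul, Nat.cast_zero,
            Nat.cast_one, Nat.cast_ofNat]
          module)
      | exact fin 2 3 _ (by norm_num) (by
          simp only [vec, map_sub, map_smul, h1, h2, AffRoot.ev_self, smul_eq_mul, Nat.cast_zero,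
            Nat.cast_one, Nat.cast_ofNat]
          module)

/-- If the pairing were positive, the difference of the two roots would be a root, and one of the
two simple roots would be a sum of positive roots. -/
lemma IsSimple.pair_nonpos {a c : AffRoot P} (ha : IsSimple b a) (hc : IsSimple b c) (hne : a ≠ c) :
    a.pair c ≤ 0 := by
  by_contra hpos
  push Not at hpos
  -- The reflection in `c` sends `c` to a negative root but both summands `a`, `d` to positive ones.
  have sum : ∀ (a c d : AffRoot P), IsSimple b a → IsSimple b c → a ≠ c →
      c.vec = a.vec + d.vec → 0 < d.ht b → False := by
    intro a c d ha hc hac hd hdpos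
    have hdc : d ≠ c := fun h => a.vec_ne_zero (by rw [h] at hd; exact left_eq_add.mp (by
      rw [add_comm]; exact hd))
    have h1 := hc.2 a ha.1 hac
    have h2 := hc.2 d hdpos hdc
    have h3 : (c.refl • c).ht b = 1 * (c.refl • a).ht b + 1 * (c.refl • d).ht b :=
      ht_smul_combo b c.refl (by rw [hd]; simp)
    rw [AffRoot.refl_smul_self, ht_neg] at h3
    have := hc.1
    omega
  -- Equal coroots: both pairings are `2`, and simplicity forces each height to exceed twice the
  -- other.
  by_cases hidx : c.idx = a.idx
  · have h1 := ha.2 c hc.1 hne.symm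
    have h2 := hc.2 a ha.1 hne
    have h3 : a.pair c = 2 := by
      rw [AffRoot.pair, hidx]
      exact a.pair_self
    have h4 : c.pair a = 2 := by
      rw [AffRoot.pair, ← hidx]
      exact c.pair_self
    rw [ht_refl_smul, h3] at h1
    rw [ht_refl_smul, h4] at h2
    have := ha.1
    have := hc.1
    omega
  · obtain ⟨d, hd⟩ := exists_sub_of_pair_pos hpos hidx
    rcases lt_or_gt_of_ne (ht_ne_zero b d) with h | h
    · exact sum c a (-d) hc ha hne.symm (by rw [AffRoot.vec_neg, hd]; abel)
        (by rw [ht_neg]; omega)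
    · exact sum a c d ha hc hne (by rw [hd]; abel) h

/-- The sum of the two roots is a multiple of `ħ`, which `W̃` fixes. -/
lemma ht_smul_sub_ht (g : ExtWeyl P) {a c : AffRoot P} (h : P.coroot a.idx + P.coroot c.idx = 0) :
    (g • a).ht b + (g • c).ht b = a.ht b + c.ht b := by
  have h1 : ∀ g : ExtWeyl P, affineRep P g (a.vec + c.vec) = a.vec + c.vec := fun g => by
    rw [affineRep_apply]
    have : (a.vec + c.vec).1 = 0 := h
    rw [this, map_zero, map_zero, sub_zero, ← this]
  have h2 := congrArg (htForm b) (h1 g)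
  rw [map_add, map_add, map_add, ← AffRoot.vec_smul, ← AffRoot.vec_smul] at h2
  simp only [htForm_vec] at h2
  exact_mod_cast h2

/-- The only pair of Cartan integers that would give an infinite dihedral group is `(-2, -2)`. Then
`a + c` is a multiple of `ħ`, fixed by `w⁻¹`, whereas its height would be positive before and
negative after the action. -/
lemma isRankTwo_or {w : ExtWeyl P} {a c : AffRoot P} (ha : IsSimple b a) (hc : IsSimple b c)
    (hne : a ≠ c) (had : (w⁻¹ • a).ht b < 0) (hcd : (w⁻¹ • c).ht b < 0) :
    ∃ q, IsRankTwo a c q ∨ IsRankTwo c a q := by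
  have h1 := ha.pair_nonpos b hc hne
  have h2 := hc.pair_nonpos b ha hne.symm
  have h3 := P.pairingIn_pairingIn_mem_set_of_isCrystal_of_isRed a.idx c.idx
  have h4 : ¬ (a.pair c = -2 ∧ c.pair a = -2) := by
    rintro ⟨h5, h6⟩
    have h7 : P.coroot a.idx + P.coroot c.idx = 0 := by
      have h8 : P.pairing a.idx c.idx = -2 := by
        rw [← AffRoot.ev_vec, AffRoot.ev_vec_eq, h5]; simp
      have h9 : P.pairing c.idx a.idx = -2 := by
        rw [← AffRoot.ev_vec, AffRoot.ev_vec_eq, h6]; simp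
      have h10 := (P.pairing_neg_two_neg_two_iff _ _).mp ⟨h8, h9⟩
      have h11 : P.coroot (P.reflectionPerm a.idx a.idx) = P.coroot c.idx := by
        congr 1
        apply P.root.injective
        rw [P.root_reflectionPerm, P.reflection_apply_self, h10, neg_neg]
      rw [← h11, P.coroot_reflectionPerm, P.coreflection_apply_self, add_neg_cancel]
    have h10 := ht_smul_sub_ht b w⁻¹ h7
    have := ha.1
    have := hc.1
    omega
  simp only [Set.mem_insert_iff, Set.mem_singleton_iff, Prod.mk.injEq] at h3
  change a.pair c = 0 ∧ c.pair a = 0 ∨ a.pair c = 1 ∧ c.pair a = 1 ∨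
    a.pair c = -1 ∧ c.pair a = -1 ∨ a.pair c = 1 ∧ c.pair a = 2 ∨ a.pair c = 2 ∧ c.pair a = 1 ∨
    a.pair c = -1 ∧ c.pair a = -2 ∨ a.pair c = -2 ∧ c.pair a = -1 ∨
    a.pair c = 1 ∧ c.pair a = 3 ∨ a.pair c = 3 ∧ c.pair a = 1 ∨ a.pair c = -1 ∧ c.pair a = -3 ∨
    a.pair c = -3 ∧ c.pair a = -1 ∨ a.pair c = 2 ∧ c.pair a = 2 ∨
    a.pair c = -2 ∧ c.pair a = -2 at h3
  rcases h3 with h | h | h | h | h | h | h | h | h | h | h | h | h <;> obtain ⟨h5, h6⟩ := h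
  · exact ⟨0, Or.inl (Or.inl ⟨rfl, h5, h6⟩)⟩
  · omega
  · exact ⟨1, Or.inl (Or.inr ⟨by simp, h5, h6⟩)⟩
  · omega
  · omega
  · exact ⟨2, Or.inl (Or.inr ⟨by simp, h5, h6⟩)⟩
  · exact ⟨2, Or.inr (Or.inr ⟨by simp, h6, h5⟩)⟩
  · omega
  · omega
  · exact ⟨3, Or.inl (Or.inr ⟨by simp, h5, h6⟩)⟩
  · exact ⟨3, Or.inr (Or.inr ⟨by simp, h6, h5⟩)⟩
  · omega
  · omega

end Coxeter

/-! ### Products of Demazure elements along reduced words -/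

section Matsumoto

variable {ι V 𝔱 : Type*} [AddCommGroup V] [Module ℂ V] [AddCommGroup 𝔱] [Module ℂ 𝔱]
  {P : RootPairing ι ℂ V 𝔱} [P.IsCrystallographic] {C : Type*} [Ring C] [Algebra ℂ C]
  (N : NilSys P C)

lemma NilSys.alt_th_eq {a c : AffRoot P} {q : ℕ} (h : IsRankTwo a c q) :
    alt (N.th a) (N.th c) (coxeterNumber q) = alt (N.th c) (N.th a) (coxeterNumber q) := by
  obtain ⟨p, h1, h2, h3⟩ := h.ev
  have hd : ∀ (a : AffRoot P) (f q : SymAff 𝔱),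
      MulSemiringAction.toRingHom (ExtWeyl P) (SymAff 𝔱) a.refl f - f = a.lin * q →
      N.th a * N.pol f =
        N.pol (MulSemiringAction.toRingHom (ExtWeyl P) (SymAff 𝔱) a.refl f) * N.th a + N.pol q :=
    fun a f q hq => by rw [N.th_pol, a.dem_unique hq]; rfl
  have hlin : ∀ (a c : AffRoot P) (p : ℕ), a.ev c.vec = -p →
      MulSemiringAction.toRingHom (ExtWeyl P) (SymAff 𝔱) a.refl c.lin = c.lin + p * a.lin := by
    intro a c p h
    change a.refl • c.lin = _
    rw [← AffRoot.lin_smul, AffRoot.lin, AffRoot.vec_smul, AffRoot.refl_apply, h, AffRoot.lin,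
      AffRoot.lin, map_sub, map_smul, ← nsmul_eq_mul, neg_smul, sub_neg_eq_add,
      Nat.cast_smul_eq_nsmul]
  refine alt_demazure_eq (S := SymAff 𝔱) N.pol.toRingHom (A := a.lin)
    (σ := MulSemiringAction.toRingHom (ExtWeyl P) _ a.refl) (B := c.lin)
    (τ := MulSemiringAction.toRingHom (ExtWeyl P) _ c.refl) (s := N.grp a.refl)
    (s' := N.grp c.refl) (N.grp_refl a) (N.grp_refl c) (N.grp_pol _) (N.grp_pol _) (N.th_th a)
    (N.th_th c) (N.grp_refl_mul_self a) (N.grp_refl_mul_self c) (hd a) (hd c) a.refl_smul_lin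
    c.refl_smul_lin (hlin a c p h1) (hlin c a q h2) h3 ?_
  rw [← map_alt, ← map_alt, alt_refl_eq h]

variable [Finite ι] [P.IsRootSystem] [P.IsReduced] (b : P.Base)

/-- A simple descent of a group element. -/
def someDescent (w : ExtWeyl P) (h : len b w ≠ 0) : AffRoot P :=
  Classical.choose (exists_simple_descent_of_len b h)

lemma someDescent_spec (w : ExtWeyl P) (h : len b w ≠ 0) :
    IsSimple b (someDescent b w h) ∧ (w⁻¹ • someDescent b w h).ht b < 0 :=
  Classical.choose_spec (exists_simple_descent_of_len b h)

/-- The product of Demazure elements along a reduced word. -/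
def NilSys.T (w : ExtWeyl P) : C :=
  if h : len b w = 0 then N.grp w
  else N.th (someDescent b w h) * NilSys.T ((someDescent b w h).refl * w)
termination_by len b w
decreasing_by
  have := len_refl_mul_of_descent b (someDescent_spec b w h).1 (someDescent_spec b w h).2
  omega

lemma NilSys.T_of_len_eq_zero {w : ExtWeyl P} (h : len b w = 0) : N.T b w = N.grp w := by
  rw [NilSys.T, dif_pos h]

lemma NilSys.T_someDescent {w : ExtWeyl P} (h : len b w ≠ 0) :
    N.T b w = N.th (someDescent b w h) * N.T b ((someDescent b w h).refl * w) := by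
  rw [NilSys.T, dif_neg h]

/-- Unrolls `k` alternating letters. The hypothesis `H` is the freedom to choose the descent for
elements of length at most `n`, available by induction in `NilSys.T_descent`. -/
lemma NilSys.T_alt {n : ℕ} (H : ∀ (u : ExtWeyl P) (a : AffRoot P), len b u ≤ n → IsSimple b a →
    (u⁻¹ • a).ht b < 0 → N.T b u = N.th a * N.T b (a.refl * u)) (k : ℕ) :
    ∀ (u : ExtWeyl P) (x y : AffRoot P), len b u ≤ n → IsSimple b x → IsSimple b y →
      (∀ j < k, (u⁻¹ • alt x.refl y.refl j • (if Even j then x else y)).ht b < 0) →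
      N.T b u = alt (N.th x) (N.th y) k * N.T b ((alt x.refl y.refl k)⁻¹ * u) := by
  induction k with
  | zero => intro u x y _ _ _ _; simp [alt]
  | succ k ih =>
    intro u x y hu hx hy hj
    have h0 : (u⁻¹ • x).ht b < 0 := by simpa [alt] using hj 0 (by omega)
    have hlen := len_refl_mul_of_descent b hx h0
    rw [H u x hu hx h0, ih (x.refl * u) y x (by omega) hy hx, alt, alt, mul_inv_rev, x.refl_inv,
      mul_assoc, mul_assoc]
    intro j hjk
    have := hj (j + 1) (by omega)
    rw [alt, mul_smul] at this
    rw [mul_inv_rev, x.refl_inv, mul_smul]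
    simp only [Nat.even_add_one, ite_not] at this
    exact this

/-- Matsumoto's argument. If `a` and the chosen `c` are two descents of `w`, then `w` begins with
the longest word of the dihedral group they generate. By induction both choices can be expanded
along the two reduced forms of this word, where the braid relation for the `θ` identifies them. -/
lemma NilSys.T_descent : ∀ (n : ℕ) (w : ExtWeyl P) (a : AffRoot P), len b w ≤ n → IsSimple b a →
    (w⁻¹ • a).ht b < 0 → N.T b w = N.th a * N.T b (a.refl * w) := by
  intro n
  induction n with
  | zero =>
    intro w a hw ha had
    have := len_refl_mul_of_descent b ha had
    omega
  | succ n ih =>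
    intro w a hw ha had
    have hlen := len_refl_mul_of_descent b ha had
    have hw0 : len b w ≠ 0 := by omega
    obtain ⟨hc, hcd⟩ := someDescent_spec b w hw0
    rw [N.T_someDescent b hw0]
    set c := someDescent b w hw0
    have hlen' := len_refl_mul_of_descent b hc hcd
    by_cases hac : a = c
    · rw [hac]
    obtain ⟨q, hq⟩ := isRankTwo_or b ha hc hac had hcd
    have ht : ∀ j < coxeterNumber q,
        (w⁻¹ • alt a.refl c.refl j • (if Even j then a else c)).ht b < 0 ∧
        (w⁻¹ • alt c.refl a.refl j • (if Even j then c else a)).ht b < 0 := fun j hj => by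
      rcases hq with hq | hq
      · exact ht_alt_neg b hq had hcd hj
      · exact (ht_alt_neg b hq hcd had hj).symm
    have hth : alt (N.th a) (N.th c) (coxeterNumber q) = alt (N.th c) (N.th a) (coxeterNumber q) := by
      rcases hq with hq | hq
      · exact N.alt_th_eq hq
      · exact (N.alt_th_eq hq).symm
    have hre : alt a.refl c.refl (coxeterNumber q) = alt c.refl a.refl (coxeterNumber q) := by
      rcases hq with hq | hq
      · exact alt_refl_eq hq
      · exact (alt_refl_eq hq).symm
    obtain ⟨m, hm⟩ : ∃ m, coxeterNumber q = m + 1 := by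
      match q with
      | 0 => exact ⟨1, rfl⟩
      | 1 => exact ⟨2, rfl⟩
      | 2 => exact ⟨3, rfl⟩
      | q + 3 => exact ⟨5, rfl⟩
    rw [hm] at ht hth hre
    -- The first letter has been split off, so that the induction hypothesis covers the remaining
    -- `m` letters.
    have e1 := N.T_alt b ih m (a.refl * w) c a (by omega) hc ha (fun j hj => by
      have := (ht (j + 1) (by omega)).1
      rw [alt, mul_smul] at this
      rw [mul_inv_rev, a.refl_inv, mul_smul]
      simp only [Nat.even_add_one, ite_not] at this
      exact this)
    have e2 := N.T_alt b ih m (c.refl * w) a c (by omega) ha hc (fun j hj => by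
      have := (ht (j + 1) (by omega)).2
      rw [alt, mul_smul] at this
      rw [mul_inv_rev, c.refl_inv, mul_smul]
      simp only [Nat.even_add_one, ite_not] at this
      exact this)
    have e3 : (alt a.refl c.refl m)⁻¹ * (c.refl * w) = (alt c.refl a.refl m)⁻¹ * (a.refl * w) := by
      rw [← mul_assoc, ← mul_assoc]
      congr 1
      rw [alt, alt] at hre
      have := congrArg (fun g => g⁻¹) hre
      simp only [mul_inv_rev, AffRoot.refl_inv] at this
      exact this.symm
    simp only [alt] at hth
    rw [e1, e2, e3, ← mul_assoc (N.th c), ← mul_assoc (N.th a), hth]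

lemma NilSys.T_refl_mul {w : ExtWeyl P} {a : AffRoot P} (ha : IsSimple b a) :
    N.th a * N.T b w = if (w⁻¹ • a).ht b < 0 then 0 else N.T b (a.refl * w) := by
  split_ifs with h
  · rw [N.T_descent b _ w a le_rfl ha h, ← mul_assoc, N.th_th, zero_mul]
  · have h0 := ht_ne_zero b (w⁻¹ • a)
    rw [N.T_descent b _ (a.refl * w) a le_rfl ha (by rw [refl_descent_iff]; omega), ← mul_assoc,
      AffRoot.refl_mul_self, one_mul]

lemma len_mul_of_len_eq_zero {g w : ExtWeyl P} (h : len b g = 0) (hw : len b w = 0) :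
    len b (g * w) = 0 := by
  by_contra hne
  obtain ⟨a, ha, had⟩ := exists_simple_descent_of_len b hne
  rw [mul_inv_rev, mul_smul] at had
  have := pos_of_len_eq_zero b hw (pos_of_len_eq_zero b h ha.1)
  omega

/-- An element of length zero permutes the simple roots, so it can be moved through a reduced word
letter by letter. -/
lemma NilSys.T_mul_of_len_eq_zero {g : ExtWeyl P} (hg : len b g = 0) (n : ℕ) :
    ∀ w, len b w = n → N.T b (g * w) = N.grp g * N.T b w := by
  induction n with
  | zero =>
    intro w hw
    rw [N.T_of_len_eq_zero b hw, N.T_of_len_eq_zero b (len_mul_of_len_eq_zero b hg hw), map_mul]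
  | succ n ih =>
    intro w hw
    obtain ⟨a, ha, had⟩ := exists_simple_descent_of_len b (w := w) (by omega)
    have hlen := len_refl_mul_of_descent b ha had
    rw [N.T_descent b _ w a le_rfl ha had, ← mul_assoc, N.grp_th, mul_assoc, ← ih _ (by omega),
      N.T_descent b _ (g * w) (g • a) le_rfl (ha.smul_of_len_eq_zero b hg) (by
        rw [mul_inv_rev, mul_smul, inv_smul_smul]; exact had), AffRoot.refl_smul]
    congr 2
    group

/-- The span of the products of polynomials and Demazure elements of reduced words. -/
def NilSys.span : Submodule ℂ C :=
  Submodule.span ℂ {x | ∃ (f : SymAff 𝔱) (w : ExtWeyl P), x = N.pol f * N.T b w}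

lemma NilSys.mem_span (f : SymAff 𝔱) (w : ExtWeyl P) : N.pol f * N.T b w ∈ N.span b :=
  Submodule.subset_span ⟨f, w, rfl⟩

lemma NilSys.mul_mem_span {y : C} (h : ∀ f w, y * (N.pol f * N.T b w) ∈ N.span b) {x : C}
    (hx : x ∈ N.span b) : y * x ∈ N.span b := by
  induction hx using Submodule.span_induction with
  | mem x hx =>
    obtain ⟨f, w, rfl⟩ := hx
    exact h f w
  | zero => rw [mul_zero]; exact zero_mem _
  | add x x' _ _ hx hx' => rw [mul_add]; exact add_mem hx hx'
  | smul c x _ hx => rw [mul_smul_comm]; exact Submodule.smul_mem _ _ hx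

lemma NilSys.pol_mul_mem (f : SymAff 𝔱) {x : C} (hx : x ∈ N.span b) : N.pol f * x ∈ N.span b :=
  N.mul_mem_span b (fun f' w => by
    rw [← mul_assoc, ← map_mul]; exact N.mem_span b _ _) hx

lemma NilSys.th_simple_mul_mem {a : AffRoot P} (ha : IsSimple b a) {x : C} (hx : x ∈ N.span b) :
    N.th a * x ∈ N.span b :=
  N.mul_mem_span b (fun f w => by
    rw [← mul_assoc, N.th_pol, add_mul, mul_assoc, N.T_refl_mul b ha]
    refine add_mem ?_ (N.mem_span b _ _)
    split_ifs
    · rw [mul_zero]; exact zero_mem _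
    · exact N.mem_span b _ _) hx

lemma NilSys.grp_mul_mem (n : ℕ) : ∀ (g : ExtWeyl P), len b g = n → ∀ {x : C}, x ∈ N.span b →
    N.grp g * x ∈ N.span b := by
  induction n with
  | zero =>
    intro g hg x hx
    refine N.mul_mem_span b (fun f w => ?_) hx
    rw [← mul_assoc, N.grp_pol, mul_assoc, ← N.T_mul_of_len_eq_zero b hg _ w rfl]
    exact N.mem_span b _ _
  | succ n ih =>
    intro g hg x hx
    obtain ⟨a, ha, had⟩ := exists_simple_descent_of_len b (w := g) (by omega)
    have hlen := len_refl_mul_of_descent b ha had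
    have h1 : N.grp g = N.grp a.refl * N.grp (a.refl * g) := by
      rw [← map_mul, ← mul_assoc, AffRoot.refl_mul_self, one_mul]
    have h2 := ih (a.refl * g) (by omega) hx
    rw [h1, mul_assoc, N.grp_refl, add_mul, one_mul, mul_assoc]
    exact add_mem h2 (N.pol_mul_mem b _ (N.th_simple_mul_mem b ha h2))

/-- The Demazure element of any affine root is conjugate to that of a simple one, and the span is
stable under the group. -/
lemma NilSys.th_mul_mem (a : AffRoot P) {x : C} (hx : x ∈ N.span b) : N.th a * x ∈ N.span b := by
  obtain ⟨g, c, hc, rfl⟩ := exists_smul_simple b a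
  have h1 : N.th (g • c) = N.grp g * N.th c * N.grp g⁻¹ := by
    rw [N.grp_th, mul_assoc, N.grp_mul_inv, mul_one]
  rw [h1, mul_assoc, mul_assoc]
  exact N.grp_mul_mem b _ g rfl (N.th_simple_mul_mem b hc (N.grp_mul_mem b _ _ rfl hx))

lemma len_one : len b (1 : ExtWeyl P) = 0 := by
  by_contra h
  obtain ⟨a, ha, had⟩ := exists_simple_descent_of_len b h
  rw [inv_one, one_smul] at had
  have := ha.1
  omega

/-- The subalgebra generated by the system. -/
def NilSys.alg : Subalgebra ℂ C :=
  Algebra.adjoin ℂ (Set.range N.pol ∪ Set.range N.grp ∪ Set.range N.th)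

/-- The span is stable under left multiplication by the generators and contains `1 = T_1`. -/
lemma NilSys.alg_le_span {x : C} (hx : x ∈ N.alg) : x ∈ N.span b := by
  have key : ∀ y ∈ N.span b, x * y ∈ N.span b := by
    induction hx using Algebra.adjoin_induction with
    | mem x hx =>
      intro y hy
      rcases hx with (⟨f, rfl⟩ | ⟨g, rfl⟩) | ⟨a, rfl⟩
      · exact N.pol_mul_mem b f hy
      · exact N.grp_mul_mem b _ g rfl hy
      · exact N.th_mul_mem b a hy
    | algebraMap c =>
      intro y hy
      rw [← Algebra.smul_def]
      exact Submodule.smul_mem _ _ hy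
    | add x x' _ _ h h' =>
      intro y hy
      rw [add_mul]
      exact add_mem (h y hy) (h' y hy)
    | mul x x' _ _ h h' =>
      intro y hy
      rw [mul_assoc]
      exact h _ (h' y hy)
  have h1 := key (N.pol 1 * N.T b 1) (N.mem_span b _ _)
  rwa [N.T_of_len_eq_zero b (len_one b), map_one, map_one, one_mul, mul_one] at h1

end Matsumoto


/-! ### Linear independence of the `T_w` and the universal property of `ℋ` -/

section Universal

variable {ι V 𝔱 : Type*} [AddCommGroup V] [Module ℂ V] [AddCommGroup 𝔱] [Module ℂ 𝔱]
  {P : RootPairing ι ℂ V 𝔱}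

lemma coeff_fracElt_mul (f : FracAff 𝔱) (x : WFrac P) (u : ExtWeyl P) :
    (fracElt P f * x).coeff u = f * x.coeff u :=
  SkewMonoidAlgebra.coeff_single_one_mul x f u

lemma coeff_groupElt_mul (g : ExtWeyl P) (x : WFrac P) (u : ExtWeyl P) :
    (groupElt P g * x).coeff u = g • x.coeff (g⁻¹ * u) :=
  (SkewMonoidAlgebra.coeff_single_mul 1 g x u).trans (one_mul _)

variable [P.IsCrystallographic] [Finite ι] [P.IsRootSystem] [P.IsReduced] (b : P.Base)

lemma len_refl_mul_le {a : AffRoot P} (ha : IsSimple b a) (w : ExtWeyl P) :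
    len b (a.refl * w) ≤ len b w + 1 := by
  by_cases h : (w⁻¹ • a).ht b < 0
  · have := len_refl_mul_of_descent b ha h
    omega
  · exact (len_refl_mul_of_ascent b ha h).le

/-- Triangularity: multiplication by `a⁻¹ (s_a - 1)` takes the leading term at `s_a w` to a nonzero
term at `w`, and all other group elements that appear are shorter. -/
lemma coeff_T (n : ℕ) : ∀ w, len b w = n → ((fracSys P).T b w).coeff w ≠ 0 ∧
    ∀ u, ((fracSys P).T b w).coeff u ≠ 0 → u = w ∨ len b u < n := by
  induction n with
  | zero =>
    intro w hw
    rw [NilSys.T_of_len_eq_zero _ b hw]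
    change (SkewMonoidAlgebra.single w (1 : FracAff 𝔱)).coeff w ≠ 0 ∧
      ∀ u, (SkewMonoidAlgebra.single w (1 : FracAff 𝔱)).coeff u ≠ 0 → _
    rw [SkewMonoidAlgebra.coeff_single]
    refine ⟨by simp, fun u hu => Or.inl ?_⟩
    by_contra hne
    exact hu (Finsupp.single_eq_of_ne hne)
  | succ n ih =>
    intro w hw
    obtain ⟨a, ha, had⟩ := exists_simple_descent_of_len b (w := w) (by omega)
    have hlen := len_refl_mul_of_descent b ha had
    obtain ⟨ih1, ih2⟩ := ih (a.refl * w) (by omega)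
    rw [NilSys.T_descent _ b _ w a le_rfl ha had]
    set X := (fracSys P).T b (a.refl * w)
    have hc : ∀ u, ((fracSys P).th a * X).coeff u =
        (algebraMap (SymAff 𝔱) (FracAff 𝔱) a.lin)⁻¹ *
          (a.refl • X.coeff (a.refl * u) - X.coeff u) := fun u => by
      change ((fracElt P (algebraMap (SymAff 𝔱) (FracAff 𝔱) a.lin)⁻¹ *
        (groupElt P a.refl - 1)) * X).coeff u = _
      rw [mul_assoc, coeff_fracElt_mul, sub_mul, one_mul, SkewMonoidAlgebra.coeff_sub,
        Finsupp.sub_apply, coeff_groupElt_mul, AffRoot.refl_inv]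
    have hinv := inv_ne_zero (algebraMap_lin_ne_zero a)
    constructor
    · rw [hc]
      have h1 : X.coeff w = 0 := by
        by_contra h
        rcases ih2 w h with h | h
        · rw [← h] at hlen; omega
        · omega
      rw [h1, sub_zero]
      exact mul_ne_zero hinv ((smul_ne_zero_iff_ne _).mpr ih1)
    · intro u hu
      rw [hc] at hu
      have h1 := right_ne_zero_of_mul hu
      by_cases h2 : X.coeff u = 0
      · rw [h2, sub_zero, smul_ne_zero_iff_ne] at h1
        rcases ih2 _ h1 with h | h
        · exact Or.inl (mul_left_cancel h)
        · right
          have := len_refl_mul_le b ha (a.refl * u)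
          rw [← mul_assoc, AffRoot.refl_mul_self, one_mul] at this
          omega
      · rcases ih2 _ h2 with h | h
        · right; rw [h]; omega
        · right; omega

/-- At an element of maximal length in the support only its own `T_w` contributes, with a nonzero
coefficient in a field. -/
lemma fracSys_T_linearIndependent (f : ExtWeyl P →₀ SymAff 𝔱)
    (h : f.sum (fun w p => (fracSys P).pol p * (fracSys P).T b w) = 0) : f = 0 := by
  by_contra hne
  obtain ⟨w, hw, hmax⟩ := Finset.exists_max_image f.support (fun w => len b w)
    (Finsupp.support_nonempty_iff.mpr hne)
  have h1 := congrArg (fun x : WFrac P => x.coeff w) h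
  simp only [Finsupp.sum] at h1
  have h2 : ∀ s : Finset (ExtWeyl P), (∑ u ∈ s, (fracSys P).pol (f u) * (fracSys P).T b u).coeff w =
      ∑ u ∈ s, algebraMap (SymAff 𝔱) (FracAff 𝔱) (f u) * ((fracSys P).T b u).coeff w := fun s => by
    induction s using Finset.cons_induction with
    | empty => simp
    | cons u s hu ih =>
      rw [Finset.sum_cons, Finset.sum_cons, SkewMonoidAlgebra.coeff_add, Finsupp.add_apply, ih]
      congr 1
      exact coeff_fracElt_mul _ _ _
  rw [h2, Finset.sum_eq_single w] at h1
  · have h3 := (coeff_T b _ w rfl).1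
    have h4 : algebraMap (SymAff 𝔱) (FracAff 𝔱) (f w) ≠ 0 := fun h =>
      Finsupp.mem_support_iff.mp hw ((FaithfulSMul.algebraMap_eq_zero_iff _ _).mp h)
    exact mul_ne_zero h4 h3 (h1.trans (by simp))
  · intro u hu hne
    by_contra h5
    rcases (coeff_T b _ u rfl).2 w (right_ne_zero_of_mul h5) with h | h
    · exact hne h.symm
    · have := hmax u hu
      omega
  · intro h5
    exact absurd hw h5

variable {C : Type*} [Ring C] [Algebra ℂ C]

lemma NilSys.exists_finsupp (N : NilSys P C) {x : C} (hx : x ∈ N.span b) :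
    ∃ f : ExtWeyl P →₀ SymAff 𝔱, x = f.sum (fun w p => N.pol p * N.T b w) := by
  induction hx using Submodule.span_induction with
  | mem x hx =>
    obtain ⟨f, w, rfl⟩ := hx
    exact ⟨Finsupp.single w f, by rw [Finsupp.sum_single_index (by simp)]⟩
  | zero => exact ⟨0, by simp⟩
  | add x y _ _ hx hy =>
    obtain ⟨f, rfl⟩ := hx
    obtain ⟨g, rfl⟩ := hy
    classical
    exact ⟨f + g, by
      rw [Finsupp.sum_add_index (fun _ _ => by simp) (fun _ _ _ _ => by rw [map_add, add_mul])]⟩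
  | smul c x _ hx =>
    obtain ⟨f, rfl⟩ := hx
    exact ⟨c • f, by
      rw [Finsupp.sum_smul_index' (fun _ => by simp), Finsupp.smul_sum]
      simp only [map_smul, smul_mul_assoc]⟩

lemma NilSys.prod_T {D : Type*} [Ring D] [Algebra ℂ D] (N : NilSys P C) (N' : NilSys P D) (n : ℕ) :
    ∀ w, len b w = n → (N.prod N').T b w = (N.T b w, N'.T b w) := by
  induction n with
  | zero =>
    intro w hw
    rw [T_of_len_eq_zero _ b hw, T_of_len_eq_zero _ b hw, T_of_len_eq_zero _ b hw]
    rfl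
  | succ n ih =>
    intro w hw
    obtain ⟨a, ha, had⟩ := exists_simple_descent_of_len b (w := w) (by omega)
    have hlen := len_refl_mul_of_descent b ha had
    rw [T_descent _ b _ w a le_rfl ha had, T_descent _ b _ w a le_rfl ha had,
      T_descent _ b _ w a le_rfl ha had, ih _ (by omega)]
    rfl

/-- An element of the generated subalgebra is a combination of the `T_w` of the product system, with
the same polynomial coefficients in both components. Independence in the first component makes these
coefficients zero. Hence the subalgebra is the graph of a homomorphism. -/
lemma NilSys.fst_injective (b : P.Base) (N : NilSys P C) {x : WFrac P × C} (hx : x ∈ ((fracSys P).prod N).alg)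
    (h : x.1 = 0) : x = 0 := by
  obtain ⟨f, rfl⟩ := NilSys.exists_finsupp b _ (NilSys.alg_le_span _ b hx)
  have h1 : f = 0 := by
    apply fracSys_T_linearIndependent b
    rw [← h]
    have := map_finsuppSum (RingHom.fst (WFrac P) C) f
      (fun w p => ((fracSys P).prod N).pol p * ((fracSys P).prod N).T b w)
    refine Eq.trans ?_ this.symm
    refine Finsupp.sum_congr fun w _ => ?_
    rw [map_mul, NilSys.prod_T b _ _ _ w rfl]
    rfl
  rw [h1, Finsupp.sum_zero_index]

lemma demazure_mem_alg (N : NilSys P C) : ∀ x ∈ nilDAHA b, ∃ y, (x, y) ∈ ((fracSys P).prod N).alg := by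
  have key : nilDAHA b ≤ ((fracSys P).prod N).alg.map (AlgHom.fst ℂ (WFrac P) C) := by
    have pol : ∀ s, polyElt P s ∈ ((fracSys P).prod N).alg.map (AlgHom.fst ℂ (WFrac P) C) :=
      fun s => ⟨_, Algebra.subset_adjoin (Or.inl (Or.inl ⟨s, rfl⟩)), rfl⟩
    have th : ∀ a : AffRoot P, demazure P a.vec a.refl ∈
        ((fracSys P).prod N).alg.map (AlgHom.fst ℂ (WFrac P) C) :=
      fun a => ⟨_, Algebra.subset_adjoin (Or.inr ⟨a, rfl⟩), rfl⟩
    refine Algebra.adjoin_le ?_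
    rintro x (hx | ⟨g, rfl⟩)
    · refine (Algebra.adjoin_le ?_ : nilHeckeAff b ≤ _) hx
      rintro _ ((⟨s, rfl⟩ | ⟨i, -, rfl⟩) | ⟨j, -, rfl⟩)
      · exact pol s
      · rw [thetaFin_eq]; exact th _
      · rw [thetaAff_eq]; exact th _
    · exact ⟨_, Algebra.subset_adjoin (Or.inl (Or.inr ⟨g, rfl⟩)), rfl⟩
  intro x hx
  obtain ⟨⟨x', y⟩, h, rfl⟩ := key hx
  exact ⟨y, h⟩

/-- A subalgebra of a product which is the graph of a function on a subalgebra defines an algebra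
homomorphism. -/
lemma exists_algHom_of_graph {A C : Type*} [Ring A] [Algebra ℂ A] [Ring C] [Algebra ℂ C]
    (S : Subalgebra ℂ A) (G : Subalgebra ℂ (A × C)) (h1 : ∀ x ∈ S, ∃ y, (x, y) ∈ G)
    (h2 : ∀ y, (0, y) ∈ G → y = 0) :
    ∃ φ : S →ₐ[ℂ] C, ∀ (x : S) (y : C), ((x : A), y) ∈ G → φ x = y := by
  choose y hy using h1
  have uniq : ∀ (x : S) (z : C), ((x : A), z) ∈ G → y x x.2 = z := fun x z hz => by
    have := sub_mem (hy x x.2) hz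
    rw [Prod.mk_sub_mk, sub_self] at this
    exact sub_eq_zero.mp (h2 _ this)
  exact ⟨{ toFun := fun x => y x x.2
           map_one' := uniq 1 _ (one_mem G)
           map_mul' := fun a c => uniq _ _ (mul_mem (hy a a.2) (hy c c.2))
           map_zero' := uniq 0 _ (zero_mem G)
           map_add' := fun a c => uniq _ _ (add_mem (hy a a.2) (hy c c.2))
           commutes' := fun c => uniq _ _ (G.algebraMap_mem c) }, uniq⟩

/-- A system of generators which satisfies the relations of rank one extends to the degenerate nil
DAHA. -/
theorem NilSys.exists_algHom (N : NilSys P C) : ∃ φ : nilDAHA b →ₐ[ℂ] C,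
    (∀ s, φ ⟨polyElt P s, polyElt_mem b s⟩ = N.pol s) ∧
    ∀ g, φ ⟨groupElt P g, groupElt_mem b g⟩ = N.grp g := by
  obtain ⟨φ, hφ⟩ := exists_algHom_of_graph (nilDAHA b) ((fracSys P).prod N).alg
    (demazure_mem_alg b N) (fun y hy => congrArg Prod.snd (NilSys.fst_injective b N hy rfl))
  refine ⟨φ, fun s => hφ _ _ ?_, fun g => hφ _ _ ?_⟩
  · exact Algebra.subset_adjoin (Or.inl (Or.inl ⟨s, rfl⟩))
  · exact Algebra.subset_adjoin (Or.inl (Or.inr ⟨g, rfl⟩))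

end Universal


/-! ### Weights and the Zariski density of their lines in `𝔱* × ℂ` -/

section EvLine

variable {ι V 𝔱 : Type*} [AddCommGroup V] [Module ℂ V] [AddCommGroup 𝔱] [Module ℂ 𝔱]
  (P : RootPairing ι ℂ V 𝔱)

/-- The value of a polynomial at `(z μ, z)`, as a polynomial in `z`. -/
def evLine (μ : V) : SymAff 𝔱 →ₐ[ℂ] Polynomial ℂ :=
  SymmetricAlgebra.lift ((Polynomial.monomial 1) ∘ₗ
    (P.toLinearMap μ ∘ₗ LinearMap.fst ℂ 𝔱 ℂ + LinearMap.snd ℂ 𝔱 ℂ))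

lemma evLine_ι (μ : V) (x : 𝔱 × ℂ) : evLine P μ (SymmetricAlgebra.ι ℂ _ x) =
    Polynomial.monomial 1 (P.toLinearMap μ x.1 + x.2) := by
  simp [evLine]

end EvLine

section Weights

variable {ι V 𝔱 : Type*} [Finite ι] [AddCommGroup V] [Module ℂ V] [AddCommGroup 𝔱] [Module ℂ 𝔱]
  {P : RootPairing ι ℂ V 𝔱} [P.IsRootSystem] [P.IsCrystallographic] [P.IsReduced] (b : P.Base)

/-- The weight with given integral coordinates with respect to the fundamental weights. -/
def wtOf (n : b.support → ℤ) : weightLattice P :=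
  ⟨P.toPerfPair.symm (b.toCoweightBasis.constr ℂ fun i => (n i : ℂ)), fun i => by
    obtain ⟨f, -, -, hf⟩ := b.flip.exists_root_eq_sum_int i
    have h2 : P.coroot i = ∑ j ∈ b.support, f j • P.coroot j := by simpa using! hf
    rw [h2, P.toLinearMap.apply_symm_toPerfPair_self, map_sum, ← Finset.sum_coe_sort]
    refine ⟨∑ j : b.support, f j * n j, ?_⟩
    push_cast
    refine Finset.sum_congr rfl fun j _ => ?_
    rw [map_zsmul, ← b.toCoweightBasis_apply, Module.Basis.constr_basis, zsmul_eq_mul]⟩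

lemma wtOf_coroot (n : b.support → ℤ) (i : b.support) :
    P.toLinearMap (wtOf b n : V) (P.coroot i) = n i := by
  rw [wtOf, P.toLinearMap.apply_symm_toPerfPair_self, ← b.toCoweightBasis_apply,
    Module.Basis.constr_basis]

lemma weight_ext {μ ν : weightLattice P}
    (h : ∀ i : b.support, P.toLinearMap (μ : V) (P.coroot i) = P.toLinearMap (ν : V) (P.coroot i)) :
    μ = ν := by
  refine Subtype.ext (P.toPerfPair.injective (b.toCoweightBasis.ext fun i => ?_))
  rw [b.toCoweightBasis_apply]
  exact h i

lemma wtOf_add (m n : b.support → ℤ) : wtOf b (m + n) = wtOf b m + wtOf b n :=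
  weight_ext b fun i => by
    change _ = P.toLinearMap ((wtOf b m : V) + (wtOf b n : V)) _
    rw [map_add, LinearMap.add_apply, wtOf_coroot, wtOf_coroot, wtOf_coroot]
    simp

lemma exists_wtOf (μ : weightLattice P) : ∃ n, wtOf b n = μ :=
  ⟨fun i => wtPair P μ i, weight_ext b fun i => by rw [wtOf_coroot, wtPair_spec]⟩

/-- In coordinates from the fundamental weights the polynomial vanishes at all `(z n, z)` with `n`
integral. For fixed `z ≠ 0` these points fill a product of infinite sets, so the polynomial vanishes
wherever `z ≠ 0`. -/
lemma eq_zero_of_evLine (b : P.Base) {f : SymAff 𝔱} (h : ∀ μ : weightLattice P, evLine P (μ : V) f = 0) :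
    f = 0 := by
  let B : Module.Basis (b.support ⊕ Unit) ℂ (𝔱 × ℂ) :=
    b.toCoweightBasis.prod (Module.Basis.singleton Unit ℂ)
  let e := SymmetricAlgebra.equivMvPolynomial B
  have h1 : ∀ (n : b.support → ℤ) (z : ℂ),
      MvPolynomial.eval (Sum.elim (fun i => (n i : ℂ) * z) fun _ => z) (e f) = 0 := fun n z => by
    have h2 : (MvPolynomial.aeval (Sum.elim (fun i => (n i : ℂ) * z) fun _ => z)).comp e.toAlgHom =
        (Polynomial.aeval z).comp (evLine P (wtOf b n : V)) := by
      refine SymmetricAlgebra.algHom_ext (B.ext fun i => ?_)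
      change MvPolynomial.aeval _ (e (SymmetricAlgebra.ι ℂ _ (B i))) =
        Polynomial.aeval z (evLine P _ (SymmetricAlgebra.ι ℂ _ (B i)))
      rw [SymmetricAlgebra.equivMvPolynomial_ι_apply, MvPolynomial.aeval_X, evLine_ι]
      rcases i with i | i
      · simp [B, wtOf_coroot, Polynomial.aeval_monomial]
      · simp [B, Polynomial.aeval_monomial]
    have h3 := DFunLike.congr_fun h2 f
    rw [AlgHom.comp_apply, AlgHom.comp_apply, h, map_zero] at h3
    exact h3
  have h2 : ∀ (y : b.support → ℂ) (z : ℂ), z ≠ 0 →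
      MvPolynomial.eval (Sum.elim y fun _ => z) (e f) = 0 := fun y z hz => by
    have h3 : ∀ x : b.support → ℂ, MvPolynomial.eval x
        (MvPolynomial.aeval (Sum.elim MvPolynomial.X fun _ => MvPolynomial.C z) (e f) :
          MvPolynomial b.support ℂ) = MvPolynomial.eval (Sum.elim x fun _ => z) (e f) := fun x => by
      have : ((MvPolynomial.aeval x).comp (MvPolynomial.aeval
          (Sum.elim MvPolynomial.X fun _ => MvPolynomial.C z) :
          MvPolynomial (b.support ⊕ Unit) ℂ →ₐ[ℂ] MvPolynomial b.support ℂ)) =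
          MvPolynomial.aeval (Sum.elim x fun _ => z) := by
        refine MvPolynomial.algHom_ext fun i => ?_
        rcases i with i | i <;> simp
      exact DFunLike.congr_fun this (e f)
    have h4 : (MvPolynomial.aeval (Sum.elim MvPolynomial.X fun _ => MvPolynomial.C z) (e f) :
        MvPolynomial b.support ℂ) = 0 := by
      refine MvPolynomial.funext_set (fun _ => Set.range fun n : ℤ => (n : ℂ) * z)
        (fun _ => Set.infinite_range_of_injective fun m n hmn => by
          exact_mod_cast mul_right_cancel₀ hz hmn) fun x hx => ?_
      choose n hn using fun i => hx i (Set.mem_univ i)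
      rw [h3, map_zero, ← funext hn]
      exact h1 n z
    rw [← h3, h4, map_zero]
  -- Multiplying by the coordinate `z` takes care of the hyperplane `z = 0`.
  have h3 : e f * MvPolynomial.X (Sum.inr ()) = 0 := by
    refine MvPolynomial.funext fun x => ?_
    rw [map_mul, MvPolynomial.eval_X, map_zero]
    by_cases hx : x (Sum.inr ()) = 0
    · rw [hx, mul_zero]
    · have := h2 (fun i => x (Sum.inl i)) (x (Sum.inr ())) hx
      rw [show (Sum.elim (fun i => x (Sum.inl i)) fun _ => x (Sum.inr ())) = x by
        funext i; rcases i with i | i <;> rfl] at this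
      rw [this, zero_mul]
  have h4 := (mul_eq_zero.mp h3).resolve_right (MvPolynomial.X_ne_zero _)
  exact (map_eq_zero_iff e e.injective).mp h4

end Weights

/-! ### The comparison map from `W̃ ⋉ Sym 𝔱_aff` to `W ⋉ 𝒟_ħ(T)` -/

section Presentation

variable {ι V 𝔱 : Type*} [AddCommGroup V] [Module ℂ V] [AddCommGroup 𝔱] [Module ℂ 𝔱]
  (P : RootPairing ι ℂ V 𝔱)

lemma hbarDh_mul (x : DhT P) : hbarDh P * x = x * hbarDh P := by
  refine Subtype.ext ?_
  change Polynomial.monomial 1 1 * (x : Polynomial (Module.End ℂ (TorusRing P))) =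
    (x : Polynomial (Module.End ℂ (TorusRing P))) * Polynomial.monomial 1 1
  rw [Polynomial.monomial_one_one_eq_X, Polynomial.X_mul]

lemma fieldDh_comm (ξ η : 𝔱) : fieldDh P ξ * fieldDh P η = fieldDh P η * fieldDh P ξ := by
  refine Subtype.ext ?_
  simp [fieldDh, Polynomial.monomial_mul_monomial, vectorField_comm P ξ η]

/-- The linear map `ξ + c ħ ↦ ∂_ξ + c ħ`. -/
def affDhLin : 𝔱 × ℂ →ₗ[ℂ] DhT P :=
  (fieldDhLin P).coprod (LinearMap.toSpanSingleton ℂ (DhT P) (hbarDh P))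

lemma affDhLin_apply (x : 𝔱 × ℂ) : affDhLin P x = fieldDh P x.1 + x.2 • hbarDh P := by
  simp [affDhLin, fieldDhLin]

/-- The embedding `Sym 𝔱_aff → 𝒟_ħ(T)`. -/
def affDh : SymAff 𝔱 →ₐ[ℂ] DhT P := symLift (affDhLin P) fun x y => by
  rw [affDhLin_apply, affDhLin_apply]
  have h : ∀ x, Commute (hbarDh P) x := hbarDh_mul P
  exact (Commute.add_right (fieldDh_comm P x.1 y.1) ((h _).symm.smul_right _)).add_left
    ((h _).smul_left _)

lemma affDh_ι (x : 𝔱 × ℂ) : affDh P (SymmetricAlgebra.ι ℂ _ x) = fieldDh P x.1 + x.2 • hbarDh P := by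
  rw [affDh, symLift_ι, affDhLin_apply]

lemma weyl_smul_charDh (w : P.weylGroup) (μ : weightLattice P) :
    w • charDh P μ = charDh P (weightAct P w μ) := by
  refine reesDiffOps_ext P fun n => ?_
  rw [weyl_smul_def, reesConj_coeff]
  simp only [charDh, Polynomial.coeff_monomial]
  split_ifs
  · rw [conjAct_mulLeft, character, torusAct_single, character]
  · exact map_zero _

lemma weyl_smul_fieldDh (w : P.weylGroup) (ξ : 𝔱) :
    w • fieldDh P ξ = fieldDh P (cartanRep P w ξ) := by
  refine reesDiffOps_ext P fun n => ?_
  rw [weyl_smul_def, reesConj_coeff]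
  simp only [fieldDh, Polynomial.coeff_monomial]
  split_ifs
  · exact weylConj_vectorField P w ξ
  · exact map_zero _

lemma weyl_smul_hbarDh (w : P.weylGroup) : w • hbarDh P = hbarDh P := by
  refine reesDiffOps_ext P fun n => ?_
  rw [weyl_smul_def, reesConj_coeff]
  simp only [hbarDh, Polynomial.coeff_monomial]
  split_ifs
  · exact map_one _
  · exact map_zero _

lemma charDh_add (μ ν : weightLattice P) : charDh P (μ + ν) = charDh P μ * charDh P ν := by
  refine Subtype.ext ?_
  simp only [charDh, MulMemClass.mk_mul_mk, Polynomial.monomial_mul_monomial, add_zero]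
  congr 1
  refine LinearMap.ext fun x => ?_
  rw [Module.End.mul_apply, LinearMap.mulLeft_apply, LinearMap.mulLeft_apply,
    LinearMap.mulLeft_apply, ← mul_assoc, character, character, character, charMonomial_mul, mul_one]

lemma charDh_zero : charDh P 0 = 1 := by
  refine Subtype.ext ?_
  have : character P 0 = 1 := rfl
  simp only [charDh, this, LinearMap.mulLeft_one]
  rfl

lemma fieldDh_mul_charDh (ξ : 𝔱) (μ : weightLattice P) : fieldDh P ξ * charDh P μ =
    charDh P μ * (fieldDh P ξ + P.toLinearMap (μ : V) ξ • hbarDh P) := by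
  refine Subtype.ext ?_
  have h : vectorField P ξ * LinearMap.mulLeft ℂ (character P μ) =
      LinearMap.mulLeft ℂ (character P μ) * (vectorField P ξ + P.toLinearMap (μ : V) ξ • 1) := by
    refine LinearMap.ext fun b => ?_
    simp only [Module.End.mul_apply, LinearMap.mulLeft_apply, vectorField_mul, character,
      vectorField_single, LinearMap.add_apply, LinearMap.smul_apply, Module.End.one_apply, mul_add,
      mul_smul_comm, smul_mul_assoc]
    abel
  change Polynomial.monomial 1 _ * Polynomial.monomial 0 _ =
    Polynomial.monomial 0 _ * (Polynomial.monomial 1 _ + _ • Polynomial.monomial 1 _)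
  rw [Polynomial.smul_monomial, ← map_add, Polynomial.monomial_mul_monomial,
    Polynomial.monomial_mul_monomial, h]

/-- The homomorphism from `W̃` to `W ⋉ 𝒟_ħ(T)`. -/
def extWeylA : ExtWeyl P →* WDhT P where
  toFun g := diffA P (charDh P g.left.toAdd) * weylA P g.right
  map_one' := by
    change diffA P (charDh P 0) * weylA P 1 = 1
    rw [charDh_zero, map_one, one_mul]
    rfl
  map_mul' g h := by
    have h1 : ((g * h).left.toAdd : weightLattice P) =
      g.left.toAdd + weightAct P g.right h.left.toAdd := rfl
    have h2 : weylA P (g * h).right = weylA P g.right * weylA P h.right := by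
      simp [weylA, SkewMonoidAlgebra.single_mul_single]
    rw [h1, h2, charDh_add, map_mul, ← weyl_smul_charDh]
    calc _ = diffA P (charDh P g.left.toAdd) * (diffA P (g.right • charDh P h.left.toAdd) *
          weylA P g.right) * weylA P h.right := by simp only [mul_assoc]
      _ = _ := by rw [← weylA_mul_diffA]; simp only [mul_assoc]

lemma extWeylA_inr (w : P.weylGroup) : extWeylA P (SemidirectProduct.inr w) = weylA P w := by
  change diffA P (charDh P 0) * weylA P w = _
  rw [charDh_zero, map_one, one_mul]

lemma extWeylA_translation (μ : weightLattice P) :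
    extWeylA P (translation P μ) = diffA P (charDh P μ) := by
  change diffA P (charDh P μ) * weylA P 1 = _
  exact mul_one _

lemma extWeylA_mul_affDh (g : ExtWeyl P) (f : SymAff 𝔱) :
    diffA P (affDh P (g • f)) * extWeylA P g = extWeylA P g * diffA P (affDh P f) := by
  induction f using SymmetricAlgebra.induction with
  | algebraMap c =>
    have : g • algebraMap ℂ (SymAff 𝔱) c = algebraMap ℂ (SymAff 𝔱) c := (symAffAct P g).commutes c
    rw [this, AlgHom.commutes, AlgHom.commutes, Algebra.commutes]
  | ι x =>
    have h1 : g • SymmetricAlgebra.ι ℂ (𝔱 × ℂ) x = SymmetricAlgebra.ι ℂ _ (affineRep P g x) :=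
      symAffAct_ι P g x
    have h2 : (fieldDh P (affineRep P g x).1 + (affineRep P g x).2 • hbarDh P) *
        charDh P g.left.toAdd = charDh P g.left.toAdd *
          (g.right • (fieldDh P x.1 + x.2 • hbarDh P)) := by
      have h3 : (affineRep P g x).2 =
        x.2 - P.toLinearMap (g.left.toAdd : V) (cartanRep P g.right x.1) := rfl
      have h4 : (affineRep P g x).1 = cartanRep P g.right x.1 := rfl
      rw [smul_add, smul_comm, weyl_smul_fieldDh, weyl_smul_hbarDh, h3, h4, add_mul,
        fieldDh_mul_charDh, smul_mul_assoc, hbarDh_mul, ← mul_smul_comm, ← mul_add, add_assoc, ← add_smul,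
        add_sub_cancel]
    rw [h1, affDh_ι, affDh_ι]
    change _ * (diffA P _ * weylA P _) = (diffA P _ * weylA P _) * _
    rw [← mul_assoc, ← map_mul, h2, map_mul, mul_assoc, mul_assoc, weylA_mul_diffA]
  | mul f f' h h' => rw [smul_mul', map_mul, map_mul, mul_assoc, h', ← mul_assoc, h, mul_assoc,
      ← map_mul, ← map_mul]
  | add f f' h h' => rw [smul_add, map_add, map_add, add_mul, h, h', map_add, map_add, mul_add]

instance symAffAction_comm : SMulCommClass (ExtWeyl P) ℂ (SymAff 𝔱) where
  smul_comm g c x := map_smul (symAffAct P g) c x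

/-- The smash product `W̃ ⋉ Sym 𝔱_aff`. -/
abbrev WSym : Type _ := SkewMonoidAlgebra (SymAff 𝔱) (ExtWeyl P)

/-- The comparison of `W̃ ⋉ Sym 𝔱_aff` with `W ⋉ 𝒟_ħ(T)`. -/
def toWDhT : WSym P →ₐ[ℂ] WDhT P :=
  SkewMonoidAlgebra.liftNCAlgHom ((diffA P).comp (affDh P)) (extWeylA P)
    fun {f g} => extWeylA_mul_affDh P g f

lemma toWDhT_single (g : ExtWeyl P) (f : SymAff 𝔱) : toWDhT P (SkewMonoidAlgebra.single g f) =
    diffA P (affDh P f) * extWeylA P g :=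
  SkewMonoidAlgebra.liftNC_single _ _ _ _

end Presentation


section TorusCoeff

variable {ι V 𝔱 : Type*} [AddCommGroup V] [Module ℂ V] [AddCommGroup 𝔱] [Module ℂ 𝔱]
  (P : RootPairing ι ℂ V 𝔱)

/-- The coefficient of `t^μ`. -/
def torusCoeff (μ : weightLattice P) : TorusRing P →ₗ[ℂ] ℂ :=
  ((Finsupp.lapply μ) ∘ₗ (AddMonoidAlgebra.coeffLinearEquiv ℂ).toLinearMap :
      AddMonoidAlgebra ℂ (weightLattice P) →ₗ[ℂ] ℂ)

lemma torusCoeff_charMonomial (μ ν : weightLattice P) (c : ℂ) :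
    torusCoeff P μ (charMonomial P ν c) = Finsupp.single ν c μ := by
  have h : ((Finsupp.lapply μ) ∘ₗ (AddMonoidAlgebra.coeffLinearEquiv ℂ).toLinearMap :
      AddMonoidAlgebra ℂ (weightLattice P) →ₗ[ℂ] ℂ) (AddMonoidAlgebra.single ν c) =
      Finsupp.single ν c μ := by simp
  exact h

lemma charMonomial_eq_smul (μ : weightLattice P) (c : ℂ) :
    charMonomial P μ c = c • character P μ := by
  have h : (AddMonoidAlgebra.single μ c : AddMonoidAlgebra ℂ (weightLattice P)) =
      c • AddMonoidAlgebra.single μ 1 := by simp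
  exact h

lemma torus_hom_ext {N : Type*} [AddCommGroup N] [Module ℂ N] {D E : TorusRing P →ₗ[ℂ] N}
    (h : ∀ μ, D (character P μ) = E (character P μ)) : D = E := by
  refine LinearMap.ext fun a => ?_
  induction a using torusRing_induction with
  | zero => simp
  | add x y hx hy => rw [map_add, map_add, hx, hy]
  | single m r => rw [charMonomial_eq_smul, map_smul, map_smul, h]

lemma character_mul (μ ν : weightLattice P) :
    character P μ * character P ν = character P (μ + ν) := by
  rw [character, character, charMonomial_mul, mul_one, character]

lemma character_zero : character P 0 = 1 := rfl

/-- Polynomials in the vector fields and `ħ` are diagonal on characters. The eigenvalue at `t^ν` is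
the value of the polynomial on the line through `(ν, 1)`, the parameter of the line recording the
power of `ħ`. -/
lemma affDh_coeff_character (f : SymAff 𝔱) : ∀ (n : ℕ) (ν : weightLattice P),
    ((affDh P f : DhT P) : Polynomial (Module.End ℂ (TorusRing P))).coeff n (character P ν) =
      (evLine P (ν : V) f).coeff n • character P ν := by
  induction f using SymmetricAlgebra.induction with
  | algebraMap c =>
    intro n ν
    rw [AlgHom.commutes, AlgHom.commutes]
    change (algebraMap ℂ (Polynomial (Module.End ℂ (TorusRing P))) c).coeff n _ = _
    rw [Polynomial.algebraMap_apply, Polynomial.algebraMap_apply, Polynomial.coeff_C,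
      Polynomial.coeff_C]
    split_ifs <;> simp
  | ι x =>
    intro n ν
    rw [affDh_ι, evLine_ι]
    have : ((fieldDh P x.1 + x.2 • hbarDh P : DhT P) : Polynomial (Module.End ℂ (TorusRing P))) =
        Polynomial.monomial 1 (vectorField P x.1 + x.2 • 1) := by
      rw [map_add, ← Polynomial.smul_monomial]
      rfl
    rw [this, Polynomial.coeff_monomial, Polynomial.coeff_monomial]
    split_ifs
    · rw [LinearMap.add_apply, character, vectorField_single, add_smul]
      rfl
    · simp
  | mul f g hf hg =>
    intro n ν
    rw [map_mul, map_mul, MulMemClass.coe_mul, Polynomial.coeff_mul, Polynomial.coeff_mul,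
      LinearMap.sum_apply, Finset.sum_smul]
    refine Finset.sum_congr rfl fun x _ => ?_
    rw [Module.End.mul_apply, hg, map_smul, hf, smul_smul, mul_comm]
  | add f g hf hg =>
    intro n ν
    rw [map_add, map_add, AddMemClass.coe_add, Polynomial.coeff_add, Polynomial.coeff_add,
      LinearMap.add_apply, hf, hg, add_smul]

lemma diffA_mul_extWeylA (x : DhT P) (g : ExtWeyl P) : diffA P x * extWeylA P g =
    SkewMonoidAlgebra.single g.right (x * charDh P g.left.toAdd) := by
  change SkewMonoidAlgebra.single 1 x * (SkewMonoidAlgebra.single 1 (charDh P g.left.toAdd) *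
    SkewMonoidAlgebra.single g.right 1) = _
  simp [SkewMonoidAlgebra.single_mul_single]

/-- A matrix coefficient on `W ⋉ 𝒟_ħ(T)`. -/
def wdhCoeff (w : P.weylGroup) (n : ℕ) (ν κ : weightLattice P) : WDhT P →+ ℂ where
  toFun y := torusCoeff P κ (((y.coeff w : DhT P) :
    Polynomial (Module.End ℂ (TorusRing P))).coeff n (character P ν))
  map_zero' := by simp
  map_add' x y := by
    rw [SkewMonoidAlgebra.coeff_add, Finsupp.add_apply, AddMemClass.coe_add, Polynomial.coeff_add,
      LinearMap.add_apply, map_add]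

lemma wdhCoeff_toWDhT_single (w : P.weylGroup) (n : ℕ) (ν κ : weightLattice P) (g : ExtWeyl P)
    (f : SymAff 𝔱) : wdhCoeff P w n ν κ (toWDhT P (SkewMonoidAlgebra.single g f)) =
      Finsupp.single g.right (Finsupp.single (g.left.toAdd + ν)
        ((evLine P ((g.left.toAdd + ν : weightLattice P) : V) f).coeff n) κ) w := by
  classical
  rw [toWDhT_single, diffA_mul_extWeylA]
  change torusCoeff P κ ((((SkewMonoidAlgebra.single g.right _ : WDhT P).coeff w : DhT P) :
    Polynomial (Module.End ℂ (TorusRing P))).coeff n (character P ν)) = _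
  rw [SkewMonoidAlgebra.coeff_single, Finsupp.single_apply, Finsupp.single_apply]
  split_ifs with h
  · have : ((affDh P f * charDh P g.left.toAdd : DhT P) :
        Polynomial (Module.End ℂ (TorusRing P))).coeff n (character P ν) =
        ((affDh P f : DhT P) : Polynomial (Module.End ℂ (TorusRing P))).coeff n
          (character P (g.left.toAdd + ν)) := by
      change (((affDh P f : DhT P) : Polynomial (Module.End ℂ (TorusRing P))) *
        Polynomial.monomial 0 (LinearMap.mulLeft ℂ (character P g.left.toAdd))).coeff n _ = _
      rw [Polynomial.monomial_zero_left, Polynomial.coeff_mul_C, Module.End.mul_apply,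
        LinearMap.mulLeft_apply, character_mul]
    rw [this, affDh_coeff_character, ← charMonomial_eq_smul, torusCoeff_charMonomial]
  · simp

end TorusCoeff

/-! ### The comparison map is an isomorphism -/

section Comparison

variable {ι V 𝔱 : Type*} [Finite ι] [AddCommGroup V] [Module ℂ V] [AddCommGroup 𝔱] [Module ℂ 𝔱]
  {P : RootPairing ι ℂ V 𝔱} [P.IsRootSystem] [P.IsCrystallographic] [P.IsReduced] (b : P.Base)

/-- Matrix coefficients separate the group elements, and the values of the polynomial coefficients
on the lines of all weights determine them by `eq_zero_of_evLine`. -/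
lemma toWDhT_injective (b : P.Base) : Function.Injective (toWDhT P) := by
  classical
  refine (injective_iff_map_eq_zero _).mpr fun x hx => ?_
  refine SkewMonoidAlgebra.ext fun g => ?_
  rw [SkewMonoidAlgebra.coeff_zero, Finsupp.zero_apply]
  refine eq_zero_of_evLine b fun κ => Polynomial.ext fun n => ?_
  -- The source character is chosen so that the summand of `g` lands on `t^κ`; a summand with the
  -- same Weyl group part and another translation lands on a different character.
  have h1 := congrArg (wdhCoeff P g.right n (-g.left.toAdd + κ) κ) hx
  rw [map_zero, ← SkewMonoidAlgebra.sum_single x, SkewMonoidAlgebra.sum_def, Finsupp.sum, map_sum,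
    map_sum] at h1
  simp only [wdhCoeff_toWDhT_single] at h1
  rw [Finset.sum_eq_single g] at h1
  · rw [Finsupp.single_eq_same, add_neg_cancel_left, Finsupp.single_eq_same] at h1
    rw [Polynomial.coeff_zero]
    exact h1
  · intro h _ hne
    by_cases hr : h.right = g.right
    · rw [hr, Finsupp.single_eq_same, Finsupp.single_eq_of_ne]
      intro he
      refine hne (SemidirectProduct.ext ?_ hr)
      have : h.left.toAdd = g.left.toAdd := by
        rw [← add_assoc, right_eq_add, ← sub_eq_add_neg, sub_eq_zero] at he
        exact he
      exact this
    · exact Finsupp.single_eq_of_ne (Ne.symm hr)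
  · intro h
    have : x.coeff g = 0 := Finsupp.notMem_support_iff.mp h
    simp [this]

variable (P) in
/-- The part of `𝒟_ħ(T)` generated by characters, invariant vector fields and `ħ`. -/
def genDhT : Subalgebra ℂ (DhT P) := (toWDhT P).range.comap (diffA P)

lemma affDh_mem_genDhT (f : SymAff 𝔱) : affDh P f ∈ genDhT P :=
  ⟨SkewMonoidAlgebra.single 1 f, by
    refine (toWDhT_single P 1 f).trans ?_
    rw [map_one, mul_one]
    rfl⟩

lemma charDh_mem_genDhT (μ : weightLattice P) : charDh P μ ∈ genDhT P :=
  ⟨SkewMonoidAlgebra.single (translation P μ) 1, by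
    refine (toWDhT_single P _ 1).trans ?_
    rw [map_one, map_one, one_mul, extWeylA_translation]
    rfl⟩

variable (P) in
/-- The operators whose homogeneous lift of degree `n` lies in `genDhT`. -/
def genOps (n : ℕ) : Submodule ℂ (Module.End ℂ (TorusRing P)) where
  carrier := {D | ∃ x ∈ genDhT P,
    (x : Polynomial (Module.End ℂ (TorusRing P))) = Polynomial.monomial n D}
  zero_mem' := ⟨0, zero_mem _, by simp⟩
  add_mem' := by
    rintro D E ⟨x, hx, hxD⟩ ⟨y, hy, hyE⟩
    exact ⟨x + y, add_mem hx hy, by rw [map_add, ← hxD, ← hyE]; rfl⟩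
  smul_mem' := by
    rintro c D ⟨x, hx, hxD⟩
    exact ⟨c • x, Subalgebra.smul_mem _ hx c, by rw [← Polynomial.smul_monomial, ← hxD]; rfl⟩

lemma genOps_le_diffOrder {n : ℕ} {D : Module.End ℂ (TorusRing P)} (h : D ∈ genOps P n) :
    D ∈ diffOrder (TorusRing P) n := by
  obtain ⟨x, -, hxD⟩ := h
  have := x.2 n
  rwa [hxD, Polynomial.coeff_monomial_same] at this

lemma mulLeft_mem_genOps (a : TorusRing P) : LinearMap.mulLeft ℂ a ∈ genOps P 0 := by
  induction a using torusRing_induction with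
  | zero => rw [LinearMap.mulLeft_zero_eq_zero]; exact zero_mem _
  | add x y hx hy =>
    rw [show LinearMap.mulLeft ℂ (x + y) = LinearMap.mulLeft ℂ x + LinearMap.mulLeft ℂ y from
      LinearMap.ext fun z => add_mul x y z]
    exact add_mem hx hy
  | single m r =>
    rw [charMonomial_eq_smul, show LinearMap.mulLeft ℂ (r • character P m) =
      r • LinearMap.mulLeft ℂ (character P m) from LinearMap.ext fun z => smul_mul_assoc r _ z]
    exact Submodule.smul_mem _ _ ⟨charDh P m, charDh_mem_genDhT m, rfl⟩

lemma mul_mem_genOps {m n : ℕ} {D E : Module.End ℂ (TorusRing P)} (hD : D ∈ genOps P m)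
    (hE : E ∈ genOps P n) : D * E ∈ genOps P (m + n) := by
  obtain ⟨x, hx, hxD⟩ := hD
  obtain ⟨y, hy, hyE⟩ := hE
  exact ⟨x * y, mul_mem hx hy, by
    rw [← Polynomial.monomial_mul_monomial, ← hxD, ← hyE]; rfl⟩

/-- Multiplication by `ħ` raises the degree without changing the operator. -/
lemma genOps_mono {m n : ℕ} (h : m ≤ n) {D : Module.End ℂ (TorusRing P)} (hD : D ∈ genOps P m) :
    D ∈ genOps P n := by
  have h1 : (1 : Module.End ℂ (TorusRing P)) ∈ genOps P 1 :=
    ⟨affDh P (SymmetricAlgebra.ι ℂ _ (0, 1)), affDh_mem_genDhT _, by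
      rw [affDh_ι]
      change Polynomial.monomial 1 (vectorField P 0) + (1 : ℂ) • Polynomial.monomial 1 1 = _
      have h0 : vectorField P 0 = 0 := by
        rw [← zero_smul ℂ (0 : 𝔱), vectorField_smul, zero_smul]
      rw [h0, map_zero, zero_add, one_smul]⟩
  obtain ⟨k, rfl⟩ := Nat.exists_eq_add_of_le h
  clear h
  induction k with
  | zero => exact hD
  | succ k ih =>
    have := mul_mem_genOps ih h1
    rwa [mul_one] at this

lemma prod_monomial {κ : Type*} (s : Finset κ) (d : κ → ℕ) (e : κ → ℂ) :
    ∏ i ∈ s, Polynomial.monomial (d i) (e i) =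
      Polynomial.monomial (∑ i ∈ s, d i) (∏ i ∈ s, e i) := by
  induction s using Finset.cons_induction with
  | empty => rfl
  | cons i s hi ih =>
    rw [Finset.prod_cons, ih, Polynomial.monomial_mul_monomial, Finset.sum_cons, Finset.prod_cons]

/-- An operator with the eigenvalues of a product of falling factorials. -/
lemma exists_interpolation (j : b.support → ℕ) : ∃ F ∈ genOps P (∑ i, j i),
    ∃ c : (b.support → ℕ) → ℂ, (∀ k, F (character P (wtOf b fun i => k i)) =
      c k • character P (wtOf b fun i => k i)) ∧ c j ≠ 0 ∧
      ∀ k, ∑ i, k i ≤ ∑ i, j i → k ≠ j → c k = 0 := by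
  -- The product of the falling factorials of the coroots, homogenized by `ħ` so that it has degree
  -- exactly `∑ j i`. Its eigenvalue vanishes at nonnegative `k` as soon as some `k i < j i`.
  let q : SymAff 𝔱 := ∏ i, ∏ m ∈ Finset.range (j i),
    SymmetricAlgebra.ι ℂ (𝔱 × ℂ) (P.coroot i, -(m : ℂ))
  let c : V → ℂ := fun ν => ∏ i : b.support, ∏ m ∈ Finset.range (j i),
    (P.toLinearMap ν (P.coroot i) - m)
  have hq : ∀ ν : V, evLine P ν q = Polynomial.monomial (∑ i, j i) (c ν) := fun ν => by
    simp only [q, map_prod, evLine_ι]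
    rw [← prod_monomial]
    refine Finset.prod_congr rfl fun i _ => ?_
    rw [prod_monomial]
    simp [sub_eq_add_neg]
  have hc : ∀ (n : ℕ) (ν : weightLattice P),
      ((affDh P q : DhT P) : Polynomial (Module.End ℂ (TorusRing P))).coeff n (character P ν) =
      (if ∑ i, j i = n then c ν else 0) • character P ν := fun n ν => by
    rw [affDh_coeff_character, hq, Polynomial.coeff_monomial]
  refine ⟨((affDh P q : DhT P) : Polynomial (Module.End ℂ (TorusRing P))).coeff (∑ i, j i),
    ⟨affDh P q, affDh_mem_genDhT q, Polynomial.ext fun n => ?_⟩, fun k => c (wtOf b fun i => k i),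
    fun k => by rw [hc, if_pos rfl], ?_, ?_⟩
  · rw [Polynomial.coeff_monomial]
    split_ifs with h
    · rw [h]
    · refine torus_hom_ext P fun ν => ?_
      rw [hc, if_neg h, zero_smul, LinearMap.zero_apply]
  · refine Finset.prod_ne_zero_iff.mpr fun i _ => Finset.prod_ne_zero_iff.mpr fun m hm => ?_
    rw [wtOf_coroot, sub_ne_zero]
    have := Finset.mem_range.mp hm
    exact_mod_cast (show j i ≠ m by omega)
  · intro k hk hne
    -- Otherwise `k ≥ j` in every coordinate, and the bound on the sum forces `k = j`.
    have : ∃ i, k i < j i := by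
      by_contra! hcon
      exact hne (funext fun i => (((Finset.sum_eq_sum_iff_of_le fun i _ => hcon i).mp
        (le_antisymm (Finset.sum_le_sum fun i _ => hcon i) hk)) i (Finset.mem_univ i)).symm)
    obtain ⟨i, hi⟩ := this
    refine Finset.prod_eq_zero (Finset.mem_univ i) (Finset.prod_eq_zero (Finset.mem_range.mpr hi) ?_)
    rw [wtOf_coroot]
    simp

/-- An operator of order `≤ n` is determined by its values on the characters of degree `≤ n` in the
dominant cone. Its commutator with a fundamental character has order one less and vanishes in
degrees `≤ n - 1`, so it is zero by induction; an operator commuting with all characters and killing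
`1` is zero. -/
lemma eq_zero_of_diffOrder (n : ℕ) : ∀ {D : Module.End ℂ (TorusRing P)},
    D ∈ diffOrder (TorusRing P) n →
    (∀ k : b.support → ℕ, ∑ i, k i ≤ n → D (character P (wtOf b fun i => k i)) = 0) → D = 0 := by
  classical
  have hone : wtOf b (fun i => ((0 : b.support → ℕ) i : ℤ)) = 0 :=
    weight_ext b fun i => by rw [wtOf_coroot]; simp
  have fin : ∀ D : Module.End ℂ (TorusRing P), D 1 = 0 →
      (∀ μ a, D (character P μ * a) = character P μ * D a) → D = 0 := fun D h1 h2 => by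
    refine torus_hom_ext P fun μ => ?_
    have := h2 μ 1
    rwa [mul_one, h1, mul_zero] at this
  induction n with
  | zero =>
    intro D hD hk
    refine fin D ?_ fun μ a => ?_
    · have := hk 0 (by simp)
      rwa [hone, character_zero] at this
    · have := LinearMap.congr_fun (sub_eq_zero.mp (hD (character P μ))) a
      simpa using this
  | succ n ih =>
    intro D hD hk
    refine fin D ?_ ?_
    · have := hk 0 (by simp)
      rwa [hone, character_zero] at this
    -- The weights whose characters commute with `D` form a subgroup, so the fundamental weights
    -- suffice.
    · let H : AddSubgroup (weightLattice P) :=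
        { carrier := {μ | ∀ a, D (character P μ * a) = character P μ * D a}
          zero_mem' := fun a => by rw [character_zero, one_mul, one_mul]
          add_mem' := fun {μ ν} hμ hν a => by
            rw [← character_mul, mul_assoc, hμ, hν, mul_assoc]
          neg_mem' := fun {μ} hμ a => by
            have h1 : ∀ x, character P (-μ) * (character P μ * x) = x := fun x => by
              rw [← mul_assoc, character_mul, neg_add_cancel, character_zero, one_mul]
            have h2 : ∀ x, character P μ * (character P (-μ) * x) = x := fun x => by
              rw [← mul_assoc, character_mul, add_neg_cancel, character_zero, one_mul]
            have := hμ (character P (-μ) * a)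
            rw [h2] at this
            rw [this, h1] }
      let w : (b.support → ℤ) →+ weightLattice P := AddMonoidHom.mk' (wtOf b) (wtOf_add b)
      have hH : ∀ i : b.support, w (Pi.single i 1) ∈ H := fun i => by
        have h1 := ih (hD (character P (w (Pi.single i 1)))) fun k hkn => by
          have h2 : character P (w (Pi.single i 1)) * character P (wtOf b fun i => k i) =
              character P (wtOf b fun l => ((k + Pi.single i 1 : b.support → ℕ) l : ℤ)) := by
            rw [character_mul]
            congr 1
            change wtOf b _ + _ = _
            rw [← wtOf_add]
            congr 1
            funext l
            by_cases hl : l = i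
            · subst hl; simp [add_comm]
            · simp [hl]
          rw [LinearMap.sub_apply, Module.End.mul_apply, Module.End.mul_apply,
            LinearMap.mulLeft_apply, LinearMap.mulLeft_apply, h2, hk k (by omega), hk, mul_zero,
            sub_zero]
          simp only [Pi.add_apply, Finset.sum_add_distrib, Finset.sum_pi_single', Finset.mem_univ,
            if_true]
          omega
        intro a
        have := LinearMap.congr_fun (sub_eq_zero.mp h1) a
        simpa using this
      intro μ
      obtain ⟨m, rfl⟩ := exists_wtOf b μ
      have : w m ∈ H := by
        rw [← Finset.univ_sum_single m, map_sum]
        refine sum_mem fun i _ => ?_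
        have h3 : (Pi.single i (m i) : b.support → ℤ) = m i • Pi.single i 1 := by
          rw [← Pi.single_smul]
          simp
        rw [h3, map_zsmul]
        exact zsmul_mem (hH i) _
      exact this

/-- Newton interpolation: generated operators of order `≤ n` are subtracted degree by degree until
the remainder vanishes on the characters of degree `≤ n`, and `eq_zero_of_diffOrder` applies. -/
lemma diffOrder_le_genOps (b : P.Base) {n : ℕ} {D : Module.End ℂ (TorusRing P)}
    (hD : D ∈ diffOrder (TorusRing P) n) : D ∈ genOps P n := by
  classical
  have key : ∀ d ≤ n + 1, ∃ E ∈ genOps P n, ∀ k : b.support → ℕ, ∑ i, k i < d →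
      (D - E) (character P (wtOf b fun i => k i)) = 0 := by
    intro d
    induction d with
    | zero => exact fun _ => ⟨0, zero_mem _, fun k hk => absurd hk (by omega)⟩
    | succ d ih =>
      intro hd
      obtain ⟨E, hE, hEk⟩ := ih (by omega)
      choose F hF c hc hcj hck using exists_interpolation (P := P) b
      -- `G j` has the missing value at `t^j` and kills every other character of degree at most that
      -- of `j`, so the values already matched are preserved.
      let G : (b.support → ℕ) → Module.End ℂ (TorusRing P) := fun j =>
        LinearMap.mulLeft ℂ ((c j j)⁻¹ • ((D - E) (character P (wtOf b fun i => j i)) *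
          character P (-wtOf b fun i => j i))) * F j
      refine ⟨E + ∑ j ∈ Finset.piAntidiag Finset.univ d, G j, add_mem hE (sum_mem fun j hj => ?_),
        fun k hk => ?_⟩
      · have hj' : ∑ i, j i = d := (Finset.mem_piAntidiag.mp hj).1
        have := mul_mem_genOps (mulLeft_mem_genOps ((c j j)⁻¹ •
          ((D - E) (character P (wtOf b fun i => j i)) * character P (-wtOf b fun i => j i)))) (hF j)
        exact genOps_mono (by omega) this
      · rw [← sub_sub, LinearMap.sub_apply, LinearMap.sum_apply]
        have hG : ∀ j ∈ Finset.piAntidiag Finset.univ d, j ≠ k →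
            G j (character P (wtOf b fun i => k i)) = 0 := fun j hj hne => by
          have hj' : ∑ i, j i = d := (Finset.mem_piAntidiag.mp hj).1
          change _ * F j _ = _
          rw [hc, hck j k (by omega) hne.symm, zero_smul, mul_zero]
        by_cases hkd : ∑ i, k i = d
        · have hmem : k ∈ Finset.piAntidiag Finset.univ d :=
            Finset.mem_piAntidiag.mpr ⟨hkd, fun i _ => Finset.mem_univ i⟩
          rw [Finset.sum_eq_single_of_mem k hmem fun j hj hne => hG j hj hne]
          change _ - _ * F k _ = _
          rw [hc, smul_mul_smul_comm, mul_assoc, character_mul, neg_add_cancel, character_zero,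
            mul_one, inv_mul_cancel₀ (hcj k), one_smul, sub_self]
        · rw [hEk k (by omega), Finset.sum_eq_zero fun j hj => hG j hj ?_, sub_zero]
          rintro rfl
          exact hkd (Finset.mem_piAntidiag.mp hj).1
  obtain ⟨E, hE, hEk⟩ := key (n + 1) le_rfl
  have := eq_zero_of_diffOrder b n (sub_mem hD (genOps_le_diffOrder hE)) fun k hk => hEk k (by omega)
  rw [sub_eq_zero.mp this]
  exact hE

lemma genDhT_eq_top (b : P.Base) (x : DhT P) : x ∈ genDhT P := by
  have h : ∀ n, ∃ y ∈ genDhT P, (y : Polynomial (Module.End ℂ (TorusRing P))) =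
      Polynomial.monomial n ((x : Polynomial (Module.End ℂ (TorusRing P))).coeff n) :=
    fun n => diffOrder_le_genOps b (x.2 n)
  choose y hy hyx using h
  have : x = ∑ n ∈ (x : Polynomial (Module.End ℂ (TorusRing P))).support, y n := by
    refine Subtype.ext ?_
    rw [AddSubmonoidClass.coe_finsetSum]
    simp only [hyx]
    exact Polynomial.as_sum_support _
  rw [this]
  exact sum_mem fun n _ => hy n

lemma toWDhT_surjective (b : P.Base) : Function.Surjective (toWDhT P) := by
  intro x
  change x ∈ (toWDhT P).range
  induction x using SkewMonoidAlgebra.induction_on with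
  | zero => exact zero_mem _
  | single w x =>
    have h1 : SkewMonoidAlgebra.single w x = diffA P x * weylA P w := by
      change _ = SkewMonoidAlgebra.single 1 x * SkewMonoidAlgebra.single w 1
      simp [SkewMonoidAlgebra.single_mul_single]
    rw [h1]
    refine mul_mem (genDhT_eq_top b x) ⟨SkewMonoidAlgebra.single (SemidirectProduct.inr w) 1, ?_⟩
    refine (toWDhT_single P _ 1).trans ?_
    rw [map_one, map_one, one_mul, extWeylA_inr]
  | add x y hx hy => exact add_mem hx hy

end Comparison


/-! ### The canonical embedding of `W ⋉ 𝒟_ħ(T)` in `ℋ` -/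

section Canonical

variable {ι V 𝔱 : Type*} [AddCommGroup V] [Module ℂ V] [AddCommGroup 𝔱] [Module ℂ 𝔱]
  {P : RootPairing ι ℂ V 𝔱} [P.IsCrystallographic] (b : P.Base)

/-- `polyElt` as a homomorphism to the degenerate nil DAHA. -/
def polyH : SymAff 𝔱 →ₐ[ℂ] nilDAHA b := (polyHom P).codRestrict (nilDAHA b) (polyElt_mem b)

/-- `groupElt` as a homomorphism to the degenerate nil DAHA. -/
def groupH : ExtWeyl P →* nilDAHA b where
  toFun g := ⟨groupElt P g, groupElt_mem b g⟩
  map_one' := rfl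
  map_mul' g h := Subtype.ext ((groupHom P).map_mul g h)

lemma groupH_mul_polyH (g : ExtWeyl P) (p : SymAff 𝔱) :
    groupH b g * polyH b p = polyH b (g • p) * groupH b g :=
  Subtype.ext (by
    change groupElt P g * fracElt P _ = fracElt P _ * groupElt P g
    rw [groupElt_mul_fracElt, smul_algebraMap_frac])

/-- The embedding `W̃ ⋉ Sym 𝔱_aff → ℋ`. -/
def toDaha : WSym P →ₐ[ℂ] nilDAHA b :=
  SkewMonoidAlgebra.liftNCAlgHom (polyH b) (groupH b) (fun {f g} => (groupH_mul_polyH b g f).symm)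

lemma toDaha_single (g : ExtWeyl P) (f : SymAff 𝔱) :
    toDaha b (SkewMonoidAlgebra.single g f) = polyH b f * groupH b g :=
  SkewMonoidAlgebra.liftNC_single _ _ _ _

lemma toDaha_coeff (x : WSym P) (g : ExtWeyl P) :
    (toDaha b x : WFrac P).coeff g = algebraMap (SymAff 𝔱) (FracAff 𝔱) (x.coeff g) := by
  induction x using SkewMonoidAlgebra.induction_on with
  | zero =>
    rw [map_zero]
    exact (map_zero (algebraMap (SymAff 𝔱) (FracAff 𝔱))).symm
  | single w f =>
    rw [toDaha_single]
    change (fracElt P (algebraMap (SymAff 𝔱) (FracAff 𝔱) f) *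
      SkewMonoidAlgebra.single w (1 : FracAff 𝔱)).coeff g = _
    rw [coeff_fracElt_mul, SkewMonoidAlgebra.coeff_single, SkewMonoidAlgebra.coeff_single]
    classical
    rw [Finsupp.single_apply, Finsupp.single_apply]
    split_ifs <;> simp
  | add x y hx hy =>
    rw [map_add]
    change ((toDaha b x : WFrac P) + (toDaha b y : WFrac P)).coeff g = _
    rw [SkewMonoidAlgebra.coeff_add, SkewMonoidAlgebra.coeff_add, Finsupp.add_apply,
      Finsupp.add_apply, hx, hy, map_add]

lemma toDaha_injective : Function.Injective (toDaha b) := by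
  intro x y h
  refine SkewMonoidAlgebra.coeff_injective (Finsupp.ext fun g => ?_)
  have := toDaha_coeff b x g
  rw [h, toDaha_coeff] at this
  exact (FaithfulSMul.algebraMap_injective (SymAff 𝔱) (FracAff 𝔱) this).symm

section Uniqueness

variable {b} {i : WDhT P →ₐ[ℂ] nilDAHA b}

lemma IsCanonical.apply_affDh (hi : IsCanonical b i) (f : SymAff 𝔱) : i (diffA P (affDh P f)) = polyH b f := by
  refine DFunLike.congr_fun (f := (i.comp (diffA P)).comp (affDh P)) (sym_algHom_ext fun x => ?_) f
  change i (diffA P (affDh P _)) = _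
  rw [affDh_ι, map_add, map_smul, map_add, map_smul]
  change i (diffA P (fieldDh P x.1)) + x.2 • i (hbarA P) = _
  rw [hi.map_field, hi.map_hbar]
  change polyH b _ + x.2 • polyH b _ = _
  rw [← map_smul, ← map_add, ← map_smul, ← map_add]
  congr 2
  ext <;> simp

lemma IsCanonical.apply_extWeylA (hi : IsCanonical b i) (g : ExtWeyl P) : i (extWeylA P g) = groupH b g := by
  obtain ⟨l, w⟩ := g
  have h : (⟨l, w⟩ : ExtWeyl P) = translation P l.toAdd * SemidirectProduct.inr w :=
    (SemidirectProduct.mk_eq_inl_mul_inr w l)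
  rw [h, map_mul, map_mul, map_mul, extWeylA_inr, hi.map_weyl, extWeylA_translation, hi.map_char]
  rfl

/-- A canonical homomorphism is prescribed on polynomials and on `W̃`, hence everywhere under the
comparison map; uniqueness and injectivity both follow. -/
lemma IsCanonical.apply_toWDhT (hi : IsCanonical b i) (x : WSym P) : i (toWDhT P x) = toDaha b x := by
  induction x using SkewMonoidAlgebra.induction_on with
  | zero => simp
  | single w f =>
    rw [toWDhT_single, map_mul, toDaha_single, hi.apply_affDh, hi.apply_extWeylA]
  | add x y hx hy => rw [map_add, map_add, hx, hy, map_add]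

end Uniqueness

variable [Finite ι] [P.IsRootSystem] [P.IsReduced]

lemma IsCanonical.injective {b : P.Base} {i : WDhT P →ₐ[ℂ] nilDAHA b} (hi : IsCanonical b i) :
    Function.Injective i := by
  intro x y h
  obtain ⟨x, rfl⟩ := toWDhT_surjective b x
  obtain ⟨y, rfl⟩ := toWDhT_surjective b y
  rw [hi.apply_toWDhT, hi.apply_toWDhT] at h
  rw [toDaha_injective b h]

/-- The canonical embedding exists and is unique. -/
lemma existsUnique_isCanonical : ∃! i : WDhT P →ₐ[ℂ] nilDAHA b, IsCanonical b i := by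
  let e := AlgEquiv.ofBijective (toWDhT P) ⟨toWDhT_injective b, toWDhT_surjective b⟩
  have he : ∀ x, e.symm (toWDhT P x) = x := e.symm_apply_apply
  have hs : ∀ g f, e.symm (diffA P (affDh P f) * extWeylA P g) = SkewMonoidAlgebra.single g f :=
    fun g f => by rw [← toWDhT_single, he]
  have hf : ∀ f, e.symm (diffA P (affDh P f)) = SkewMonoidAlgebra.single 1 f := fun f => by
    rw [← hs, map_one, mul_one]
  have hg : ∀ g, e.symm (extWeylA P g) = SkewMonoidAlgebra.single g 1 := fun g => by
    rw [← hs, map_one, map_one, one_mul]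
  have hpol : ∀ f, toDaha b (SkewMonoidAlgebra.single 1 f) = polyH b f := fun f => by
    rw [toDaha_single, map_one, mul_one]
  have hgrp : ∀ g, toDaha b (SkewMonoidAlgebra.single g 1) = groupH b g := fun g => by
    rw [toDaha_single, map_one, one_mul]
  refine ⟨(toDaha b).comp e.symm.toAlgHom, ⟨fun w => ?_, fun μ => ?_, fun ξ => ?_, ?_⟩, ?_⟩
  · change toDaha b (e.symm _) = _
    rw [← extWeylA_inr, hg, hgrp]
    rfl
  · change toDaha b (e.symm _) = _
    rw [← extWeylA_translation, hg, hgrp]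
    rfl
  · change toDaha b (e.symm _) = polyH b _
    have : fieldDh P ξ = affDh P (SymmetricAlgebra.ι ℂ _ (ξ, 0)) := by
      rw [affDh_ι, zero_smul, add_zero]
    rw [this, hf, hpol]
  · change toDaha b (e.symm (diffA P (hbarDh P))) = polyH b _
    have : hbarDh P = affDh P (SymmetricAlgebra.ι ℂ _ (0, 1)) := by
      rw [affDh_ι, one_smul]
      exact ((congrArg (fun z => z + hbarDh P) (map_zero (fieldDhLin P))).trans (zero_add _)).symm
    rw [this, hf, hpol]
  · intro i hi
    refine AlgHom.ext fun x => ?_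
    obtain ⟨x, rfl⟩ := toWDhT_surjective b x
    rw [hi.apply_toWDhT]
    change _ = toDaha b (e.symm _)
    rw [he]

end Canonical


/-! ### Conjugating affine roots to finite simple roots -/

section Conjugation

variable {ι V 𝔱 : Type*} [Finite ι] [AddCommGroup V] [Module ℂ V] [AddCommGroup 𝔱] [Module ℂ 𝔱]
  {P : RootPairing ι ℂ V 𝔱} [P.IsRootSystem] [P.IsCrystallographic] [P.IsReduced] (b : P.Base)

lemma weylGroupToPerm_ofIdx (i j : ι) :
    P.weylGroupToPerm (RootPairing.weylGroup.ofIdx P i) j = P.reflectionPerm i j := rfl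

lemma ofIdx_weylGroupToPerm (w : P.weylGroup) (i : ι) :
    RootPairing.weylGroup.ofIdx P (P.weylGroupToPerm w i) =
      w * RootPairing.weylGroup.ofIdx P i * w⁻¹ := by
  have h := congrArg SemidirectProduct.right
    (AffRoot.refl_smul (P := P) (SemidirectProduct.inr w) ⟨i, 0⟩)
  rw [AffRoot.refl_right, SemidirectProduct.mul_right, SemidirectProduct.mul_right,
    AffRoot.refl_right] at h
  exact h

lemma exists_weylGroupToPerm_eq (G : Subgroup P.weylGroup)
    (hG : ∀ i ∈ b.support, RootPairing.weylGroup.ofIdx P i ∈ G) (i : ι) :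
    ∃ w ∈ G, ∃ j ∈ b.support, P.weylGroupToPerm w j = i := by
  refine b.induction_reflect i (p := fun i => ∃ w ∈ G, ∃ j ∈ b.support, P.weylGroupToPerm w j = i)
    (fun i ⟨w, hw, j, hj, h⟩ => ?_)
    (fun i hi => ⟨1, one_mem _, i, hi, by simp⟩) (fun i k ⟨w, hw, j, hj, h⟩ hk => ?_)
  · refine ⟨RootPairing.weylGroup.ofIdx P i * w, mul_mem ?_ hw, j, hj, ?_⟩
    · rw [← h, ofIdx_weylGroupToPerm]
      exact mul_mem (mul_mem hw (hG j hj)) (inv_mem hw)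
    · rw [map_mul, Equiv.Perm.mul_apply, h, weylGroupToPerm_ofIdx]
  · refine ⟨RootPairing.weylGroup.ofIdx P k * w, mul_mem (hG k hk) hw, j, hj, ?_⟩
    rw [map_mul, Equiv.Perm.mul_apply, h, weylGroupToPerm_ofIdx]

/-- The Weyl group is generated by the simple reflections. -/
lemma subgroup_eq_top (G : Subgroup P.weylGroup)
    (hG : ∀ i ∈ b.support, RootPairing.weylGroup.ofIdx P i ∈ G) : G = ⊤ := by
  refine (Subgroup.eq_top_iff' _).mpr fun w => ?_
  obtain ⟨w, hw⟩ := w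
  induction hw using RootPairing.weylGroup.induction with
  | mem i =>
    obtain ⟨w, hw, j, hj, rfl⟩ := exists_weylGroupToPerm_eq b G hG i
    change RootPairing.weylGroup.ofIdx P _ ∈ G
    rw [ofIdx_weylGroupToPerm]
    exact mul_mem (mul_mem hw (hG j hj)) (inv_mem hw)
  | one => exact one_mem _
  | mul x y hx hy h h' => exact mul_mem h h'

/-- The coroot is moved to a simple one by `W`, and the level is corrected by a multiple of the
fundamental weight of that simple root. This uses that the lattice is the full weight lattice. -/
lemma exists_eq_smul (a : AffRoot P) :
    ∃ (g : ExtWeyl P) (j : ι), j ∈ b.support ∧ a = g • (⟨j, 0⟩ : AffRoot P) := by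
  classical
  obtain ⟨w, -, j, hj, h⟩ := exists_weylGroupToPerm_eq b ⊤ (fun _ _ => Subgroup.mem_top _) a.idx
  -- As `e^μ` lowers the level by `⟨μ, ξ⟩`, the weight is minus the level times the fundamental
  -- weight.
  refine ⟨SemidirectProduct.inr w *
    translation P (wtOf b fun k => if k = ⟨j, hj⟩ then -a.lev else 0), j, hj, ?_⟩
  apply AffRoot.vec_injective
  rw [AffRoot.vec_smul, map_mul, Module.End.mul_apply, affineRep_apply, affineRep_apply]
  have h1 := wtOf_coroot b (fun k => if k = ⟨j, hj⟩ then -a.lev else 0) ⟨j, hj⟩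
  rw [if_pos rfl] at h1
  refine Prod.ext ?_ ?_
  · change P.coroot a.idx = cartanRep P w (cartanRep P 1 (P.coroot j))
    rw [map_one]
    change _ = cartanRep P w (P.coroot j)
    rw [cartanRep_coroot, h]
  · change (a.lev : ℂ) = _ - P.toLinearMap (0 : V) _
    rw [map_zero, LinearMap.zero_apply, sub_zero]
    change (a.lev : ℂ) = ((0 : ℤ) : ℂ) - P.toLinearMap _ (cartanRep P 1 (P.coroot j))
    rw [map_one]
    refine Eq.trans ?_ (congrArg (fun z => ((0 : ℤ) : ℂ) - z) h1.symm)
    push_cast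
    ring

lemma isSimple_of_mem_support {i : ι} (hi : i ∈ b.support) :
    IsSimple b (⟨i, 0⟩ : AffRoot P) := by
  have h1 : (⟨i, 0⟩ : AffRoot P).ht b = 1 := by
    have : b.flip.height i = 1 := b.flip.height_one_of_mem_support hi
    simp [AffRoot.ht, this]
  refine isSimple_of_indecomposable b (by rw [h1]; norm_num) ?_ fun c d h hc hd => ?_
  · have := height_lt_hbarHeight b i
    have h2 : b.flip.height i = 1 := b.flip.height_one_of_mem_support hi
    rw [h2] at this
    rw [h1]
    exact lt_of_le_of_lt (le_abs_self _) this
  · have := ht_combo b (c := (⟨i, 0⟩ : AffRoot P)) (a := c) (d := d) (x := 1) (y := 1)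
      (by rw [h]; push_cast; module)
    omega

end Conjugation

/-! ### The tautological system in `ℋ` and the uniqueness of extensions -/

section System

variable {ι V 𝔱 : Type*} [Finite ι] [AddCommGroup V] [Module ℂ V] [AddCommGroup 𝔱] [Module ℂ 𝔱]
  {P : RootPairing ι ℂ V 𝔱} [P.IsRootSystem] [P.IsCrystallographic] [P.IsReduced] (b : P.Base)

lemma NilSys.th_smul {C : Type*} [Ring C] [Algebra ℂ C] (N : NilSys P C) (g : ExtWeyl P)
    (a : AffRoot P) : N.th (g • a) = N.grp g * N.th a * N.grp g⁻¹ := by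
  rw [N.grp_th, mul_assoc, N.grp_mul_inv, mul_one]

lemma demazure_smul (g : ExtWeyl P) (a : AffRoot P) : demazure P (g • a).vec (g • a).refl =
    groupElt P g * demazure P a.vec a.refl * groupElt P g⁻¹ :=
  (fracSys P).th_smul g a

/-- By conjugation under `W̃`, the Demazure elements of the finite simple roots already yield those
of all affine roots. -/
lemma demazure_mem (a : AffRoot P) : demazure P a.vec a.refl ∈ nilDAHA b := by
  obtain ⟨g, j, hj, h⟩ := exists_eq_smul b a
  have h2 : thetaFin P j ∈ nilDAHA b :=
    Algebra.subset_adjoin (Or.inl (Algebra.subset_adjoin (Or.inl (Or.inr ⟨j, hj, rfl⟩))))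
  rw [h, demazure_smul, ← thetaFin_eq]
  exact mul_mem (mul_mem (groupElt_mem b g) h2) (groupElt_mem b g⁻¹)

/-- The tautological system in the degenerate nil DAHA. -/
def dahaSys : NilSys P (nilDAHA b) where
  pol := polyH b
  grp := groupH b
  th a := ⟨demazure P a.vec a.refl, demazure_mem b a⟩
  grp_pol g p := Subtype.ext ((fracSys P).grp_pol g p)
  pol_th a := Subtype.ext ((fracSys P).pol_th a)
  th_th a := Subtype.ext ((fracSys P).th_th a)
  th_pol a p := Subtype.ext ((fracSys P).th_pol a p)
  grp_th g a := Subtype.ext ((fracSys P).grp_th g a)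

variable {C D : Type*} [Ring C] [Algebra ℂ C] [Ring D] [Algebra ℂ D]

/-- The image of a system under a homomorphism. -/
def NilSys.map (N : NilSys P C) (φ : C →ₐ[ℂ] D) : NilSys P D where
  pol := φ.comp N.pol
  grp := (φ : C →* D).comp N.grp
  th a := φ (N.th a)
  grp_pol g p := (map_mul φ _ _).symm.trans ((congrArg φ (N.grp_pol g p)).trans (map_mul φ _ _))
  pol_th a := (map_mul φ _ _).symm.trans ((congrArg φ (N.pol_th a)).trans
    ((map_sub φ _ _).trans (congrArg (φ (N.grp a.refl) - ·) (map_one φ))))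
  th_th a := by rw [← map_mul, N.th_th, map_zero]
  th_pol a p := (map_mul φ _ _).symm.trans ((congrArg φ (N.th_pol a p)).trans
    ((map_add φ _ _).trans (congrArg (· + φ (N.pol (a.dem p))) (map_mul φ _ _))))
  grp_th g a := (map_mul φ _ _).symm.trans ((congrArg φ (N.grp_th g a)).trans (map_mul φ _ _))

lemma AffRoot.dem_lin (a : AffRoot P) : a.dem a.lin = -2 :=
  a.dem_unique (by rw [AffRoot.refl_smul_lin]; ring)

lemma NilSys.th_lin (N : NilSys P C) (a : AffRoot P) :
    N.th a * N.pol a.lin = -(N.grp a.refl + 1) := by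
  have h : N.pol (a.dem a.lin) = -(1 + 1) := by
    rw [AffRoot.dem_lin, ← one_add_one_eq_two, map_neg, map_add, map_one]
  rw [N.th_pol, AffRoot.refl_smul_lin, map_neg, neg_mul, N.pol_th, h]
  abel

lemma NilSys.refl_th (N : NilSys P C) (a : AffRoot P) : N.grp a.refl * N.th a = N.th a := by
  rw [N.grp_refl, add_mul, one_mul, mul_assoc, N.th_th, mul_zero, add_zero]

lemma NilSys.th_refl (N : NilSys P C) (a : AffRoot P) : N.th a * N.grp a.refl = -N.th a := by
  rw [N.grp_refl, mul_add, mul_one, ← mul_assoc, N.th_lin, neg_mul, add_mul, N.refl_th, one_mul]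
  abel

/-- Applying `θ_a` to `a x` gives `-(s_a + 1) x = -2x` when `x` is fixed by `s_a`. Applied to `θ_a`
itself, this makes the Demazure elements determined by the polynomials and the group. -/
lemma NilSys.eq_of_refl_eq (N : NilSys P C) (a : AffRoot P) {x y : C}
    (hx : N.grp a.refl * x = x) (hy : N.grp a.refl * y = y) (h : N.pol a.lin * x = N.pol a.lin * y) :
    x = y := by
  have h1 := congrArg (N.th a * ·) h
  simp only [← mul_assoc] at h1
  rw [N.th_lin, neg_mul, neg_mul, add_mul, add_mul, hx, hy, one_mul, one_mul, neg_inj,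
    ← two_smul ℂ x, ← two_smul ℂ y] at h1
  exact smul_right_injective C (two_ne_zero' ℂ) h1

lemma nilDAHA_hom_ext_th {φ ψ : nilDAHA b →ₐ[ℂ] C} (h1 : ∀ p, φ (polyH b p) = ψ (polyH b p))
    (h2 : ∀ g, φ (groupH b g) = ψ (groupH b g))
    (h3 : ∀ a, φ ((dahaSys b).th a) = ψ ((dahaSys b).th a)) : φ = ψ := by
  have key : nilDAHA b ≤ (AlgHom.equalizer φ ψ).map (nilDAHA b).val := by
    refine Algebra.adjoin_le ?_
    rintro x (hx | ⟨g, rfl⟩)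
    · refine (Algebra.adjoin_le ?_ : nilHeckeAff b ≤ _) hx
      rintro _ ((⟨s, rfl⟩ | ⟨i, -, rfl⟩) | ⟨j, -, rfl⟩)
      · exact ⟨_, h1 s, rfl⟩
      · rw [thetaFin_eq]; exact ⟨_, h3 _, rfl⟩
      · rw [thetaAff_eq]; exact ⟨_, h3 _, rfl⟩
    · exact ⟨_, h2 g, rfl⟩
  refine AlgHom.ext fun x => ?_
  obtain ⟨y, hy, hyx⟩ := key x.2
  rw [← Subtype.ext (a1 := y) (a2 := x) hyx]
  exact hy

/-- A homomorphism from the degenerate nil DAHA is determined by its restriction to polynomials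
and to the extended affine Weyl group. -/
lemma nilDAHA_hom_ext {φ ψ : nilDAHA b →ₐ[ℂ] C} (h1 : ∀ p, φ (polyH b p) = ψ (polyH b p))
    (h2 : ∀ g, φ (groupH b g) = ψ (groupH b g)) : φ = ψ := by
  refine nilDAHA_hom_ext_th b h1 h2 fun a => ?_
  refine ((dahaSys b).map φ).eq_of_refl_eq a (((dahaSys b).map φ).refl_th a) ?_ ?_
  · change φ (groupH b _) * _ = _
    rw [h2]
    exact ((dahaSys b).map ψ).refl_th a
  · have e1 := ((dahaSys b).map φ).pol_th a
    have e2 := ((dahaSys b).map ψ).pol_th a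
    change φ (polyH b _) * φ _ = φ (groupH b _) - 1 at e1
    change ψ (polyH b _) * ψ _ = ψ (groupH b _) - 1 at e2
    change φ (polyH b _) * φ _ = φ (polyH b _) * ψ _
    rw [e1, h1, e2, h2]

end System


/-! ### The symmetrizer of a finite group -/

section Symmetrizer

variable {B : Type*} [Semiring B] [Algebra ℂ B] {G : Type*} [Group G] [Finite G] (u : G →* B)

lemma mul_symmetrizer (g : G) : u g * symmetrizer u = symmetrizer u := by
  cases nonempty_fintype G
  rw [symmetrizer, finsum_eq_sum_of_fintype, mul_smul_comm, Finset.mul_sum]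
  congr 1
  exact Fintype.sum_equiv (Equiv.mulLeft g) _ _ fun x => (map_mul u g x).symm

lemma symmetrizer_mul (g : G) : symmetrizer u * u g = symmetrizer u := by
  cases nonempty_fintype G
  rw [symmetrizer, finsum_eq_sum_of_fintype, smul_mul_assoc, Finset.sum_mul]
  congr 1
  exact Fintype.sum_equiv (Equiv.mulRight g) _ _ fun x => (map_mul u x g).symm

lemma symmetrizer_mul_sub_mem {B : Type*} [Ring B] [Algebra ℂ B] (u : G →* B) {x : B} (J : Submodule ℂ B) (h : ∀ g, u g * x - x ∈ J) :
    symmetrizer u * x - x ∈ J := by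
  cases nonempty_fintype G
  have h1 : symmetrizer u * x - x = (Nat.card G : ℂ)⁻¹ • ∑ g, (u g * x - x) := by
    rw [Finset.sum_sub_distrib, smul_sub, Finset.sum_const, Finset.card_univ,
      ← Nat.cast_smul_eq_nsmul ℂ, smul_smul, Nat.card_eq_fintype_card,
      inv_mul_cancel₀ (Nat.cast_ne_zero.mpr Fintype.card_ne_zero), one_smul, symmetrizer,
      finsum_eq_sum_of_fintype, smul_mul_assoc, Finset.sum_mul, Nat.card_eq_fintype_card]
  rw [h1]
  exact Submodule.smul_mem _ _ (sum_mem fun g _ => h g)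

lemma map_symmetrizer {D : Type*} [Semiring D] [Algebra ℂ D] (φ : B →ₐ[ℂ] D) :
    φ (symmetrizer u) = symmetrizer ((φ : B →* D).comp u) := by
  cases nonempty_fintype G
  rw [symmetrizer, symmetrizer, finsum_eq_sum_of_fintype, finsum_eq_sum_of_fintype, map_smul,
    map_sum]
  rfl

end Symmetrizer

/-! ### Polynomials on `𝔱*`, finite Demazure operators and Weyl group averages -/

section Inclusion

variable {ι V 𝔱 : Type*} [AddCommGroup V] [Module ℂ V] [AddCommGroup 𝔱] [Module ℂ 𝔱]

variable (𝔱) in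
/-- The inclusion `Sym 𝔱 → Sym 𝔱_aff`. -/
def symIncl : SymmetricAlgebra ℂ 𝔱 →ₐ[ℂ] SymAff 𝔱 :=
  SymmetricAlgebra.lift (SymmetricAlgebra.ι ℂ (𝔱 × ℂ) ∘ₗ LinearMap.inl ℂ 𝔱 ℂ)

lemma symIncl_ι (ξ : 𝔱) : symIncl 𝔱 (SymmetricAlgebra.ι ℂ 𝔱 ξ) =
    SymmetricAlgebra.ι ℂ (𝔱 × ℂ) (ξ, 0) := by
  simp [symIncl]

lemma symIncl_injective : Function.Injective (symIncl 𝔱) := by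
  let r : SymAff 𝔱 →ₐ[ℂ] SymmetricAlgebra ℂ 𝔱 :=
    SymmetricAlgebra.lift (SymmetricAlgebra.ι ℂ 𝔱 ∘ₗ LinearMap.fst ℂ 𝔱 ℂ)
  have h : r.comp (symIncl 𝔱) = AlgHom.id ℂ _ := sym_algHom_ext fun x => by
    rw [AlgHom.comp_apply, symIncl_ι]
    simp [r]
  exact Function.LeftInverse.injective (g := r) fun p => DFunLike.congr_fun h p

variable (P : RootPairing ι ℂ V 𝔱)

lemma affDh_symIncl (p : SymmetricAlgebra ℂ 𝔱) : affDh P (symIncl 𝔱 p) = symDh P p := by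
  refine DFunLike.congr_fun (f := (affDh P).comp (symIncl 𝔱)) (sym_algHom_ext fun x => ?_) p
  rw [AlgHom.comp_apply, symIncl_ι, affDh_ι, symDh_ι, zero_smul, add_zero]

lemma symAct_ι (w : P.weylGroup) (ξ : 𝔱) : symAct P w (SymmetricAlgebra.ι ℂ 𝔱 ξ) =
    SymmetricAlgebra.ι ℂ 𝔱 (cartanRep P w ξ) := by
  simp [symAct]

lemma inr_smul_symIncl (w : P.weylGroup) (p : SymmetricAlgebra ℂ 𝔱) :
    (SemidirectProduct.inr w : ExtWeyl P) • symIncl 𝔱 p = symIncl 𝔱 (symAct P w p) := by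
  refine DFunLike.congr_fun (f := (symAffAct P (SemidirectProduct.inr w)).comp (symIncl 𝔱))
    (g := (symIncl 𝔱).comp (symAct P w)) (sym_algHom_ext fun x => ?_) p
  rw [AlgHom.comp_apply, AlgHom.comp_apply, symIncl_ι, symAffAct_ι, symAct_ι, symIncl_ι,
    affineRep_apply]
  congr 2
  change (0 : ℂ) - P.toLinearMap (0 : V) _ = 0
  simp

lemma symAct_mul (v w : P.weylGroup) (p : SymmetricAlgebra ℂ 𝔱) :
    symAct P (v * w) p = symAct P v (symAct P w p) := by
  refine DFunLike.congr_fun (f := symAct P (v * w)) (g := (symAct P v).comp (symAct P w))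
    (sym_algHom_ext fun x => ?_) p
  rw [AlgHom.comp_apply, symAct_ι, symAct_ι, symAct_ι, map_mul]
  rfl

variable {P} in
lemma coroot_ne_zero (i : ι) : P.coroot i ≠ 0 := fun h => by
  have := P.pairing_same i
  have h2 : P.toLinearMap (P.root i) (P.coroot i) = 2 := this
  rw [h, map_zero] at h2
  norm_num at h2

/-- The Demazure operator on `Sym 𝔱`. -/
def finDem (i : ι) : SymmetricAlgebra ℂ 𝔱 →ₗ[ℂ] SymmetricAlgebra ℂ 𝔱 :=
  divDiff (coroot_ne_zero (P := P) i) (P.toLinearMap (P.root i))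

lemma symAct_ofIdx (i : ι) (p : SymmetricAlgebra ℂ 𝔱) :
    symAct P (RootPairing.weylGroup.ofIdx P i) p =
      symRefl (P.coroot i) (P.toLinearMap (P.root i)) p := by
  refine DFunLike.congr_fun (sym_algHom_ext fun x => ?_) p
  rw [symAct_ι, symRefl_ι, cartanRep_ofIdx]
  rfl

lemma coroot_mul_finDem (i : ι) (p : SymmetricAlgebra ℂ 𝔱) :
    SymmetricAlgebra.ι ℂ 𝔱 (P.coroot i) * finDem P i p =
      symAct P (RootPairing.weylGroup.ofIdx P i) p - p := by
  rw [symAct_ofIdx]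
  exact divDiff_spec _ _ _

variable {P} [P.IsCrystallographic]

lemma AffRoot.refl_zero (i : ι) : (⟨i, 0⟩ : AffRoot P).refl =
    SemidirectProduct.inr (RootPairing.weylGroup.ofIdx P i) := by
  simp [AffRoot.refl, translation]

lemma AffRoot.lin_zero (i : ι) : (⟨i, 0⟩ : AffRoot P).lin =
    symIncl 𝔱 (SymmetricAlgebra.ι ℂ 𝔱 (P.coroot i)) := by
  rw [symIncl_ι]
  simp [AffRoot.lin, AffRoot.vec]

lemma dem_symIncl (i : ι) (p : SymmetricAlgebra ℂ 𝔱) :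
    (⟨i, 0⟩ : AffRoot P).dem (symIncl 𝔱 p) = symIncl 𝔱 (finDem P i p) := by
  refine AffRoot.dem_unique _ ?_
  rw [AffRoot.refl_zero, inr_smul_symIncl, AffRoot.lin_zero, ← map_mul, coroot_mul_finDem, map_sub]

end Inclusion

section Average

variable {ι V 𝔱 : Type*} [Finite ι] [AddCommGroup V] [Module ℂ V] [AddCommGroup 𝔱] [Module ℂ 𝔱]
  (P : RootPairing ι ℂ V 𝔱) [P.IsRootSystem]

/-- The average over the Weyl group. -/
def symAvg (p : SymmetricAlgebra ℂ 𝔱) : symInv P :=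
  ⟨(Nat.card P.weylGroup : ℂ)⁻¹ • ∑ᶠ w, symAct P w p, fun w => by
    cases nonempty_fintype P.weylGroup
    rw [finsum_eq_sum_of_fintype, map_smul, map_sum]
    congr 1
    exact Fintype.sum_equiv (Equiv.mulLeft w) _ _ fun x => (symAct_mul P w x p).symm⟩

lemma symAvg_coe (p : SymmetricAlgebra ℂ 𝔱) : (symAvg P p : SymmetricAlgebra ℂ 𝔱) =
    (Nat.card P.weylGroup : ℂ)⁻¹ • ∑ᶠ w, symAct P w p := rfl

variable {P} [P.IsCrystallographic] {C : Type*} [Ring C] [Algebra ℂ C] (N : NilSys P C)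

/-- The action of `Sym 𝔱`. -/
def NilSys.sym : SymmetricAlgebra ℂ 𝔱 →ₐ[ℂ] C := N.pol.comp (symIncl 𝔱)

/-- The action of the Weyl group. -/
def NilSys.weyl : P.weylGroup →* C := N.grp.comp SemidirectProduct.inr

lemma NilSys.weyl_sym (w : P.weylGroup) (p : SymmetricAlgebra ℂ 𝔱) :
    N.weyl w * N.sym p = N.sym (symAct P w p) * N.weyl w :=
  (N.grp_pol _ _).trans (congrArg (fun x => N.pol x * N.weyl w) (inr_smul_symIncl P w p))

/-- Each `w` moves through `p` by acting on it and is then absorbed by the symmetrizer on the right,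
so `e p e` is the average of `p` times `e`. -/
lemma NilSys.symmetrizer_sym_symmetrizer (p : SymmetricAlgebra ℂ 𝔱) :
    symmetrizer N.weyl * (N.sym p * symmetrizer N.weyl) =
      N.sym (symAvg P p) * symmetrizer N.weyl := by
  cases nonempty_fintype P.weylGroup
  have h : ∀ w, N.weyl w * (N.sym p * symmetrizer N.weyl) =
      N.sym (symAct P w p) * symmetrizer N.weyl := fun w => by
    rw [← mul_assoc, N.weyl_sym, mul_assoc, mul_symmetrizer]
  have h2 : N.sym (symAvg P p) = (Nat.card P.weylGroup : ℂ)⁻¹ • ∑ w, N.sym (symAct P w p) := by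
    rw [symAvg_coe, finsum_eq_sum_of_fintype, map_smul, map_sum]
  rw [h2, smul_mul_assoc, Finset.sum_mul, ← Finset.sum_congr rfl fun w _ => h w]
  generalize N.sym p * symmetrizer N.weyl = X
  rw [symmetrizer, finsum_eq_sum_of_fintype, smul_mul_assoc, Finset.sum_mul]

end Average

/-! ### The decomposition `1 = ∑ u_j e y_j` and dual bases of `Sym 𝔱` over its invariants -/

section DualBases

variable {ι V 𝔱 : Type*} [Finite ι] [AddCommGroup V] [Module ℂ V] [AddCommGroup 𝔱] [Module ℂ 𝔱]
  {P : RootPairing ι ℂ V 𝔱} [P.IsRootSystem] [P.IsCrystallographic] [P.IsReduced] (b : P.Base)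
  {C : Type*} [Ring C] [Algebra ℂ C] (N : NilSys P C)

/-- The elements which act on symmetric elements by operators on `Sym 𝔱`. -/
def NilSys.finPart : Submonoid C where
  carrier := {y | ∀ p, ∃ q, y * (N.sym p * symmetrizer N.weyl) = N.sym q * symmetrizer N.weyl}
  one_mem' p := ⟨p, one_mul _⟩
  mul_mem' {x y} hx hy p := by
    obtain ⟨q, hq⟩ := hy p
    obtain ⟨r, hr⟩ := hx q
    exact ⟨r, by rw [mul_assoc, hq, hr]⟩

/-- The symmetrizer absorbs `s_i`, while `θ_i s_i = -θ_i`. -/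
lemma NilSys.th_symmetrizer (i : ι) : N.th ⟨i, 0⟩ * symmetrizer N.weyl = 0 := by
  have h := mul_symmetrizer N.weyl (RootPairing.weylGroup.ofIdx P i)
  have h1 : N.weyl (RootPairing.weylGroup.ofIdx P i) = N.grp (⟨i, 0⟩ : AffRoot P).refl := by
    rw [AffRoot.refl_zero]
    rfl
  rw [h1] at h
  have h2 : N.th ⟨i, 0⟩ * symmetrizer N.weyl = -(N.th ⟨i, 0⟩ * symmetrizer N.weyl) := by
    conv_lhs => rw [← h, ← mul_assoc, N.th_refl, neg_mul]
  rw [eq_neg_iff_add_eq_zero, ← two_smul ℂ] at h2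
  exact (smul_eq_zero.mp h2).resolve_left two_ne_zero

lemma NilSys.th_mem_finPart (i : ι) : N.th ⟨i, 0⟩ ∈ N.finPart := fun p => by
  refine ⟨finDem P i p, ?_⟩
  have h : N.th ⟨i, 0⟩ * N.sym p = _ := N.th_pol ⟨i, 0⟩ (symIncl 𝔱 p)
  rw [← mul_assoc, h, add_mul, mul_assoc, N.th_symmetrizer, mul_zero, zero_add, dem_symIncl]
  rfl

/-- The left ideal generated by symmetric elements. -/
def NilSys.symIdeal : Submodule ℂ C :=
  Submodule.span ℂ {x | ∃ p, ∃ y ∈ N.finPart, x = N.sym p * (symmetrizer N.weyl * y)}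

lemma NilSys.sym_mul_mem (p : SymmetricAlgebra ℂ 𝔱) {x : C} (hx : x ∈ N.symIdeal) :
    N.sym p * x ∈ N.symIdeal := by
  induction hx using Submodule.span_induction with
  | mem x hx =>
    obtain ⟨q, y, hy, rfl⟩ := hx
    exact Submodule.subset_span ⟨p * q, y, hy, by rw [map_mul, mul_assoc]⟩
  | zero => rw [mul_zero]; exact zero_mem _
  | add x y _ _ hx hy => rw [mul_add]; exact add_mem hx hy
  | smul c x _ hx => rw [mul_smul_comm]; exact Submodule.smul_mem _ _ hx

lemma NilSys.weyl_mul_mem (w : P.weylGroup) {x : C} (hx : x ∈ N.symIdeal) :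
    N.weyl w * x ∈ N.symIdeal := by
  induction hx using Submodule.span_induction with
  | mem x hx =>
    obtain ⟨q, y, hy, rfl⟩ := hx
    refine Submodule.subset_span ⟨symAct P w q, y, hy, ?_⟩
    rw [← mul_assoc, N.weyl_sym, mul_assoc, ← mul_assoc (N.weyl w), mul_symmetrizer]
  | zero => rw [mul_zero]; exact zero_mem _
  | add x y _ _ hx hy => rw [mul_add]; exact add_mem hx hy
  | smul c x _ hx => rw [mul_smul_comm]; exact Submodule.smul_mem _ _ hx

/-- The hypothesis puts `(s_i - 1) y = α̌_i θ_i y` into the span. It then contains `(w - 1) y` for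
all `w`, hence `e y - y`; and it contains `e y` by definition. -/
lemma NilSys.mem_symIdeal {y : C} (hy : y ∈ N.finPart)
    (h : ∀ i ∈ b.support, N.th ⟨i, 0⟩ * y ∈ N.symIdeal) : y ∈ N.symIdeal := by
  let G : Subgroup P.weylGroup :=
    { carrier := {w | N.weyl w * y - y ∈ N.symIdeal}
      one_mem' := by
        change N.weyl 1 * y - y ∈ N.symIdeal
        rw [map_one, one_mul, sub_self]
        exact zero_mem _
      mul_mem' := fun {v w} hv hw => by
        have e : N.weyl (v * w) * y - y = N.weyl v * (N.weyl w * y - y) + (N.weyl v * y - y) := by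
          rw [map_mul, mul_assoc, mul_sub]
          abel
        change N.weyl (v * w) * y - y ∈ N.symIdeal
        rw [e]
        exact add_mem (N.weyl_mul_mem v hw) hv
      inv_mem' := fun {w} hw => by
        have e : N.weyl w⁻¹ * y - y = -(N.weyl w⁻¹ * (N.weyl w * y - y)) := by
          rw [mul_sub, ← mul_assoc, ← map_mul, inv_mul_cancel, map_one, one_mul, neg_sub]
        change N.weyl w⁻¹ * y - y ∈ N.symIdeal
        rw [e]
        exact neg_mem (N.weyl_mul_mem _ hw) }
  have hG : G = ⊤ := subgroup_eq_top b G fun i hi => by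
    change N.weyl (RootPairing.weylGroup.ofIdx P i) * y - y ∈ N.symIdeal
    have h1 : N.weyl (RootPairing.weylGroup.ofIdx P i) = N.grp (⟨i, 0⟩ : AffRoot P).refl := by
      rw [AffRoot.refl_zero]
      rfl
    rw [h1, N.grp_refl, add_mul, one_mul, add_sub_cancel_left, mul_assoc, AffRoot.lin_zero]
    exact N.sym_mul_mem _ (h i hi)
  have h2 : symmetrizer N.weyl * y - y ∈ N.symIdeal :=
    symmetrizer_mul_sub_mem _ _ fun w => (hG ▸ Subgroup.mem_top w : w ∈ G)
  have h3 : symmetrizer N.weyl * y ∈ N.symIdeal :=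
    Submodule.subset_span ⟨1, y, hy, by rw [map_one, one_mul]⟩
  have := sub_mem h3 h2
  rwa [sub_sub_cancel] at this

/-- Descending induction on the length over the finite Weyl group. By `NilSys.mem_symIdeal` the
claim for `T_w` follows from the claim for the products `θ_i T_w`, which are zero or a longer `T`.
The length is bounded, so the recursion ends, and `T_1 = 1`. -/
lemma NilSys.one_mem_symIdeal (b : P.Base) (N : NilSys P C) : (1 : C) ∈ N.symIdeal := by
  obtain ⟨B, hB⟩ := (Set.finite_range fun w : P.weylGroup =>
    len b (SemidirectProduct.inr w : ExtWeyl P)).bddAbove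
  have key : ∀ (k : ℕ) (w : P.weylGroup), B < len b (SemidirectProduct.inr w : ExtWeyl P) + k →
      N.T b (SemidirectProduct.inr w) ∈ N.finPart → N.T b (SemidirectProduct.inr w) ∈ N.symIdeal := by
    intro k
    induction k with
    | zero =>
      intro w hw
      have := hB ⟨w, rfl⟩
      simp only at this
      omega
    | succ k ih =>
      intro w hw hT
      refine N.mem_symIdeal b hT fun i hi => ?_
      have hs := isSimple_of_mem_support b hi
      have h1 := N.T_refl_mul b (w := SemidirectProduct.inr w) hs
      split_ifs at h1 with hd
      · rw [h1]; exact zero_mem _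
      · have h2 : (⟨i, 0⟩ : AffRoot P).refl * SemidirectProduct.inr w =
            SemidirectProduct.inr (RootPairing.weylGroup.ofIdx P i * w) := by
          rw [AffRoot.refl_zero, map_mul]
        have h3 := len_refl_mul_of_ascent b hs hd
        rw [h2] at h1 h3
        rw [h1]
        refine ih _ (by omega) ?_
        rw [← h1]
        exact mul_mem (N.th_mem_finPart i) hT
  have h1 : N.T b (SemidirectProduct.inr 1) = 1 := by
    rw [map_one, N.T_of_len_eq_zero b (len_one b), map_one]
  have := key (B + 1) 1 (by omega) (by rw [h1]; exact one_mem _)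
  rwa [h1] at this

lemma NilSys.exists_decomposition (b : P.Base) (N : NilSys P C) : ∃ (n : ℕ) (u : Fin n → SymmetricAlgebra ℂ 𝔱) (y : Fin n → C),
    (∀ j, y j ∈ N.finPart) ∧ ∑ j, N.sym (u j) * (symmetrizer N.weyl * y j) = 1 := by
  obtain ⟨n, c, g, h⟩ := Submodule.mem_span_set'.mp (NilSys.one_mem_symIdeal b N)
  choose p y hy hg using fun j => (g j).2
  refine ⟨n, fun j => c j • p j, y, hy, ?_⟩
  rw [← h]
  refine Finset.sum_congr rfl fun j _ => ?_
  rw [hg, map_smul, smul_mul_assoc]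

/-- The coefficient of the identity in `p ∑ w` is `p`. -/
lemma dahaSys_sym_mul_symmetrizer {p : SymmetricAlgebra ℂ 𝔱}
    (h : (dahaSys b).sym p * symmetrizer (dahaSys b).weyl = 0) : p = 0 := by
  cases nonempty_fintype P.weylGroup
  have h1 : (dahaSys b).sym p * ∑ w, (dahaSys b).weyl w = 0 := by
    rw [symmetrizer, mul_smul_comm, finsum_eq_sum_of_fintype] at h
    exact (smul_eq_zero.mp h).resolve_left
      (inv_ne_zero (Nat.cast_ne_zero.mpr Nat.card_pos.ne'))
  have h2 : toDaha b (∑ w : P.weylGroup,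
      SkewMonoidAlgebra.single (SemidirectProduct.inr w) (symIncl 𝔱 p)) = toDaha b 0 := by
    rw [map_sum, map_zero, ← h1, Finset.mul_sum]
    exact Finset.sum_congr rfl fun w _ => toDaha_single b _ _
  have h3 := DFunLike.congr_fun
    (congrArg SkewMonoidAlgebra.coeffAddEquiv (toDaha_injective b h2)) (1 : ExtWeyl P)
  rw [map_sum, Finsupp.finsetSum_apply, Finset.sum_eq_single 1] at h3
  · rw [SkewMonoidAlgebra.coeffAddEquiv_apply, SkewMonoidAlgebra.coeff_single,
      map_one SemidirectProduct.inr, Finsupp.single_eq_same] at h3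
    exact symIncl_injective (h3.trans (map_zero _).symm)
  · intro w _ hw
    rw [SkewMonoidAlgebra.coeffAddEquiv_apply, SkewMonoidAlgebra.coeff_single]
    refine Finsupp.single_eq_of_ne fun h => hw ?_
    exact (SemidirectProduct.inr_injective (h.symm.trans (map_one _).symm))
  · intro h
    exact absurd (Finset.mem_univ _) h

/-- Multiplying `1 = ∑ u_j e y_j` by `p e` gives `p e = ∑ u_j r_j e`, where `r_j` is the average of
the polynomial that `y_j` produces from `p`. The hypothesis `hN` allows `e` to be cancelled. -/
lemma NilSys.exists_dualBases (b : P.Base) (N : NilSys P C)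
    (hN : ∀ p, N.sym p * symmetrizer N.weyl = 0 → p = 0) :
    ∃ (n : ℕ) (u : Fin n → SymmetricAlgebra ℂ 𝔱) (y : Fin n → C),
    ∑ j, N.sym (u j) * (symmetrizer N.weyl * y j) = 1 ∧
    ∀ p, ∃ r : Fin n → symInv P, ∑ j, u j * r j = p ∧
      ∀ j, symmetrizer N.weyl * (y j * (N.sym p * symmetrizer N.weyl)) =
          N.sym (r j) * symmetrizer N.weyl := by
  obtain ⟨n, u, y, hy, h⟩ := NilSys.exists_decomposition b N
  refine ⟨n, u, y, h, fun p => ?_⟩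
  choose q hq using fun j => hy j p
  have h2 : ∀ j, symmetrizer N.weyl * (y j * (N.sym p * symmetrizer N.weyl)) =
      N.sym (symAvg P (q j)) * symmetrizer N.weyl := fun j => by
    rw [hq, NilSys.symmetrizer_sym_symmetrizer]
  refine ⟨fun j => symAvg P (q j), ?_, h2⟩
  rw [← sub_eq_zero]
  refine hN _ ?_
  rw [map_sub, map_sum, sub_mul, Finset.sum_mul, sub_eq_zero]
  refine Eq.trans ?_ ((congrArg (· * (N.sym p * symmetrizer N.weyl)) h).trans (one_mul _))
  simp only [Finset.sum_mul]
  refine Finset.sum_congr rfl fun j _ => ?_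
  rw [map_mul, mul_assoc, ← h2]
  simp only [mul_assoc]

/-- Dual bases of `Sym 𝔱` over its invariants. -/
lemma exists_dualBases : ∃ (n : ℕ) (u : Fin n → SymmetricAlgebra ℂ 𝔱) (y : Fin n → nilDAHA b),
    ∑ j, (dahaSys b).sym (u j) * (symmetrizer (dahaSys b).weyl * y j) = 1 ∧
    ∀ p, ∃ r : Fin n → symInv P, ∑ j, u j * r j = p ∧
      ∀ j, symmetrizer (dahaSys b).weyl * (y j *
        ((dahaSys b).sym p * symmetrizer (dahaSys b).weyl)) =
          (dahaSys b).sym (r j) * symmetrizer (dahaSys b).weyl :=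
  NilSys.exists_dualBases b (dahaSys b) fun _ => dahaSys_sym_mul_symmetrizer b

end DualBases


/-! ### The universal property of the balanced tensor product -/

namespace BalancedTensor

variable {X R L M : Type*} [Ring X] [Algebra ℂ X] [Semiring R] [Algebra ℂ R]
  [AddCommGroup L] [Module ℂ L] [AddCommGroup M] [Module ℂ M]
  (f : R →ₐ[ℂ] X) (σ : R →ₐ[ℂ] Module.End ℂ L)

/-- The balanced bilinear map `(x, l) ↦ x ⊗ l`. -/
def mk : X →ₗ[ℂ] L →ₗ[ℂ] BalancedTensor f σ :=
  (TensorProduct.mk ℂ X L).compr₂ (balancedRel f σ).mkQ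

lemma mk_mul (x : X) (r : R) (l : L) : mk f σ (x * f r) l = mk f σ x (σ r l) :=
  (Submodule.Quotient.eq _).mpr (Submodule.subset_span ⟨x, r, l, rfl⟩)

variable {f σ}

lemma hom_ext {F G : BalancedTensor f σ →ₗ[ℂ] M} (h : ∀ x l, F (mk f σ x l) = G (mk f σ x l)) :
    F = G :=
  Submodule.linearMap_qext _ (TensorProduct.ext' h)

lemma induction {motive : BalancedTensor f σ → Prop} (t : BalancedTensor f σ)
    (mk : ∀ x l, motive (mk f σ x l)) (add : ∀ s t, motive s → motive t → motive (s + t)) :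
    motive t := by
  obtain ⟨t, rfl⟩ := Submodule.mkQ_surjective (balancedRel f σ) t
  induction t using TensorProduct.induction_on with
  | zero =>
    have := mk 0 0
    rw [map_zero] at this
    rw [map_zero]
    exact this
  | tmul x l => exact mk x l
  | add s t hs ht =>
    rw [map_add]
    exact add _ _ hs ht

variable (f σ) in
/-- The linear map induced by a balanced bilinear map. -/
def lift (F : X →ₗ[ℂ] L →ₗ[ℂ] M) (hF : ∀ x r l, F (x * f r) l = F x (σ r l)) :
    BalancedTensor f σ →ₗ[ℂ] M :=
  (balancedRel f σ).liftQ (TensorProduct.lift F) (by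
    rw [balancedRel, Submodule.span_le]
    rintro _ ⟨x, r, l, rfl⟩
    simp [hF])

lemma lift_mk (F : X →ₗ[ℂ] L →ₗ[ℂ] M) (hF : ∀ x r l, F (x * f r) l = F x (σ r l)) (x : X) (l : L) :
    lift f σ F hF (mk f σ x l) = F x l := rfl

end BalancedTensor

/-! ### Systems from the finite simple roots alone -/

section Conjugate

variable {ι V 𝔱 : Type*} [Finite ι] [AddCommGroup V] [Module ℂ V] [AddCommGroup 𝔱] [Module ℂ 𝔱]
  {P : RootPairing ι ℂ V 𝔱} [P.IsRootSystem] [P.IsCrystallographic] [P.IsReduced] (b : P.Base)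
  {C : Type*} [Ring C] [Algebra ℂ C]

/-- A system is determined by Demazure elements of the simple roots. -/
lemma exists_nilSys (pol : SymAff 𝔱 →ₐ[ℂ] C) (grp : ExtWeyl P →* C)
    (grp_pol : ∀ g p, grp g * pol p = pol (g • p) * grp g)
    (h : ∀ i ∈ b.support, ∃ D, pol (⟨i, 0⟩ : AffRoot P).lin * D = grp (⟨i, 0⟩ : AffRoot P).refl - 1 ∧
      grp (⟨i, 0⟩ : AffRoot P).refl * D = D ∧
      D * pol (⟨i, 0⟩ : AffRoot P).lin = -(grp (⟨i, 0⟩ : AffRoot P).refl + 1)) :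
    ∃ N : NilSys P C, N.pol = pol ∧ N.grp = grp := by
  have key : ∀ a : AffRoot P, ∃ D, pol a.lin * D = grp a.refl - 1 ∧ grp a.refl * D = D ∧
      D * pol a.lin = -(grp a.refl + 1) := by
    intro a
    obtain ⟨g, j, hj, rfl⟩ := exists_eq_smul b a
    obtain ⟨D, h1, h2, h3⟩ := h j hj
    have hg : grp g * grp g⁻¹ = 1 := by rw [← map_mul, mul_inv_cancel, map_one]
    have hg' : grp g⁻¹ * grp g = 1 := by rw [← map_mul, inv_mul_cancel, map_one]
    have hp : ∀ x : C, x * grp g⁻¹ * (grp g * pol (⟨j, 0⟩ : AffRoot P).lin * grp g⁻¹) =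
        x * pol (⟨j, 0⟩ : AffRoot P).lin * grp g⁻¹ := fun x => by
      rw [← mul_assoc, ← mul_assoc, mul_assoc x, hg', mul_one]
    have hl : pol (g • (⟨j, 0⟩ : AffRoot P)).lin =
        grp g * pol (⟨j, 0⟩ : AffRoot P).lin * grp g⁻¹ := by
      rw [grp_pol, AffRoot.lin_smul, mul_assoc, hg, mul_one]
    rw [AffRoot.refl_smul, map_mul, map_mul]
    refine ⟨grp g * D * grp g⁻¹, ?_, ?_, ?_⟩
    · calc _ = grp g * (pol (⟨j, 0⟩ : AffRoot P).lin * (grp g⁻¹ * grp g) * D) * grp g⁻¹ := by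
            rw [hl]; simp only [mul_assoc]
        _ = _ := by rw [hg', mul_one, h1, mul_sub, sub_mul, mul_one, hg]
    · calc _ = grp g * (grp (⟨j, 0⟩ : AffRoot P).refl * (grp g⁻¹ * grp g) * D) * grp g⁻¹ := by
            simp only [mul_assoc]
        _ = _ := by rw [hg', mul_one, h2]
    · rw [hl, hp, mul_assoc (grp g), h3, mul_neg, mul_add, mul_one, neg_mul, add_mul, hg]
  choose th h1 h2 h3 using key
  refine ⟨NilSys.ofInjective pol grp th grp_pol h1 h2 fun a y hy hz => ?_, rfl, rfl⟩
  -- The third relation gives the injectivity: if `s_a y = y` and `a y = 0`, then `0 = θ_a a y =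
  -- -2y`.
  have := h3 a
  have h4 := congrArg (· * y) this
  simp only [mul_assoc, hz, mul_zero, neg_mul, add_mul, hy, one_mul] at h4
  rw [zero_eq_neg, ← two_smul ℂ y] at h4
  exact (smul_eq_zero.mp h4).resolve_left two_ne_zero

end Conjugate

/-! ### Part (i): the criterion for `ℋ` and its specializations -/

section Modules

variable {ι V 𝔱 : Type*} [Finite ι] [AddCommGroup V] [Module ℂ V] [AddCommGroup 𝔱] [Module ℂ 𝔱]
  {P : RootPairing ι ℂ V 𝔱} [P.IsRootSystem] [P.IsCrystallographic] [P.IsReduced] {b : P.Base}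
  {M : Type*} [AddCommGroup M] [Module ℂ M]

lemma naturalMap_mk (ρ : WDhT P →ₐ[ℂ] Module.End ℂ M) (p : SymmetricAlgebra ℂ 𝔱)
    (m : invariants P ρ) :
    naturalMap P ρ (BalancedTensor.mk _ _ p m) = ρ (symA P p) m := rfl

lemma symmetrizer_apply_eq {B G : Type*} [Semiring B] [Algebra ℂ B] [Group G] [Finite G]
    (u : G →* B) (φ : B →ₐ[ℂ] Module.End ℂ M) {m : M} (h : ∀ g, φ (u g) m = m) :
    φ (symmetrizer u) m = m := by
  cases nonempty_fintype G
  rw [symmetrizer, finsum_eq_sum_of_fintype, map_smul, map_sum, LinearMap.smul_apply,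
    LinearMap.sum_apply, Finset.sum_congr rfl fun w _ => h w, Finset.sum_const, Finset.card_univ,
    ← Nat.cast_smul_eq_nsmul ℂ, smul_smul, Nat.card_eq_fintype_card,
    inv_mul_cancel₀ (Nat.cast_ne_zero.mpr Fintype.card_ne_zero), one_smul]

/-- The inverse is `m ↦ ∑ u_j ⊗ e y_j m`. It is a right inverse since `∑ u_j e y_j = 1`. It is a
left inverse since `e y_j p m = r_j m` for invariant `m`, and the `r_j` move across the tensor sign
to give `∑ u_j r_j = p`. -/
lemma naturalMap_bijective (ρ : WDhT P →ₐ[ℂ] Module.End ℂ M) (φ : nilDAHA b →ₐ[ℂ] Module.End ℂ M)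
    (hsym : ∀ p, φ ((dahaSys b).sym p) = ρ (symA P p))
    (hweyl : ∀ w, φ ((dahaSys b).weyl w) = ρ (weylA P w)) :
    Function.Bijective (naturalMap P ρ) := by
  obtain ⟨n, u, y, h1, h2⟩ := exists_dualBases b
  set e := symmetrizer (dahaSys b).weyl with he
  have e_inv : ∀ x m, φ (e * x) m ∈ invariants P ρ := fun x m w => by
    rw [← hweyl, ← Module.End.mul_apply, ← map_mul, ← mul_assoc, mul_symmetrizer]
  have e_id : ∀ m ∈ invariants P ρ, φ e m = m := fun m hm => by
    exact symmetrizer_apply_eq _ φ fun w => (DFunLike.congr_fun (hweyl w) m).trans (hm w)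
  let κ : M →ₗ[ℂ] BalancedTensor (symInv P).val (invariantsAct P ρ) :=
    ∑ j, (BalancedTensor.mk (symInv P).val (invariantsAct P ρ) (u j)) ∘ₗ
      (φ (e * y j)).codRestrict (invariants P ρ) (e_inv (y j))
  have κ_apply : ∀ m, κ m = ∑ j, BalancedTensor.mk (symInv P).val (invariantsAct P ρ) (u j)
      ⟨φ (e * y j) m, e_inv _ _⟩ := fun m => by
    rw [LinearMap.sum_apply]
    rfl
  have hr : Function.RightInverse κ (naturalMap P ρ) := fun m => by
    rw [κ_apply, map_sum]
    simp only [naturalMap_mk, ← hsym]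
    simp only [← Module.End.mul_apply, ← map_mul]
    rw [← LinearMap.sum_apply, ← map_sum, h1, map_one, Module.End.one_apply]
  have hl : Function.LeftInverse κ (naturalMap P ρ) := fun t => by
    induction t using BalancedTensor.induction with
    | mk p m =>
      obtain ⟨r, hr, hr2⟩ := h2 p
      rw [naturalMap_mk, κ_apply]
      have h3 : ∀ j, (⟨φ (e * y j) (ρ (symA P p) m), e_inv _ _⟩ : invariants P ρ) =
          invariantsAct P ρ (r j) m := fun j => by
        refine Subtype.ext ?_
        change _ = ρ (symA P (r j)) (m : M)
        have h4 := DFunLike.congr_fun (congrArg φ (hr2 j)) (m : M)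
        simp only [map_mul, Module.End.mul_apply] at h4
        rw [e_id m m.2, hsym, hsym] at h4
        exact (DFunLike.congr_fun (map_mul φ e (y j)) _).trans h4
      simp only [h3]
      rw [Finset.sum_congr rfl fun j _ =>
        (BalancedTensor.mk_mul (symInv P).val (invariantsAct P ρ) (u j) (r j) m).symm,
        ← LinearMap.sum_apply, ← map_sum]
      exact congrArg (fun q => BalancedTensor.mk _ _ q m) hr
    | add s t hs ht => rw [map_add, map_add, hs, ht]
  exact ⟨hl.injective, hr.surjective⟩

/-- Linearity over the invariants is what lets the operator act on `Sym 𝔱 ⊗ L`. -/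
lemma finDem_mul_symInv (i : ι) (p : SymmetricAlgebra ℂ 𝔱) (r : symInv P) :
    finDem P i (p * r) = finDem P i p * r := by
  refine divDiff_unique _ _ ?_
  rw [← symAct_ofIdx, map_mul, r.2, ← mul_assoc]
  rw [coroot_mul_finDem, sub_mul]

/-- The Demazure operator on `Sym 𝔱 ⊗ L`. -/
def tensorDem (i : ι) {L : Type*} [AddCommGroup L] [Module ℂ L]
    (σ : symInv P →ₐ[ℂ] Module.End ℂ L) :
    BalancedTensor (symInv P).val σ →ₗ[ℂ] BalancedTensor (symInv P).val σ :=
  BalancedTensor.lift (symInv P).val σ ((BalancedTensor.mk (symInv P).val σ) ∘ₗ finDem P i)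
    fun x r l => by
      change BalancedTensor.mk (symInv P).val σ (finDem P i (x * r)) l = _
      rw [finDem_mul_symInv]
      exact BalancedTensor.mk_mul _ _ _ r l

lemma symA_eq (p : SymmetricAlgebra ℂ 𝔱) : symA P p = diffA P (affDh P (symIncl 𝔱 p)) := by
  rw [affDh_symIncl]
  rfl

/-- Through the isomorphism `Sym 𝔱 ⊗ M^W ≃ M`, the operator is the divided difference on the first
factor. The three relations may be tested on elements `p m` with `m` invariant, where they are
identities in `Sym 𝔱`. -/
lemma exists_demazure (ρ : WDhT P →ₐ[ℂ] Module.End ℂ M) (h : Function.Bijective (naturalMap P ρ))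
    (i : ι) : ∃ D : Module.End ℂ M,
      ρ (symA P (SymmetricAlgebra.ι ℂ 𝔱 (P.coroot i))) * D =
        ρ (weylA P (RootPairing.weylGroup.ofIdx P i)) - 1 ∧
      ρ (weylA P (RootPairing.weylGroup.ofIdx P i)) * D = D ∧
      D * ρ (symA P (SymmetricAlgebra.ι ℂ 𝔱 (P.coroot i))) =
        -(ρ (weylA P (RootPairing.weylGroup.ofIdx P i)) + 1) := by
  let e := LinearEquiv.ofBijective (naturalMap P ρ) h
  let D : Module.End ℂ M := e.toLinearMap ∘ₗ tensorDem i _ ∘ₗ e.symm.toLinearMap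
  have hD : ∀ p (m : invariants P ρ), D (ρ (symA P p) m) = ρ (symA P (finDem P i p)) m :=
    fun p m => by
      change e (tensorDem i _ (e.symm (naturalMap P ρ (BalancedTensor.mk _ _ p m)))) = _
      have : e.symm (naturalMap P ρ (BalancedTensor.mk _ _ p m)) = BalancedTensor.mk _ _ p m :=
        e.symm_apply_apply _
      rw [this]
      rfl
  have ext : ∀ {F G : Module.End ℂ M}, (∀ p (m : invariants P ρ),
      F (ρ (symA P p) m) = G (ρ (symA P p) m)) → F = G := fun {F G} hFG => by
    have : F ∘ₗ naturalMap P ρ = G ∘ₗ naturalMap P ρ := BalancedTensor.hom_ext hFG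
    exact LinearMap.ext fun m => by
      obtain ⟨t, rfl⟩ := h.2 m
      exact DFunLike.congr_fun this t
  have hs : ∀ p (m : invariants P ρ), ρ (weylA P (RootPairing.weylGroup.ofIdx P i))
      (ρ (symA P p) m) = ρ (symA P (symAct P (RootPairing.weylGroup.ofIdx P i) p)) m :=
    fun p m => by
      have h3 : weylA P (RootPairing.weylGroup.ofIdx P i) * symA P p =
          symA P (symAct P (RootPairing.weylGroup.ofIdx P i) p) *
            weylA P (RootPairing.weylGroup.ofIdx P i) := by
        exact (weylA_mul_diffA P _ _).trans (congrArg (fun z => diffA P z *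
          weylA P (RootPairing.weylGroup.ofIdx P i)) (symDh_symAct P _ p).symm)
      rw [← Module.End.mul_apply, ← map_mul, h3, map_mul, Module.End.mul_apply, m.2]
  have hA : ∀ p q (m : invariants P ρ), ρ (symA P p) (ρ (symA P q) m) = ρ (symA P (p * q)) m :=
    fun p q m => by rw [map_mul, map_mul, Module.End.mul_apply]
  refine ⟨D, ext fun p m => ?_, ext fun p m => ?_, ext fun p m => ?_⟩
  · rw [Module.End.mul_apply, hD, hA, coroot_mul_finDem, LinearMap.sub_apply,
      Module.End.one_apply, hs]
    exact DFunLike.congr_fun (map_sub (ρ.comp (symA P)) _ _) (m : M)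
  · have h4 : symAct P (RootPairing.weylGroup.ofIdx P i) (finDem P i p) = finDem P i p := by
      rw [symAct_ofIdx]
      exact symRefl_divDiff _ (P.pairing_same i) p
    rw [Module.End.mul_apply, hD, hs, h4]
  · have h4 : finDem P i (SymmetricAlgebra.ι ℂ 𝔱 (P.coroot i) * p) =
        -(symAct P (RootPairing.weylGroup.ofIdx P i) p + p) := by
      refine divDiff_unique _ _ ?_
      have h5 : symRefl (P.coroot i) (P.toLinearMap (P.root i))
          (SymmetricAlgebra.ι ℂ 𝔱 (P.coroot i)) = -SymmetricAlgebra.ι ℂ 𝔱 (P.coroot i) := by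
        have h6 : P.toLinearMap (P.root i) (P.coroot i) = 2 := P.pairing_same i
        rw [symRefl_ι, h6, ← map_neg]
        congr 1
        module
      rw [map_mul, h5, symAct_ofIdx]
      ring
    rw [Module.End.mul_apply, hA, hD, h4, LinearMap.neg_apply, LinearMap.add_apply,
      Module.End.one_apply, hs]
    exact DFunLike.congr_fun ((map_neg (ρ.comp (symA P)) _).trans
      (congrArg Neg.neg (map_add (ρ.comp (symA P)) _ _))) (m : M)

/-- The operators of `exists_demazure` complete the given action to a `NilSys`, to which the
universal property of `ℋ` applies. -/
lemma exists_extension {i : WDhT P →ₐ[ℂ] nilDAHA b} (hi : IsCanonical b i)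
    (ρ : WDhT P →ₐ[ℂ] Module.End ℂ M) (h : Function.Bijective (naturalMap P ρ)) :
    ∃ φ : nilDAHA b →ₐ[ℂ] Module.End ℂ M, φ.comp i = ρ := by
  obtain ⟨N, hpol, hgrp⟩ := exists_nilSys b (ρ.comp ((diffA P).comp (affDh P)))
    ((ρ : WDhT P →* Module.End ℂ M).comp (extWeylA P))
    (fun g p => (map_mul ρ _ _).symm.trans
      ((congrArg ρ (extWeylA_mul_affDh P g p).symm).trans (map_mul ρ _ _)))
    (fun j _ => by
      obtain ⟨D, h1⟩ := exists_demazure ρ h j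
      refine ⟨D, ?_⟩
      rw [AffRoot.lin_zero, AffRoot.refl_zero]
      change ρ (diffA P (affDh P _)) * D = ρ (extWeylA P _) - 1 ∧ ρ (extWeylA P _) * D = D ∧
        D * ρ (diffA P (affDh P _)) = -(ρ (extWeylA P _) + 1)
      rw [← symA_eq, extWeylA_inr]
      exact h1)
  obtain ⟨φ, h1, h2⟩ := NilSys.exists_algHom b N
  refine ⟨φ, AlgHom.ext fun x => ?_⟩
  obtain ⟨x, rfl⟩ := toWDhT_surjective b x
  rw [AlgHom.comp_apply, hi.apply_toWDhT]
  induction x using SkewMonoidAlgebra.induction_on with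
  | zero => simp only [map_zero]
  | single w f =>
    rw [toDaha_single, toWDhT_single, map_mul, map_mul]
    have h3 : φ (polyH b f) = N.pol f := h1 f
    have h4 : φ (groupH b w) = N.grp w := h2 w
    rw [h3, h4, hpol, hgrp]
    rfl
  | add x y hx hy => rw [map_add, map_add, map_add, map_add, hx, hy]

lemma IsCanonical.apply_symA {i : WDhT P →ₐ[ℂ] nilDAHA b} (hi : IsCanonical b i)
    (p : SymmetricAlgebra ℂ 𝔱) : i (symA P p) = (dahaSys b).sym p := by
  rw [symA_eq, hi.apply_affDh]
  rfl

lemma IsCanonical.hom_ext {i : WDhT P →ₐ[ℂ] nilDAHA b} (hi : IsCanonical b i)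
    {C : Type*} [Ring C] [Algebra ℂ C] {φ ψ : nilDAHA b →ₐ[ℂ] C} (h : φ.comp i = ψ.comp i) :
    φ = ψ := by
  refine nilDAHA_hom_ext b (fun p => ?_) fun g => ?_
  · rw [← hi.apply_affDh]
    exact DFunLike.congr_fun h _
  · rw [← hi.apply_extWeylA]
    exact DFunLike.congr_fun h _

lemma IsCanonical.naturalMap_bijective {i : WDhT P →ₐ[ℂ] nilDAHA b} (hi : IsCanonical b i)
    (φ : nilDAHA b →ₐ[ℂ] Module.End ℂ M) : Function.Bijective (naturalMap P (φ.comp i)) :=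
  NilDAHA.naturalMap_bijective (φ.comp i) φ (fun p => by rw [AlgHom.comp_apply, hi.apply_symA])
    fun w => by
      rw [AlgHom.comp_apply, hi.map_weyl]
      rfl

/-- The criterion for the extension of an action to the degenerate nil DAHA. -/
lemma extension_iff {i : WDhT P →ₐ[ℂ] nilDAHA b} (hi : IsCanonical b i)
    (ρ : WDhT P →ₐ[ℂ] Module.End ℂ M) :
    (Nonempty (Extension i ρ) ↔ Function.Bijective (naturalMap P ρ)) ∧
      Subsingleton (Extension i ρ) := by
  refine ⟨⟨?_, fun h => ?_⟩, ⟨fun φ ψ => Subtype.ext (hi.hom_ext (φ.2.trans ψ.2.symm))⟩⟩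
  · rintro ⟨φ, rfl⟩
    exact hi.naturalMap_bijective φ
  · obtain ⟨φ, hφ⟩ := exists_extension hi ρ h
    exact ⟨⟨φ, hφ⟩⟩

/-- The criterion for the specialized algebras. -/
lemma extension_specialization_iff {i : WDhT P →ₐ[ℂ] nilDAHA b} (hi : IsCanonical b i) (c : ℂ)
    (ρ : Specialization (hbarA P) c →ₐ[ℂ] Module.End ℂ M) :
    (Nonempty (Extension (Specialization.map i hi.map_hbar c) ρ) ↔
      Function.Bijective (naturalMap P (ρ.comp (Specialization.mk (hbarA P) c)))) ∧
    Subsingleton (Extension (Specialization.map i hi.map_hbar c) ρ) := by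
  have hmap : (Specialization.map i hi.map_hbar c).comp (Specialization.mk (hbarA P) c) =
      (Specialization.mk (hbarH b) c).comp i := AlgHom.ext fun x =>
    RingQuot.liftAlgHom_mkAlgHom_apply ℂ _ _ x
  obtain ⟨h1, -⟩ := extension_iff hi (ρ.comp (Specialization.mk (hbarA P) c))
  constructor
  · rw [← h1]
    constructor
    · rintro ⟨φ, hφ⟩
      refine ⟨φ.comp (Specialization.mk (hbarH b) c), ?_⟩
      rw [AlgHom.comp_assoc, ← hmap, ← AlgHom.comp_assoc, hφ]
    · rintro ⟨φ, hφ⟩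
      refine ⟨RingQuot.liftAlgHom ℂ ⟨φ, ?_⟩, ?_⟩
      -- `ħ` lies in the image of `W ⋉ 𝒟_ħ(T)`, where it acts by `c`, so the extension factors
      -- through the specialization.
      · rintro _ _ ⟨rfl, rfl⟩
        rw [← hi.map_hbar, AlgHom.commutes]
        have h2 := DFunLike.congr_fun hφ (hbarA P)
        have h3 : Specialization.mk (hbarA P) c (hbarA P) = algebraMap ℂ _ c := by
          rw [← (Specialization.mk (hbarA P) c).commutes c]
          exact RingQuot.mkAlgHom_rel ℂ ⟨rfl, rfl⟩
        rw [AlgHom.comp_apply, AlgHom.comp_apply, h3, AlgHom.commutes] at h2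
        exact h2
      · refine RingQuot.ringQuot_ext' ℂ _ _ ?_
        change (AlgHom.comp _ _).comp (Specialization.mk (hbarA P) c) =
          ρ.comp (Specialization.mk (hbarA P) c)
        rw [AlgHom.comp_assoc, hmap, ← AlgHom.comp_assoc]
        refine Eq.trans ?_ hφ
        congr 1
        exact AlgHom.ext fun x => RingQuot.liftAlgHom_mkAlgHom_apply ℂ _ _ x
  · refine ⟨fun φ ψ => Subtype.ext (RingQuot.ringQuot_ext' ℂ _ _ (hi.hom_ext ?_))⟩
    change (AlgHom.comp _ (Specialization.mk (hbarH b) c)).comp i =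
      (AlgHom.comp _ (Specialization.mk (hbarH b) c)).comp i
    rw [AlgHom.comp_assoc, AlgHom.comp_assoc, ← hmap, ← AlgHom.comp_assoc, ← AlgHom.comp_assoc]
    exact congrArg (fun F => AlgHom.comp F (Specialization.mk (hbarA P) c)) (φ.2.trans ψ.2.symm)

end Modules


lemma exists_algHom_of_surjective {A B C : Type*} [Semiring A] [Algebra ℂ A] [Semiring B]
    [Algebra ℂ B] [Semiring C] [Algebra ℂ C] (p : A →ₐ[ℂ] B) (hp : Function.Surjective p)
    (J : A →ₐ[ℂ] C) (h : ∀ x y, p x = p y → J x = J y) : ∃ j : B →ₐ[ℂ] C, ∀ x, j (p x) = J x := by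
  choose s hs using hp
  have key : ∀ x, J (s (p x)) = J x := fun x => h _ _ (hs _)
  exact ⟨{ toFun := fun y => J (s y)
           map_one' := by rw [← map_one p, key, map_one]
           map_mul' := fun x y => by rw [← map_mul, h]; simp [hs]
           map_zero' := by rw [← map_zero p, key, map_zero]
           map_add' := fun x y => by rw [← map_add, h]; simp [hs]
           commutes' := fun c => by rw [← p.commutes, key, J.commutes] }, key⟩

/-! ### The Rees algebra at `ħ = 1` -/

section Descent

variable {ι V 𝔱 : Type*} [AddCommGroup V] [Module ℂ V] [AddCommGroup 𝔱] [Module ℂ 𝔱]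
  {P : RootPairing ι ℂ V 𝔱}

/-- `D ħ^n` for an operator `D` of order `≤ n`. -/
def monoDh {n : ℕ} {D : Module.End ℂ (TorusRing P)} (hD : D ∈ diffOrder (TorusRing P) n) : DhT P :=
  ⟨Polynomial.monomial n D, monomial_mem_reesDiffOps hD⟩

lemma reesEvalOne_monoDh {n : ℕ} {D : Module.End ℂ (TorusRing P)}
    (hD : D ∈ diffOrder (TorusRing P) n) : reesEvalOne (monoDh hD) = ⟨D, n, hD⟩ := by
  refine Subtype.ext ?_
  change Polynomial.eval₂ _ 1 (Polynomial.monomial n D) = D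
  rw [Polynomial.eval₂_monomial, one_pow, mul_one]
  rfl

variable (P) in
lemma reesEvalOne_surjective : Function.Surjective (reesEvalOne : DhT P →ₐ[ℂ] DT P) :=
  fun ⟨_, _, hD⟩ => ⟨monoDh hD, reesEvalOne_monoDh hD⟩

variable {C : Type*} [Semiring C] [Algebra ℂ C]

lemma apply_monoDh_add {J : DhT P →ₐ[ℂ] C} (hJ : J (hbarDh P) = 1) {n : ℕ}
    {D : Module.End ℂ (TorusRing P)} (hD : D ∈ diffOrder (TorusRing P) n) (k : ℕ) :
    J (monoDh (diffOrder_mono (Nat.le_add_right n k) hD)) = J (monoDh hD) := by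
  induction k with
  | zero => rfl
  | succ k ih =>
    have h : monoDh (diffOrder_mono (Nat.le_add_right n (k + 1)) hD) =
        hbarDh P * monoDh (diffOrder_mono (Nat.le_add_right n k) hD) := by
      refine Subtype.ext ?_
      change Polynomial.monomial _ D = Polynomial.monomial 1 1 * Polynomial.monomial _ D
      rw [Polynomial.monomial_mul_monomial, one_mul, add_comm 1]
      rfl
    rw [h, map_mul, hJ, one_mul, ih]

lemma apply_monoDh_le {J : DhT P →ₐ[ℂ] C} (hJ : J (hbarDh P) = 1) {m n : ℕ}
    {D : Module.End ℂ (TorusRing P)} (hD : D ∈ diffOrder (TorusRing P) m)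
    (hD' : D ∈ diffOrder (TorusRing P) n) (hmn : m ≤ n) : J (monoDh hD) = J (monoDh hD') := by
  obtain ⟨k, rfl⟩ := Nat.exists_eq_add_of_le hmn
  exact (apply_monoDh_add hJ hD k).symm

lemma eq_sum_monoDh (x : DhT P) : x = ∑ n ∈ Finset.range
    ((x : Polynomial (Module.End ℂ (TorusRing P))).natDegree + 1), monoDh (x.2 n) := by
  refine Subtype.ext ?_
  rw [AddSubmonoidClass.coe_finsetSum]
  exact Polynomial.as_sum_range _

/-- If `ħ ↦ 1`, then `D ħ^n` has the same image for every admissible `n`. All homogeneous parts can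
thus be lifted to one common degree, where the image depends only on the sum of the coefficients. -/
lemma apply_eq_of_reesEvalOne_eq {J : DhT P →ₐ[ℂ] C} (hJ : J (hbarDh P) = 1) {x y : DhT P}
    (h : reesEvalOne x = reesEvalOne y) : J x = J y := by
  have key : ∀ (N : ℕ) (x : DhT P),
      (x : Polynomial (Module.End ℂ (TorusRing P))).natDegree ≤ N →
      ∃ hN : (reesEvalOne x : Module.End ℂ (TorusRing P)) ∈ diffOrder (TorusRing P) N,
        J x = J (monoDh hN) := by
    intro N x hx
    have hle : ∀ n ∈ Finset.range ((x : Polynomial (Module.End ℂ (TorusRing P))).natDegree + 1),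
        n ≤ N := fun n hn => by
      have := Finset.mem_range.mp hn
      omega
    have hN : (reesEvalOne x : Module.End ℂ (TorusRing P)) ∈ diffOrder (TorusRing P) N := by
      rw [reesEvalOne_apply]
      exact sum_mem fun n hn => diffOrder_mono (hle n hn) (x.2 n)
    refine ⟨hN, ?_⟩
    have h2 : monoDh hN = ∑ n ∈ (Finset.range
        ((x : Polynomial (Module.End ℂ (TorusRing P))).natDegree + 1)).attach,
          monoDh (diffOrder_mono (hle n n.2) (x.2 n)) := by
      refine Subtype.ext ?_
      rw [AddSubmonoidClass.coe_finsetSum]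
      change Polynomial.monomial N _ = ∑ n ∈ Finset.attach _, Polynomial.monomial N _
      rw [← map_sum, reesEvalOne_apply, ← Finset.sum_attach]
    conv_lhs => rw [eq_sum_monoDh x]
    rw [h2, map_sum, map_sum, ← Finset.sum_attach]
    exact Finset.sum_congr rfl fun n _ => apply_monoDh_le hJ _ _ (hle n n.2)
  obtain ⟨h1, h2⟩ := key _ x (le_max_left _
    (y : Polynomial (Module.End ℂ (TorusRing P))).natDegree)
  obtain ⟨h3, h4⟩ := key _ y (le_max_right
    (x : Polynomial (Module.End ℂ (TorusRing P))).natDegree _)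
  rw [h2, h4]
  congr 1
  refine Subtype.ext ?_
  change Polynomial.monomial _ _ = Polynomial.monomial _ _
  rw [h]

/-- A homomorphism with `ħ ↦ 1` factors through the specialization at `ħ = 1`. -/
lemma exists_descent {J : DhT P →ₐ[ℂ] C} (hJ : J (hbarDh P) = 1) :
    ∃ j : DT P →ₐ[ℂ] C, ∀ x, j (reesEvalOne x) = J x :=
  exists_algHom_of_surjective reesEvalOne (reesEvalOne_surjective P) J
    fun _ _ => apply_eq_of_reesEvalOne_eq hJ

end Descent

/-! ### The module `𝒟(T) ⊗ L` over `𝒟(T)^W` -/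

section Spherical

/-- The formal properties of `𝒟(T)^W ⊂ 𝒟(T)`, for algebras `R` and `X` in their place. -/
structure InvariantSystem {ι V 𝔱 : Type*} [AddCommGroup V] [Module ℂ V] [AddCommGroup 𝔱]
    [Module ℂ 𝔱] (P : RootPairing ι ℂ V 𝔱) (X R : Type*) [Ring X] [Algebra ℂ X]
    [Semiring R] [Algebra ℂ R] where
  /-- the inclusion -/
  incl : R →ₐ[ℂ] X
  incl_injective : Function.Injective incl
  /-- the action of the Weyl group -/
  act : P.weylGroup →* (X →ₗ[ℂ] X)
  act_one : ∀ w, act w 1 = 1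
  act_mul : ∀ w x y, act w (x * y) = act w x * act w y
  act_incl : ∀ w r, act w (incl r) = incl r
  /-- the average over the Weyl group -/
  avg : X → R
  incl_avg : ∀ x, incl (avg x) = (Nat.card P.weylGroup : ℂ)⁻¹ • ∑ᶠ w, act w x
  /-- the specialization of the Rees algebra -/
  spec : DhT P →ₐ[ℂ] X
  spec_smul : ∀ (w : P.weylGroup) x, spec (w • x) = act w (spec x)
  spec_hbar : spec (hbarDh P) = 1
  spec_surjective : Function.Surjective spec
  /-- the embedding of the invariant symmetric tensors -/
  sym : symInv P →ₐ[ℂ] R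
  sym_spec : ∀ p : symInv P, spec (symDh P p) = incl (sym p)

namespace InvariantSystem

variable {ι V 𝔱 : Type*} [AddCommGroup V] [Module ℂ V] [AddCommGroup 𝔱] [Module ℂ 𝔱]
  {P : RootPairing ι ℂ V 𝔱} [Finite ι] [P.IsRootSystem]
  {X R : Type*} [Ring X] [Algebra ℂ X] [Semiring R] [Algebra ℂ R] (S : InvariantSystem P X R)

/-- The average over the Weyl group as a linear map. -/
def avgLin : X →ₗ[ℂ] R where
  toFun := S.avg
  map_add' x y := by
    cases nonempty_fintype P.weylGroup
    apply S.incl_injective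
    rw [map_add, S.incl_avg, S.incl_avg, S.incl_avg]
    simp only [finsum_eq_sum_of_fintype, map_add, Finset.sum_add_distrib, smul_add]
  map_smul' c x := by
    cases nonempty_fintype P.weylGroup
    apply S.incl_injective
    rw [RingHom.id_apply, map_smul, S.incl_avg, S.incl_avg]
    simp only [finsum_eq_sum_of_fintype, map_smul]
    rw [← Finset.smul_sum, smul_comm]

lemma incl_avgLin (x : X) : S.incl (S.avgLin x) = (Nat.card P.weylGroup : ℂ)⁻¹ • ∑ᶠ w, S.act w x :=
  S.incl_avg x

lemma avgLin_mul (x : X) (r : R) : S.avgLin (x * S.incl r) = S.avgLin x * r := by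
  cases nonempty_fintype P.weylGroup
  apply S.incl_injective
  rw [incl_avgLin, map_mul S.incl, incl_avgLin, finsum_eq_sum_of_fintype,
    finsum_eq_sum_of_fintype, smul_mul_assoc, Finset.sum_mul]
  simp only [S.act_mul, S.act_incl]

lemma avgLin_one : S.avgLin 1 = 1 := by
  cases nonempty_fintype P.weylGroup
  apply S.incl_injective
  rw [incl_avgLin, finsum_eq_sum_of_fintype, Finset.sum_congr rfl fun w _ => S.act_one w,
    Finset.sum_const, Finset.card_univ, ← Nat.cast_smul_eq_nsmul ℂ, smul_smul,
    Nat.card_eq_fintype_card,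
    inv_mul_cancel₀ (Nat.cast_ne_zero.mpr Fintype.card_ne_zero), one_smul, map_one]

variable {L : Type*} [AddCommGroup L] [Module ℂ L] (σ : R →ₐ[ℂ] Module.End ℂ L)

/-- The tensor product `X ⊗ L` over `R`. -/
abbrev Tensor : Type _ := BalancedTensor S.incl σ

/-- The operator on `X ⊗ L` induced by an operator on `X`. -/
def mapLeft (F : X →ₗ[ℂ] X) (hF : ∀ D r, F (D * S.incl r) = F D * S.incl r) :
    Module.End ℂ (S.Tensor σ) :=
  BalancedTensor.lift S.incl σ ((BalancedTensor.mk S.incl σ) ∘ₗ F) fun D r l => by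
    change BalancedTensor.mk S.incl σ (F (D * S.incl r)) l = _
    rw [hF]
    exact BalancedTensor.mk_mul S.incl σ _ r l

lemma mapLeft_mk (F : X →ₗ[ℂ] X) (hF : ∀ D r, F (D * S.incl r) = F D * S.incl r)
    (D : X) (l : L) : S.mapLeft σ F hF (BalancedTensor.mk S.incl σ D l) = BalancedTensor.mk S.incl σ (F D) l :=
  rfl

/-- The action of `X` on `X ⊗ L`. -/
def leftMul : X →ₐ[ℂ] Module.End ℂ (S.Tensor σ) where
  toFun D := S.mapLeft σ (LinearMap.mulLeft ℂ D) fun E r => by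
    rw [LinearMap.mulLeft_apply, LinearMap.mulLeft_apply, mul_assoc]
  map_one' := BalancedTensor.hom_ext fun E l => by
    rw [mapLeft_mk, LinearMap.mulLeft_apply, one_mul, Module.End.one_apply]
  map_mul' D D' := BalancedTensor.hom_ext fun E l => by
    rw [mapLeft_mk, Module.End.mul_apply, mapLeft_mk, mapLeft_mk, LinearMap.mulLeft_apply,
      LinearMap.mulLeft_apply, LinearMap.mulLeft_apply, mul_assoc]
  map_zero' := BalancedTensor.hom_ext fun E l => by
    rw [mapLeft_mk, LinearMap.mulLeft_apply, zero_mul, map_zero]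
    rfl
  map_add' D D' := BalancedTensor.hom_ext fun E l => by
    rw [mapLeft_mk, LinearMap.add_apply, mapLeft_mk, mapLeft_mk, LinearMap.mulLeft_apply,
      LinearMap.mulLeft_apply, LinearMap.mulLeft_apply, add_mul, map_add, LinearMap.add_apply]
  commutes' c := BalancedTensor.hom_ext fun E l => by
    rw [mapLeft_mk, LinearMap.mulLeft_apply, ← Algebra.smul_def, map_smul,
      Module.algebraMap_end_apply, LinearMap.smul_apply]

lemma leftMul_mk (D E : X) (l : L) :
    S.leftMul σ D (BalancedTensor.mk S.incl σ E l) = BalancedTensor.mk S.incl σ (D * E) l := rfl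

/-- The action of the Weyl group on `X ⊗ L`. -/
def weylTensor : P.weylGroup →* Module.End ℂ (S.Tensor σ) where
  toFun w := S.mapLeft σ (S.act w) fun D r => by rw [S.act_mul, S.act_incl]
  map_one' := BalancedTensor.hom_ext fun E l => by
    rw [mapLeft_mk, map_one]
    rfl
  map_mul' v w := BalancedTensor.hom_ext fun E l => by
    rw [mapLeft_mk, Module.End.mul_apply, mapLeft_mk, mapLeft_mk, map_mul]
    rfl

lemma weylTensor_mk (w : P.weylGroup) (E : X) (l : L) :
    S.weylTensor σ w (BalancedTensor.mk S.incl σ E l) = BalancedTensor.mk S.incl σ (S.act w E) l := rfl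

lemma weylTensor_leftMul (w : P.weylGroup) (D : X) :
    S.leftMul σ (S.act w D) * S.weylTensor σ w = S.weylTensor σ w * S.leftMul σ D :=
  BalancedTensor.hom_ext fun E l => by
    rw [Module.End.mul_apply, Module.End.mul_apply, leftMul_mk, weylTensor_mk, weylTensor_mk,
      leftMul_mk, S.act_mul]

/-- The action of `W ⋉ 𝒟_ħ(T)` on `X ⊗ L`. -/
def tensorRep : WDhT P →ₐ[ℂ] Module.End ℂ (S.Tensor σ) :=
  SkewMonoidAlgebra.liftNCAlgHom ((S.leftMul σ).comp S.spec) (S.weylTensor σ) fun {x w} => by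
    change S.leftMul σ (S.spec (w • x)) * _ = _ * S.leftMul σ (S.spec x)
    rw [S.spec_smul, weylTensor_leftMul]

lemma tensorRep_single (w : P.weylGroup) (x : DhT P) :
    S.tensorRep σ (SkewMonoidAlgebra.single w x) = S.leftMul σ (S.spec x) * S.weylTensor σ w :=
  SkewMonoidAlgebra.liftNC_single _ _ _ _

lemma tensorRep_diffA (x : DhT P) : S.tensorRep σ (diffA P x) = S.leftMul σ (S.spec x) :=
  (S.tensorRep_single σ 1 x).trans (by rw [map_one, mul_one])

lemma tensorRep_weylA (w : P.weylGroup) : S.tensorRep σ (weylA P w) = S.weylTensor σ w :=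
  (S.tensorRep_single σ w 1).trans (by rw [map_one, map_one, one_mul])

/-- The projection `X ⊗ L → L`. -/
def tensorProj : S.Tensor σ →ₗ[ℂ] L :=
  BalancedTensor.lift S.incl σ (σ.toLinearMap ∘ₗ S.avgLin) fun D r l => by
    change σ (S.avgLin (D * S.incl r)) l = σ (S.avgLin D) (σ r l)
    rw [avgLin_mul, map_mul, Module.End.mul_apply]

lemma tensorProj_mk (D : X) (l : L) :
    S.tensorProj σ (BalancedTensor.mk S.incl σ D l) = σ (S.avgLin D) l := rfl

lemma mk_incl (r : R) (l : L) : BalancedTensor.mk S.incl σ (S.incl r) l =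
    BalancedTensor.mk S.incl σ 1 (σ r l) := by
  rw [← BalancedTensor.mk_mul, one_mul]

lemma tensorProj_one (l : L) : S.tensorProj σ (BalancedTensor.mk S.incl σ 1 l) = l := by
  rw [tensorProj_mk, avgLin_one, map_one, Module.End.one_apply]

/-- The average of `D` lies in `R` and moves across the tensor sign. Hence the invariants of `X ⊗ L`
are exactly `1 ⊗ L`, a copy of `L`. -/
lemma symmetrizer_weylTensor (t : S.Tensor σ) :
    symmetrizer (S.weylTensor σ) t = BalancedTensor.mk S.incl σ 1 (S.tensorProj σ t) := by
  cases nonempty_fintype P.weylGroup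
  induction t using BalancedTensor.induction with
  | mk D l =>
    rw [tensorProj_mk, ← mk_incl, incl_avgLin, symmetrizer, finsum_eq_sum_of_fintype,
      finsum_eq_sum_of_fintype, LinearMap.smul_apply, LinearMap.sum_apply, map_smul, map_sum,
      LinearMap.smul_apply, LinearMap.sum_apply]
    rfl
  | add s t hs ht => rw [map_add, map_add, map_add, hs, ht]

lemma mk_one_mem_invariants (l : L) :
    BalancedTensor.mk S.incl σ 1 l ∈ invariants P (S.tensorRep σ) := fun w => by
  rw [tensorRep_weylA, weylTensor_mk]
  congr 2
  exact S.act_one w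

lemma eq_mk_of_mem_invariants {t : S.Tensor σ}
    (ht : t ∈ invariants P (S.tensorRep σ)) : BalancedTensor.mk S.incl σ 1 (S.tensorProj σ t) = t := by
  rw [← symmetrizer_weylTensor]
  refine symmetrizer_apply_eq (S.weylTensor σ) (AlgHom.id ℂ _) fun w => ?_
  rw [AlgHom.id_apply, ← tensorRep_weylA]
  exact ht w

lemma tensorRep_symA (p : SymmetricAlgebra ℂ 𝔱) : S.tensorRep σ (symA P p) = S.leftMul σ (S.spec (symDh P p)) :=
  S.tensorRep_diffA σ _

/-- The spherical map is the natural map of `X ⊗ L`. -/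
lemma naturalMap_tensorRep_bijective_iff :
    Function.Bijective (naturalMap P (S.tensorRep σ)) ↔ Function.Bijective (BalancedTensor.map (symInv P).val S.incl
        (S.spec.comp (symDh P)) S.sym S.sym_spec σ) := by
  -- `F` and `G` are induced by the mutually inverse maps `l ↦ 1 ⊗ l` and the projection between `L`
  -- and the invariants.
  let F : BalancedTensor (symInv P).val (σ.comp (S.sym)) →ₗ[ℂ]
      BalancedTensor (symInv P).val (invariantsAct P (S.tensorRep σ)) :=
    BalancedTensor.lift _ _ ((BalancedTensor.mk _ _).compl₂
      ((BalancedTensor.mk S.incl σ 1).codRestrict (invariants P (S.tensorRep σ))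
        (S.mk_one_mem_invariants σ))) fun p r l => by
      refine (BalancedTensor.mk_mul _ _ p r _).trans ?_
      refine congrArg (BalancedTensor.mk _ _ p) (Subtype.ext ?_)
      change S.tensorRep σ (symA P r) (BalancedTensor.mk S.incl σ 1 l) =
        BalancedTensor.mk S.incl σ 1 (σ (S.sym r) l)
      rw [tensorRep_symA, leftMul_mk, mul_one, S.sym_spec, mk_incl]
  let G : BalancedTensor (symInv P).val (invariantsAct P (S.tensorRep σ)) →ₗ[ℂ]
      BalancedTensor (symInv P).val (σ.comp (S.sym)) :=
    BalancedTensor.lift _ _ ((BalancedTensor.mk _ _).compl₂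
      (S.tensorProj σ ∘ₗ (invariants P (S.tensorRep σ)).subtype)) fun p r m => by
      refine (BalancedTensor.mk_mul _ _ p r _).trans ?_
      refine congrArg (BalancedTensor.mk _ _ p) ?_
      change σ (S.sym r) (S.tensorProj σ m) = S.tensorProj σ (S.tensorRep σ (symA P r) m)
      conv_rhs => rw [← S.eq_mk_of_mem_invariants σ m.2]
      rw [tensorRep_symA, leftMul_mk, mul_one, S.sym_spec, mk_incl, tensorProj_one]
  have hFG : F ∘ₗ G = LinearMap.id := BalancedTensor.hom_ext fun p m =>
    congrArg (BalancedTensor.mk _ _ p) (Subtype.ext (S.eq_mk_of_mem_invariants σ m.2))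
  have hGF : G ∘ₗ F = LinearMap.id := BalancedTensor.hom_ext fun p l =>
    congrArg (BalancedTensor.mk _ _ p) (S.tensorProj_one σ l)
  have hF : Function.Bijective F := Function.bijective_iff_has_inverse.mpr
    ⟨G, LinearMap.congr_fun hGF, LinearMap.congr_fun hFG⟩
  have h : naturalMap P (S.tensorRep σ) ∘ₗ F = BalancedTensor.map (symInv P).val S.incl
        (S.spec.comp (symDh P)) S.sym S.sym_spec σ :=
    BalancedTensor.hom_ext fun p l => by
      change S.tensorRep σ (symA P p) (BalancedTensor.mk S.incl σ 1 l) =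
        BalancedTensor.mk S.incl σ (S.spec (symDh P p)) l
      rw [tensorRep_symA, leftMul_mk, mul_one]
  rw [← h]
  exact (Function.Bijective.of_comp_iff (naturalMap P (S.tensorRep σ)) hF).symm

end InvariantSystem

end Spherical


/-! ### The symmetrizer generates the unit ideal of `W ⋉ 𝒟(T)` -/

section TorusIdeal

variable {ι V 𝔱 : Type*} [AddCommGroup V] [Module ℂ V] [AddCommGroup 𝔱] [Module ℂ 𝔱]
  {P : RootPairing ι ℂ V 𝔱}

lemma torusRing_ext {f g : TorusRing P} (h : ∀ μ, torusCoeff P μ f = torusCoeff P μ g) : f = g := by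
  have : ((AddMonoidAlgebra.coeffLinearEquiv ℂ :
      AddMonoidAlgebra ℂ (weightLattice P) ≃ₗ[ℂ] _) f) =
      ((AddMonoidAlgebra.coeffLinearEquiv ℂ : AddMonoidAlgebra ℂ (weightLattice P) ≃ₗ[ℂ] _) g) :=
    Finsupp.ext h
  exact (AddMonoidAlgebra.coeffLinearEquiv ℂ).injective this

lemma exists_finset_torusCoeff (f : TorusRing P) :
    ∃ s : Finset (weightLattice P), ∀ μ ∉ s, torusCoeff P μ f = 0 := by
  classical
  induction f using torusRing_induction with
  | zero => exact ⟨∅, fun μ _ => map_zero _⟩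
  | add x y hx hy =>
    obtain ⟨s, hs⟩ := hx
    obtain ⟨t, ht⟩ := hy
    refine ⟨s ∪ t, fun μ hμ => ?_⟩
    rw [Finset.mem_union, not_or] at hμ
    rw [map_add, hs μ hμ.1, ht μ hμ.2, add_zero]
  | single m r =>
    refine ⟨{m}, fun μ hμ => ?_⟩
    rw [torusCoeff_charMonomial, Finsupp.single_apply, if_neg]
    exact fun h => hμ (Finset.mem_singleton.mpr h.symm)

lemma torusCoeff_vectorField (μ : weightLattice P) (ξ : 𝔱) (f : TorusRing P) :
    torusCoeff P μ (vectorField P ξ f) = P.toLinearMap (μ : V) ξ * torusCoeff P μ f := by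
  classical
  induction f using torusRing_induction with
  | zero => simp
  | add x y hx hy => rw [map_add, map_add, map_add, hx, hy, mul_add]
  | single m r =>
    rw [vectorField_single, map_smul, torusCoeff_charMonomial, Finsupp.single_apply, smul_eq_mul]
    split_ifs with h
    · rw [h]
    · rw [mul_zero, mul_zero]

/-- `ℂ[T]` has no proper nonzero ideal stable under the invariant vector fields. -/
lemma one_mem_of_vectorField [P.IsRootSystem] (I : Ideal (TorusRing P))
    (hI : ∀ ξ, ∀ f ∈ I, vectorField P ξ f ∈ I)
    {f : TorusRing P} (hf : f ∈ I) (hf0 : f ≠ 0) : (1 : TorusRing P) ∈ I := by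
  classical
  have key : ∀ (s : Finset (weightLattice P)) (f : TorusRing P), f ∈ I → f ≠ 0 →
      (∀ μ ∉ s, torusCoeff P μ f = 0) → (1 : TorusRing P) ∈ I := by
    intro s
    induction s using Finset.strongInduction with
    | H s ih =>
      intro f hf hf0 hs
      obtain ⟨ν, hν⟩ : ∃ ν, torusCoeff P ν f ≠ 0 := by
        by_contra! h
        exact hf0 (torusRing_ext fun μ => (h μ).trans (map_zero _).symm)
      -- While two characters occur, `∂_ξ - ⟨μ, ξ⟩` with `ξ` separating them removes `μ` and keeps
      -- `ν`. A single remaining term is a unit.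
      by_cases h : ∃ μ, μ ≠ ν ∧ torusCoeff P μ f ≠ 0
      · obtain ⟨μ, hμν, hμ⟩ := h
        obtain ⟨ξ, hξ⟩ : ∃ ξ, P.toLinearMap (ν : V) ξ ≠ P.toLinearMap (μ : V) ξ := by
          by_contra! h
          exact hμν (Subtype.ext (P.toPerfPair.injective (LinearMap.ext h)).symm)
        have hc : ∀ κ, torusCoeff P κ (vectorField P ξ f - P.toLinearMap (μ : V) ξ • f) =
            (P.toLinearMap (κ : V) ξ - P.toLinearMap (μ : V) ξ) * torusCoeff P κ f := fun κ => by
          rw [map_sub, torusCoeff_vectorField, map_smul, smul_eq_mul, sub_mul]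
        have hμs : μ ∈ s := by
          by_contra h
          exact hμ (hs μ h)
        have hsmul : P.toLinearMap (μ : V) ξ • f ∈ I := by
          rw [Algebra.smul_def]
          exact I.mul_mem_left _ hf
        refine ih (s.erase μ) (Finset.erase_ssubset hμs) _
          (sub_mem (hI ξ f hf) hsmul) (fun h0 => ?_) fun κ hκ => ?_
        · have := hc ν
          rw [h0, map_zero] at this
          exact mul_ne_zero (sub_ne_zero.mpr hξ) hν this.symm
        · rw [hc]
          by_cases hκμ : κ = μ
          · rw [hκμ, sub_self, zero_mul]
          · rw [hs κ fun h => hκ (Finset.mem_erase.mpr ⟨hκμ, h⟩), mul_zero]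
      · push Not at h
        have hfν : f = charMonomial P ν (torusCoeff P ν f) := torusRing_ext fun μ => by
          rw [torusCoeff_charMonomial, Finsupp.single_apply]
          split_ifs with hμ
          · rw [hμ]
          · exact h μ fun h => hμ h.symm
        have h1 : charMonomial P (-ν) (torusCoeff P ν f)⁻¹ * f = 1 := by
          conv_lhs => enter [2]; rw [hfν]
          rw [charMonomial_mul, neg_add_cancel, inv_mul_cancel₀ hν]
          rfl
        rw [← h1]
        exact I.mul_mem_left _ hf
  obtain ⟨s, hs⟩ := exists_finset_torusCoeff f
  exact key s f hf hf0 hs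

/-- A subgroup of a rational vector space has the unique sums property, so its group algebra is a
domain. -/
instance : NoZeroDivisors (TorusRing P) := by
  have h1 : TwoUniqueSums V := by
    let _ : Module ℚ V := Module.compHom V (algebraMap ℚ ℂ)
    infer_instance
  have h2 : TwoUniqueSums (weightLattice P) :=
    TwoUniqueSums.of_injective_addHom (weightLattice P).subtype.toAddHom
      (weightLattice P).subtype_injective h1
  exact inferInstanceAs (NoZeroDivisors (AddMonoidAlgebra ℂ (weightLattice P)))

lemma exists_weightAct_ne [P.IsRootSystem] [P.IsCrystallographic] {w : P.weylGroup} (hw : w ≠ 1) :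
    ∃ μ, weightAct P w μ ≠ μ := by
  by_contra! h
  refine hw (Subtype.ext (RootPairing.Equiv.weightHom_injective P (LinearEquiv.ext fun x => ?_)))
  change w • x = x
  have hx : x ∈ Submodule.span ℂ (Set.range P.root) := by simp
  induction hx using Submodule.span_induction with
  | mem x hx =>
    obtain ⟨i, rfl⟩ := hx
    exact congrArg Subtype.val (h (rootWeight P i))
  | zero => simp
  | add x y _ _ hx hy => rw [smul_add, hx, hy]
  | smul c x _ hx => rw [smul_comm, hx]

lemma character_injective : Function.Injective (character P) := fun μ ν h => by
  classical
  have := congrArg (torusCoeff P μ) h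
  rw [character, character, torusCoeff_charMonomial, torusCoeff_charMonomial,
    Finsupp.single_eq_same, Finsupp.single_apply] at this
  by_contra hne
  rw [if_neg fun h => hne h.symm] at this
  exact one_ne_zero this

/-- The two-sided ideal generated by the symmetrizer in `W ⋉ 𝒟(T)` is the whole algebra. -/
lemma one_mem_of_symmetrizer_mem [Finite ι] [P.IsRootSystem] [P.IsCrystallographic]
    {C : Type*} [Ring C] [Algebra ℂ C]
    (F : TorusRing P →ₐ[ℂ] C) (u : P.weylGroup →* C) (X : 𝔱 → C)
    (hu : ∀ w f, u w * F f = F (torusAct P w f) * u w)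
    (hX : ∀ ξ f, X ξ * F f - F f * X ξ = F (vectorField P ξ f))
    (J : Submodule ℂ C) (hl : ∀ c, ∀ x ∈ J, c * x ∈ J) (hF : ∀ f, ∀ x ∈ J, x * F f ∈ J)
    (hJX : ∀ ξ, ∀ x ∈ J, x * X ξ ∈ J) (he : symmetrizer u ∈ J) : (1 : C) ∈ J := by
  classical
  cases nonempty_fintype P.weylGroup
  have key : ∀ s : Finset P.weylGroup, 1 ∉ s → ∃ g : P.weylGroup → TorusRing P, g 1 ≠ 0 ∧
      (∀ v ∈ s, g v = 0) ∧ ∑ w, F (g w) * u w ∈ J := by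
    intro s
    induction s using Finset.induction with
    | empty =>
      intro _
      refine ⟨fun _ => algebraMap ℂ _ (Nat.card P.weylGroup : ℂ)⁻¹, fun h => ?_, by simp, ?_⟩
      · have h2 := congrArg (torusCoeff P 0) h
        rw [Algebra.algebraMap_eq_smul_one, ← character_zero, character, map_smul,
          torusCoeff_charMonomial, Finsupp.single_eq_same, smul_eq_mul, mul_one, map_zero] at h2
        exact inv_ne_zero (Nat.cast_ne_zero.mpr Nat.card_pos.ne') h2
      · convert he using 1
        rw [symmetrizer, finsum_eq_sum_of_fintype, Finset.smul_sum]
        exact Finset.sum_congr rfl fun w _ => by rw [AlgHom.commutes, ← Algebra.smul_def]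
    | insert v s hv ih =>
      intro h1
      rw [Finset.mem_insert, not_or] at h1
      obtain ⟨g, hg1, hg, hgJ⟩ := ih h1.2
      obtain ⟨μ, hμ⟩ := exists_weightAct_ne (Ne.symm h1.1)
      -- Replacing `x` by `t^{vμ} x - x t^μ` multiplies the coefficient of `w` by `t^{vμ} - t^{wμ}`.
      -- This kills the coefficient of `v`; that of `1` stays nonzero because `vμ ≠ μ` and `ℂ[T]` is
      -- a domain.
      refine ⟨fun w => (character P (weightAct P v μ) - character P (weightAct P w μ)) * g w,
        mul_ne_zero (sub_ne_zero.mpr fun h => hμ ?_) hg1, fun w hw => ?_, ?_⟩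
      · rw [character_injective h]
        exact Subtype.ext (one_smul P.weylGroup (μ : V))
      · rcases Finset.mem_insert.mp hw with rfl | hw
        · simp only [sub_self, zero_mul]
        · simp only [hg w hw, mul_zero]
      · convert sub_mem (hl (F (character P (weightAct P v μ))) _ hgJ)
          (hF (character P μ) _ hgJ) using 1
        rw [Finset.mul_sum, Finset.sum_mul, ← Finset.sum_sub_distrib]
        refine Finset.sum_congr rfl fun w _ => ?_
        have h2 : u w * F (character P μ) = F (character P (weightAct P w μ)) * u w := by
          rw [hu, character, torusAct_single, character]
        beta_reduce
        rw [mul_assoc (F (g w)), h2, sub_mul, map_sub, sub_mul, map_mul, mul_assoc,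
          mul_comm _ (g w), map_mul, mul_assoc]
  obtain ⟨g, hg1, hg, hgJ⟩ := key (Finset.univ.erase 1) (by simp)
  rw [Finset.sum_eq_single 1 (fun w _ hw => by
    rw [hg w (Finset.mem_erase.mpr ⟨hw, Finset.mem_univ w⟩), map_zero, zero_mul]) (by simp),
    map_one, mul_one] at hgJ
  -- Only a nonzero function is left. The functions in `J` form an ideal stable under the vector
  -- fields, by commutators.
  let I : Ideal (TorusRing P) :=
    { carrier := {f | F f ∈ J}
      add_mem' := fun {x y} hx hy => by
        rw [Set.mem_ofPred_eq, map_add]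
        exact add_mem hx hy
      zero_mem' := by
        rw [Set.mem_ofPred_eq, map_zero]
        exact zero_mem _
      smul_mem' := fun c x hx => by
        rw [Set.mem_ofPred_eq, smul_eq_mul, map_mul]
        exact hl _ _ hx }
  have h1 : (1 : TorusRing P) ∈ I := one_mem_of_vectorField I (fun ξ f hf => by
    change F (vectorField P ξ f) ∈ J
    rw [← hX]
    exact sub_mem (hl _ _ hf) (hJX _ _ hf)) (f := g 1) hgJ hg1
  have h2 : F 1 ∈ J := h1
  rwa [map_one] at h2

end TorusIdeal


/-! ### Separation of points by projections, and actions built from the corner `e B e` -/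

section Multiplication

variable {ι V 𝔱 : Type*} [AddCommGroup V] [Module ℂ V] [AddCommGroup 𝔱] [Module ℂ 𝔱]
  (P : RootPairing ι ℂ V 𝔱)

/-- The embedding `ℂ[T] → 𝒟_ħ(T)`. -/
def mulDh : TorusRing P →ₐ[ℂ] DhT P :=
  ((Polynomial.CAlgHom : Module.End ℂ (TorusRing P) →ₐ[ℂ] _).comp
    (Algebra.lmul ℂ (TorusRing P))).codRestrict (DhT P) fun f =>
      monomial_mem_reesDiffOps (mulLeft_mem_diffOrder f 0)

lemma mulDh_coe (f : TorusRing P) : (mulDh P f : Polynomial (Module.End ℂ (TorusRing P))) =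
    Polynomial.monomial 0 (LinearMap.mulLeft ℂ f) := rfl

lemma weyl_smul_mulDh (w : P.weylGroup) (f : TorusRing P) :
    w • mulDh P f = mulDh P (torusAct P w f) := by
  refine reesDiffOps_ext P fun n => ?_
  rw [weyl_smul_def, reesConj_coeff, mulDh_coe, mulDh_coe, Polynomial.coeff_monomial,
    Polynomial.coeff_monomial]
  split_ifs
  · exact conjAct_mulLeft _ _
  · exact map_zero _

lemma fieldDh_mul_mulDh (ξ : 𝔱) (f : TorusRing P) : fieldDh P ξ * mulDh P f =
    mulDh P f * fieldDh P ξ + hbarDh P * mulDh P (vectorField P ξ f) := by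
  refine Subtype.ext ?_
  have h : vectorField P ξ * LinearMap.mulLeft ℂ f =
      LinearMap.mulLeft ℂ f * vectorField P ξ + LinearMap.mulLeft ℂ (vectorField P ξ f) := by
    refine LinearMap.ext fun b => ?_
    simp only [Module.End.mul_apply, LinearMap.mulLeft_apply, vectorField_mul, LinearMap.add_apply]
    exact add_comm _ _
  change Polynomial.monomial 1 (vectorField P ξ) * Polynomial.monomial 0 (LinearMap.mulLeft ℂ f) =
    Polynomial.monomial 0 (LinearMap.mulLeft ℂ f) * Polynomial.monomial 1 (vectorField P ξ) +
      Polynomial.monomial 1 1 * Polynomial.monomial 0 (LinearMap.mulLeft ℂ (vectorField P ξ f))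
  rw [Polynomial.monomial_mul_monomial, Polynomial.monomial_mul_monomial,
    Polynomial.monomial_mul_monomial, h, one_mul, ← map_add]

end Multiplication

namespace InvariantSystem

variable {ι V 𝔱 : Type*} [AddCommGroup V] [Module ℂ V] [AddCommGroup 𝔱] [Module ℂ 𝔱]
  {P : RootPairing ι ℂ V 𝔱} [Finite ι] [P.IsRootSystem]
  {X R : Type*} [Ring X] [Algebra ℂ X] [Semiring R] [Algebra ℂ R] (S : InvariantSystem P X R)
  {L : Type*} [AddCommGroup L] [Module ℂ L] (σ : R →ₐ[ℂ] Module.End ℂ L)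

/-- The elements of the tensor product are separated by the projections of their translates. -/
lemma eq_zero_of_tensorProj [P.IsCrystallographic] {t : S.Tensor σ}
    (h : ∀ z, S.tensorProj σ (S.tensorRep σ z t) = 0) : t = 0 := by
  -- The operators that kill all translates of `t` form a left ideal stable on the right under `W ⋉
  -- 𝒟_ħ(T)`. It contains the symmetrizer, because `e z t = 1 ⊗` the projection of `z t`.
  let J : Submodule ℂ (Module.End ℂ (S.Tensor σ)) :=
    { carrier := {a | ∀ z, a (S.tensorRep σ z t) = 0}
      add_mem' := fun {a c} ha hc z => by rw [LinearMap.add_apply, ha z, hc z, add_zero]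
      zero_mem' := fun z => rfl
      smul_mem' := fun c a ha z => by rw [LinearMap.smul_apply, ha z, smul_zero] }
  have hr : ∀ a ∈ J, ∀ z, a * S.tensorRep σ z ∈ J := fun a ha z z' => by
    rw [Module.End.mul_apply, ← Module.End.mul_apply (S.tensorRep σ z), ← map_mul]
    exact ha _
  have h1 : (1 : Module.End ℂ (S.Tensor σ)) ∈ J := by
    refine one_mem_of_symmetrizer_mem (((S.tensorRep σ).comp (diffA P)).comp (mulDh P))
      (S.weylTensor σ) (fun ξ => S.tensorRep σ (diffA P (fieldDh P ξ))) (fun w f => ?_)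
      (fun ξ f => ?_) J (fun c a ha z => ?_) (fun f a ha => hr a ha _) (fun ξ a ha => hr a ha _)
      fun z => ?_
    · rw [← tensorRep_weylA]
      simp only [AlgHom.comp_apply]
      rw [← map_mul, ← map_mul, weylA_mul_diffA, weyl_smul_mulDh]
    · simp only [AlgHom.comp_apply]
      rw [← map_mul, ← map_mul, ← map_mul, ← map_mul, fieldDh_mul_mulDh, map_add, map_add,
        add_sub_cancel_left, tensorRep_diffA, map_mul S.spec, S.spec_hbar, one_mul,
        tensorRep_diffA]
    · rw [Module.End.mul_apply, ha z, map_zero]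
    · rw [symmetrizer_weylTensor, h, map_zero]
  have := h1 1
  rwa [map_one] at this

lemma eq_of_tensorProj [P.IsCrystallographic] {s t : S.Tensor σ}
    (h : ∀ z, S.tensorProj σ (S.tensorRep σ z s) = S.tensorProj σ (S.tensorRep σ z t)) : s = t :=
  sub_eq_zero.mp (S.eq_zero_of_tensorProj σ fun z => by rw [map_sub, map_sub, h, sub_self])

end InvariantSystem

/-- An algebra `B` over `W ⋉ X` in which the symmetrizer generates the unit ideal through elements
of `Sym 𝔱`. -/
structure SphericalSystem {ι V 𝔱 : Type*} [AddCommGroup V] [Module ℂ V] [AddCommGroup 𝔱]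
    [Module ℂ 𝔱] {P : RootPairing ι ℂ V 𝔱} {X R : Type*} [Ring X] [Algebra ℂ X]
    [Semiring R] [Algebra ℂ R] (S : InvariantSystem P X R) (B : Type*) [Semiring B]
    [Algebra ℂ B] where
  /-- the structure map -/
  hom : WDhT P →ₐ[ℂ] B
  /-- its factorization on `X` -/
  homX : X →ₐ[ℂ] B
  homX_spec : ∀ x, homX (S.spec x) = hom (diffA P x)
  /-- the Weyl group -/
  weyl : P.weylGroup →* B
  hom_weyl : ∀ w, hom (weylA P w) = weyl w
  /-- the number of dual elements -/
  num : ℕ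
  /-- elements of `Sym 𝔱` -/
  elt : Fin num → SymmetricAlgebra ℂ 𝔱
  /-- dual elements -/
  dual : Fin num → B
  sum_dual : ∑ j, hom (symA P (elt j)) * (symmetrizer weyl * dual j) = 1

namespace SphericalSystem

variable {ι V 𝔱 : Type*} [AddCommGroup V] [Module ℂ V] [AddCommGroup 𝔱] [Module ℂ 𝔱]
  {P : RootPairing ι ℂ V 𝔱} [Finite ι] [P.IsRootSystem]
  {X R : Type*} [Ring X] [Algebra ℂ X] [Semiring R] [Algebra ℂ R] {S : InvariantSystem P X R}
  {B : Type*} [Semiring B] [Algebra ℂ B] (N : SphericalSystem S B)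
  {L : Type*} [AddCommGroup L] [Module ℂ L] (σ : R →ₐ[ℂ] Module.End ℂ L)

/-- A representation of the spherical subalgebra, precomposed with `h ↦ e h e`, that extends `σ`. -/
structure IsSpherical (κ : B →ₗ[ℂ] Module.End ℂ L) : Prop where
  map_one : κ 1 = 1
  map_mul : ∀ h h', κ (h * symmetrizer N.weyl * h') = κ h * κ h'
  map_incl : ∀ r, κ (N.homX (S.incl r)) = σ r

lemma weyl_mul_homX (w : P.weylGroup) (x : X) :
    N.weyl w * N.homX x = N.homX (S.act w x) * N.weyl w := by
  obtain ⟨y, rfl⟩ := S.spec_surjective x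
  rw [← S.spec_smul, N.homX_spec, N.homX_spec, ← N.hom_weyl, ← map_mul, weylA_mul_diffA, map_mul]

lemma symmetrizer_mul_homX (r : R) :
    symmetrizer N.weyl * N.homX (S.incl r) = N.homX (S.incl r) * symmetrizer N.weyl := by
  cases nonempty_fintype P.weylGroup
  rw [symmetrizer, finsum_eq_sum_of_fintype, smul_mul_assoc, mul_smul_comm, Finset.sum_mul,
    Finset.mul_sum]
  congr 1
  refine Finset.sum_congr rfl fun w _ => ?_
  rw [weyl_mul_homX, S.act_incl]

variable {N σ} {κ : B →ₗ[ℂ] Module.End ℂ L}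

namespace IsSpherical

lemma mul_symmetrizer (hκ : N.IsSpherical σ κ) (h : B) : κ (h * symmetrizer N.weyl) = κ h := by
  rw [← mul_one (h * symmetrizer N.weyl), hκ.map_mul, hκ.map_one, mul_one]

lemma symmetrizer_mul (hκ : N.IsSpherical σ κ) (h : B) : κ (symmetrizer N.weyl * h) = κ h := by
  rw [← one_mul (symmetrizer N.weyl), hκ.map_mul, hκ.map_one, one_mul]

lemma weyl_mul (hκ : N.IsSpherical σ κ) (w : P.weylGroup) (h : B) : κ (N.weyl w * h) = κ h := by
  rw [← hκ.symmetrizer_mul, ← mul_assoc, NilDAHA.symmetrizer_mul, hκ.symmetrizer_mul]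

lemma mul_weyl (hκ : N.IsSpherical σ κ) (w : P.weylGroup) (h : B) : κ (h * N.weyl w) = κ h := by
  rw [← hκ.mul_symmetrizer, mul_assoc, NilDAHA.mul_symmetrizer, hκ.mul_symmetrizer]

lemma mul_incl (hκ : N.IsSpherical σ κ) (h : B) (r : R) :
    κ (h * N.homX (S.incl r)) = κ h * σ r := by
  rw [← hκ.mul_symmetrizer, mul_assoc, ← symmetrizer_mul_homX, ← mul_assoc, hκ.map_mul,
    hκ.map_incl]

lemma act (hκ : N.IsSpherical σ κ) (w : P.weylGroup) (x : X) :
    κ (N.homX (S.act w x)) = κ (N.homX x) := by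
  rw [← hκ.mul_weyl w, ← weyl_mul_homX, hκ.weyl_mul]

lemma avg (hκ : N.IsSpherical σ κ) (x : X) : σ (S.avgLin x) = κ (N.homX x) := by
  cases nonempty_fintype P.weylGroup
  rw [← hκ.map_incl, S.incl_avgLin, finsum_eq_sum_of_fintype, map_smul, map_sum, map_smul, map_sum,
    Finset.sum_congr rfl fun w _ => hκ.act w x, Finset.sum_const, Finset.card_univ,
    ← Nat.cast_smul_eq_nsmul ℂ, smul_smul, Nat.card_eq_fintype_card,
    inv_mul_cancel₀ (Nat.cast_ne_zero.mpr Fintype.card_ne_zero), one_smul]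

/-- Weyl group elements are absorbed on either side by `κ`, and on `X` it agrees with `σ` of the
average. -/
lemma tensorProj_tensorRep (hκ : N.IsSpherical σ κ) (z : WDhT P) (x : X) (l : L) :
    S.tensorProj σ (S.tensorRep σ z (BalancedTensor.mk S.incl σ x l)) =
      κ (N.hom z * N.homX x) l := by
  induction z using SkewMonoidAlgebra.induction_on with
  | zero => simp
  | single w y =>
    have h1 : (SkewMonoidAlgebra.single w y : WDhT P) = diffA P y * weylA P w := by
      change _ = SkewMonoidAlgebra.single 1 y * SkewMonoidAlgebra.single w 1
      simp [SkewMonoidAlgebra.single_mul_single]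
    rw [S.tensorRep_single, h1, _root_.map_mul N.hom, N.hom_weyl, mul_assoc, weyl_mul_homX, ← N.homX_spec,
      ← mul_assoc, hκ.mul_weyl, ← _root_.map_mul N.homX, ← hκ.avg]
    rfl
  | add y z hy hz =>
    rw [map_add, map_add, LinearMap.add_apply, map_add, hy, hz, add_mul, map_add,
      LinearMap.add_apply]

/-- The operator on `X ⊗ L` given by an element of `B`. -/
def op (hκ : N.IsSpherical σ κ) (h : B) : Module.End ℂ (S.Tensor σ) :=
  BalancedTensor.lift S.incl σ
    (∑ j, (LinearMap.compr₂ (κ ∘ₗ LinearMap.mulLeft ℂ (N.dual j * h) ∘ₗ N.homX.toLinearMap)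
      (BalancedTensor.mk S.incl σ (S.spec (symDh P (N.elt j)))))) fun x r l => by
    simp only [LinearMap.sum_apply, LinearMap.compr₂_apply, LinearMap.comp_apply,
      AlgHom.toLinearMap_apply, LinearMap.mulLeft_apply]
    refine Finset.sum_congr rfl fun j _ => ?_
    rw [_root_.map_mul N.homX, ← mul_assoc, hκ.mul_incl, Module.End.mul_apply]

lemma op_mk (hκ : N.IsSpherical σ κ) (h : B) (x : X) (l : L) :
    hκ.op h (BalancedTensor.mk S.incl σ x l) = ∑ j, BalancedTensor.mk S.incl σ
      (S.spec (symDh P (N.elt j))) (κ (N.dual j * h * N.homX x) l) := by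
  rw [op, BalancedTensor.lift_mk, LinearMap.sum_apply, LinearMap.sum_apply]
  rfl

/-- Insertion of `1 = ∑ u_j e y_j` between `h` and `h'`, with `κ` multiplicative across `e`. -/
lemma sum_mul (hκ : N.IsSpherical σ κ) (h h' : B) :
    ∑ j, κ (h * N.homX (S.spec (symDh P (N.elt j)))) * κ (N.dual j * h') = κ (h * h') := by
  have h1 : h * h' = ∑ j, h * N.homX (S.spec (symDh P (N.elt j))) * symmetrizer N.weyl *
      (N.dual j * h') := by
    conv_lhs => rw [← one_mul h', ← N.sum_dual, Finset.sum_mul, Finset.mul_sum]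
    refine Finset.sum_congr rfl fun j _ => ?_
    rw [N.homX_spec]
    simp only [mul_assoc]
    rfl
  rw [h1, map_sum]
  exact Finset.sum_congr rfl fun j _ => (hκ.map_mul _ _).symm

/-- The projection of `z · h · (x ⊗ l)` depends on the product `z h x` in `B` only. Since
projections of translates separate points, the axioms of an action of `B` reduce to associativity in
`B`. -/
lemma tensorProj_op (hκ : N.IsSpherical σ κ) (z : WDhT P) (h : B) (x : X) (l : L) :
    S.tensorProj σ (S.tensorRep σ z (hκ.op h (BalancedTensor.mk S.incl σ x l))) =
      κ (N.hom z * h * N.homX x) l := by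
  rw [op_mk, map_sum, map_sum, mul_assoc, ← hκ.sum_mul, LinearMap.sum_apply]
  refine Finset.sum_congr rfl fun j _ => ?_
  rw [hκ.tensorProj_tensorRep, Module.End.mul_apply, mul_assoc (N.dual j)]

lemma tensorProj_op_op (hκ : N.IsSpherical σ κ) (z : WDhT P) (h h' : B) (x : X) (l : L) :
    S.tensorProj σ (S.tensorRep σ z (hκ.op h (hκ.op h' (BalancedTensor.mk S.incl σ x l)))) =
      κ (N.hom z * (h * h') * N.homX x) l := by
  rw [op_mk, map_sum, map_sum, map_sum, mul_assoc, mul_assoc h, ← mul_assoc, ← hκ.sum_mul,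
    LinearMap.sum_apply]
  refine Finset.sum_congr rfl fun j _ => ?_
  rw [hκ.tensorProj_op, Module.End.mul_apply, mul_assoc (N.dual j)]

variable [P.IsCrystallographic]

lemma op_ext {s t : Module.End ℂ (S.Tensor σ)}
    (h : ∀ z x l, S.tensorProj σ (S.tensorRep σ z (s (BalancedTensor.mk S.incl σ x l))) =
      S.tensorProj σ (S.tensorRep σ z (t (BalancedTensor.mk S.incl σ x l)))) : s = t :=
  BalancedTensor.hom_ext fun x l => S.eq_of_tensorProj σ fun z => h z x l

/-- The action of `B` on `X ⊗ L`. -/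
def rep (hκ : N.IsSpherical σ κ) : B →ₐ[ℂ] Module.End ℂ (S.Tensor σ) where
  toFun := hκ.op
  map_one' := op_ext fun z x l => by
    rw [hκ.tensorProj_op, mul_one, Module.End.one_apply, hκ.tensorProj_tensorRep]
  map_mul' h h' := op_ext fun z x l => by
    rw [hκ.tensorProj_op, Module.End.mul_apply, hκ.tensorProj_op_op]
  map_zero' := op_ext fun z x l => by
    rw [hκ.tensorProj_op, mul_zero, zero_mul, map_zero]
    simp
  map_add' h h' := op_ext fun z x l => by
    rw [hκ.tensorProj_op, LinearMap.add_apply, map_add, map_add, hκ.tensorProj_op,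
      hκ.tensorProj_op, mul_add, add_mul, map_add, LinearMap.add_apply]
  commutes' c := op_ext fun z x l => by
    rw [hκ.tensorProj_op, Algebra.algebraMap_eq_smul_one, mul_smul_comm, mul_one, smul_mul_assoc,
      map_smul, LinearMap.smul_apply, Module.algebraMap_end_apply, map_smul, map_smul,
      hκ.tensorProj_tensorRep]

lemma rep_comp (hκ : N.IsSpherical σ κ) : hκ.rep.comp N.hom = S.tensorRep σ :=
  AlgHom.ext fun y => op_ext fun z x l => by
    rw [← Module.End.mul_apply (S.tensorRep σ z) (S.tensorRep σ y), ← _root_.map_mul,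
      hκ.tensorProj_tensorRep, _root_.map_mul N.hom]
    exact hκ.tensorProj_op _ _ _ _

lemma tensorProj_rep (hκ : N.IsSpherical σ κ) (h : B) (l : L) :
    S.tensorProj σ (hκ.rep h (BalancedTensor.mk S.incl σ 1 l)) = κ h l := by
  have := hκ.tensorProj_op 1 h 1 l
  rwa [_root_.map_one, _root_.map_one N.hom, one_mul, _root_.map_one N.homX, mul_one,
    Module.End.one_apply] at this

end IsSpherical

/-- Take `κ(h) l` to be the projection of `h (1 ⊗ l)`. It is multiplicative across `e` because `e t`
equals `1 ⊗` the projection of `t`. -/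
lemma exists_isSpherical (N : SphericalSystem S B) (σ : R →ₐ[ℂ] Module.End ℂ L)
    (φ : B →ₐ[ℂ] Module.End ℂ (S.Tensor σ)) (hφ : φ.comp N.hom = S.tensorRep σ) :
    ∃ κ, N.IsSpherical σ κ := by
  have hw : ∀ w, φ (N.weyl w) = S.weylTensor σ w := fun w => by
    rw [← N.hom_weyl, ← S.tensorRep_weylA, ← hφ]
    rfl
  have he : ∀ t, φ (symmetrizer N.weyl) t = BalancedTensor.mk S.incl σ 1 (S.tensorProj σ t) :=
    fun t => by
      rw [← S.symmetrizer_weylTensor, map_symmetrizer]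
      congr 2
      exact MonoidHom.ext hw
  have hX : ∀ x l, φ (N.homX x) (BalancedTensor.mk S.incl σ 1 l) = BalancedTensor.mk S.incl σ x l :=
    fun x l => by
      obtain ⟨y, rfl⟩ := S.spec_surjective x
      have := LinearMap.congr_fun (AlgHom.congr_fun hφ (diffA P y)) (BalancedTensor.mk S.incl σ 1 l)
      rw [S.tensorRep_diffA, S.leftMul_mk, mul_one] at this
      rw [N.homX_spec]
      exact this
  refine ⟨{ toFun := fun h => S.tensorProj σ ∘ₗ φ h ∘ₗ BalancedTensor.mk S.incl σ 1
            map_add' := fun h h' => by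
              refine LinearMap.ext fun l => ?_
              simp only [LinearMap.comp_apply, map_add, LinearMap.add_apply]
            map_smul' := fun c h => by
              refine LinearMap.ext fun l => ?_
              simp only [LinearMap.comp_apply, map_smul, LinearMap.smul_apply, RingHom.id_apply] },
    LinearMap.ext fun l => ?_, fun h h' => LinearMap.ext fun l => ?_,
    fun r => LinearMap.ext fun l => ?_⟩
  · change S.tensorProj σ (φ 1 _) = l
    rw [map_one, Module.End.one_apply, S.tensorProj_one]
  · change S.tensorProj σ (φ _ _) = S.tensorProj σ (φ h (BalancedTensor.mk S.incl σ 1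
      (S.tensorProj σ (φ h' _))))
    rw [← he, map_mul, map_mul, Module.End.mul_apply, Module.End.mul_apply]
  · change S.tensorProj σ (φ _ _) = _
    rw [hX, S.mk_incl, S.tensorProj_one]

end SphericalSystem


/-! ### A module of functions on `W̃` with `ħ = 1` -/

section Evaluation

variable {ι V 𝔱 : Type*} [AddCommGroup V] [Module ℂ V] [AddCommGroup 𝔱] [Module ℂ 𝔱]
  (P : RootPairing ι ℂ V 𝔱)

/-- Evaluation at the point `(μ, 1)` of `𝔱* × ℂ`. -/
def evPoint (μ : V) : SymAff 𝔱 →ₐ[ℂ] ℂ :=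
  SymmetricAlgebra.lift ((P.toLinearMap μ).coprod LinearMap.id)

lemma evPoint_ι (μ : V) (x : 𝔱 × ℂ) :
    evPoint P μ (SymmetricAlgebra.ι ℂ _ x) = P.toLinearMap μ x.1 + x.2 := by
  simp [evPoint]

variable (𝔱) in
/-- The specialization `ħ = 1` of `Sym 𝔱_aff`. -/
def symOne : SymAff 𝔱 →ₐ[ℂ] SymmetricAlgebra ℂ 𝔱 :=
  SymmetricAlgebra.lift ((SymmetricAlgebra.ι ℂ 𝔱).coprod (Algebra.linearMap ℂ _))

lemma symOne_ι (x : 𝔱 × ℂ) : symOne 𝔱 (SymmetricAlgebra.ι ℂ _ x) =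
    SymmetricAlgebra.ι ℂ 𝔱 x.1 + algebraMap ℂ _ x.2 := by
  simp [symOne]

lemma evPoint_symOne (μ : V) (p : SymAff 𝔱) :
    evPoint P μ (symIncl 𝔱 (symOne 𝔱 p)) = evPoint P μ p := by
  have : ((evPoint P μ).comp (symIncl 𝔱)).comp (symOne 𝔱) = evPoint P μ := by
    refine SymmetricAlgebra.algHom_ext (LinearMap.ext fun x => ?_)
    change evPoint P μ (symIncl 𝔱 (symOne 𝔱 (SymmetricAlgebra.ι ℂ _ x))) =
      evPoint P μ (SymmetricAlgebra.ι ℂ _ x)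
    rw [symOne_ι, map_add, map_add, AlgHom.commutes, AlgHom.commutes, symIncl_ι, evPoint_ι,
      evPoint_ι, add_zero]
    rfl
  exact DFunLike.congr_fun this p

lemma evPoint_translation (μ ν : weightLattice P) (p : SymAff 𝔱) :
    evPoint P (ν : V) ((translation P μ)⁻¹ • p) = evPoint P ((ν + μ : weightLattice P) : V) p := by
  have : (evPoint P (ν : V)).comp (symAffAct P (translation P μ)⁻¹) =
      evPoint P ((ν + μ : weightLattice P) : V) := by
    refine SymmetricAlgebra.algHom_ext (LinearMap.ext fun x => ?_)
    change evPoint P (ν : V) (symAffAct P _ (SymmetricAlgebra.ι ℂ _ x)) =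
      evPoint P _ (SymmetricAlgebra.ι ℂ _ x)
    have h : (translation P μ)⁻¹ = translation P (-μ) := (map_inv SemidirectProduct.inl _).symm
    rw [symAffAct_ι, evPoint_ι, evPoint_ι, h, affineRep_apply]
    have h2 : cartanRep P (translation P (-μ)).right x.1 = x.1 := by
      change cartanRep P 1 x.1 = x.1
      rw [map_one]
      rfl
    have h3 : (((translation P (-μ)).left.toAdd : weightLattice P) : V) = -(μ : V) := rfl
    rw [h2, h3]
    simp only [AddSubgroup.coe_add, map_add, map_neg, LinearMap.add_apply, LinearMap.neg_apply]
    ring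
  exact DFunLike.congr_fun this p

lemma reesEvalOne_affDh (f : SymAff 𝔱) (ν : weightLattice P) :
    (reesEvalOne (affDh P f) : Module.End ℂ (TorusRing P)) (character P ν) =
      evPoint P (ν : V) f • character P ν := by
  have hm : ∀ (n : ℕ) (D : Module.End ℂ (TorusRing P)) (hD : D ∈ diffOrder (TorusRing P) n),
      (reesEvalOne (monoDh hD) : Module.End ℂ (TorusRing P)) = D := fun n D hD => by
    rw [reesEvalOne_monoDh]
  induction f using SymmetricAlgebra.induction with
  | algebraMap c =>
    rw [AlgHom.commutes, AlgHom.commutes, AlgHom.commutes]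
    rfl
  | ι x =>
    rw [affDh_ι, map_add, map_smul, evPoint_ι]
    have h1 : (reesEvalOne (fieldDh P x.1) : Module.End ℂ (TorusRing P)) = vectorField P x.1 :=
      hm _ _ (vectorField_mem P x.1)
    have h2 : (reesEvalOne (hbarDh P) : Module.End ℂ (TorusRing P)) = 1 :=
      hm _ _ (one_mem_diffOrder 1)
    change (reesEvalOne (fieldDh P x.1) : Module.End ℂ (TorusRing P)) _ +
      x.2 • (reesEvalOne (hbarDh P) : Module.End ℂ (TorusRing P)) _ = _
    rw [h1, h2, character, vectorField_single, add_smul]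
    rfl
  | mul f g hf hg =>
    rw [map_mul, map_mul, map_mul]
    change (reesEvalOne (affDh P f) : Module.End ℂ (TorusRing P))
      ((reesEvalOne (affDh P g) : Module.End ℂ (TorusRing P)) _) = _
    rw [hg, map_smul, hf, smul_smul, mul_comm]
  | add f g hf hg =>
    rw [map_add, map_add, map_add, add_smul, ← hf, ← hg]
    rfl

lemma reesEvalOne_charDh (μ ν : weightLattice P) :
    (reesEvalOne (charDh P μ) : Module.End ℂ (TorusRing P)) (character P ν) =
      character P (μ + ν) := by
  have h : reesEvalOne (charDh P μ) = _ :=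
    reesEvalOne_monoDh (mulLeft_mem_diffOrder (character P μ) 0)
  rw [h, ← character_mul]
  rfl

end Evaluation

section Regular

variable {ι V 𝔱 : Type*} [Finite ι] [AddCommGroup V] [Module ℂ V] [AddCommGroup 𝔱] [Module ℂ 𝔱]
  (P : RootPairing ι ℂ V 𝔱) [P.IsRootSystem] [P.IsCrystallographic] [P.IsReduced]

/-- The affine function `α̌ + n` is nonconstant along the direction of `α`, so the Demazure
operators still make sense after setting `ħ = 1`. -/
lemma symOne_lin_ne_zero (a : AffRoot P) : symOne 𝔱 a.lin ≠ 0 := fun h => by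
  have h1 : ∀ z : ℂ, z * 2 + a.lev = 0 := fun z => by
    have := congrArg (fun q => evPoint P (z • P.root a.idx) (symIncl 𝔱 q)) h
    simp only [evPoint_symOne, map_zero] at this
    rw [AffRoot.lin, evPoint_ι] at this
    have h2 : P.toLinearMap (P.root a.idx) (P.coroot a.idx) = 2 := P.root_coroot_two a.idx
    simpa [AffRoot.vec, h2] using this
  have h2 := h1 0
  have h3 := h1 1
  rw [zero_mul, zero_add] at h2
  rw [h2] at h3
  norm_num at h3

variable (𝔱) in
/-- The field of fractions of `Sym 𝔱`. -/
abbrev SymFrac : Type _ := FractionRing (SymmetricAlgebra ℂ 𝔱)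

/-- The value at `g` of a function on `𝔱* × ℂ`, as a function on the translate of `𝔱* × 1`. -/
def symOneAt (g : ExtWeyl P) (p : SymAff 𝔱) : SymFrac 𝔱 := algebraMap _ _ (symOne 𝔱 (g⁻¹ • p))

lemma symOneAt_lin_ne_zero (g : ExtWeyl P) (a : AffRoot P) : symOneAt P g a.lin ≠ 0 := by
  rw [symOneAt, ← AffRoot.lin_smul]
  exact (map_ne_zero_iff _ (IsFractionRing.injective _ _)).mpr (symOne_lin_ne_zero P _)

lemma symOneAt_refl (g : ExtWeyl P) (a : AffRoot P) :
    symOneAt P (a.refl⁻¹ * g) a.lin = -symOneAt P g a.lin := by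
  rw [symOneAt, symOneAt, mul_inv_rev, inv_inv, mul_smul, ← AffRoot.lin_smul a.refl,
    AffRoot.refl_smul_self]
  have h : (-a : AffRoot P).lin = -a.lin := by
    rw [AffRoot.lin, AffRoot.vec_neg, map_neg]
    rfl
  rw [h, smul_neg, map_neg, map_neg]

/-- Multiplication operators on the functions on `W̃`. -/
def regPol : SymAff 𝔱 →ₐ[ℂ] Module.End ℂ (ExtWeyl P → SymFrac 𝔱) where
  toFun p :=
    { toFun := fun f g => symOneAt P g p * f g
      map_add' := fun f f' => funext fun g => mul_add _ _ _
      map_smul' := fun c f => funext fun g => by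
        change symOneAt P g p * c • f g = c • (symOneAt P g p * f g)
        rw [mul_smul_comm] }
  map_one' := LinearMap.ext fun f => funext fun g => by
    change symOneAt P g 1 * f g = f g
    rw [symOneAt, smul_one, map_one, map_one, one_mul]
  map_mul' p q := LinearMap.ext fun f => funext fun g => by
    change symOneAt P g (p * q) * f g = symOneAt P g p * (symOneAt P g q * f g)
    rw [symOneAt, smul_mul', map_mul, map_mul, mul_assoc]
    rfl
  map_zero' := LinearMap.ext fun f => funext fun g => by
    change symOneAt P g 0 * f g = 0
    rw [symOneAt, smul_zero, map_zero, map_zero, zero_mul]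
  map_add' p q := LinearMap.ext fun f => funext fun g => by
    change symOneAt P g (p + q) * f g = symOneAt P g p * f g + symOneAt P g q * f g
    rw [symOneAt, smul_add, map_add, map_add, add_mul]
    rfl
  commutes' c := LinearMap.ext fun f => funext fun g => by
    change symOneAt P g (algebraMap ℂ _ c) * f g = c • f g
    have h : g⁻¹ • algebraMap ℂ (SymAff 𝔱) c = algebraMap ℂ _ c := (symAffAct P g⁻¹).commutes c
    rw [symOneAt, h, AlgHom.commutes, ← IsScalarTower.algebraMap_apply, ← Algebra.smul_def]

lemma regPol_apply (p : SymAff 𝔱) (f : ExtWeyl P → SymFrac 𝔱) (g : ExtWeyl P) :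
    regPol P p f g = symOneAt P g p * f g := rfl

/-- Left translations of the functions on `W̃`. -/
def regGrp : ExtWeyl P →* Module.End ℂ (ExtWeyl P → SymFrac 𝔱) where
  toFun h :=
    { toFun := fun f g => f (h⁻¹ * g)
      map_add' := fun f f' => rfl
      map_smul' := fun c f => rfl }
  map_one' := LinearMap.ext fun f => funext fun g => by
    change f (1⁻¹ * g) = f g
    rw [inv_one, one_mul]
  map_mul' h k := LinearMap.ext fun f => funext fun g => by
    change f ((h * k)⁻¹ * g) = f (k⁻¹ * (h⁻¹ * g))
    rw [mul_inv_rev, mul_assoc]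

lemma regGrp_apply (h : ExtWeyl P) (f : ExtWeyl P → SymFrac 𝔱) (g : ExtWeyl P) :
    regGrp P h f g = f (h⁻¹ * g) := rfl

/-- Demazure operators on the functions on `W̃`. -/
def regTh (a : AffRoot P) : Module.End ℂ (ExtWeyl P → SymFrac 𝔱) where
  toFun f g := (symOneAt P g a.lin)⁻¹ * (f (a.refl⁻¹ * g) - f g)
  map_add' f f' := funext fun g => by
    simp only [Pi.add_apply]
    ring
  map_smul' c f := funext fun g => by
    simp only [Pi.smul_apply, RingHom.id_apply]
    rw [← smul_sub, mul_smul_comm]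

lemma regTh_apply (a : AffRoot P) (f : ExtWeyl P → SymFrac 𝔱) (g : ExtWeyl P) :
    regTh P a f g = (symOneAt P g a.lin)⁻¹ * (f (a.refl⁻¹ * g) - f g) := rfl

lemma neg_inv_mul_sub {K : Type*} [Field K] (z x y : K) : (-z)⁻¹ * (x - y) = z⁻¹ * (y - x) := by
  rw [inv_neg]
  ring

/-- The functions on `W̃`, on which `ħ` acts by `1`. -/
def regSys : NilSys P (Module.End ℂ (ExtWeyl P → SymFrac 𝔱)) :=
  NilSys.ofInjective (regPol P) (regGrp P) (regTh P)
    (fun h p => LinearMap.ext fun f => funext fun g => by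
      rw [Module.End.mul_apply, Module.End.mul_apply, regGrp_apply, regPol_apply, regPol_apply,
        regGrp_apply, symOneAt, symOneAt, mul_inv_rev, inv_inv, mul_smul])
    (fun a => LinearMap.ext fun f => funext fun g => by
      rw [Module.End.mul_apply, regPol_apply, regTh_apply,
        mul_inv_cancel_left₀ (symOneAt_lin_ne_zero P g a)]
      rfl)
    (fun a => LinearMap.ext fun f => funext fun g => by
      rw [Module.End.mul_apply, regGrp_apply, regTh_apply, regTh_apply, symOneAt_refl,
        ← mul_assoc a.refl⁻¹, ← mul_inv_rev, AffRoot.refl_mul_self, inv_one, one_mul]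
      exact neg_inv_mul_sub _ _ _)
    fun a y _ h => LinearMap.ext fun f => funext fun g => by
      have := congrFun (LinearMap.congr_fun h f) g
      rw [Module.End.mul_apply, regPol_apply] at this
      exact (mul_eq_zero.mp this).resolve_left (symOneAt_lin_ne_zero P g a)

lemma regSys_hbar : (regSys P).pol (SymmetricAlgebra.ι ℂ _ (0, 1)) = 1 :=
  LinearMap.ext fun f => funext fun g => by
    change symOneAt P g (SymmetricAlgebra.ι ℂ _ (0, 1)) * f g = f g
    have h : g⁻¹ • (SymmetricAlgebra.ι ℂ (𝔱 × ℂ) (0, 1)) = SymmetricAlgebra.ι ℂ _ (0, 1) := by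
      refine (symAffAct_ι P g⁻¹ _).trans ?_
      rw [affineRep_apply]
      simp
    rw [symOneAt, h, symOne_ι, map_zero, map_one, zero_add, map_one, one_mul]

end Regular

section Faithful

variable {ι V 𝔱 : Type*} [Finite ι] [AddCommGroup V] [Module ℂ V] [AddCommGroup 𝔱] [Module ℂ 𝔱]
  {P : RootPairing ι ℂ V 𝔱} [P.IsRootSystem] [P.IsCrystallographic] [P.IsReduced]

lemma mem_span_affDh_mul_charDh (b : P.Base) (x : DhT P) :
    x ∈ AddSubmonoid.closure {y | ∃ f μ, y = affDh P f * charDh P μ} := by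
  have key : ∀ (y : WSym P) (w : P.weylGroup), (toWDhT P y).coeff w ∈
      AddSubmonoid.closure {y | ∃ f μ, y = affDh P f * charDh P μ} := by
    classical
    intro y w
    induction y using SkewMonoidAlgebra.induction_on with
    | zero =>
      rw [map_zero]
      exact zero_mem _
    | single g f =>
      rw [toWDhT_single]
      have h : diffA P (affDh P f) * extWeylA P g =
          SkewMonoidAlgebra.single g.right (affDh P f * charDh P g.left.toAdd) := by
        change diffA P (affDh P f) * (diffA P _ * weylA P _) = _
        rw [← mul_assoc, ← map_mul]
        change SkewMonoidAlgebra.single 1 _ * SkewMonoidAlgebra.single _ 1 = _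
        simp [SkewMonoidAlgebra.single_mul_single]
      rw [h, SkewMonoidAlgebra.coeff_single, Finsupp.single_apply]
      split_ifs
      · exact AddSubmonoid.subset_closure ⟨_, _, rfl⟩
      · exact zero_mem _
    | add x y hx hy =>
      rw [map_add, SkewMonoidAlgebra.coeff_add, Finsupp.add_apply]
      exact add_mem hx hy
  obtain ⟨y, hy⟩ := toWDhT_surjective b (diffA P x)
  have h := key y 1
  rw [hy] at h
  have h2 : (diffA P x).coeff 1 = x := by
    change (SkewMonoidAlgebra.single 1 x : WDhT P).coeff 1 = x
    rw [SkewMonoidAlgebra.coeff_single, Finsupp.single_eq_same]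
  rwa [h2] at h

/-- The invariant delta function on `W̃`. -/
def weylDelta (P : RootPairing ι ℂ V 𝔱) (g : ExtWeyl P) : SymFrac 𝔱 :=
  open Classical in if g.left = 1 then 1 else 0

lemma symmetrizer_regGrp_delta : symmetrizer ((regGrp P).comp SemidirectProduct.inr)
    (open Classical in fun g => if g = 1 then 1 else 0) =
      (Nat.card P.weylGroup : ℂ)⁻¹ • weylDelta P := by
  classical
  cases nonempty_fintype P.weylGroup
  rw [symmetrizer, finsum_eq_sum_of_fintype, LinearMap.smul_apply, LinearMap.sum_apply]
  congr 1
  refine funext fun g => ?_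
  rw [Finset.sum_apply, weylDelta]
  have h : ∀ w : P.weylGroup, (SemidirectProduct.inr w)⁻¹ * g = 1 ↔ g.left = 1 ∧ g.right = w := by
    intro w
    rw [inv_mul_eq_one]
    constructor
    · rintro rfl
      exact ⟨rfl, rfl⟩
    · rintro ⟨h1, rfl⟩
      exact SemidirectProduct.ext h1.symm rfl
  simp only [MonoidHom.comp_apply, regGrp_apply, h]
  split_ifs with h1
  · simp [h1]
  · simp [h1]

/-- The value at `e^κ` is a polynomial on `𝔱*` whose values at the weights `ν` are the matrix
coefficients from `t^ν` to `t^{ν + κ}`. It suffices to check this on products of a polynomial and a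
character, which span `𝒟_ħ(T)`. -/
lemma exists_symbol (b : P.Base) (Ψ : DhT P →ₐ[ℂ] Module.End ℂ (ExtWeyl P → SymFrac 𝔱))
    (h1 : ∀ f, Ψ (affDh P f) = regPol P f) (h2 : ∀ μ, Ψ (charDh P μ) = regGrp P (translation P μ))
    (x : DhT P) (κ : weightLattice P) : ∃ p : SymmetricAlgebra ℂ 𝔱,
      Ψ x (weylDelta P) (translation P κ) = algebraMap _ (SymFrac 𝔱) p ∧
      ∀ ν : weightLattice P, evPoint P (ν : V) (symIncl 𝔱 p) = torusCoeff P (ν + κ)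
        ((reesEvalOne x : Module.End ℂ (TorusRing P)) (character P ν)) := by
  classical
  induction mem_span_affDh_mul_charDh b x using AddSubmonoid.closure_induction with
  | mem x hx =>
    obtain ⟨f, μ, rfl⟩ := hx
    refine ⟨if μ = κ then symOne 𝔱 (((translation P κ)⁻¹ • f : SymAff 𝔱)) else 0, ?_, fun ν => ?_⟩
    · rw [map_mul, h1, h2, Module.End.mul_apply, regPol_apply, regGrp_apply, weylDelta]
      have h3 : ((translation P μ)⁻¹ * translation P κ).left = 1 ↔ μ = κ := by
        have h : (translation P μ)⁻¹ * translation P κ =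
            SemidirectProduct.inl ((Multiplicative.ofAdd μ)⁻¹ * Multiplicative.ofAdd κ) := by
          rw [map_mul, map_inv]
          rfl
        rw [h, SemidirectProduct.left_inl, inv_mul_eq_one]
        exact Iff.rfl
      simp only [h3]
      split_ifs
      · rw [mul_one]
        rfl
      · rw [mul_zero, map_zero]
    · rw [map_mul]
      change _ = torusCoeff P (ν + κ) ((reesEvalOne (affDh P f) : Module.End ℂ (TorusRing P))
        ((reesEvalOne (charDh P μ) : Module.End ℂ (TorusRing P)) (character P ν)))
      rw [reesEvalOne_charDh, reesEvalOne_affDh, (torusCoeff P (ν + κ)).map_smul, character, torusCoeff_charMonomial,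
        Finsupp.single_apply]
      by_cases h : μ = κ
      · rw [if_pos h, if_pos (by rw [h, add_comm]), evPoint_symOne, evPoint_translation, h,
          add_comm ν, smul_eq_mul, mul_one]
      · rw [if_neg h, if_neg (fun h' => h (by rwa [add_comm ν, add_left_inj] at h')), map_zero,
          map_zero, smul_zero]
  | zero => exact ⟨0, by simp, fun ν => by simp⟩
  | add x y _ _ hx hy =>
    obtain ⟨p, hp, hp'⟩ := hx
    obtain ⟨q, hq, hq'⟩ := hy
    refine ⟨p + q, ?_, fun ν => ?_⟩
    · rw [map_add, map_add, ← hp, ← hq]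
      rfl
    · rw [map_add, map_add, map_add, hp', hq', ← map_add]
      rfl

/-- The image of the delta function determines all the polynomials of `exists_symbol`, hence all
matrix coefficients of the operator. -/
lemma reesEvalOne_eq_of_weylDelta (b : P.Base)
    (Ψ : DhT P →ₐ[ℂ] Module.End ℂ (ExtWeyl P → SymFrac 𝔱))
    (h1 : ∀ f, Ψ (affDh P f) = regPol P f) (h2 : ∀ μ, Ψ (charDh P μ) = regGrp P (translation P μ))
    {x y : DhT P} (h : Ψ x (weylDelta P) = Ψ y (weylDelta P)) : reesEvalOne x = reesEvalOne y := by
  refine Subtype.ext (torus_hom_ext P fun ν => torusRing_ext fun μ => ?_)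
  obtain ⟨p, hp, hp'⟩ := exists_symbol b Ψ h1 h2 x (μ - ν)
  obtain ⟨q, hq, hq'⟩ := exists_symbol b Ψ h1 h2 y (μ - ν)
  have h3 : p = q := IsFractionRing.injective (SymmetricAlgebra ℂ 𝔱) (SymFrac 𝔱) (by
    rw [← hp, ← hq, h])
  have h4 := hp' ν
  rw [h3, hq' ν, add_sub_cancel] at h4
  exact h4.symm

end Faithful


/-! ### Extensions to the spherical subalgebra and to the whole algebra -/

section Corner

variable {ι V 𝔱 : Type*} [AddCommGroup V] [Module ℂ V] [AddCommGroup 𝔱] [Module ℂ 𝔱]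
  {P : RootPairing ι ℂ V 𝔱} [Finite ι] [P.IsRootSystem]
  {X R : Type*} [Ring X] [Algebra ℂ X] [Semiring R] [Algebra ℂ R] {S : InvariantSystem P X R}
  {B : Type*} [Semiring B] [Algebra ℂ B] (N : SphericalSystem S B)
  {L : Type*} [AddCommGroup L] [Module ℂ L] (σ : R →ₐ[ℂ] Module.End ℂ L)

namespace SphericalSystem

/-- The homomorphism `r ↦ r e` to the spherical subalgebra. -/
def toCorner (he : IsIdempotentElem (symmetrizer N.weyl)) : R →ₐ[ℂ] he.Corner where
  toFun r := ⟨N.homX (S.incl r) * symmetrizer N.weyl, (Subsemigroup.mem_corner_iff he).mpr (by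
    rw [← mul_assoc, symmetrizer_mul_homX, mul_assoc, he.eq]
    exact ⟨rfl, rfl⟩)⟩
  map_one' := Subtype.ext (by
    change N.homX (S.incl 1) * symmetrizer N.weyl = symmetrizer N.weyl
    rw [map_one, map_one, one_mul])
  map_mul' r s := Subtype.ext (by
    change N.homX (S.incl (r * s)) * symmetrizer N.weyl =
      N.homX (S.incl r) * symmetrizer N.weyl * (N.homX (S.incl s) * symmetrizer N.weyl)
    rw [mul_assoc, ← mul_assoc (symmetrizer N.weyl), symmetrizer_mul_homX, mul_assoc, he.eq,
      map_mul, map_mul, mul_assoc])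
  map_zero' := Subtype.ext (by
    change N.homX (S.incl 0) * symmetrizer N.weyl = 0
    rw [map_zero, map_zero, zero_mul])
  map_add' r s := Subtype.ext (by
    change N.homX (S.incl (r + s)) * symmetrizer N.weyl =
      N.homX (S.incl r) * symmetrizer N.weyl + N.homX (S.incl s) * symmetrizer N.weyl
    rw [map_add, map_add, add_mul])
  commutes' c := Subtype.ext (by
    change N.homX (S.incl (algebraMap ℂ R c)) * symmetrizer N.weyl = c • symmetrizer N.weyl
    rw [AlgHom.commutes, AlgHom.commutes, ← Algebra.smul_def])

lemma toCorner_coe (he : IsIdempotentElem (symmetrizer N.weyl)) (r : R) :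
    (N.toCorner he r).1 = N.homX (S.incl r) * symmetrizer N.weyl := rfl

variable {N σ}

/-- The compression `h ↦ e h e`. -/
def compress {e : B} (he : IsIdempotentElem e) : B →ₗ[ℂ] he.Corner where
  toFun h := ⟨e * h * e, h, rfl⟩
  map_add' h h' := Subtype.ext (by
    change e * (h + h') * e = e * h * e + e * h' * e
    rw [mul_add, add_mul])
  map_smul' c h := Subtype.ext (by
    change e * (c • h) * e = c • (e * h * e)
    rw [mul_smul_comm, smul_mul_assoc])

lemma compress_coe {e : B} (he : IsIdempotentElem e) (h : B) : (compress he h).1 = e * h * e := rfl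

lemma compress_val {e : B} (he : IsIdempotentElem e) (x : he.Corner) : compress he x.1 = x := by
  have hx := (Subsemigroup.mem_corner_iff he).mp x.2
  exact Subtype.ext (by rw [compress_coe, hx.1, hx.2])

lemma isSpherical_of_extension {he : IsIdempotentElem (symmetrizer N.weyl)}
    (κ : he.Corner →ₐ[ℂ] Module.End ℂ L) (hκ : κ.comp (N.toCorner he) = σ) :
    N.IsSpherical σ (κ.toLinearMap ∘ₗ compress he) where
  map_one := by
    have : compress he 1 = 1 := Subtype.ext (by
      rw [compress_coe, mul_one, he.eq]
      rfl)
    rw [LinearMap.comp_apply, this, AlgHom.toLinearMap_apply, map_one]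
  map_mul h h' := by
    simp only [LinearMap.comp_apply, AlgHom.toLinearMap_apply]
    rw [← map_mul]
    congr 1
    refine Subtype.ext ?_
    change _ = symmetrizer N.weyl * h * symmetrizer N.weyl *
      (symmetrizer N.weyl * h' * symmetrizer N.weyl)
    rw [compress_coe]
    calc _ = symmetrizer N.weyl * h * (symmetrizer N.weyl) * h' * symmetrizer N.weyl := by
          simp only [mul_assoc]
      _ = symmetrizer N.weyl * h * (symmetrizer N.weyl * symmetrizer N.weyl) * h' *
          symmetrizer N.weyl := by rw [he.eq]
      _ = _ := by simp only [mul_assoc]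
  map_incl r := by
    rw [← hκ]
    simp only [LinearMap.comp_apply, AlgHom.toLinearMap_apply, AlgHom.comp_apply]
    congr 1
    refine Subtype.ext ?_
    rw [compress_coe, toCorner_coe, symmetrizer_mul_homX, mul_assoc, he.eq]

lemma IsSpherical.exists_extension {he : IsIdempotentElem (symmetrizer N.weyl)}
    {κ : B →ₗ[ℂ] Module.End ℂ L} (hκ : N.IsSpherical σ κ) :
    Nonempty (Extension (N.toCorner he) σ) := by
  refine ⟨⟨{ toFun := fun x => κ x.1
             map_one' := ?_
             map_mul' := fun x y => ?_
             map_zero' := map_zero κ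
             map_add' := fun x y => map_add κ x.1 y.1
             commutes' := fun c => ?_ }, ?_⟩⟩
  · change κ (symmetrizer N.weyl) = 1
    rw [← one_mul (symmetrizer N.weyl), hκ.mul_symmetrizer, hκ.map_one]
  · have hx := (Subsemigroup.mem_corner_iff he).mp x.2
    change κ (x.1 * y.1) = κ x.1 * κ y.1
    rw [← hκ.map_mul, hx.2]
  · change κ (c • symmetrizer N.weyl) = _
    rw [map_smul, ← one_mul (symmetrizer N.weyl), hκ.mul_symmetrizer, hκ.map_one,
      Algebra.algebraMap_eq_smul_one]
  · refine AlgHom.ext fun r => ?_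
    change κ (N.homX (S.incl r) * symmetrizer N.weyl) = _
    rw [hκ.mul_symmetrizer, hκ.map_incl]

variable [P.IsCrystallographic]

/-- Extensions of `σ` to the spherical subalgebra correspond to actions of the whole algebra. -/
lemma nonempty_extension_iff (N : SphericalSystem S B) (σ : R →ₐ[ℂ] Module.End ℂ L)
    (he : IsIdempotentElem (symmetrizer N.weyl)) :
    Nonempty (Extension (N.toCorner he) σ) ↔ Nonempty (Extension N.hom (S.tensorRep σ)) := by
  constructor
  · rintro ⟨κ, hκ⟩
    exact ⟨_, (isSpherical_of_extension κ hκ).rep_comp⟩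
  · rintro ⟨φ, hφ⟩
    obtain ⟨κ, hκ⟩ := N.exists_isSpherical σ φ hφ
    exact hκ.exists_extension

/-- The action of the corner is recovered from the induced action on `X ⊗ L` as the projection of `h
(1 ⊗ l)`, so uniqueness of the latter gives uniqueness of the former. -/
lemma subsingleton_extension (N : SphericalSystem S B) (σ : R →ₐ[ℂ] Module.End ℂ L)
    (he : IsIdempotentElem (symmetrizer N.weyl))
    (h : Subsingleton (Extension N.hom (S.tensorRep σ))) :
    Subsingleton (Extension (N.toCorner he) σ) := by
  refine ⟨fun ⟨κ, hκ⟩ ⟨κ', hκ'⟩ => Subtype.ext (AlgHom.ext fun x => LinearMap.ext fun l => ?_)⟩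
  have h1 := isSpherical_of_extension κ hκ
  have h2 := isSpherical_of_extension κ' hκ'
  have h3 : h1.rep = h2.rep := congrArg Subtype.val
    (h.elim ⟨_, h1.rep_comp⟩ ⟨_, h2.rep_comp⟩)
  have h4 := h1.tensorProj_rep x.1 l
  rw [h3, h2.tensorProj_rep x.1 l] at h4
  simp only [LinearMap.comp_apply, AlgHom.toLinearMap_apply, compress_val] at h4
  exact h4.symm

end SphericalSystem

end Corner

section DiffOpSystem

variable {ι V 𝔱 : Type*} [AddCommGroup V] [Module ℂ V] [AddCommGroup 𝔱] [Module ℂ 𝔱]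
  (P : RootPairing ι ℂ V 𝔱)

/-- The action of the Weyl group on `𝒟(T)`. -/
def weylDT : P.weylGroup →* (DT P →ₗ[ℂ] DT P) where
  toFun w :=
    { toFun := fun D => ⟨weylConj P w D, by
        obtain ⟨n, hn⟩ := D.2
        exact ⟨n, conjAct_mem_diffOrder _ hn⟩⟩
      map_add' := fun D E => Subtype.ext (map_add (weylConj P w) _ _)
      map_smul' := fun c D => Subtype.ext (map_smul (weylConj P w) _ _) }
  map_one' := LinearMap.ext fun D => Subtype.ext (weylConj_one P _)
  map_mul' v w := LinearMap.ext fun D => Subtype.ext (weylConj_mul P v w _)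

variable [Finite ι] [P.IsRootSystem]

/-- The average over the Weyl group. -/
def avgDT (D : DT P) : DT P := (Nat.card P.weylGroup : ℂ)⁻¹ • ∑ᶠ w, weylDT P w D

lemma weylDT_avgDT (w : P.weylGroup) (D : DT P) : weylDT P w (avgDT P D) = avgDT P D := by
  cases nonempty_fintype P.weylGroup
  rw [avgDT, finsum_eq_sum_of_fintype, map_smul, map_sum]
  congr 1
  refine Fintype.sum_equiv (Equiv.mulLeft w) _ _ fun x => ?_
  rw [Equiv.coe_mulLeft, map_mul]
  rfl

/-- The invariants `𝒟(T)^W ⊂ 𝒟(T)`. -/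
def diffOpSystem : InvariantSystem P (DT P) (DTinv P) where
  incl := DTinvIncl P
  incl_injective _ _ h :=
    Subtype.ext (congrArg (fun D : DT P => (D : Module.End ℂ (TorusRing P))) h)
  act := weylDT P
  act_one w := Subtype.ext (map_one (weylConj P w))
  act_mul w _ _ := Subtype.ext (map_mul (weylConj P w) _ _)
  act_incl w r := Subtype.ext (r.2.2 w)
  avg D := ⟨avgDT P D, (avgDT P D).2, fun w =>
    congrArg (fun D : DT P => (D : Module.End ℂ (TorusRing P))) (weylDT_avgDT P w D)⟩
  incl_avg _ := Subtype.ext rfl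
  spec := reesEvalOne
  spec_hbar := (reesEvalOne_monoDh (one_mem_diffOrder 1)).trans (Subtype.ext rfl)
  spec_smul w x := Subtype.ext (reesEvalOne_smul P w x)
  spec_surjective := reesEvalOne_surjective P
  sym := symDinv P
  sym_spec := symD_comp P

end DiffOpSystem


/-! ### Part (ii): the spherical algebra at `ħ = 1` -/

section Specialized

universe uL

variable {ι V 𝔱 : Type*} [Finite ι] [AddCommGroup V] [Module ℂ V] [AddCommGroup 𝔱] [Module ℂ 𝔱]
  {P : RootPairing ι ℂ V 𝔱} [P.IsRootSystem] [P.IsCrystallographic] [P.IsReduced] {b : P.Base}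

lemma Specialization.mk_self {B : Type*} [Semiring B] [Algebra ℂ B] (h : B) (c : ℂ) :
    Specialization.mk h c h = algebraMap ℂ _ c := by
  rw [← (Specialization.mk h c).commutes c]
  exact RingQuot.mkAlgHom_rel ℂ ⟨rfl, rfl⟩

/-- The homomorphism `W ⋉ 𝒟_ħ(T) → ℍ`. -/
def toHOne (i : WDhT P →ₐ[ℂ] nilDAHA b) : WDhT P →ₐ[ℂ] HOne b := (Specialization.mk (hbarH b) 1).comp i

lemma toHOne_hbar {i : WDhT P →ₐ[ℂ] nilDAHA b} (hi : IsCanonical b i) :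
    ((toHOne i).comp (diffA P)) (hbarDh P) = 1 := by
  change Specialization.mk (hbarH b) 1 (i (hbarA P)) = 1
  rw [hi.map_hbar, Specialization.mk_self, map_one]

/-- The homomorphism from `W` to `ℍ`. -/
def weylHOne (b : P.Base) : P.weylGroup →* HOne b :=
  ((Specialization.mk (hbarH b) 1 : nilDAHA b →ₐ[ℂ] HOne b) : nilDAHA b →* HOne b).comp (weylH b)

lemma exists_dual_hOne {i : WDhT P →ₐ[ℂ] nilDAHA b} (hi : IsCanonical b i) :
    ∃ (n : ℕ) (u : Fin n → SymmetricAlgebra ℂ 𝔱) (y : Fin n → HOne b),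
      ∑ j, toHOne i (symA P (u j)) * (symmetrizer (weylHOne b) * y j) = 1 := by
  obtain ⟨n, u, y, h, -⟩ := exists_dualBases b
  refine ⟨n, u, fun j => Specialization.mk (hbarH b) 1 (y j), ?_⟩
  rw [← map_one (Specialization.mk (hbarH b) 1), ← h, map_sum]
  refine Finset.sum_congr rfl fun j _ => ?_
  rw [map_mul, map_mul, map_symmetrizer, ← hi.apply_symA]
  rfl

lemma exists_sphericalSystem {i : WDhT P →ₐ[ℂ] nilDAHA b} (hi : IsCanonical b i) :
    ∃ N : SphericalSystem (diffOpSystem P) (HOne b), N.hom = toHOne i ∧ N.weyl = weylHOne b := by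
  obtain ⟨j, hj⟩ := exists_descent (toHOne_hbar hi)
  obtain ⟨n, u, y, h⟩ := exists_dual_hOne hi
  exact ⟨{ hom := toHOne i
           homX := j
           homX_spec := hj
           weyl := weylHOne b
           hom_weyl := fun w => congrArg (Specialization.mk (hbarH b) 1) (hi.map_weyl w)
           num := n
           elt := u
           dual := y
           sum_dual := h }, rfl, rfl⟩

lemma subsingleton_extension_toHOne {i : WDhT P →ₐ[ℂ] nilDAHA b} (hi : IsCanonical b i)
    {M : Type*} [AddCommGroup M] [Module ℂ M] (ρ : WDhT P →ₐ[ℂ] Module.End ℂ M) :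
    Subsingleton (Extension (toHOne i) ρ) :=
  ⟨fun φ ψ => Subtype.ext (RingQuot.ringQuot_ext' ℂ _ _ (hi.hom_ext (φ.2.trans ψ.2.symm)))⟩

lemma extension_toHOne_iff {i : WDhT P →ₐ[ℂ] nilDAHA b} (hi : IsCanonical b i)
    {M : Type*} [AddCommGroup M] [Module ℂ M] (ρ : WDhT P →ₐ[ℂ] Module.End ℂ M)
    (hρ : ρ (hbarA P) = 1) :
    Nonempty (Extension (toHOne i) ρ) ↔ Function.Bijective (naturalMap P ρ) := by
  rw [← (extension_iff hi ρ).1]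
  constructor
  · rintro ⟨φ, hφ⟩
    exact ⟨⟨φ.comp (Specialization.mk (hbarH b) 1), hφ⟩⟩
  · rintro ⟨φ, hφ⟩
    refine ⟨⟨RingQuot.liftAlgHom ℂ ⟨φ, ?_⟩, ?_⟩⟩
    · rintro _ _ ⟨rfl, rfl⟩
      rw [← hi.map_hbar, map_one, map_one, ← hρ, ← hφ]
      rfl
    · refine Eq.trans (AlgHom.ext fun x => ?_) hφ
      exact RingQuot.liftAlgHom_mkAlgHom_apply ℂ _ _ (i x)

/-- An explicit form of the defining property of the canonical homomorphism. -/
lemma isCanonicalSph_iff {i : WDhT P →ₐ[ℂ] nilDAHA b}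
    (N : SphericalSystem (diffOpSystem P) (HOne b)) (h1 : N.hom = toHOne i)
    (k : DTinv P →ₐ[ℂ] HSph b) :
    IsCanonicalSph b i k ↔ ∀ D, (k D).1 = N.homX (DTinvIncl P D) * eOne b := by
  have key : ∀ (x : DhT P) (D : DTinv P), (reesEvalOne x : Module.End ℂ (TorusRing P)) = D →
      N.homX (DTinvIncl P D) = Specialization.mk (hbarH b) 1 (i (diffA P x)) := fun x D h => by
    have h3 : DTinvIncl P D = reesEvalOne x := Subtype.ext h.symm
    rw [h3]
    refine (N.homX_spec x).trans ?_
    rw [h1]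
    rfl
  constructor
  · intro hk D
    obtain ⟨x, hx⟩ := reesEvalOne_surjective P (DTinvIncl P D)
    have hx' : (reesEvalOne x : Module.End ℂ (TorusRing P)) = D := by
      rw [hx]
      rfl
    rw [key x D hx']
    exact hk x D hx'
  · intro hk x D h
    rw [hk, key x D h]

lemma exists_isCanonicalSph {i : WDhT P →ₐ[ℂ] nilDAHA b}
    (N : SphericalSystem (diffOpSystem P) (HOne b)) (h1 : N.hom = toHOne i)
    (h2 : N.weyl = weylHOne b) : ∃ k : DTinv P →ₐ[ℂ] HSph b, IsCanonicalSph b i k ∧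
      ∀ (L : Type uL) [AddCommGroup L] [Module ℂ L] (σ : DTinv P →ₐ[ℂ] Module.End ℂ L),
        (Nonempty (Extension k σ) ↔
          Nonempty (Extension (toHOne i) ((diffOpSystem P).tensorRep σ))) ∧
        (Subsingleton (Extension (toHOne i) ((diffOpSystem P).tensorRep σ)) →
          Subsingleton (Extension k σ)) := by
  have he : eOne b = symmetrizer N.weyl := by
    rw [h2]
    rfl
  have hidem : IsIdempotentElem (symmetrizer N.weyl) := symmetrizer_idem _
  -- The type of the corner depends on the idempotent, so the idempotent is generalized before the
  -- equality with the symmetrizer is substituted.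
  have key : ∀ (e : HOne b) (hid : IsIdempotentElem e), e = symmetrizer N.weyl →
      ∃ k : DTinv P →ₐ[ℂ] hid.Corner, (∀ D, (k D).1 = N.homX (DTinvIncl P D) * e) ∧
      ∀ (L : Type uL) [AddCommGroup L] [Module ℂ L] (σ : DTinv P →ₐ[ℂ] Module.End ℂ L),
        (Nonempty (Extension k σ) ↔
          Nonempty (Extension N.hom ((diffOpSystem P).tensorRep σ))) ∧
        (Subsingleton (Extension N.hom ((diffOpSystem P).tensorRep σ)) →
          Subsingleton (Extension k σ)) := by
    rintro _ hid rfl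
    exact ⟨N.toCorner hid, fun D => rfl, fun L _ _ σ => ⟨N.nonempty_extension_iff σ hid,
      N.subsingleton_extension σ hid⟩⟩
  obtain ⟨k, hk, hk'⟩ := key (eOne b) (eOne_idem b) he
  refine ⟨k, (isCanonicalSph_iff N h1 k).mpr hk, ?_⟩
  rw [← h1]
  exact hk'

/-- Injectivity over `ℂ[ħ]` need not survive specialization, so it is tested in the functions on
`W̃`. There `D e` sends the delta function at `1` to a nonzero multiple of `D` applied to the delta
function of `W`, which determines `D`. -/
lemma IsCanonicalSph.injective {i : WDhT P →ₐ[ℂ] nilDAHA b} (hi : IsCanonical b i)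
    {k : DTinv P →ₐ[ℂ] HSph b} (hk : IsCanonicalSph b i k) : Function.Injective k := by
  obtain ⟨φ, hpol, hgrp⟩ := (regSys P).exists_algHom (b := b)
  have hφ : φ (hbarH b) = 1 := (hpol _).trans (regSys_hbar P)
  let φ' : HOne b →ₐ[ℂ] Module.End ℂ (ExtWeyl P → SymFrac 𝔱) := RingQuot.liftAlgHom ℂ ⟨φ, by
    rintro _ _ ⟨rfl, rfl⟩
    rw [hφ, map_one, map_one]⟩
  have hφ' : ∀ x, φ' (Specialization.mk (hbarH b) 1 x) = φ x := fun x =>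
    RingQuot.liftAlgHom_mkAlgHom_apply ℂ _ _ x
  have he : φ' (eOne b) = symmetrizer ((regGrp P).comp SemidirectProduct.inr) := by
    rw [eOne, map_symmetrizer]
    congr 1
    refine MonoidHom.ext fun w => ?_
    exact (hφ' _).trans (hgrp _)
  have hδ : ∀ (x : DhT P) (D : DTinv P), (reesEvalOne x : Module.End ℂ (TorusRing P)) = D →
      φ' (k D).1 (open Classical in fun g => if g = 1 then 1 else 0) =
        (Nat.card P.weylGroup : ℂ)⁻¹ • ((φ.comp i).comp (diffA P)) x (weylDelta P) := by
    intro x D hx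
    rw [hk x D hx, map_mul, Module.End.mul_apply, he, symmetrizer_regGrp_delta, map_smul, hφ']
    rfl
  intro D D' h
  obtain ⟨x, hx⟩ := reesEvalOne_surjective P (DTinvIncl P D)
  obtain ⟨y, hy⟩ := reesEvalOne_surjective P (DTinvIncl P D')
  have hx' : (reesEvalOne x : Module.End ℂ (TorusRing P)) = D := by
    rw [hx]
    rfl
  have hy' : (reesEvalOne y : Module.End ℂ (TorusRing P)) = D' := by
    rw [hy]
    rfl
  have h1 := hδ x D hx'
  rw [h, hδ y D' hy'] at h1
  have hc : (Nat.card P.weylGroup : ℂ)⁻¹ ≠ 0 :=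
    inv_ne_zero (Nat.cast_ne_zero.mpr Nat.card_pos.ne')
  have h2 := reesEvalOne_eq_of_weylDelta b ((φ.comp i).comp (diffA P)) (fun f => ?_) (fun μ => ?_)
    (smul_right_injective _ hc h1)
  · refine Subtype.ext ?_
    rw [← hx', ← hy', h2]
  · change φ (i (diffA P (affDh P f))) = _
    rw [hi.apply_affDh]
    exact hpol f
  · change φ (i (diffA P (charDh P μ))) = _
    rw [hi.map_char]
    exact hgrp _

/-- The criterion for the extension of an action to the spherical algebra. -/
lemma spherical_extension_iff {i : WDhT P →ₐ[ℂ] nilDAHA b} (hi : IsCanonical b i) :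
    (∃! k : DTinv P →ₐ[ℂ] HSph b, IsCanonicalSph b i k) ∧
    ∀ k : DTinv P →ₐ[ℂ] HSph b, IsCanonicalSph b i k → Function.Injective k ∧
      ∀ (L : Type uL) [AddCommGroup L] [Module ℂ L] (σ : DTinv P →ₐ[ℂ] Module.End ℂ L),
        (Nonempty (Extension k σ) ↔ Function.Bijective (sphericalMap P σ)) ∧
        Subsingleton (Extension k σ) := by
  obtain ⟨N, h1, h2⟩ := exists_sphericalSystem hi
  obtain ⟨k, hk, hk'⟩ := exists_isCanonicalSph N h1 h2
  have huniq : ∀ k', IsCanonicalSph b i k' → k' = k := fun k' h => AlgHom.ext fun D =>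
    Subtype.ext (((isCanonicalSph_iff N h1 k').mp h D).trans
      ((isCanonicalSph_iff N h1 k).mp hk D).symm)
  refine ⟨⟨k, hk, huniq⟩, fun k' h => ?_⟩
  obtain rfl := huniq k' h
  refine ⟨hk.injective hi, fun L _ _ σ => ⟨?_, ?_⟩⟩
  -- `ħ` acts by `1` on `𝒟(T) ⊗ L`, so extending its action to `ℋ` or to `ℍ` is the same thing and
  -- (i) applies.
  · have hρ : (diffOpSystem P).tensorRep σ (hbarA P) = 1 := by
      refine ((diffOpSystem P).tensorRep_diffA σ (hbarDh P)).trans ?_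
      rw [(diffOpSystem P).spec_hbar, map_one]
    rw [(hk' L σ).1, extension_toHOne_iff hi _ hρ]
    exact (diffOpSystem P).naturalMap_tensorRep_bijective_iff σ
  · exact (hk' L σ).2 (subsingleton_extension_toHOne hi _)

end Specialized

end NilDAHA

theorem mainTheorem9 {ι V 𝔱 : Type*} [Finite ι] [AddCommGroup V] [Module ℂ V]
    [AddCommGroup 𝔱] [Module ℂ 𝔱] (P : RootPairing ι ℂ V 𝔱) [P.IsRootSystem]
    [P.IsCrystallographic] [P.IsReduced] (b : P.Base) :
    -- the canonical embedding exists and is unique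
    (∃! i : NilDAHA.WDhT P →ₐ[ℂ] NilDAHA.nilDAHA b, NilDAHA.IsCanonical b i) ∧
    ∀ (i : NilDAHA.WDhT P →ₐ[ℂ] NilDAHA.nilDAHA b) (hi : NilDAHA.IsCanonical b i),
      Function.Injective i ∧
      -- (i)
      (∀ (M : Type*) [AddCommGroup M] [Module ℂ M]
        (ρ : NilDAHA.WDhT P →ₐ[ℂ] Module.End ℂ M),
        (Nonempty (NilDAHA.Extension i ρ) ↔ Function.Bijective (NilDAHA.naturalMap P ρ)) ∧
        Subsingleton (NilDAHA.Extension i ρ)) ∧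
      -- (i) for the specialization at `ħ = c`
      (∀ (c : ℂ) (M : Type*) [AddCommGroup M] [Module ℂ M]
        (ρ : NilDAHA.Specialization (NilDAHA.hbarA P) c →ₐ[ℂ] Module.End ℂ M),
        (Nonempty (NilDAHA.Extension (NilDAHA.Specialization.map i hi.map_hbar c) ρ) ↔
          Function.Bijective
            (NilDAHA.naturalMap P (ρ.comp (NilDAHA.Specialization.mk (NilDAHA.hbarA P) c)))) ∧
        Subsingleton (NilDAHA.Extension (NilDAHA.Specialization.map i hi.map_hbar c) ρ)) ∧
      -- (ii)
      (∃! k : NilDAHA.DTinv P →ₐ[ℂ] NilDAHA.HSph b, NilDAHA.IsCanonicalSph b i k) ∧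
      (∀ k : NilDAHA.DTinv P →ₐ[ℂ] NilDAHA.HSph b, NilDAHA.IsCanonicalSph b i k →
        Function.Injective k ∧
        ∀ (L : Type*) [AddCommGroup L] [Module ℂ L] (σ : NilDAHA.DTinv P →ₐ[ℂ] Module.End ℂ L),
          (Nonempty (NilDAHA.Extension k σ) ↔ Function.Bijective (NilDAHA.sphericalMap P σ)) ∧
          Subsingleton (NilDAHA.Extension k σ)) := by
  refine ⟨NilDAHA.existsUnique_isCanonical b, fun i hi => ⟨hi.injective,
    fun M _ _ ρ => NilDAHA.extension_iff hi ρ,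
    fun c M _ _ ρ => NilDAHA.extension_specialization_iff hi c ρ, ?_⟩⟩
  exact NilDAHA.spherical_extension_iff hi
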